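/- Let $M$ be a smooth (Hausdorff, $\sigma$-compact, finite-dimensional) manifold, and let $E\to M$ and $F\to M$ be smooth real vector bundles of ranks $m$ and $n$ with smooth linear connections $\nabla_E,\nabla_F$. Let $\mathcal M=\Pi E\oplus\Pi F$ and $\mathcal N=\Pi T^*\mathcal M\cong \Pi E\oplus\Pi F\oplus E^*\oplus F^*\oplus\Pi T^*M$, the splitting being given by the connections. Local coordinates on $\mathcal N$ are $x^i,\eta^a,c^\alpha$ (on $M$, $\Pi E$, $\Pi F$) and the momenta $x^*_i,\eta^*_a,c^*_\alpha$. Here $\eta^a,c^\alpha,x^*_i$ are odd and $x^i,\eta^*_a,c^*_\alpha$ are even. For $(x^i,\eta^a,c^\alpha,x^*_i,\eta^*_a,c^*_\alpha)$ the ghost degrees are $(0,-1,1,1,2,0)$, the momentum degrees $(0,0,0,1,1,1)$ and the resolution degrees $(0,1,0,0,0,1)$. Let $C^{\infty,k}_l(\mathcal N)$ be the space of functions on $\mathcal N$ that are smooth in $x$, homogeneous polynomials of degree $k$ in the momenta, and of ghost degree $l$. Let $(\cdot,\cdot)$ be the canonical odd Poisson bracket on $\mathcal N=\Pi T^*\mathcal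 M$. With $z^A=(\eta^a,c^\alpha)$, $z^*_A=(\eta^*_a,c^*_\alpha)$, and $A^C_{iB}$ and $\mathcal R^C_{Bij}$ the coefficients and the curvature of $\nabla=\nabla_E\oplus\nabla_F$ (so $\nabla_i e_B=A^C_{iB}e_C$ and $[\nabla_i,\nabla_j]e_B=\mathcal R^C_{Bij}e_C$), it is the odd biderivation with $$(x^*_i,x^j)=\delta_i^j,\quad (z^*_A,z^B)=\delta_A^B,\quad (x^*_i,z^C)=-z^BA^C_{iB},\quad (x^*_i,z^*_B)=A^C_{iB}z^*_C,\quad (x^*_i,x^*_j)=-z^B\mathcal R^C_{Bij}z^*_C ,$$ the brackets in the opposite order being given by $(f,g)=-(-1)^{(\epsilon(f)+1)(\epsilon(g)+1)}(g,f)$, and all other brackets of coordinates being zero. Let $T$ be a smooth section of $E$ with zero locus $\Sigma$ and let $R:F\to TM$ be a smooth bundle map such that, at every point of $\Sigma$, $\nabla_E T:TM\to E$ is surjective and $R$ is injective. Let $S=\sum_{k\ge1}S^k$ be a master function, i.e. a series with $S^k\in C^{\infty,k}_2(\mathcal N)$ that satisfies $(S,S)=0$ (in each momentum degree), such that $$S^1=T^a\eta^*_a+c^\alpha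 R^i_\alpha x^*_i+(\text{terms of positive resolution degree}).$$ Let $QG=(S^1,G)$, a differential $C^{\infty,k}_{l}(\mathcal N)\to C^{\infty,k}_{l+1}(\mathcal N)$, and let $H^k_l(Q)$ be its cohomology in momentum degree $k$ and ghost degree $l$. Then $H^k_l(Q)=0$ for all integers $k\ge 0$ and $l$ with $k>l$: the elements $G\in C^{\infty,k}_l(\mathcal N)$ with $QG=0$ are exactly the elements $QG'$ with $G'\in C^{\infty,k}_{l-1}(\mathcal N)$. -/

import Mathlib

open Bundle Module
open scoped Manifold ContDiff TensorProduct

noncomputable section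

namespace BRST

/-! ### The algebra of fibrewise polynomial functions over a point -/

section Algebra

variable (L₁ L₂ X : Type*) [AddCommGroup L₁] [Module ℝ L₁] [AddCommGroup L₂] [Module ℝ L₂]
  [AddCommGroup X] [Module ℝ X]

/-- The odd linear coordinates are `η` (linear forms on `L₁`), `c` (linear forms on `L₂`) and the
momenta `x*` (vectors of `X`). -/
abbrev OddGen : Type _ := Dual ℝ L₁ × Dual ℝ L₂ × X

/-- Polynomial functions on `ΠL₁ ⊕ ΠL₂ ⊕ L₁* ⊕ L₂* ⊕ ΠX*`: polynomial in the even momenta `η*`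
(vectors of `L₁`) and `c*` (vectors of `L₂`), exterior in the odd coordinates `η, c, x*`. -/
abbrev FunAlg : Type _ :=
  SymmetricAlgebra ℝ (L₁ × L₂) ⊗[ℝ] ExteriorAlgebra ℝ (OddGen L₁ L₂ X)

variable {L₁ L₂ X}

/-- The even generators `η*` and `c*`. -/
def evenGen (v : L₁ × L₂) : FunAlg L₁ L₂ X := SymmetricAlgebra.ι ℝ (L₁ × L₂) v ⊗ₜ[ℝ] 1

/-- The odd generators `η`, `c` and `x*`. -/
def oddGen (w : OddGen L₁ L₂ X) : FunAlg L₁ L₂ X := 1 ⊗ₜ[ℝ] ExteriorAlgebra.ι ℝ w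

def etaStar (v : L₁) : FunAlg L₁ L₂ X := evenGen (v, 0)
def cStar (v : L₂) : FunAlg L₁ L₂ X := evenGen (0, v)
def eta (ξ : Dual ℝ L₁) : FunAlg L₁ L₂ X := oddGen (ξ, 0, 0)
def gho (ξ : Dual ℝ L₂) : FunAlg L₁ L₂ X := oddGen (0, ξ, 0)
def xStar (v : X) : FunAlg L₁ L₂ X := oddGen (0, 0, v)

/-- Functions of momentum degree `k`, ghost number `l` and resolution degree `r`: the span of the
monomials of these degrees, with the generators graded by

|       | `η` | `c` | `x*` | `η*` | `c*` |
|-------|-----|-----|------|------|------|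
| `gh`  | -1  | 1   | 1    | 2    | 0    |
| `Deg` | 0   | 0   | 1    | 1    | 1    |
| `res` | 1   | 0   | 0    | 0    | 1    |
-/
def homog (k : ℕ) (l : ℤ) (r : ℕ) : Submodule ℝ (FunAlg L₁ L₂ X) :=
  Submodule.span ℝ {w | ∃ (e : List (Dual ℝ L₁)) (g : List (Dual ℝ L₂)) (xs : List X)
      (es : List L₁) (gs : List L₂),
    k = xs.length + es.length + gs.length ∧
    l = -(e.length : ℤ) + g.length + xs.length + 2 * es.length ∧
    r = e.length + gs.length ∧
    w = (e.map eta).prod * (g.map gho).prod * (xs.map xStar).prod *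
      (es.map etaStar).prod * (gs.map cStar).prod}

/-- Functions of momentum degree `k` and ghost number `l`. -/
def bihomog (k : ℕ) (l : ℤ) : Submodule ℝ (FunAlg L₁ L₂ X) := ⨆ r : ℕ, homog k l r

/-- Functions of momentum degree `k`, ghost number `l` and positive resolution degree. -/
def bihomogResPos (k : ℕ) (l : ℤ) : Submodule ℝ (FunAlg L₁ L₂ X) := ⨆ r : ℕ, homog k l (r + 1)

/-- The substitution `v ↦ v + ε ℓ(v)` into the dual numbers over the symmetric algebra. -/
def symShift {L : Type*} [AddCommGroup L] [Module ℝ L] (ℓ : Dual ℝ L) :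
    SymmetricAlgebra ℝ L →ₐ[ℝ] DualNumber (SymmetricAlgebra ℝ L) :=
  SymmetricAlgebra.lift
    ((TrivSqZeroExt.inlAlgHom ℝ (SymmetricAlgebra ℝ L) (SymmetricAlgebra ℝ L)).toLinearMap ∘ₗ
        SymmetricAlgebra.ι ℝ L +
      ((TrivSqZeroExt.inrHom (SymmetricAlgebra ℝ L) (SymmetricAlgebra ℝ L)).restrictScalars ℝ) ∘ₗ
        ℓ.smulRight (1 : SymmetricAlgebra ℝ L))

theorem symShift_fst {L : Type*} [AddCommGroup L] [Module ℝ L] (ℓ : Dual ℝ L)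
    (a : SymmetricAlgebra ℝ L) : (symShift ℓ a).fst = a := by
  have h : (TrivSqZeroExt.fstHom ℝ (SymmetricAlgebra ℝ L) (SymmetricAlgebra ℝ L)).comp
      (symShift ℓ) = AlgHom.id ℝ (SymmetricAlgebra ℝ L) := by
    apply SymmetricAlgebra.algHom_ext
    ext v
    simp [symShift]
  exact DFunLike.congr_fun h a

/-- The derivation of the symmetric algebra that extends the linear form `ℓ`. -/
def symDeriv {L : Type*} [AddCommGroup L] [Module ℝ L] (ℓ : Dual ℝ L) :
    Derivation ℝ (SymmetricAlgebra ℝ L) (SymmetricAlgebra ℝ L) :=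
  Derivation.mk'
    (((TrivSqZeroExt.sndHom (SymmetricAlgebra ℝ L) (SymmetricAlgebra ℝ L)).restrictScalars ℝ) ∘ₗ
      (symShift ℓ).toLinearMap)
    (fun a b => by simp [symShift_fst, TrivSqZeroExt.snd_mul, mul_comm])

theorem symDeriv_ι {L : Type*} [AddCommGroup L] [Module ℝ L] (ℓ : Dual ℝ L) (v : L) :
    symDeriv ℓ (SymmetricAlgebra.ι ℝ L v) = algebraMap ℝ _ (ℓ v) := by
  simp [symDeriv, symShift, Algebra.algebraMap_eq_smul_one]

/-- The derivative along the even coordinates dual to `ℓ`. -/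
def evenDeriv (ℓ : Dual ℝ (L₁ × L₂)) : FunAlg L₁ L₂ X →ₗ[ℝ] FunAlg L₁ L₂ X :=
  LinearMap.rTensor _ (symDeriv ℓ).toLinearMap

/-- The left derivative along the odd coordinates dual to `ℓ`. -/
def oddDerivL (ℓ : Dual ℝ (OddGen L₁ L₂ X)) : FunAlg L₁ L₂ X →ₗ[ℝ] FunAlg L₁ L₂ X :=
  LinearMap.lTensor _ (CliffordAlgebra.contractLeft ℓ)

/-- The right derivative along the odd coordinates dual to `ℓ`. -/
def oddDerivR (ℓ : Dual ℝ (OddGen L₁ L₂ X)) : FunAlg L₁ L₂ X →ₗ[ℝ] FunAlg L₁ L₂ X :=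
  LinearMap.lTensor _ (CliffordAlgebra.contractRight.flip ℓ)

/-- The change of linear coordinates given by `f₁, f₂, f`, where `g₁, g₂` are the inverses of
`f₁, f₂` and act on the linear forms. -/
def FunAlg.map {L₁' L₂' X' : Type*} [AddCommGroup L₁'] [Module ℝ L₁'] [AddCommGroup L₂']
    [Module ℝ L₂'] [AddCommGroup X'] [Module ℝ X']
    (f₁ : L₁ →ₗ[ℝ] L₁') (g₁ : L₁' →ₗ[ℝ] L₁) (f₂ : L₂ →ₗ[ℝ] L₂') (g₂ : L₂' →ₗ[ℝ] L₂)
    (f : X →ₗ[ℝ] X') : FunAlg L₁ L₂ X →ₐ[ℝ] FunAlg L₁' L₂' X' :=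
  Algebra.TensorProduct.map
    (SymmetricAlgebra.lift (SymmetricAlgebra.ι ℝ (L₁' × L₂') ∘ₗ f₁.prodMap f₂))
    (ExteriorAlgebra.map (g₁.dualMap.prodMap (g₂.dualMap.prodMap f)))

end Algebra

/-! ### Local coordinates -/

section Coordinates

variable {d m n : ℕ}

/-- Polynomial functions of the local fibre coordinates. -/
abbrev LocAlg (d m n : ℕ) : Type :=
  FunAlg (Fin m → ℝ) (Fin n → ℝ) (EuclideanSpace ℝ (Fin d))

/-- The coordinates `x^i`, `z^A = (η^a, c^α)`, `x*_i` and `z*_A = (η*_a, c*_α)`. -/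
inductive Coord (d m n : ℕ) : Type
  | x (i : Fin d)
  | z (A : Fin m ⊕ Fin n)
  | xs (i : Fin d)
  | zs (A : Fin m ⊕ Fin n)
  deriving Fintype

/-- The coordinates `z^A` as functions. -/
def zFun : Fin m ⊕ Fin n → LocAlg d m n
  | .inl a => eta (LinearMap.proj a)
  | .inr α => gho (LinearMap.proj α)

/-- The momenta `z*_A` as functions. -/
def zsFun : Fin m ⊕ Fin n → LocAlg d m n
  | .inl a => etaStar (Pi.single a 1)
  | .inr α => cStar (Pi.single α 1)

/-- The linear form on the odd generators that picks the coefficient of `z^A`. -/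
def zForm : Fin m ⊕ Fin n →
    Dual ℝ (OddGen (Fin m → ℝ) (Fin n → ℝ) (EuclideanSpace ℝ (Fin d)))
  | .inl a => Dual.eval ℝ (Fin m → ℝ) (Pi.single a 1) ∘ₗ LinearMap.fst ℝ _ _
  | .inr α => Dual.eval ℝ (Fin n → ℝ) (Pi.single α 1) ∘ₗ LinearMap.fst ℝ _ _ ∘ₗ
      LinearMap.snd ℝ _ _

/-- The linear form on the odd generators that picks the coefficient of `x*_i`. -/
def xsForm (i : Fin d) :
    Dual ℝ (OddGen (Fin m → ℝ) (Fin n → ℝ) (EuclideanSpace ℝ (Fin d))) :=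
  (EuclideanSpace.proj i : EuclideanSpace ℝ (Fin d) →L[ℝ] ℝ).toLinearMap ∘ₗ
    LinearMap.snd ℝ _ _ ∘ₗ LinearMap.snd ℝ _ _

/-- The linear form on the even generators that picks the coefficient of `z*_A`. -/
def zsForm : Fin m ⊕ Fin n → Dual ℝ ((Fin m → ℝ) × (Fin n → ℝ))
  | .inl a => LinearMap.proj a ∘ₗ LinearMap.fst ℝ _ _
  | .inr α => LinearMap.proj α ∘ₗ LinearMap.snd ℝ _ _

/-- The brackets `(u, v)` of the coordinates in long momenta, where `A i B C` is the connection
coefficient `A^C_{iB}`, `∇_i e_B = A^C_{iB} e_C`, and `K i j B C` is the curvature component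
`[∇_i, ∇_j] e_B = K^C_{Bij} e_C`. -/
def coordBracket (A : Fin d → Fin m ⊕ Fin n → Fin m ⊕ Fin n → ℝ)
    (K : Fin d → Fin d → Fin m ⊕ Fin n → Fin m ⊕ Fin n → ℝ) :
    Coord d m n → Coord d m n → LocAlg d m n
  | .xs i, .x j => if i = j then 1 else 0
  | .x j, .xs i => if i = j then -1 else 0
  | .zs B, .z C => if B = C then 1 else 0
  | .z C, .zs B => if B = C then -1 else 0
  | .xs i, .z C => -∑ B, A i B C • zFun B
  | .z C, .xs i => ∑ B, A i B C • zFun B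
  | .xs i, .zs B => ∑ C, A i B C • zsFun C
  | .zs B, .xs i => -∑ C, A i B C • zsFun C
  | .xs i, .xs j => -∑ B, ∑ C, K i j B C • (zFun B * zsFun C)
  | _, _ => 0

/-- The left derivative along a coordinate of a function with value `f` at the given point and with
derivatives `f' i` along the `x^i`. -/
def coordDerivL (f : LocAlg d m n) (f' : Fin d → LocAlg d m n) : Coord d m n → LocAlg d m n
  | .x i => f' i
  | .z A => oddDerivL (zForm A) f
  | .xs i => oddDerivL (xsForm i) f
  | .zs A => evenDeriv (zsForm A) f

/-- The right derivative along a coordinate. -/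
def coordDerivR (f : LocAlg d m n) (f' : Fin d → LocAlg d m n) : Coord d m n → LocAlg d m n
  | .x i => f' i
  | .z A => oddDerivR (zForm A) f
  | .xs i => oddDerivR (xsForm i) f
  | .zs A => evenDeriv (zsForm A) f

end Coordinates

/-! ### Functions on the extended manifold -/

section Manifold

variable {d m n : ℕ}
  {M : Type*} [TopologicalSpace M] [ChartedSpace (EuclideanSpace ℝ (Fin d)) M]
  [IsManifold (𝓡 d) ∞ M]

/-- The coordinate vector field `∂/∂x^i` of the preferred chart at `p₀`, at the point `p`. -/
def coordVec (p₀ : M) (i : Fin d) (p : M) : TangentSpace (𝓡 d) p :=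
  (trivializationAt (EuclideanSpace ℝ (Fin d)) (TangentSpace (𝓡 d)) p₀).symmₗ ℝ p
    (EuclideanSpace.single i 1)

/-- `w` is the derivative at `p` of the function `f` along the tangent vector `v`. The values of `f`
lie in a vector space of countable dimension, so that it is tested by linear forms. -/
def HasVecDeriv {W : Type*} [AddCommGroup W] [Module ℝ W] (f : M → W) (p : M)
    (v : TangentSpace (𝓡 d) p) (w : W) : Prop :=
  ∀ φ : Dual ℝ W, MDifferentiableAt (𝓡 d) 𝓘(ℝ, ℝ) (fun q => φ (f q)) p ∧
    mvfderiv (𝓡 d) (fun q => φ (f q)) p v = φ w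

open Classical in
/-- The derivative of a function along a tangent vector (zero if there is none). -/
def vecDeriv {W : Type*} [AddCommGroup W] [Module ℝ W] (f : M → W) (p : M)
    (v : TangentSpace (𝓡 d) p) : W :=
  if h : ∃ w, HasVecDeriv f p v w then h.choose else 0

section Connection

variable {r : ℕ} {V : M → Type*} [TopologicalSpace (TotalSpace (Fin r → ℝ) V)]
  [∀ p, AddCommGroup (V p)] [∀ p, Module ℝ (V p)] [∀ p, TopologicalSpace (V p)]
  [FiberBundle (Fin r → ℝ) V] [VectorBundle ℝ (Fin r → ℝ) V]

/-- The frame of `V` given by the preferred trivialization at `p₀`. -/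
def frame (p₀ : M) (a : Fin r) (p : M) : V p :=
  (trivializationAt (Fin r → ℝ) V p₀).symmₗ ℝ p (Pi.single a 1)

variable [∀ p, IsTopologicalAddGroup (V p)] [∀ p, ContinuousSMul ℝ (V p)]

/-- The connection coefficient `A^b_{ia}(p)` in the preferred chart and frame at `p₀`:
`∇_i e_a = A^b_{ia} e_b`. -/
def connCoeff (cov : CovariantDerivative (𝓡 d) (Fin r → ℝ) V) (p₀ : M) (i : Fin d) (a b : Fin r)
    (p : M) : ℝ :=
  (trivializationAt (Fin r → ℝ) V p₀).linearMapAt ℝ p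
    (cov (frame p₀ a) p (coordVec p₀ i p)) b

/-- The curvature component at `p₀`, `[∇_i, ∇_j] e_a = K^b_{aij} e_b`. -/
def curvCoeff (cov : CovariantDerivative (𝓡 d) (Fin r → ℝ) V) (p₀ : M) (i j : Fin d)
    (a b : Fin r) : ℝ :=
  mvfderiv (𝓡 d) (connCoeff cov p₀ j a b) p₀ (coordVec p₀ i p₀) -
    mvfderiv (𝓡 d) (connCoeff cov p₀ i a b) p₀ (coordVec p₀ j p₀) +
    ∑ e, (connCoeff cov p₀ i e b p₀ * connCoeff cov p₀ j a e p₀ -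
      connCoeff cov p₀ j e b p₀ * connCoeff cov p₀ i a e p₀)

end Connection

variable
  (E : M → Type*) [TopologicalSpace (TotalSpace (Fin m → ℝ) E)]
  [∀ p, AddCommGroup (E p)] [∀ p, Module ℝ (E p)] [∀ p, TopologicalSpace (E p)]
  [FiberBundle (Fin m → ℝ) E] [VectorBundle ℝ (Fin m → ℝ) E]
  (F : M → Type*) [TopologicalSpace (TotalSpace (Fin n → ℝ) F)]
  [∀ p, AddCommGroup (F p)] [∀ p, Module ℝ (F p)] [∀ p, TopologicalSpace (F p)]
  [FiberBundle (Fin n → ℝ) F] [VectorBundle ℝ (Fin n → ℝ) F]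

/-- Fibrewise polynomial functions on `𝒩 = ΠE ⊕ ΠF ⊕ E* ⊕ F* ⊕ ΠT*M`, not necessarily smooth along
`M`. -/
abbrev PreFun : Type _ := (p : M) → FunAlg (E p) (F p) (TangentSpace (𝓡 d) p)

variable {E F}

variable (m n) in
/-- The expression of `f` in the preferred coordinates at `p₀`, as a function of `p` near `p₀`. -/
def localRep (f : PreFun (d := d) E F) (p₀ p : M) : LocAlg d m n :=
  FunAlg.map
    ((trivializationAt (Fin m → ℝ) E p₀).linearMapAt ℝ p)
    ((trivializationAt (Fin m → ℝ) E p₀).symmₗ ℝ p)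
    ((trivializationAt (Fin n → ℝ) F p₀).linearMapAt ℝ p)
    ((trivializationAt (Fin n → ℝ) F p₀).symmₗ ℝ p)
    ((trivializationAt (EuclideanSpace ℝ (Fin d)) (TangentSpace (𝓡 d)) p₀).linearMapAt ℝ p)
    (f p)

/-- The function over `p₀` with a given expression in the preferred coordinates at `p₀`. -/
def ofLocal (p₀ : M) (w : LocAlg d m n) : FunAlg (E p₀) (F p₀) (TangentSpace (𝓡 d) p₀) :=
  FunAlg.map
    ((trivializationAt (Fin m → ℝ) E p₀).symmₗ ℝ p₀)
    ((trivializationAt (Fin m → ℝ) E p₀).linearMapAt ℝ p₀)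
    ((trivializationAt (Fin n → ℝ) F p₀).symmₗ ℝ p₀)
    ((trivializationAt (Fin n → ℝ) F p₀).linearMapAt ℝ p₀)
    ((trivializationAt (EuclideanSpace ℝ (Fin d)) (TangentSpace (𝓡 d)) p₀).symmₗ ℝ p₀)
    w

variable (m n) in
/-- Smoothness: all coefficients in local coordinates are smooth. -/
def IsSmooth (f : PreFun (d := d) E F) : Prop :=
  ∀ (p₀ : M) (φ : Dual ℝ (LocAlg d m n)),
    ContMDiffAt (𝓡 d) 𝓘(ℝ, ℝ) ∞ (fun p => φ (localRep m n f p₀ p)) p₀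

variable (m n E F) in
/-- The space `C^{∞,k}_l(𝒩)` of smooth functions of momentum degree `k` and ghost number `l`. -/
def smoothFun (k : ℕ) (l : ℤ) : Set (PreFun (d := d) E F) :=
  {f | IsSmooth m n f ∧ ∀ p, f p ∈ bihomog k l}

variable (n) in
/-- The terms `T^a η*_a + c^α R^i_α x*_i`; they do not depend on the choice of a frame of `F`. -/
def initialTerm (T : (p : M) → E p) (R : (p : M) → F p →L[ℝ] TangentSpace (𝓡 d) p) :
    PreFun (d := d) E F := fun p =>
  (etaStar (T p) : FunAlg (E p) (F p) (TangentSpace (𝓡 d) p)) +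
    ∑ α : Fin n, gho (LinearMap.proj α ∘ₗ (trivializationAt (Fin n → ℝ) F p).linearMapAt ℝ p) *
      xStar (R p (frame (V := F) p α p))

variable [∀ p, IsTopologicalAddGroup (E p)] [∀ p, ContinuousSMul ℝ (E p)]
  [∀ p, IsTopologicalAddGroup (F p)] [∀ p, ContinuousSMul ℝ (F p)]
  (covE : CovariantDerivative (𝓡 d) (Fin m → ℝ) E)
  (covF : CovariantDerivative (𝓡 d) (Fin n → ℝ) F)

/-- The coefficients at `p₀` of the connection `∇_E ⊕ ∇_F`. -/
def sumConnCoeff (p₀ : M) (i : Fin d) : Fin m ⊕ Fin n → Fin m ⊕ Fin n → ℝ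
  | .inl a, .inl b => connCoeff covE p₀ i a b p₀
  | .inr α, .inr β => connCoeff covF p₀ i α β p₀
  | _, _ => 0

/-- The curvature components at `p₀` of the connection `∇_E ⊕ ∇_F`. -/
def sumCurvCoeff (p₀ : M) (i j : Fin d) : Fin m ⊕ Fin n → Fin m ⊕ Fin n → ℝ
  | .inl a, .inl b => curvCoeff covE p₀ i j a b
  | .inr α, .inr β => curvCoeff covF p₀ i j α β
  | _, _ => 0

/-- The odd Poisson bracket `(f, g) = ∑_{u,v} (f ∂/∂u) (u, v) (∂/∂v g)`, with right derivatives of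
`f` and left derivatives of `g`, at each point computed in the preferred coordinates there. -/
def bracket (f g : PreFun (d := d) E F) : PreFun (d := d) E F := fun p =>
  ofLocal p (∑ u : Coord d m n, ∑ v : Coord d m n,
    coordDerivR (localRep m n f p p) (fun i => vecDeriv (localRep m n f p) p (coordVec p i p)) u *
      coordBracket (sumConnCoeff covE covF p) (sumCurvCoeff covE covF p) u v *
      coordDerivL (localRep m n g p p) (fun i => vecDeriv (localRep m n g p) p (coordVec p i p)) v)

/-- `S = ∑_{k ≥ 1} S k` is a master function, `S k` being its component of momentum degree `k`: it
has ghost number `2` and satisfies the master equation `(S, S) = 0`, stated in each momentum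
degree. -/
structure IsMasterFunction (S : ℕ → PreFun (d := d) E F) : Prop where
  mem : ∀ k, S k ∈ smoothFun m n E F k 2
  zero : S 0 = 0
  master : ∀ N, ∑ ij ∈ Finset.HasAntidiagonal.antidiagonal N, bracket covE covF (S ij.1) (S ij.2) = 0

/-- The homological vector field `Q f = (S¹, f)`. -/
def Q (S : ℕ → PreFun (d := d) E F) (f : PreFun (d := d) E F) : PreFun (d := d) E F :=
  bracket covE covF (S 1) f

/-- The `Q`-cocycles of momentum degree `k` and ghost number `l`. -/
def cocycles (S : ℕ → PreFun (d := d) E F) (k : ℕ) (l : ℤ) : Set (PreFun (d := d) E F) :=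
  {f | f ∈ smoothFun m n E F k l ∧ Q covE covF S f = 0}

/-- The `Q`-coboundaries of momentum degree `k` and ghost number `l`. -/
def coboundaries (S : ℕ → PreFun (d := d) E F) (k : ℕ) (l : ℤ) : Set (PreFun (d := d) E F) :=
  Q covE covF S '' smoothFun m n E F k (l - 1)

end Manifold

end BRST

end

noncomputable section

set_option linter.unusedSectionVars false

namespace BRST

/-! ### Derivations and parity on the algebra of fibrewise polynomial functions -/

/-! Filter the functions by resolution degree and let F^r consist of those of degree at least r
(`Pol.fil`). In Q only the derivatives along η and c* lower this degree, and they lower it by one.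
Because of the form of S¹, the part of Q that lowers the degree is the Koszul differential δ = T^a
∂/∂η^a + R^i_α x*_i ∂/∂c*_α (`kosDiff`); all other terms map F^r to F^r
(`rep_bracket_sub_vertP_mem`, `vertP_rep_sub_kosDiff_mem`). For every generator the momentum degree
is at most the sum of the ghost degree and the resolution degree, so for l < k every function lies
in F^1. On the other side, a monomial has at most m factors η and at most k factors c*, so F^r = 0
for r > m + k. Hence a cocycle is exact once one knows the following step: for a cocycle G in F^r
with r ≥ 1 there is H in F^(r+1) with G - QH in F^(r+1). As Q² = 0, the difference is again a
cocycle, and finitely many steps reach zero (`exists_primitive`).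

In the step, QG = 0 says that δG lies in F^r, one degree better than expected. Where some T^a is
nonzero, multiplication by η^a/T^a is a contraction. Near a zero of T the map R has a smooth left
inverse P, and the anticommutator N of δ with P^α_i c*_α ∂/∂x*_i counts the factors c* and the
factors x* in the image of R. Its eigenvalues in momentum degree k are among 0, …, k, so a
polynomial in N removes c* from the leading term (`evD_sub_kosDiff_mem`). The Koszul complex of T
alone remains. Since T is a submersion at its zeros, it is linear in suitable coordinates
(`exists_straightening`), and η^a ∂/∂T^a integrated along rays is a homotopy in degrees r ≥ 1
(`exists_koszul_primitive`). The leading part of Q does not differentiate along M and does not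
depend on the coordinates, so a partition of unity glues the local solutions (`exists_glued`).

Q² = 0 is the Jacobi identity combined with (S¹, S¹) = 0. A direct proof would have to expand the
connection and the curvature in the bracket. Instead there is an odd second order operator Δ with Δ²
= 0, by the Bianchi identity and the trace of the curvature, such that Qf = Δ(Sf) - SΔf - (ΔS)f with
S = S¹; from this Q² = 0 is formal (`LQ_LQ`). Finally, the bracket at a point is defined in the
coordinates preferred at that point. That Qf is smooth, and that Q can be applied twice, requires
that all coordinate systems give the same bracket (`LQ_subst`, `rep_bracket`). -/

theorem contractLeft_mul {V : Type*} [AddCommGroup V] [Module ℝ V] (ℓ : Dual ℝ V)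
    (a b : ExteriorAlgebra ℝ V) :
    CliffordAlgebra.contractLeft ℓ (a * b) = CliffordAlgebra.contractLeft ℓ a * b +
      CliffordAlgebra.involute a * CliffordAlgebra.contractLeft ℓ b := by
  induction a using CliffordAlgebra.left_induction with
  | algebraMap r => simp [← Algebra.smul_def]
  | add x y hx hy => simp only [add_mul, map_add, hx, hy]; abel
  | ι_mul x v hx =>
    rw [mul_assoc, CliffordAlgebra.contractLeft_ι_mul, hx, CliffordAlgebra.contractLeft_ι_mul]
    simp only [map_mul, CliffordAlgebra.involute_ι, sub_mul, mul_add, smul_mul_assoc, mul_assoc,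
      neg_mul]
    abel

/-- In degree p the contracted vector moves from the right end to the left end past p - 1 others,
which costs the sign (-1)^(p-1). This lets all later arguments use left derivatives only. -/
theorem contractRight_eq_neg_contractLeft {V : Type*} [AddCommGroup V] [Module ℝ V] (ℓ : Dual ℝ V)
    (a : ExteriorAlgebra ℝ V) : CliffordAlgebra.contractRight a ℓ =
      -CliffordAlgebra.contractLeft ℓ (CliffordAlgebra.involute a) := by
  induction a using CliffordAlgebra.right_induction with
  | algebraMap r => simp
  | add x y hx hy => simp only [map_add, LinearMap.add_apply, hx, hy]; abel
  | mul_ι v x hx =>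
    rw [CliffordAlgebra.contractRight_mul_ι, hx, map_mul, contractLeft_mul]
    simp [Algebra.smul_def, Algebra.commutes, sub_eq_add_neg, add_comm]

/-- The algebra `FunAlg`, as a type with a single ring structure. -/
def Pol (L₁ L₂ X : Type*) [AddCommGroup L₁] [Module ℝ L₁] [AddCommGroup L₂] [Module ℝ L₂]
    [AddCommGroup X] [Module ℝ X] : Type _ := FunAlg L₁ L₂ X

section Pol

variable {L₁ L₂ X : Type*} [AddCommGroup L₁] [Module ℝ L₁] [AddCommGroup L₂] [Module ℝ L₂]
  [AddCommGroup X] [Module ℝ X]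

instance : Ring (Pol L₁ L₂ X) := inferInstanceAs (Ring (FunAlg L₁ L₂ X))

instance : Algebra ℝ (Pol L₁ L₂ X) := inferInstanceAs (Algebra ℝ (FunAlg L₁ L₂ X))

/-- The identification of `FunAlg` with `Pol`. -/
def toPol : FunAlg L₁ L₂ X ≃ₐ[ℝ] Pol L₁ L₂ X :=
  AlgEquiv.refl (R := ℝ) (A₁ := FunAlg L₁ L₂ X)

namespace Pol

/-- The even generators. -/
def ev : L₁ × L₂ →ₗ[ℝ] Pol L₁ L₂ X :=
  toPol.toLinearMap ∘ₗ (TensorProduct.mk ℝ (SymmetricAlgebra ℝ (L₁ × L₂))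
    (ExteriorAlgebra ℝ (OddGen L₁ L₂ X))).flip 1 ∘ₗ SymmetricAlgebra.ι ℝ (L₁ × L₂)

/-- The odd generators. -/
def od : OddGen L₁ L₂ X →ₗ[ℝ] Pol L₁ L₂ X :=
  toPol.toLinearMap ∘ₗ TensorProduct.mk ℝ (SymmetricAlgebra ℝ (L₁ × L₂))
    (ExteriorAlgebra ℝ (OddGen L₁ L₂ X)) 1 ∘ₗ ExteriorAlgebra.ι ℝ

theorem toPol_evenGen (v : L₁ × L₂) : toPol (evenGen v : FunAlg L₁ L₂ X) = ev v := rfl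
theorem toPol_oddGen (w : OddGen L₁ L₂ X) : toPol (oddGen w) = od w := rfl

/-- Elementary tensors. -/
def tm (s : SymmetricAlgebra ℝ (L₁ × L₂)) (t : ExteriorAlgebra ℝ (OddGen L₁ L₂ X)) :
    Pol L₁ L₂ X := toPol (s ⊗ₜ[ℝ] t)

theorem tm_mul (s s' : SymmetricAlgebra ℝ (L₁ × L₂)) (t t' : ExteriorAlgebra ℝ (OddGen L₁ L₂ X)) :
    tm s t * tm s' t' = tm (s * s') (t * t') := by
  rw [tm, tm, ← map_mul, Algebra.TensorProduct.tmul_mul_tmul]; rfl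

theorem tm_add_left (s s' : SymmetricAlgebra ℝ (L₁ × L₂))
    (t : ExteriorAlgebra ℝ (OddGen L₁ L₂ X)) : tm (s + s') t = tm s t + tm s' t := by
  rw [tm, TensorProduct.add_tmul, map_add]; rfl

theorem tm_add_right (s : SymmetricAlgebra ℝ (L₁ × L₂))
    (t t' : ExteriorAlgebra ℝ (OddGen L₁ L₂ X)) : tm s (t + t') = tm s t + tm s t' := by
  rw [tm, TensorProduct.tmul_add, map_add]; rfl

theorem tm_smul_left (r : ℝ) (s : SymmetricAlgebra ℝ (L₁ × L₂))
    (t : ExteriorAlgebra ℝ (OddGen L₁ L₂ X)) : tm (r • s) t = r • tm s t := by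
  rw [tm, ← TensorProduct.smul_tmul', map_smul]; rfl

theorem tm_smul_right (r : ℝ) (s : SymmetricAlgebra ℝ (L₁ × L₂))
    (t : ExteriorAlgebra ℝ (OddGen L₁ L₂ X)) : tm s (r • t) = r • tm s t := by
  rw [tm, TensorProduct.tmul_smul, map_smul]; rfl

theorem tm_neg_right (s : SymmetricAlgebra ℝ (L₁ × L₂))
    (t : ExteriorAlgebra ℝ (OddGen L₁ L₂ X)) : tm s (-t) = -tm s t := by
  simpa using tm_smul_right (-1) s t

theorem tm_zero_left (t : ExteriorAlgebra ℝ (OddGen L₁ L₂ X)) :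
    (tm 0 t : Pol L₁ L₂ X) = 0 := by
  simpa using tm_smul_left 0 0 t

theorem tm_zero_right (s : SymmetricAlgebra ℝ (L₁ × L₂)) :
    (tm s 0 : Pol L₁ L₂ X) = 0 := by
  simpa using tm_smul_right 0 s 0

theorem tm_one_one : (tm 1 1 : Pol L₁ L₂ X) = 1 := rfl

theorem ev_def (v : L₁ × L₂) : (ev v : Pol L₁ L₂ X) = tm (SymmetricAlgebra.ι ℝ _ v) 1 := rfl
theorem od_def (w : OddGen L₁ L₂ X) : od w = tm 1 (ExteriorAlgebra.ι ℝ w) := rfl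

theorem tensor_induction {C : Pol L₁ L₂ X → Prop} (tmul : ∀ s t, C (tm s t))
    (add : ∀ a b, C a → C b → C (a + b)) (a : Pol L₁ L₂ X) : C a := by
  obtain ⟨a, rfl⟩ := toPol.surjective a
  induction a using TensorProduct.induction_on with
  | zero => simpa [tm_zero_left] using tmul 0 0
  | tmul s t => exact tmul s t
  | add a b ha hb => rw [map_add]; exact add _ _ ha hb

/-- Induction on the generators of the algebra of polynomial functions. -/
theorem induction {C : Pol L₁ L₂ X → Prop}
    (scalar : ∀ r : ℝ, C (r • 1)) (even : ∀ v, C (ev v)) (odd : ∀ w, C (od w))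
    (mul : ∀ a b, C a → C b → C (a * b)) (add : ∀ a b, C a → C b → C (a + b))
    (a : Pol L₁ L₂ X) : C a := by
  induction a using tensor_induction with
  | add a b ha hb => exact add a b ha hb
  | tmul s t =>
    have hs : C (tm s 1) := by
      induction s using SymmetricAlgebra.induction with
      | algebraMap r => rw [Algebra.algebraMap_eq_smul_one, tm_smul_left]; exact scalar r
      | ι x => exact even x
      | mul a b ha hb => simpa [tm_mul] using mul _ _ ha hb
      | add a b ha hb => simpa [tm_add_left] using add _ _ ha hb
    have ht : C (tm 1 t) := by
      induction t using ExteriorAlgebra.induction with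
      | algebraMap r => rw [Algebra.algebraMap_eq_smul_one, tm_smul_right]; exact scalar r
      | ι x => exact odd x
      | mul a b ha hb => simpa [tm_mul] using mul _ _ ha hb
      | add a b ha hb => simpa [tm_add_right] using add _ _ ha hb
    simpa [tm_mul] using mul _ _ hs ht

/-- The parity involution, `-1` on the odd generators. -/
def parity : Pol L₁ L₂ X →ₐ[ℝ] Pol L₁ L₂ X :=
  ((toPol (L₁ := L₁) (L₂ := L₂) (X := X)).toAlgHom.comp
    (Algebra.TensorProduct.map (AlgHom.id ℝ (SymmetricAlgebra ℝ (L₁ × L₂)))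
      (CliffordAlgebra.involute (Q := (0 : QuadraticForm ℝ (OddGen L₁ L₂ X)))))).comp
    toPol.symm.toAlgHom

/-- The derivative along the even coordinates dual to `ℓ`. -/
def evD (ℓ : Dual ℝ (L₁ × L₂)) : Pol L₁ L₂ X →ₗ[ℝ] Pol L₁ L₂ X :=
  toPol.toLinearMap ∘ₗ evenDeriv ℓ ∘ₗ toPol.symm.toLinearMap

/-- The left derivative along the odd coordinates dual to `ℓ`. -/
def odD (ℓ : Dual ℝ (OddGen L₁ L₂ X)) : Pol L₁ L₂ X →ₗ[ℝ] Pol L₁ L₂ X :=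
  toPol.toLinearMap ∘ₗ oddDerivL ℓ ∘ₗ toPol.symm.toLinearMap

theorem toPol_evenDeriv (ℓ : Dual ℝ (L₁ × L₂)) (a : FunAlg L₁ L₂ X) :
    toPol (evenDeriv ℓ a) = evD ℓ (toPol a) := rfl
theorem toPol_oddDerivL (ℓ : Dual ℝ (OddGen L₁ L₂ X)) (a : FunAlg L₁ L₂ X) :
    toPol (oddDerivL ℓ a) = odD ℓ (toPol a) := rfl

theorem parity_tm (s : SymmetricAlgebra ℝ (L₁ × L₂)) (t : ExteriorAlgebra ℝ (OddGen L₁ L₂ X)) :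
    parity (tm s t) = tm s (CliffordAlgebra.involute t) := rfl
theorem evD_tm (ℓ : Dual ℝ (L₁ × L₂)) (s : SymmetricAlgebra ℝ (L₁ × L₂))
    (t : ExteriorAlgebra ℝ (OddGen L₁ L₂ X)) : evD ℓ (tm s t) = tm (symDeriv ℓ s) t := rfl
theorem odD_tm (ℓ : Dual ℝ (OddGen L₁ L₂ X)) (s : SymmetricAlgebra ℝ (L₁ × L₂))
    (t : ExteriorAlgebra ℝ (OddGen L₁ L₂ X)) :
    odD ℓ (tm s t) = tm s (CliffordAlgebra.contractLeft ℓ t) := rfl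

@[simp] theorem parity_ev (v : L₁ × L₂) : parity (ev v : Pol L₁ L₂ X) = ev v := by
  simp [ev_def, parity_tm]

@[simp] theorem parity_od (w : OddGen L₁ L₂ X) : parity (od w) = -od w := by
  simp [od_def, parity_tm, ExteriorAlgebra.ι, tm_neg_right]

@[simp] theorem parity_parity (a : Pol L₁ L₂ X) : parity (parity a) = a := by
  induction a using induction with
  | scalar r => simp
  | even v => simp
  | odd w => simp
  | mul a b ha hb => simp [ha, hb]
  | add a b ha hb => simp [ha, hb]

theorem evD_mul (ℓ : Dual ℝ (L₁ × L₂)) (a b : Pol L₁ L₂ X) :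
    evD ℓ (a * b) = evD ℓ a * b + a * evD ℓ b := by
  induction a using tensor_induction with
  | add a a' ha ha' => simp only [add_mul, map_add, ha, ha']; abel
  | tmul s t =>
    induction b using tensor_induction with
    | add b b' hb hb' => simp only [mul_add, map_add, hb, hb']; abel
    | tmul s' t' => simp [evD_tm, tm_mul, tm_add_left, mul_comm, add_comm]

theorem odD_mul (ℓ : Dual ℝ (OddGen L₁ L₂ X)) (a b : Pol L₁ L₂ X) :
    odD ℓ (a * b) = odD ℓ a * b + parity a * odD ℓ b := by
  induction a using tensor_induction with
  | add a a' ha ha' => simp only [add_mul, map_add, ha, ha']; abel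
  | tmul s t =>
    induction b using tensor_induction with
    | add b b' hb hb' => simp only [mul_add, map_add, hb, hb']; abel
    | tmul s' t' => simp [odD_tm, tm_mul, tm_add_right, contractLeft_mul, parity_tm]

theorem toPol_oddDerivR (ℓ : Dual ℝ (OddGen L₁ L₂ X)) (a : FunAlg L₁ L₂ X) :
    toPol (oddDerivR ℓ a) = -odD ℓ (parity (toPol a)) := by
  induction a using TensorProduct.induction_on with
  | zero => simp
  | add a b ha hb => simp only [map_add, ha, hb]; abel
  | tmul s t =>
    have h : oddDerivR ℓ (s ⊗ₜ[ℝ] t) = s ⊗ₜ[ℝ] CliffordAlgebra.contractRight t ℓ := rfl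
    rw [h, contractRight_eq_neg_contractLeft]
    exact tm_neg_right s (CliffordAlgebra.contractLeft ℓ (CliffordAlgebra.involute t))

@[simp] theorem evD_ev (ℓ : Dual ℝ (L₁ × L₂)) (v : L₁ × L₂) :
    evD ℓ (ev v : Pol L₁ L₂ X) = ℓ v • 1 := by
  rw [ev_def, evD_tm, symDeriv_ι, Algebra.algebraMap_eq_smul_one, tm_smul_left, tm_one_one]

@[simp] theorem evD_od (ℓ : Dual ℝ (L₁ × L₂)) (w : OddGen L₁ L₂ X) : evD ℓ (od w) = 0 := by
  simp [od_def, evD_tm, tm_zero_left]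

@[simp] theorem evD_one (ℓ : Dual ℝ (L₁ × L₂)) : evD ℓ (1 : Pol L₁ L₂ X) = 0 := by
  simp [← tm_one_one, evD_tm, tm_zero_left]

@[simp] theorem odD_ev (ℓ : Dual ℝ (OddGen L₁ L₂ X)) (v : L₁ × L₂) :
    odD ℓ (ev v : Pol L₁ L₂ X) = 0 := by
  simp [ev_def, odD_tm, tm_zero_right]

@[simp] theorem odD_od (ℓ : Dual ℝ (OddGen L₁ L₂ X)) (w : OddGen L₁ L₂ X) :
    odD ℓ (od w) = ℓ w • 1 := by
  rw [od_def, odD_tm, ExteriorAlgebra.ι, CliffordAlgebra.contractLeft_ι,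
    Algebra.algebraMap_eq_smul_one, tm_smul_right, tm_one_one]

@[simp] theorem odD_one (ℓ : Dual ℝ (OddGen L₁ L₂ X)) : odD ℓ (1 : Pol L₁ L₂ X) = 0 := by
  simp [← tm_one_one, odD_tm, tm_zero_right]

theorem ev_mul_comm (v : L₁ × L₂) (a : Pol L₁ L₂ X) : ev v * a = a * ev v := by
  induction a using tensor_induction with
  | add a b ha hb => simp only [mul_add, add_mul, ha, hb]
  | tmul s t => simp [ev_def, mul_comm, tm_mul]

theorem od_mul_od (v w : OddGen L₁ L₂ X) : od v * od w = -(od w * od v) := by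
  have h : ExteriorAlgebra.ι ℝ v * ExteriorAlgebra.ι ℝ w =
      -(ExteriorAlgebra.ι ℝ w * ExteriorAlgebra.ι ℝ v) :=
    eq_neg_of_add_eq_zero_left (ExteriorAlgebra.ι_add_mul_swap v w)
  simp [od_def, h, tm_mul, tm_neg_right]

theorem od_mul (w : OddGen L₁ L₂ X) (a : Pol L₁ L₂ X) : od w * a = parity a * od w := by
  induction a using induction with
  | scalar r => simp
  | even v => simp [ev_mul_comm]
  | odd w' => simp [od_mul_od w w']
  | mul a b ha hb => rw [← mul_assoc, ha, mul_assoc, hb, ← mul_assoc, map_mul]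
  | add a b ha hb => simp only [mul_add, add_mul, ha, hb, map_add]

/-- Even elements are central. -/
theorem mul_comm_of_even {a : Pol L₁ L₂ X} (ha : parity a = a) (b : Pol L₁ L₂ X) :
    a * b = b * a := by
  induction b using induction with
  | scalar r => simp
  | even v => rw [ev_mul_comm]
  | odd w => rw [od_mul, ha]
  | mul b c hb hc => rw [← mul_assoc, hb, mul_assoc, hc, mul_assoc]
  | add b c hb hc => simp only [mul_add, add_mul, hb, hc]

theorem mul_comm_of_odd {a : Pol L₁ L₂ X} (ha : parity a = -a)
    (b : Pol L₁ L₂ X) : a * b = parity b * a := by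
  induction b using induction with
  | scalar r => simp
  | even v => simp [ev_mul_comm]
  | odd w => rw [parity_od, neg_mul, od_mul, ha, neg_mul, neg_neg]
  | mul b c hb hc => rw [← mul_assoc, hb, mul_assoc, hc, map_mul, mul_assoc]
  | add b c hb hc => simp only [mul_add, add_mul, hb, hc, map_add]

theorem parity_odD (ℓ : Dual ℝ (OddGen L₁ L₂ X)) (a : Pol L₁ L₂ X) :
    parity (odD ℓ a) = -odD ℓ (parity a) := by
  induction a using induction with
  | scalar r => simp
  | even v => simp
  | odd w => simp
  | mul a b ha hb =>
    simp only [odD_mul, map_mul, map_add, ha, hb, parity_parity]; simp; abel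
  | add a b ha hb => simp only [map_add, ha, hb]; abel

theorem parity_evD (ℓ : Dual ℝ (L₁ × L₂)) (a : Pol L₁ L₂ X) :
    parity (evD ℓ a) = evD ℓ (parity a) := by
  induction a using induction with
  | scalar r => simp
  | even v => simp
  | odd w => simp
  | mul a b ha hb => simp only [evD_mul, map_mul, map_add, ha, hb]
  | add a b ha hb => simp only [map_add, ha, hb]

theorem odD_odD (ℓ ℓ' : Dual ℝ (OddGen L₁ L₂ X)) (a : Pol L₁ L₂ X) :
    odD ℓ (odD ℓ' a) = -odD ℓ' (odD ℓ a) := by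
  induction a using induction with
  | scalar r => simp
  | even v => simp
  | odd w => simp
  | mul a b ha hb =>
    simp only [odD_mul, map_add, parity_odD, parity_parity, ha, hb]; simp; abel
  | add a b ha hb => simp only [map_add, ha, hb]; abel

theorem evD_evD (ℓ ℓ' : Dual ℝ (L₁ × L₂)) (a : Pol L₁ L₂ X) :
    evD ℓ (evD ℓ' a) = evD ℓ' (evD ℓ a) := by
  induction a using induction with
  | scalar r => simp
  | even v => simp
  | odd w => simp
  | mul a b ha hb => simp only [evD_mul, map_add, ha, hb]; abel
  | add a b ha hb => simp only [map_add, ha, hb]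

theorem evD_odD (ℓ : Dual ℝ (L₁ × L₂)) (ℓ' : Dual ℝ (OddGen L₁ L₂ X))
    (a : Pol L₁ L₂ X) : evD ℓ (odD ℓ' a) = odD ℓ' (evD ℓ a) := by
  induction a using tensor_induction with
  | add a b ha hb => simp only [map_add, ha, hb]
  | tmul s t => rfl

/-- The change of linear coordinates given by `f₁, f₂, f`, where `g₁, g₂` are the inverses of
`f₁, f₂` and act on the linear forms. -/
def map {L₁' L₂' X' : Type*} [AddCommGroup L₁'] [Module ℝ L₁'] [AddCommGroup L₂']
    [Module ℝ L₂'] [AddCommGroup X'] [Module ℝ X']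
    (f₁ : L₁ →ₗ[ℝ] L₁') (g₁ : L₁' →ₗ[ℝ] L₁) (f₂ : L₂ →ₗ[ℝ] L₂') (g₂ : L₂' →ₗ[ℝ] L₂)
    (f : X →ₗ[ℝ] X') : Pol L₁ L₂ X →ₐ[ℝ] Pol L₁' L₂' X' :=
  (toPol.toAlgHom.comp (FunAlg.map f₁ g₁ f₂ g₂ f)).comp toPol.symm.toAlgHom

section Map

variable {L₁' L₂' X' : Type*} [AddCommGroup L₁'] [Module ℝ L₁'] [AddCommGroup L₂']
    [Module ℝ L₂'] [AddCommGroup X'] [Module ℝ X']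
    (f₁ : L₁ →ₗ[ℝ] L₁') (g₁ : L₁' →ₗ[ℝ] L₁) (f₂ : L₂ →ₗ[ℝ] L₂') (g₂ : L₂' →ₗ[ℝ] L₂)
    (f : X →ₗ[ℝ] X')

theorem toPol_map (a : FunAlg L₁ L₂ X) :
    toPol (FunAlg.map f₁ g₁ f₂ g₂ f a) = map f₁ g₁ f₂ g₂ f (toPol a) := rfl

@[simp] theorem map_ev (v : L₁ × L₂) : map f₁ g₁ f₂ g₂ f (ev v) = ev (f₁ v.1, f₂ v.2) := by
  have : FunAlg.map f₁ g₁ f₂ g₂ f (evenGen v) = evenGen (f₁ v.1, f₂ v.2) := by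
    simp [FunAlg.map, evenGen]
  rw [← toPol_evenGen, ← toPol_map, this]; rfl

@[simp] theorem map_od (w : OddGen L₁ L₂ X) : map f₁ g₁ f₂ g₂ f (od w) =
    od (w.1 ∘ₗ g₁, w.2.1 ∘ₗ g₂, f w.2.2) := by
  have : FunAlg.map f₁ g₁ f₂ g₂ f (oddGen w) = oddGen (w.1 ∘ₗ g₁, w.2.1 ∘ₗ g₂, f w.2.2) := by
    simp [FunAlg.map, oddGen]; rfl
  rw [← toPol_oddGen, ← toPol_map, this]; rfl

end Map

theorem algHom_ext {B : Type*} [Ring B] [Algebra ℝ B] {φ ψ : Pol L₁ L₂ X →ₐ[ℝ] B}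
    (hev : ∀ v, φ (ev v) = ψ (ev v)) (hod : ∀ w, φ (od w) = ψ (od w)) : φ = ψ := by
  ext a
  induction a using induction with
  | scalar r => simp
  | even v => exact hev v
  | odd w => exact hod w
  | mul a b ha hb => simp only [map_mul, ha, hb]
  | add a b ha hb => simp only [map_add, ha, hb]

end Pol
end Pol

/-! ### Spans of homogeneous products of generators -/

section GradedSpan

variable {A ι G : Type*} [Ring A] [Algebra ℝ A] [AddCommMonoid G] (gen : ι → A) (deg : ι → G)

/-- The span of the products of generators of total degree `g`. -/
def gradedSpan (g : G) : Submodule ℝ A :=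
  Submodule.span ℝ {w | ∃ L : List ι, (L.map deg).sum = g ∧ w = (L.map gen).prod}

variable {gen deg}

theorem prod_mem_gradedSpan (L : List ι) :
    (L.map gen).prod ∈ gradedSpan gen deg (L.map deg).sum :=
  Submodule.subset_span ⟨L, rfl, rfl⟩

theorem gen_mem_gradedSpan (i : ι) : gen i ∈ gradedSpan gen deg (deg i) := by
  simpa using prod_mem_gradedSpan (gen := gen) (deg := deg) [i]

theorem one_mem_gradedSpan : (1 : A) ∈ gradedSpan gen deg 0 := by
  simpa using prod_mem_gradedSpan (gen := gen) (deg := deg) []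

theorem gradedSpan_le {g : G} {N : Submodule ℝ A}
    (h : ∀ L : List ι, (L.map deg).sum = g → (L.map gen).prod ∈ N) : gradedSpan gen deg g ≤ N :=
  Submodule.span_le.2 (by rintro _ ⟨L, hL, rfl⟩; exact h L hL)

theorem mul_mem_gradedSpan {g h : G} {a b : A} (ha : a ∈ gradedSpan gen deg g)
    (hb : b ∈ gradedSpan gen deg h) : a * b ∈ gradedSpan gen deg (g + h) := by
  refine Submodule.span_induction (p := fun a _ => a * b ∈ gradedSpan gen deg (g + h))
    ?_ (by simp) (fun x y _ _ hx hy => by rw [add_mul]; exact add_mem hx hy)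
    (fun r x _ hx => by rw [smul_mul_assoc]; exact Submodule.smul_mem _ r hx) ha
  rintro _ ⟨L, rfl, rfl⟩
  refine Submodule.span_induction
    (p := fun b _ => (L.map gen).prod * b ∈ gradedSpan gen deg ((L.map deg).sum + h))
    ?_ (by simp) (fun x y _ _ hx hy => by rw [mul_add]; exact add_mem hx hy)
    (fun r x _ hx => by rw [mul_smul_comm]; exact Submodule.smul_mem _ r hx) hb
  rintro _ ⟨L', rfl, rfl⟩
  simpa using prod_mem_gradedSpan (gen := gen) (deg := deg) (L ++ L')

/-- A twisted derivation that is homogeneous of degree `s` on the generators is so everywhere. -/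
theorem deriv_mem_gradedSpan {D : A →ₗ[ℝ] A} {ε : ι → ℝ} {s : G} (h1 : D 1 = 0)
    (hD : ∀ i b, D (gen i * b) = D (gen i) * b + ε i • (gen i * D b))
    (hgen : ∀ i, D (gen i) ∈ gradedSpan gen deg (deg i + s)) {g : G} {a : A}
    (ha : a ∈ gradedSpan gen deg g) : D a ∈ gradedSpan gen deg (g + s) := by
  have key : ∀ L : List ι, D (L.map gen).prod ∈ gradedSpan gen deg ((L.map deg).sum + s) := by
    intro L
    induction L with
    | nil => simp [h1]
    | cons i L ih =>
      simp only [List.map_cons, List.prod_cons, List.sum_cons, hD]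
      refine add_mem ?_ (Submodule.smul_mem _ _ ?_)
      · rw [add_right_comm]
        exact mul_mem_gradedSpan (hgen i) (prod_mem_gradedSpan L)
      · rw [add_assoc]
        exact mul_mem_gradedSpan (gen_mem_gradedSpan i) ih
  have : gradedSpan gen deg g ≤ (gradedSpan gen deg (g + s)).comap D :=
    gradedSpan_le fun L hL => by
      subst hL
      exact key L
  exact this ha

end GradedSpan

/-! ### The grading of the algebra of polynomial functions -/

/-- The generators `η`, `c`, `x*`, `η*`, `c*`. -/
inductive Gen (L₁ L₂ X : Type*) [AddCommGroup L₁] [Module ℝ L₁] [AddCommGroup L₂] [Module ℝ L₂]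
    [AddCommGroup X] [Module ℝ X] : Type _
  | eta (ξ : Dual ℝ L₁)
  | gho (ξ : Dual ℝ L₂)
  | xs (v : X)
  | es (v : L₁)
  | gs (v : L₂)

namespace Pol

variable {L₁ L₂ X : Type*} [AddCommGroup L₁] [Module ℝ L₁] [AddCommGroup L₂] [Module ℝ L₂]
  [AddCommGroup X] [Module ℝ X]

def η (ξ : Dual ℝ L₁) : Pol L₁ L₂ X := od (ξ, 0, 0)
def c (ξ : Dual ℝ L₂) : Pol L₁ L₂ X := od (0, ξ, 0)
def xs (v : X) : Pol L₁ L₂ X := od (0, 0, v)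
def ηs (v : L₁) : Pol L₁ L₂ X := ev (v, 0)
def cs (v : L₂) : Pol L₁ L₂ X := ev (0, v)

/-- The generators as functions. -/
def gen : Gen L₁ L₂ X → Pol L₁ L₂ X
  | .eta ξ => η ξ
  | .gho ξ => c ξ
  | .xs v => xs v
  | .es v => ηs v
  | .gs v => cs v

/-- Momentum degree, ghost number and resolution degree of the generators. -/
def deg : Gen L₁ L₂ X → ℤ × ℤ × ℤ
  | .eta _ => (0, -1, 1)
  | .gho _ => (0, 1, 0)
  | .xs _ => (1, 1, 0)
  | .es _ => (1, 2, 0)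
  | .gs _ => (1, 0, 1)

/-- Functions of given momentum degree, ghost number and resolution degree. -/
def gr (g : ℤ × ℤ × ℤ) : Submodule ℝ (Pol L₁ L₂ X) := gradedSpan gen deg g

theorem mul_mem_gr {g h : ℤ × ℤ × ℤ} {a b : Pol L₁ L₂ X} (ha : a ∈ gr g) (hb : b ∈ gr h) :
    a * b ∈ gr (g + h) := mul_mem_gradedSpan ha hb

theorem one_mem_gr : (1 : Pol L₁ L₂ X) ∈ gr 0 := one_mem_gradedSpan

theorem eta_mem_gr (ξ : Dual ℝ L₁) : (η ξ : Pol L₁ L₂ X) ∈ gr (0, -1, 1) :=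
  gen_mem_gradedSpan (gen := gen) (deg := deg) (.eta ξ)
theorem c_mem_gr (ξ : Dual ℝ L₂) : (c ξ : Pol L₁ L₂ X) ∈ gr (0, 1, 0) :=
  gen_mem_gradedSpan (gen := gen) (deg := deg) (.gho ξ)
theorem xs_mem_gr (v : X) : (xs v : Pol L₁ L₂ X) ∈ gr (1, 1, 0) :=
  gen_mem_gradedSpan (gen := gen) (deg := deg) (.xs v)
theorem etaStar_mem_gr (v : L₁) : (ηs v : Pol L₁ L₂ X) ∈ gr (1, 2, 0) :=
  gen_mem_gradedSpan (gen := gen) (deg := deg) (.es v)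
theorem cStar_mem_gr (v : L₂) : (cs v : Pol L₁ L₂ X) ∈ gr (1, 0, 1) :=
  gen_mem_gradedSpan (gen := gen) (deg := deg) (.gs v)

theorem parity_gen (i : Gen L₁ L₂ X) :
    parity (gen i) = (-1 : ℝ) ^ (deg i).2.1 • gen i := by
  cases i <;> simp [gen, deg, η, c, xs, ηs, cs]

/-- The odd generators are exactly those of odd ghost number, so the ghost number determines all
signs. -/
theorem parity_of_mem_gr {g : ℤ × ℤ × ℤ} {a : Pol L₁ L₂ X} (ha : a ∈ gr g) :
    parity a = (-1 : ℝ) ^ g.2.1 • a := by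
  have key : ∀ L : List (Gen L₁ L₂ X), parity (L.map gen).prod =
      (-1 : ℝ) ^ (L.map deg).sum.2.1 • (L.map gen).prod := by
    intro L
    induction L with
    | nil => simp
    | cons i L ih =>
      simp only [List.map_cons, List.prod_cons, List.sum_cons, map_mul, ih, parity_gen,
        Prod.snd_add, Prod.fst_add, zpow_add₀ (by norm_num : (-1 : ℝ) ≠ 0), mul_smul, smul_mul_assoc,
        mul_smul_comm]
      rw [smul_comm]
  refine Submodule.span_induction (p := fun a _ => parity a = (-1 : ℝ) ^ g.2.1 • a)
    ?_ (by simp) (fun x y _ _ hx hy => by simp [hx, hy])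
    (fun r x _ hx => by rw [map_smul, hx, smul_comm]) ha
  rintro _ ⟨L, rfl, rfl⟩
  exact key L

/-- Linear maps that are homogeneous of degree `s`. -/
def Shifts (f : Pol L₁ L₂ X →ₗ[ℝ] Pol L₁ L₂ X) (s : ℤ × ℤ × ℤ) : Prop :=
  ∀ ⦃g a⦄, a ∈ gr g → f a ∈ gr (g + s)

theorem shifts_odD {ℓ : Dual ℝ (OddGen L₁ L₂ X)} {s : ℤ × ℤ × ℤ}
    (h : ∀ i : Gen L₁ L₂ X, odD ℓ (gen i) ∈ gr (deg i + s)) : Shifts (odD ℓ) s := by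
  intro g a ha
  refine deriv_mem_gradedSpan (ε := fun i => (-1 : ℝ) ^ (deg i).2.1) (by simp) ?_ h ha
  intro i b
  rw [odD_mul, parity_gen, smul_mul_assoc]

theorem shifts_evD {ℓ : Dual ℝ (L₁ × L₂)} {s : ℤ × ℤ × ℤ}
    (h : ∀ i : Gen L₁ L₂ X, evD ℓ (gen i) ∈ gr (deg i + s)) :
    Shifts (evD ℓ : Pol L₁ L₂ X →ₗ[ℝ] Pol L₁ L₂ X) s := by
  intro g a ha
  refine deriv_mem_gradedSpan (ε := fun i => 1) (by simp) ?_ h ha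
  intro i b
  rw [evD_mul, one_smul]

theorem smul_one_mem_gr (r : ℝ) : (r • 1 : Pol L₁ L₂ X) ∈ gr 0 :=
  Submodule.smul_mem _ _ one_mem_gr

/-- The derivative along `η`. -/
def dη (v : L₁) : Pol L₁ L₂ X →ₗ[ℝ] Pol L₁ L₂ X :=
  odD (Dual.eval ℝ L₁ v ∘ₗ LinearMap.fst ℝ _ _)
/-- The left derivative along `c`. -/
def dc (v : L₂) : Pol L₁ L₂ X →ₗ[ℝ] Pol L₁ L₂ X :=
  odD (Dual.eval ℝ L₂ v ∘ₗ LinearMap.fst ℝ _ _ ∘ₗ LinearMap.snd ℝ _ _)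
/-- The left derivative along `x*`. -/
def dxs (ξ : Dual ℝ X) : Pol L₁ L₂ X →ₗ[ℝ] Pol L₁ L₂ X :=
  odD (ξ ∘ₗ LinearMap.snd ℝ _ _ ∘ₗ LinearMap.snd ℝ _ _)
/-- The derivative along `η*`. -/
def dηs (ξ : Dual ℝ L₁) : Pol L₁ L₂ X →ₗ[ℝ] Pol L₁ L₂ X := evD (ξ ∘ₗ LinearMap.fst ℝ _ _)
/-- The derivative along `c*`. -/
def dcs (ξ : Dual ℝ L₂) : Pol L₁ L₂ X →ₗ[ℝ] Pol L₁ L₂ X := evD (ξ ∘ₗ LinearMap.snd ℝ _ _)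

theorem shifts_dη (v : L₁) : Shifts (dη v : Pol L₁ L₂ X →ₗ[ℝ] _) (0, 1, -1) :=
  shifts_odD fun i => by
    cases i <;> simp [gen, deg, η, c, xs, ηs, cs]
    exact smul_one_mem_gr _
theorem shifts_dc (v : L₂) : Shifts (dc v : Pol L₁ L₂ X →ₗ[ℝ] _) (0, -1, 0) :=
  shifts_odD fun i => by
    cases i <;> simp [gen, deg, η, c, xs, ηs, cs]
    exact smul_one_mem_gr _
theorem shifts_dxs (ξ : Dual ℝ X) : Shifts (dxs ξ : Pol L₁ L₂ X →ₗ[ℝ] _) (-1, -1, 0) :=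
  shifts_odD fun i => by
    cases i <;> simp [gen, deg, η, c, xs, ηs, cs]
    exact smul_one_mem_gr _
theorem shifts_dηs (ξ : Dual ℝ L₁) : Shifts (dηs ξ : Pol L₁ L₂ X →ₗ[ℝ] _) (-1, -2, 0) :=
  shifts_evD fun i => by
    cases i <;> simp [gen, deg, η, c, xs, ηs, cs]
    exact smul_one_mem_gr _
theorem shifts_dcs (ξ : Dual ℝ L₂) : Shifts (dcs ξ : Pol L₁ L₂ X →ₗ[ℝ] _) (-1, 0, -1) :=
  shifts_evD fun i => by
    cases i <;> simp [gen, deg, η, c, xs, ηs, cs]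
    exact smul_one_mem_gr _

/-- Functions of momentum degree `k`, ghost number `l` and resolution degree at least `r`. -/
def fil (k l r : ℤ) : Submodule ℝ (Pol L₁ L₂ X) := ⨆ (r' : ℤ) (_ : r ≤ r'), gr (k, l, r')

theorem gr_le_fil {k l r r' : ℤ} (h : r ≤ r') :
    (gr (k, l, r') : Submodule ℝ (Pol L₁ L₂ X)) ≤ fil k l r :=
  le_iSup₂_of_le r' h le_rfl

theorem fil_le {k l r : ℤ} {N : Submodule ℝ (Pol L₁ L₂ X)} (h : ∀ r', r ≤ r' → gr (k, l, r') ≤ N) :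
    fil k l r ≤ N := iSup₂_le h

theorem fil_mono {k l r r' : ℤ} (h : r ≤ r') :
    (fil k l r' : Submodule ℝ (Pol L₁ L₂ X)) ≤ fil k l r :=
  fil_le fun _ hr => gr_le_fil (h.trans hr)

theorem Shifts.fil {f : Pol L₁ L₂ X →ₗ[ℝ] Pol L₁ L₂ X} {a b s : ℤ} (hf : Shifts f (a, b, s))
    {k l r : ℤ} {w : Pol L₁ L₂ X} (hw : w ∈ fil k l r) :
    f w ∈ Pol.fil (k + a) (l + b) (r + s) := by
  have : Pol.fil k l r ≤ (Pol.fil (k + a) (l + b) (r + s)).comap f := by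
    refine fil_le fun r' hr w hw => ?_
    have h := hf hw
    rw [Prod.mk_add_mk, Prod.mk_add_mk] at h
    exact gr_le_fil (add_le_add_left hr s) h
  exact this hw

theorem mul_mem_fil {k l r k' l' r' : ℤ} {a b : Pol L₁ L₂ X} (ha : a ∈ fil k l r)
    (hb : b ∈ fil k' l' r') : a * b ∈ fil (k + k') (l + l') (r + r') := by
  have : fil k l r ≤ (fil (k + k') (l + l') (r + r')).comap (LinearMap.mulRight ℝ b) := by
    refine fil_le fun s hs a ha => ?_
    have : fil k' l' r' ≤ (fil (k + k') (l + l') (r + r')).comap (LinearMap.mulLeft ℝ a) := by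
      refine fil_le fun s' hs' b hb => ?_
      have h := mul_mem_gr ha hb
      rw [Prod.mk_add_mk, Prod.mk_add_mk] at h
      exact gr_le_fil (add_le_add hs hs') h
    exact this hb
  exact this ha

theorem parity_of_mem_fil {k l r : ℤ} {a : Pol L₁ L₂ X} (ha : a ∈ fil k l r) :
    parity a = (-1 : ℝ) ^ l • a := by
  have : fil k l r ≤ LinearMap.ker ((parity (L₁ := L₁) (L₂ := L₂) (X := X)).toLinearMap -
      (-1 : ℝ) ^ l • LinearMap.id) := by
    refine fil_le fun r' _ a ha => ?_
    rw [LinearMap.mem_ker, LinearMap.sub_apply, LinearMap.smul_apply, LinearMap.id_apply,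
      AlgHom.toLinearMap_apply, parity_of_mem_gr ha, sub_self]
  have h := this ha
  rwa [LinearMap.mem_ker, LinearMap.sub_apply, LinearMap.smul_apply, LinearMap.id_apply,
      AlgHom.toLinearMap_apply, sub_eq_zero] at h

/-- The third inequality holds for each of the five generators. It is the only place from which the
condition k > l draws its force. -/
theorem deg_sum_nonneg (L : List (Gen L₁ L₂ X)) : 0 ≤ (L.map deg).sum.1 ∧
    0 ≤ (L.map deg).sum.2.2 ∧ (L.map deg).sum.1 ≤ (L.map deg).sum.2.1 + (L.map deg).sum.2.2 := by
  induction L with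
  | nil => simp
  | cons i L ih =>
    cases i <;> simp [deg] <;> omega

theorem gr_eq_bot {k l r : ℤ} (h : r < 0 ∨ l + r < k) :
    (gr (k, l, r) : Submodule ℝ (Pol L₁ L₂ X)) = ⊥ := by
  refine le_bot_iff.1 (gradedSpan_le fun L hL => ?_)
  have := deg_sum_nonneg L
  simp only [hL] at this
  omega

/-- Below the diagonal all functions have positive resolution degree. -/
theorem fil_zero_le_fil_one {k l : ℤ} (h : l < k) :
    (fil k l 0 : Submodule ℝ (Pol L₁ L₂ X)) ≤ fil k l 1 := by
  refine fil_le fun r hr => ?_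
  rcases hr.lt_or_eq with hr | rfl
  · exact gr_le_fil hr
  · rw [gr_eq_bot (by omega)]; exact bot_le

section Ordered

/-- The ordered monomials. -/
def mono (e : List (Dual ℝ L₁)) (g : List (Dual ℝ L₂)) (x : List X) (es : List L₁)
    (gs : List L₂) : Pol L₁ L₂ X :=
  (e.map η).prod * (g.map c).prod * (x.map xs).prod * (es.map ηs).prod * (gs.map cs).prod

theorem od_mul_prod (w : OddGen L₁ L₂ X) {α : Type*} (f : α → OddGen L₁ L₂ X) (L : List α) :
    od w * (L.map fun x => od (f x)).prod =
      (-1 : ℝ) ^ L.length • ((L.map fun x => od (f x)).prod * od w) := by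
  induction L with
  | nil => simp
  | cons x L ih =>
    simp only [List.map_cons, List.prod_cons, List.length_cons, pow_succ]
    rw [← mul_assoc, od_mul_od, neg_mul, mul_assoc, ih]
    simp [mul_assoc]

theorem gen_mul_mono (i : Gen L₁ L₂ X) (e : List (Dual ℝ L₁)) (g : List (Dual ℝ L₂)) (x : List X)
    (es : List L₁) (gs : List L₂) : ∃ r : ℝ, gen i * mono e g x es gs = r •
      match i with
      | .eta ξ => mono (ξ :: e) g x es gs
      | .gho ξ => mono e (ξ :: g) x es gs
      | .xs v => mono e g (v :: x) es gs
      | .es v => mono e g x (v :: es) gs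
      | .gs v => mono e g x es (v :: gs) := by
  have h1 : ∀ w, od w * (e.map η).prod = (-1 : ℝ) ^ e.length • ((e.map η).prod * od w :
      Pol L₁ L₂ X) := fun w => od_mul_prod w _ e
  have h2 : ∀ w, od w * (g.map c).prod = (-1 : ℝ) ^ g.length • ((g.map c).prod * od w :
      Pol L₁ L₂ X) := fun w => od_mul_prod w _ g
  cases i with
  | eta ξ => exact ⟨1, by simp [mono, gen, mul_assoc]⟩
  | gho ξ =>
    refine ⟨(-1) ^ e.length, ?_⟩
    simp only [gen, mono, c, List.map_cons, List.prod_cons]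
    rw [← mul_assoc, ← mul_assoc, ← mul_assoc, ← mul_assoc, h1]
    simp only [smul_mul_assoc, mul_assoc]
  | xs v =>
    refine ⟨(-1) ^ e.length * (-1) ^ g.length, ?_⟩
    simp only [gen, mono, xs, List.map_cons, List.prod_cons]
    rw [← mul_assoc, ← mul_assoc, ← mul_assoc, ← mul_assoc, h1, smul_mul_assoc,
      mul_assoc ((e.map η).prod), h2]
    simp only [smul_mul_assoc, mul_assoc, mul_smul_comm, smul_smul]
  | es v =>
    refine ⟨1, ?_⟩
    simp only [gen, mono, ηs, List.map_cons, List.prod_cons, one_smul]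
    rw [← mul_assoc, ← mul_assoc, ev_mul_comm]
    simp only [mul_assoc]
  | gs v =>
    refine ⟨1, ?_⟩
    simp only [gen, mono, cs, List.map_cons, List.prod_cons, one_smul]
    rw [← mul_assoc, ev_mul_comm]
    simp only [mul_assoc]

/-- Odd generators anticommute and even ones are central, so sorting a word costs only a sign. This
reconciles the span of arbitrary words, convenient for derivations, with the span of ordered
monomials in `homog`. -/
theorem prod_gen_eq_mono (L : List (Gen L₁ L₂ X)) : ∃ (r : ℝ) (e : List (Dual ℝ L₁))
    (g : List (Dual ℝ L₂)) (x : List X) (es : List L₁) (gs : List L₂),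
    (L.map gen).prod = r • mono e g x es gs ∧ (L.map deg).sum =
      ((x.length + es.length + gs.length : ℤ),
        -(e.length : ℤ) + g.length + x.length + 2 * es.length, (e.length + gs.length : ℤ)) := by
  induction L with
  | nil => exact ⟨1, [], [], [], [], [], by simp [mono], by simp; rfl⟩
  | cons i L ih =>
    obtain ⟨r, e, g, x, es, gs, h, hd⟩ := ih
    obtain ⟨r', h'⟩ := gen_mul_mono i e g x es gs
    cases i with
    | eta ξ =>
      refine ⟨r * r', ξ :: e, g, x, es, gs, ?_, ?_⟩
      · simp [h, h', mul_smul]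
      · simp [hd, deg]; constructor <;> ring
    | gho ξ =>
      refine ⟨r * r', e, ξ :: g, x, es, gs, ?_, ?_⟩
      · simp [h, h', mul_smul]
      · simp [hd, deg]; ring
    | xs v =>
      refine ⟨r * r', e, g, v :: x, es, gs, ?_, ?_⟩
      · simp [h, h', mul_smul]
      · simp [hd, deg]; constructor <;> ring
    | es v =>
      refine ⟨r * r', e, g, x, v :: es, gs, ?_, ?_⟩
      · simp [h, h', mul_smul]
      · simp [hd, deg]; constructor <;> ring
    | gs v =>
      refine ⟨r * r', e, g, x, es, v :: gs, ?_, ?_⟩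
      · simp [h, h', mul_smul]
      · simp [hd, deg]; constructor <;> ring

theorem toPol_mono (e : List (Dual ℝ L₁)) (g : List (Dual ℝ L₂)) (x : List X) (es : List L₁)
    (gs : List L₂) : toPol ((e.map eta).prod * (g.map gho).prod * (x.map xStar).prod *
      (es.map etaStar).prod * (gs.map cStar).prod) = mono e g x es gs := by
  simp only [map_mul, map_list_prod, List.map_map]
  rfl

theorem toPol_mem_gr_of_mem_homog {k : ℕ} {l : ℤ} {r : ℕ} {a : FunAlg L₁ L₂ X}
    (ha : a ∈ homog k l r) : toPol a ∈ gr ((k : ℤ), l, (r : ℤ)) := by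
  refine Submodule.span_induction (p := fun a _ => toPol a ∈ gr ((k : ℤ), l, (r : ℤ)))
    ?_ (by simp) (fun x y _ _ hx hy => by rw [map_add]; exact add_mem hx hy)
    (fun r x _ hx => by rw [map_smul]; exact Submodule.smul_mem _ r hx) ha
  rintro _ ⟨e, g, x, es, gs, rfl, rfl, rfl, rfl⟩
  rw [toPol_mono, mono]
  have := prod_mem_gradedSpan (gen := gen) (deg := deg)
    (e.map .eta ++ g.map .gho ++ x.map .xs ++ es.map .es ++ gs.map .gs : List (Gen L₁ L₂ X))
  have key : ((e.map .eta ++ g.map .gho ++ x.map .xs ++ es.map .es ++ gs.map .gs :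
      List (Gen L₁ L₂ X)).map deg).sum = ((x.length + es.length + gs.length : ℤ),
        -(e.length : ℤ) + g.length + x.length + 2 * es.length, (e.length + gs.length : ℤ)) := by
    simp [Function.comp_def, deg]
    constructor <;> ring
  rw [key] at this
  simpa [Function.comp_def, gen, gr, mul_assoc] using this

theorem mem_homog_of_toPol_mem_gr {k : ℕ} {l : ℤ} {r : ℕ} {a : FunAlg L₁ L₂ X}
    (ha : toPol a ∈ gr ((k : ℤ), l, (r : ℤ))) : a ∈ homog k l r := by
  have : (gr ((k : ℤ), l, (r : ℤ)) : Submodule ℝ (Pol L₁ L₂ X)) ≤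
      (homog k l r).comap (toPol (L₁ := L₁) (L₂ := L₂) (X := X)).symm.toLinearMap := by
    refine gradedSpan_le fun L hL => ?_
    obtain ⟨s, e, g, x, es, gs, h, hd⟩ := prod_gen_eq_mono L
    rw [h, Submodule.mem_comap, map_smul]
    refine Submodule.smul_mem _ _ (Submodule.subset_span ⟨e, g, x, es, gs, ?_, ?_, ?_, ?_⟩)
    · have := congrArg Prod.fst (hL.symm.trans hd); simp at this; omega
    · have := congrArg (fun p => p.2.1) (hL.symm.trans hd); simpa using this
    · have := congrArg (fun p => p.2.2) (hL.symm.trans hd); simp at this; omega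
    · rw [← toPol_mono]; exact toPol.symm_apply_apply _
  have := this ha
  simpa using this

theorem mem_homog_iff {k : ℕ} {l : ℤ} {r : ℕ} {a : FunAlg L₁ L₂ X} :
    a ∈ homog k l r ↔ toPol a ∈ gr ((k : ℤ), l, (r : ℤ)) :=
  ⟨toPol_mem_gr_of_mem_homog, mem_homog_of_toPol_mem_gr⟩

theorem mem_bihomog_iff {k : ℕ} {l : ℤ} {a : FunAlg L₁ L₂ X} :
    a ∈ bihomog k l ↔ toPol a ∈ fil (k : ℤ) l 0 := by
  constructor
  · intro ha
    have : (bihomog k l : Submodule ℝ (FunAlg L₁ L₂ X)) ≤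
        (fil (k : ℤ) l 0).comap toPol.toAlgHom.toLinearMap :=
      iSup_le fun r a ha => gr_le_fil (Int.natCast_nonneg r) (mem_homog_iff.1 ha)
    exact this ha
  · intro ha
    have : (fil (k : ℤ) l 0 : Submodule ℝ (Pol L₁ L₂ X)) ≤
        (bihomog k l).comap (toPol (L₁ := L₁) (L₂ := L₂) (X := X)).symm.toLinearMap := by
      refine fil_le fun r hr a ha => ?_
      lift r to ℕ using hr
      obtain ⟨a, rfl⟩ := toPol.surjective a
      have := Submodule.mem_iSup_of_mem (p := fun r => homog k l r) r (mem_homog_iff.2 ha)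
      simpa [bihomog] using this
    simpa using this ha

theorem toPol_mem_of_mem_bihomogResPos {k : ℕ} {l : ℤ} {a : FunAlg L₁ L₂ X}
    (ha : a ∈ bihomogResPos k l) : toPol a ∈ fil (k : ℤ) l 1 := by
  have : (bihomogResPos k l : Submodule ℝ (FunAlg L₁ L₂ X)) ≤
      (fil (k : ℤ) l 1).comap toPol.toAlgHom.toLinearMap :=
    iSup_le fun r a ha => gr_le_fil (r' := ((r + 1 : ℕ) : ℤ)) (by simp) (mem_homog_iff.1 ha)
  exact this ha

/-- The product is an alternating function of the list, and a list longer than the dimension is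
linearly dependent. -/
theorem prod_od_eq_zero {V : Type*} [AddCommGroup V] [Module ℝ V] [FiniteDimensional ℝ V]
    (f : V →ₗ[ℝ] OddGen L₁ L₂ X) (e : List V) (he : finrank ℝ V < e.length) :
    (e.map fun v => od (f v)).prod = 0 := by
  have h : (e.map fun v => od (f v)).prod =
      tm 1 (ExteriorAlgebra.ιMulti ℝ e.length fun i => f (e.get i)) := by
    have hl : List.ofFn (fun i => ExteriorAlgebra.ι ℝ (f (e.get i))) =
        e.map fun v => ExteriorAlgebra.ι ℝ (f v) := by
      conv_rhs => rw [← List.ofFn_get e, List.map_ofFn]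
      rfl
    rw [ExteriorAlgebra.ιMulti_apply, hl]
    clear he hl
    induction e with
    | nil => rfl
    | cons x e ih => 
      rw [List.map_cons, List.prod_cons, ih, List.map_cons, List.prod_cons, od_def, tm_mul, one_mul]
  rw [h, AlternatingMap.map_linearDependent, tm_zero_right]
  intro hli
  have : LinearIndependent ℝ (fun i => e.get i) := LinearIndependent.of_comp f hli
  have := this.fintype_card_le_finrank
  rw [Fintype.card_fin] at this
  omega

theorem prod_eta_eq_zero [FiniteDimensional ℝ L₁] (e : List (Dual ℝ L₁))
    (he : finrank ℝ L₁ < e.length) : (e.map (η : _ → Pol L₁ L₂ X)).prod = 0 :=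
  prod_od_eq_zero (LinearMap.inl ℝ _ _) e (by rwa [Subspace.dual_finrank_eq])

theorem prod_c_eq_zero [FiniteDimensional ℝ L₂] (e : List (Dual ℝ L₂))
    (he : finrank ℝ L₂ < e.length) : (e.map (c : _ → Pol L₁ L₂ X)).prod = 0 :=
  prod_od_eq_zero (LinearMap.inr ℝ _ _ ∘ₗ LinearMap.inl ℝ _ _) e
    (by rwa [Subspace.dual_finrank_eq])

/-- The resolution degree is the number of η plus the number of c*. The former is bounded by the
rank, the latter by the momentum degree. The filtration is therefore finite, which ends the descent.
-/
theorem gr_eq_bot_of_lt [FiniteDimensional ℝ L₁] {k l r : ℤ} (h : finrank ℝ L₁ + k < r) :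
    (gr (k, l, r) : Submodule ℝ (Pol L₁ L₂ X)) = ⊥ := by
  refine le_bot_iff.1 (gradedSpan_le fun L hL => ?_)
  obtain ⟨s, e, g, x, es, gs, hp, hd⟩ := prod_gen_eq_mono L
  rw [hL] at hd
  simp only [Prod.mk.injEq] at hd
  rw [hp, mono, prod_eta_eq_zero e (by omega)]
  simp

theorem fil_eq_bot_of_lt [FiniteDimensional ℝ L₁] {k l r : ℤ} (h : finrank ℝ L₁ + k < r) :
    (fil k l r : Submodule ℝ (Pol L₁ L₂ X)) = ⊥ :=
  le_bot_iff.1 (fil_le fun r' hr => (gr_eq_bot_of_lt (by omega)).le)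

end Ordered

theorem map_mem_gr {L₁' L₂' X' : Type*} [AddCommGroup L₁'] [Module ℝ L₁'] [AddCommGroup L₂']
    [Module ℝ L₂'] [AddCommGroup X'] [Module ℝ X']
    (f₁ : L₁ →ₗ[ℝ] L₁') (g₁ : L₁' →ₗ[ℝ] L₁) (f₂ : L₂ →ₗ[ℝ] L₂') (g₂ : L₂' →ₗ[ℝ] L₂)
    (f : X →ₗ[ℝ] X') {g : ℤ × ℤ × ℤ} {a : Pol L₁ L₂ X} (ha : a ∈ gr g) :
    map f₁ g₁ f₂ g₂ f a ∈ gr g := by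
  let σ : Gen L₁ L₂ X → Gen L₁' L₂' X'
    | .eta ξ => .eta (ξ ∘ₗ g₁)
    | .gho ξ => .gho (ξ ∘ₗ g₂)
    | .xs v => .xs (f v)
    | .es v => .es (f₁ v)
    | .gs v => .gs (f₂ v)
  have hgen : ∀ i, map f₁ g₁ f₂ g₂ f (gen i) = gen (σ i) := by
    intro i; cases i <;> simp [gen, σ, η, c, xs, ηs, cs]
  have hdeg : ∀ i, deg (σ i) = deg i := by
    intro i; cases i <;> rfl
  have : gr g ≤ (gr g).comap (map f₁ g₁ f₂ g₂ f).toLinearMap := by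
    refine gradedSpan_le fun L hL => ?_
    simp only [Submodule.mem_comap, AlgHom.toLinearMap_apply, map_list_prod, List.map_map]
    have := prod_mem_gradedSpan (gen := gen) (deg := deg) (L.map σ)
    simp only [List.map_map, Function.comp_def, hdeg, hL] at this
    simpa only [Function.comp_def, hgen, gr] using this
  exact this ha

theorem map_mem_fil {L₁' L₂' X' : Type*} [AddCommGroup L₁'] [Module ℝ L₁'] [AddCommGroup L₂']
    [Module ℝ L₂'] [AddCommGroup X'] [Module ℝ X']
    (f₁ : L₁ →ₗ[ℝ] L₁') (g₁ : L₁' →ₗ[ℝ] L₁) (f₂ : L₂ →ₗ[ℝ] L₂') (g₂ : L₂' →ₗ[ℝ] L₂)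
    (f : X →ₗ[ℝ] X') {k l r : ℤ} {a : Pol L₁ L₂ X} (ha : a ∈ fil k l r) :
    map f₁ g₁ f₂ g₂ f a ∈ fil k l r := by
  have : fil k l r ≤ (fil k l r).comap (map f₁ g₁ f₂ g₂ f).toLinearMap :=
    fil_le fun r' hr a ha => gr_le_fil hr (map_mem_gr f₁ g₁ f₂ g₂ f ha)
  exact this ha

theorem prod_mem_pow {A V : Type*} [Ring A] [Algebra ℝ A] (f : V → A) {P : Submodule ℝ A}
    (hf : ∀ v, f v ∈ P) (h1 : 1 ≤ P) (L : List V) {N : ℕ} (hL : L.length ≤ N) :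
    (L.map f).prod ∈ P ^ N := by
  have h : (L.map f).prod ∈ P ^ L.length := by
    induction L with
    | nil => simpa using ⟨1, map_one _⟩
    | cons x L ih =>
      rw [List.map_cons, List.prod_cons, List.length_cons, pow_succ']
      exact Submodule.mul_mem_mul (hf x) (ih (Nat.le_of_succ_le hL))
  exact pow_le_pow_right₀ h1 hL h

/-- Functions of fixed momentum degree and ghost number form a finite-dimensional space. -/
theorem finiteDimensional_fil [FiniteDimensional ℝ L₁] [FiniteDimensional ℝ L₂]
    [FiniteDimensional ℝ X] (k l r : ℤ) :
    FiniteDimensional ℝ (fil k l r : Submodule ℝ (Pol L₁ L₂ X)) := by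
  let P : Submodule ℝ (Pol L₁ L₂ X) := 1 ⊔ (LinearMap.range od ⊔ LinearMap.range ev)
  have hP : P.FG := by
    refine Submodule.FG.sup ?_ (Submodule.FG.sup ?_ ?_)
    · exact Submodule.one_eq_span (R := ℝ) (A := Pol L₁ L₂ X) ▸ Submodule.fg_span_singleton 1
    · exact LinearMap.range_eq_map (od (L₁ := L₁) (L₂ := L₂) (X := X)) ▸
        (Module.Finite.fg_top (R := ℝ) (M := OddGen L₁ L₂ X)).map _
    · exact LinearMap.range_eq_map (ev (L₁ := L₁) (L₂ := L₂) (X := X)) ▸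
        (Module.Finite.fg_top (R := ℝ) (M := L₁ × L₂)).map _
  have hod : ∀ w, od w ∈ P := fun w =>
    Submodule.mem_sup_right (Submodule.mem_sup_left ⟨w, rfl⟩)
  have hev : ∀ w, ev w ∈ P := fun w =>
    Submodule.mem_sup_right (Submodule.mem_sup_right ⟨w, rfl⟩)
  -- A common bound for each of the five blocks of an ordered monomial: there are at most k momenta
  -- of each kind, and longer products of η or of c vanish.
  let N := k.toNat + finrank ℝ L₁ + finrank ℝ L₂
  let W : Submodule ℝ (Pol L₁ L₂ X) := P ^ N * P ^ N * P ^ N * P ^ N * P ^ N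
  have hW : W.FG := ((((hP.pow N).mul (hP.pow N)).mul (hP.pow N)).mul (hP.pow N)).mul (hP.pow N)
  have hle : fil k l r ≤ W := by
    refine fil_le fun r' _ => gradedSpan_le fun L hL => ?_
    obtain ⟨s, e, g, x, es, gs, hp, hd⟩ := prod_gen_eq_mono L
    rw [hL] at hd
    simp only [Prod.mk.injEq] at hd
    rw [hp]
    refine Submodule.smul_mem _ _ ?_
    by_cases he : finrank ℝ L₁ < e.length
    · rw [mono, prod_eta_eq_zero e he]; simp
    by_cases hg : finrank ℝ L₂ < g.length
    · rw [mono, prod_c_eq_zero g hg]; simp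
    have h1 : (1 : Submodule ℝ (Pol L₁ L₂ X)) ≤ P := le_sup_left
    refine Submodule.mul_mem_mul (Submodule.mul_mem_mul (Submodule.mul_mem_mul
      (Submodule.mul_mem_mul ?_ ?_) ?_) ?_) ?_
    · exact prod_mem_pow _ (fun _ => hod _) h1 _ (by omega)
    · exact prod_mem_pow _ (fun _ => hod _) h1 _ (by omega)
    · exact prod_mem_pow _ (fun _ => hod _) h1 _ (by omega)
    · exact prod_mem_pow _ (fun _ => hev _) h1 _ (by omega)
    · exact prod_mem_pow _ (fun _ => hev _) h1 _ (by omega)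
  have : FiniteDimensional ℝ W := Module.Finite.iff_fg.2 hW
  exact Submodule.finiteDimensional_of_le hle

end Pol

/-! ### A second order operator with square zero -/

section OperatorSquare

variable {R I : Type*} [Ring R] [Algebra ℝ R] [Fintype I]

theorem sum_eq_zero_of_antisymm {J : Type*} [Fintype J] {X : J → J → R}
    (h : ∀ p q, X p q = -X q p) : ∑ p, ∑ q, X p q = 0 := by
  have h1 : ∑ p, ∑ q, X p q = -∑ p, ∑ q, X p q := by
    conv_lhs => rw [Finset.sum_comm]
    simp_rw [← Finset.sum_neg_distrib]
    exact Finset.sum_congr rfl fun p _ => Finset.sum_congr rfl fun q _ => h q p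
  have h2 : (2 : ℝ) • ∑ p, ∑ q, X p q = 0 := by
    rw [two_smul]; nth_rewrite 1 [h1]; exact neg_add_cancel _
  exact (smul_eq_zero.1 h2).resolve_left two_ne_zero

theorem sum_eq_half_sum_sub {J : Type*} [Fintype J] (X : J → J → R) :
    ∑ p, ∑ q, X p q + ∑ p, ∑ q, X q p = (2 : ℝ) • ∑ p, ∑ q, X p q := by
  rw [two_smul, Finset.sum_comm (f := fun p q => X q p)]

theorem sum_rotate {M : Type*} [AddCommMonoid M] (F : I → I → I → M) :
    ∑ k, ∑ i, ∑ j, F i j k = ∑ k, ∑ i, ∑ j, F k i j := by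
  rw [Finset.sum_comm]
  exact Finset.sum_congr rfl fun i _ => Finset.sum_comm

/-- In the square, the commutators N of the D_i contribute N/2 and the trace form τ contributes
tr/2, both contracted with θθ; the term with Δ₀ and ρ contributes -(N + tr)/2 and cancels them. The
cross term of θD with ρ is the cyclic sum of the Bianchi identity. All other terms vanish by parity.
-/
theorem delta_sq_eq_zero {D θ τ : I → R} {ρ N tr : I → I → R} {Δ₀ : R}
    (hθθ : ∀ i j, θ i * θ j = -(θ j * θ i)) (hDθ : ∀ i j, D i * θ j = θ j * D i)
    (hN : ∀ i j, D i * D j - D j * D i = N i j)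
    (hD₀ : ∀ i, D i * Δ₀ = Δ₀ * D i) (hθ₀ : ∀ i, θ i * Δ₀ = -(Δ₀ * θ i)) (h₀ : Δ₀ * Δ₀ = 0)
    (hθρ : ∀ k i j, θ k * ρ i j = -(ρ i j * θ k))
    (hρρ : ∀ i j k l, ρ i j * ρ k l = -(ρ k l * ρ i j))
    (hρ₀ : ∀ i j, Δ₀ * ρ i j + ρ i j * Δ₀ = N i j + tr i j)
    (hB : ∀ k i j, (D k * ρ i j - ρ i j * D k) + (D i * ρ j k - ρ j k * D i) +
      (D j * ρ k i - ρ k i * D j) = 0)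
    (hτθ : ∀ i j, θ i * τ j = τ j * θ i) (hττ : ∀ i j, τ i * τ j = τ j * τ i)
    (hτρ : ∀ k i j, τ k * ρ i j = ρ i j * τ k) (hτ₀ : ∀ i, τ i * Δ₀ = Δ₀ * τ i)
    (hDτ : ∀ i j, (D i * τ j - τ j * D i) - (D j * τ i - τ i * D j) = -tr i j) :
    (-∑ i, θ i * D i + Δ₀ - (1 / 2 : ℝ) • ∑ i, ∑ j, ρ i j * (θ i * θ j) + ∑ i, τ i * θ i) *
      (-∑ i, θ i * D i + Δ₀ - (1 / 2 : ℝ) • ∑ i, ∑ j, ρ i j * (θ i * θ j) + ∑ i, τ i * θ i) = 0 := by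
  set a := ∑ i, θ i * D i with ha
  set c := ∑ i, ∑ j, ρ i j * (θ i * θ j) with hc
  set e := ∑ i, τ i * θ i with he
  have hθN : ∀ k i j, θ k * N i j = N i j * θ k := by
    intro k i j
    simp only [← hN, mul_sub, sub_mul]
    rw [← mul_assoc, ← hDθ, mul_assoc, ← hDθ, ← mul_assoc, ← mul_assoc, ← hDθ, mul_assoc (D j),
      ← hDθ, mul_assoc, mul_assoc]
  -- The product of two θ is antisymmetric, so only the commutator of the two D survives.
  have haa : (2 : ℝ) • (a * a) = ∑ i, ∑ j, N i j * (θ i * θ j) := by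
    have h : a * a = ∑ i, ∑ j, θ i * θ j * (D i * D j) := by
      rw [ha, Finset.sum_mul_sum]
      refine Finset.sum_congr rfl fun i _ => Finset.sum_congr rfl fun j _ => ?_
      rw [mul_assoc, ← mul_assoc (D i), hDθ, mul_assoc, mul_assoc]
    rw [h, ← sum_eq_half_sum_sub, ← Finset.sum_add_distrib]
    refine Finset.sum_congr rfl fun i _ => ?_
    rw [← Finset.sum_add_distrib]
    refine Finset.sum_congr rfl fun j _ => ?_
    rw [hθθ j i, neg_mul, ← sub_eq_add_neg, ← mul_sub, hN, mul_assoc, hθN, ← mul_assoc, hθN,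
      mul_assoc]
  have hcc : c * c = 0 := by
    have h : c = ∑ p : I × I, ρ p.1 p.2 * (θ p.1 * θ p.2) := by
      rw [hc, Fintype.sum_prod_type]
    rw [h, Finset.sum_mul_sum]
    refine sum_eq_zero_of_antisymm fun p q => ?_
    have h1 : ∀ p q : I × I, ρ p.1 p.2 * (θ p.1 * θ p.2) * (ρ q.1 q.2 * (θ q.1 * θ q.2)) =
        ρ p.1 p.2 * ρ q.1 q.2 * ((θ p.1 * θ p.2) * (θ q.1 * θ q.2)) := by
      intro p q
      have : (θ p.1 * θ p.2) * ρ q.1 q.2 = ρ q.1 q.2 * (θ p.1 * θ p.2) := by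
        rw [mul_assoc, hθρ, mul_neg, ← mul_assoc, hθρ, neg_mul, neg_neg, mul_assoc]
      rw [mul_assoc, ← mul_assoc (θ p.1 * θ p.2), this]; simp only [mul_assoc]
    have h2 : (θ p.1 * θ p.2) * (θ q.1 * θ q.2) = (θ q.1 * θ q.2) * (θ p.1 * θ p.2) := by
      have : ∀ k, (θ p.1 * θ p.2) * θ k = θ k * (θ p.1 * θ p.2) := by
        intro k
        rw [mul_assoc, hθθ _ k, mul_neg, ← mul_assoc, hθθ _ k, neg_mul, neg_neg, mul_assoc]
      rw [← mul_assoc, this, mul_assoc, this, ← mul_assoc]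
    rw [h1, h1, hρρ, h2, neg_mul]
  have hee : e * e = 0 := by
    rw [he, Finset.sum_mul_sum]
    refine sum_eq_zero_of_antisymm fun i j => ?_
    have h1 : ∀ i j, τ i * θ i * (τ j * θ j) = τ i * τ j * (θ i * θ j) := by
      intro i j
      rw [mul_assoc, ← mul_assoc (θ i), hτθ]; simp only [mul_assoc]
    rw [h1, h1, hττ, hθθ, mul_neg]
  have hab : a * Δ₀ + Δ₀ * a = 0 := by
    rw [ha, Finset.sum_mul, Finset.mul_sum, ← Finset.sum_add_distrib]
    refine Finset.sum_eq_zero fun i _ => ?_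
    rw [mul_assoc, hD₀, ← mul_assoc, hθ₀, neg_mul, mul_assoc, neg_add_cancel]
  have hbe : Δ₀ * e + e * Δ₀ = 0 := by
    rw [he, Finset.sum_mul, Finset.mul_sum, ← Finset.sum_add_distrib]
    refine Finset.sum_eq_zero fun i _ => ?_
    rw [mul_assoc, hθ₀, mul_neg, ← mul_assoc, ← mul_assoc, hτ₀, add_neg_cancel]
  have hcp : c = ∑ p : I × I, ρ p.1 p.2 * (θ p.1 * θ p.2) := by
    rw [hc, Fintype.sum_prod_type]
  have hWθ : ∀ i j k, (θ i * θ j) * θ k = θ k * (θ i * θ j) := by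
    intro i j k
    rw [mul_assoc, hθθ _ k, mul_neg, ← mul_assoc, hθθ _ k, neg_mul, neg_neg, mul_assoc]
  have hce : c * e + e * c = 0 := by
    rw [hcp, he, Finset.sum_mul_sum, Finset.sum_mul_sum,
      Finset.sum_comm (f := fun k (p : I × I) => τ k * θ k * (ρ p.1 p.2 * (θ p.1 * θ p.2))),
      ← Finset.sum_add_distrib]
    refine Finset.sum_eq_zero fun p _ => ?_
    rw [← Finset.sum_add_distrib]
    refine Finset.sum_eq_zero fun k _ => ?_
    obtain ⟨i, j⟩ := p
    have h2 : (θ i * θ j) * τ k = τ k * (θ i * θ j) := by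
      rw [mul_assoc, hτθ, ← mul_assoc, hτθ, mul_assoc]
    calc ρ i j * (θ i * θ j) * (τ k * θ k) + τ k * θ k * (ρ i j * (θ i * θ j))
        = ρ i j * ((θ i * θ j) * τ k) * θ k + τ k * (θ k * ρ i j) * (θ i * θ j) := by
          simp only [mul_assoc]
      _ = ρ i j * τ k * ((θ i * θ j) * θ k) - τ k * ρ i j * (θ k * (θ i * θ j)) := by
          rw [h2, hθρ]; simp only [mul_assoc, mul_neg, neg_mul, sub_eq_add_neg]
      _ = 0 := by rw [hWθ, hτρ, sub_self]
  have hac : a * c + c * a = 0 := by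
    have h1 : a * c + c * a = ∑ k, ∑ i, ∑ j,
        θ k * (D k * ρ i j - ρ i j * D k) * (θ i * θ j) := by
      rw [hcp, ha, Finset.sum_mul_sum, Finset.sum_mul_sum,
        Finset.sum_comm (f := fun (p : I × I) k => ρ p.1 p.2 * (θ p.1 * θ p.2) * (θ k * D k)),
        ← Finset.sum_add_distrib]
      refine Finset.sum_congr rfl fun k _ => ?_
      rw [← Finset.sum_add_distrib, Fintype.sum_prod_type]
      refine Finset.sum_congr rfl fun i _ => Finset.sum_congr rfl fun j _ => ?_
      have hDW : D k * (θ i * θ j) = (θ i * θ j) * D k := by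
        rw [← mul_assoc, hDθ, mul_assoc, hDθ, mul_assoc]
      calc θ k * D k * (ρ i j * (θ i * θ j)) + ρ i j * (θ i * θ j) * (θ k * D k)
          = θ k * D k * ρ i j * (θ i * θ j) + ρ i j * ((θ i * θ j) * θ k) * D k := by
            simp only [mul_assoc]
        _ = θ k * D k * ρ i j * (θ i * θ j) + ρ i j * θ k * (D k * (θ i * θ j)) := by
            rw [hWθ, hDW]; simp only [mul_assoc]
        _ = _ := by
            rw [← neg_eq_iff_eq_neg.2 (hθρ k i j)]; noncomm_ring
    have h2 : ∀ k i j, θ k * (D k * ρ i j - ρ i j * D k) * (θ i * θ j) =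
        -((D k * ρ i j - ρ i j * D k) * (θ k * θ i * θ j)) := by
      intro k i j
      have : θ k * (D k * ρ i j - ρ i j * D k) = -((D k * ρ i j - ρ i j * D k) * θ k) := by
        rw [mul_sub, ← mul_assoc, ← hDθ, mul_assoc, hθρ, ← mul_assoc, hθρ, sub_mul,
          mul_assoc (ρ i j), hDθ]
        noncomm_ring
      rw [this]; simp only [mul_assoc, neg_mul]
    set B : I → I → I → R := fun k i j => D k * ρ i j - ρ i j * D k with hBdef
    have hcyc : ∀ k i j, θ i * θ j * θ k = θ k * θ i * θ j := by
      intro k i j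
      rw [mul_assoc, hθθ _ k, mul_neg, ← mul_assoc, hθθ _ k, neg_mul, neg_neg]
    -- The product of three θ is invariant under cyclic permutations. Three copies of the sum can
    -- thus be relabelled to form the cyclic sum of `hB`.
    have h3 : (3 : ℝ) • ∑ k, ∑ i, ∑ j, B k i j * (θ k * θ i * θ j) = 0 := by
      have r1 : ∑ k, ∑ i, ∑ j, B k i j * (θ k * θ i * θ j) =
          ∑ k, ∑ i, ∑ j, B i j k * (θ k * θ i * θ j) := by
        rw [← sum_rotate]
        simp only [hcyc]
      have r2 : ∑ k, ∑ i, ∑ j, B k i j * (θ k * θ i * θ j) =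
          ∑ k, ∑ i, ∑ j, B j k i * (θ k * θ i * θ j) := by
        rw [r1, ← sum_rotate]
        simp only [hcyc]
      have : (3 : ℝ) • ∑ k, ∑ i, ∑ j, B k i j * (θ k * θ i * θ j) =
          ∑ k, ∑ i, ∑ j, B k i j * (θ k * θ i * θ j) +
          ∑ k, ∑ i, ∑ j, B i j k * (θ k * θ i * θ j) +
          ∑ k, ∑ i, ∑ j, B j k i * (θ k * θ i * θ j) := by
        rw [← r1, ← r2]; module
      rw [this]
      simp only [← Finset.sum_add_distrib, ← add_mul]
      refine Finset.sum_eq_zero fun k _ => Finset.sum_eq_zero fun i _ =>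
        Finset.sum_eq_zero fun j _ => ?_
      rw [hBdef]; simp only [hB k i j, zero_mul]
    rw [h1]
    simp only [h2, Finset.sum_neg_distrib]
    rw [(smul_eq_zero.1 h3).resolve_left three_ne_zero, neg_zero]
  have hae : (2 : ℝ) • (a * e + e * a) = -∑ i, ∑ j, tr i j * (θ i * θ j) := by
    have h : a * e + e * a = ∑ i, ∑ j, (D i * τ j - τ j * D i) * (θ i * θ j) := by
      rw [ha, he, Finset.sum_mul_sum, Finset.sum_mul_sum,
        Finset.sum_comm (f := fun i j => τ i * θ i * (θ j * D j)), ← Finset.sum_add_distrib]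
      refine Finset.sum_congr rfl fun i _ => ?_
      rw [← Finset.sum_add_distrib]
      refine Finset.sum_congr rfl fun j _ => ?_
      calc θ i * D i * (τ j * θ j) + τ j * θ j * (θ i * D i)
          = (θ i * D i) * τ j * θ j + τ j * (θ j * θ i) * D i := by simp only [mul_assoc]
        _ = D i * (θ i * τ j) * θ j - τ j * (θ i * θ j * D i) := by
            rw [hθθ j i, ← hDθ]; noncomm_ring
        _ = _ := by
            rw [hτθ, mul_assoc (θ i), ← hDθ, ← mul_assoc (θ i), ← hDθ]; noncomm_ring
    rw [h, ← sum_eq_half_sum_sub, ← Finset.sum_add_distrib, ← Finset.sum_neg_distrib]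
    refine Finset.sum_congr rfl fun i _ => ?_
    rw [← Finset.sum_add_distrib, ← Finset.sum_neg_distrib]
    refine Finset.sum_congr rfl fun j _ => ?_
    rw [hθθ j i, mul_neg, ← sub_eq_add_neg, ← sub_mul, hDτ, neg_mul]
  have hbc : Δ₀ * c + c * Δ₀ = ∑ i, ∑ j, (N i j + tr i j) * (θ i * θ j) := by
    rw [hc]
    simp only [Finset.sum_mul, Finset.mul_sum]
    rw [← Finset.sum_add_distrib]
    refine Finset.sum_congr rfl fun i _ => ?_
    rw [← Finset.sum_add_distrib]
    refine Finset.sum_congr rfl fun j _ => ?_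
    rw [← hρ₀, mul_assoc (ρ i j), mul_assoc (θ i), hθ₀, mul_neg, ← mul_assoc (θ i), hθ₀]
    noncomm_ring
  have : (-a + Δ₀ - (1 / 2 : ℝ) • c + e) * (-a + Δ₀ - (1 / 2 : ℝ) • c + e) =
      a * a + Δ₀ * Δ₀ + (1 / 4 : ℝ) • (c * c) + e * e - (a * Δ₀ + Δ₀ * a) +
        (1 / 2 : ℝ) • (a * c + c * a) - (a * e + e * a) - (1 / 2 : ℝ) • (Δ₀ * c + c * Δ₀) +
        (Δ₀ * e + e * Δ₀) - (1 / 2 : ℝ) • (c * e + e * c) := by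
    simp only [add_mul, mul_add, sub_mul, mul_sub, neg_mul, mul_neg, smul_mul_assoc,
      mul_smul_comm]
    module
  rw [this, h₀, hcc, hee, hab, hac, hbe, hce]
  -- The three contributions that do not vanish one by one: curvature, its trace, and their
  -- compensation by Δ₀.
  have h2 : (2 : ℝ) • (a * a - (a * e + e * a) - (1 / 2 : ℝ) • (Δ₀ * c + c * Δ₀)) = 0 := by
    rw [smul_sub, smul_sub, haa, hae, smul_smul, hbc]
    norm_num
    simp only [add_mul, Finset.sum_add_distrib]
    abel
  have h3 := (smul_eq_zero.1 h2).resolve_left two_ne_zero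
  simp only [smul_zero, add_zero, sub_zero]
  exact h3

/-- If `Δ` has square zero and `q = [Δ, s] - δ` satisfies the Leibniz rule with respect to the even
element `s` and the odd element `δ`, then `q` squares to a multiplication operator. -/
theorem square_eq_of_delta {Δ s δ m : R} (hΔ : Δ * Δ = 0) (hs : s * δ = δ * s) (hδ : δ * δ = 0)
    (hq : (Δ * s - s * Δ - δ) * s = s * (Δ * s - s * Δ - δ))
    (hm : (Δ * s - s * Δ - δ) * δ + δ * (Δ * s - s * Δ - δ) = m) :
    (Δ * s - s * Δ - δ) * (Δ * s - s * Δ - δ) = -m := by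
  set q := Δ * s - s * Δ - δ with hqdef
  have hd : Δ * s - s * Δ = q + δ := by rw [hqdef, sub_add_cancel]
  -- Since q + δ = [Δ, s], the anticommutator of q + δ with Δ is [Δ², s] = 0. Inserting the
  -- definition of q into one factor of q² and moving Δ across with this rule returns -q² and
  -- multiples of m.
  have h1 : q * Δ = -(Δ * q) - δ * Δ - Δ * δ := by
    have : q * Δ + Δ * q + δ * Δ + Δ * δ = Δ * Δ * s - s * (Δ * Δ) := by
      rw [hqdef]; noncomm_ring
    rw [hΔ, zero_mul, mul_zero, sub_zero] at this
    rw [← sub_eq_zero, ← this]; abel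
  have h2 : q * q = -(q * q) - m - m := by
    calc q * q = q * (Δ * s - s * Δ - δ) := by rw [hqdef]
      _ = q * Δ * s - q * s * Δ - q * δ := by noncomm_ring
      _ = (q * Δ) * s - s * (q * Δ) - q * δ := by rw [hq, mul_assoc s]
      _ = -(Δ * (q * s)) + s * Δ * q - δ * (Δ * s) - Δ * (δ * s) + (s * δ) * Δ + s * Δ * δ
          - q * δ := by rw [h1]; noncomm_ring
      _ = -((Δ * s - s * Δ) * q) - δ * (Δ * s - s * Δ) - (Δ * s - s * Δ) * δ - q * δ := by
          have e1 : (s * δ) * Δ = (δ * s) * Δ := by rw [hs]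
          have e2 : Δ * (δ * s) = Δ * (s * δ) := by rw [hs]
          rw [hq, e1, e2]; noncomm_ring
      _ = -(q * q) - (q * δ + δ * q) - (q * δ + δ * q) - δ * δ - δ * δ := by
          rw [hd]; noncomm_ring
      _ = _ := by rw [hδ, hm]; abel
  have h3 : (2 : ℝ) • (q * q + m) = 0 := by
    rw [two_smul]; nth_rewrite 1 [h2]; abel
  exact eq_neg_of_add_eq_zero_left ((smul_eq_zero.1 h3).resolve_left two_ne_zero)

end OperatorSquare

/-! ### Superalgebras with coordinate derivations -/

/-- A supercommutative algebra with odd coordinates `x i`, `z A` and even coordinates `y A`, and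
with the left derivatives along them. -/
structure SuperCoord (A : Type*) [Ring A] [Algebra ℝ A] (I κ : Type*) [DecidableEq I]
    [DecidableEq κ] where
  par : A →ₐ[ℝ] A
  θ : I → Module.End ℝ A
  ζ : κ → Module.End ℝ A
  χ : κ → Module.End ℝ A
  x : I → A
  z : κ → A
  y : κ → A
  even_comm : ∀ {a}, par a = a → ∀ b, a * b = b * a
  odd_comm : ∀ {a}, par a = -a → ∀ b, a * b = par b * a
  θ_mul : ∀ i a b, θ i (a * b) = θ i a * b + par a * θ i b
  ζ_mul : ∀ B a b, ζ B (a * b) = ζ B a * b + par a * ζ B b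
  χ_mul : ∀ B a b, χ B (a * b) = χ B a * b + a * χ B b
  par_par : ∀ a, par (par a) = a
  par_θ : ∀ i a, par (θ i a) = -θ i (par a)
  par_ζ : ∀ B a, par (ζ B a) = -ζ B (par a)
  par_χ : ∀ B a, par (χ B a) = χ B (par a)
  θ_θ : ∀ i j, θ i * θ j = -(θ j * θ i)
  θ_ζ : ∀ i B, θ i * ζ B = -(ζ B * θ i)
  ζ_ζ : ∀ B C, ζ B * ζ C = -(ζ C * ζ B)
  χ_χ : ∀ B C, χ B * χ C = χ C * χ B
  χ_θ : ∀ B i, χ B * θ i = θ i * χ B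
  χ_ζ : ∀ B C, χ B * ζ C = ζ C * χ B
  par_x : ∀ i, par (x i) = -x i
  par_z : ∀ B, par (z B) = -z B
  par_y : ∀ B, par (y B) = y B
  θ_x : ∀ i j, θ i (x j) = if i = j then 1 else 0
  θ_z : ∀ i B, θ i (z B) = 0
  θ_y : ∀ i B, θ i (y B) = 0
  ζ_x : ∀ B i, ζ B (x i) = 0
  ζ_z : ∀ B C, ζ B (z C) = if B = C then 1 else 0
  ζ_y : ∀ B C, ζ B (y C) = 0
  χ_x : ∀ B i, χ B (x i) = 0
  χ_z : ∀ B C, χ B (z C) = 0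
  χ_y : ∀ B C, χ B (y C) = if B = C then 1 else 0

namespace SuperCoord

variable {A : Type*} [Ring A] [Algebra ℝ A] {I κ : Type*} [DecidableEq I] [DecidableEq κ]
  [Fintype I] [Fintype κ] (X : SuperCoord A I κ)

/-- The elements that do not depend on the coordinates. -/
structure IsScalar (a : A) : Prop where
  par : X.par a = a
  θ : ∀ i, X.θ i a = 0
  ζ : ∀ B, X.ζ B a = 0
  χ : ∀ B, X.χ B a = 0

/-- Multiplication operators. -/
abbrev lm (a : A) : Module.End ℝ A := LinearMap.mulLeft ℝ a

variable {X}

theorem lm_mul (a b : A) : lm (a * b) = lm a * lm b := LinearMap.mulLeft_mul ..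
theorem lm_add (a b : A) : lm (a + b) = lm a + lm b := by ext c; simp [add_mul]
theorem lm_sub (a b : A) : lm (a - b) = lm a - lm b := by ext c; simp [sub_mul]
theorem lm_neg (a : A) : lm (-a) = -lm a := by ext c; simp
theorem lm_zero : lm (0 : A) = 0 := by ext c; simp
theorem lm_sum {J : Type*} (s : Finset J) (f : J → A) : lm (∑ j ∈ s, f j) = ∑ j ∈ s, lm (f j) := by
  ext c; simp [Finset.sum_mul]

namespace IsScalar

theorem add {a b : A} (ha : X.IsScalar a) (hb : X.IsScalar b) : X.IsScalar (a + b) :=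
  ⟨by rw [map_add, ha.par, hb.par], fun i => by rw [map_add, ha.θ, hb.θ, add_zero],
    fun i => by rw [map_add, ha.ζ, hb.ζ, add_zero], fun i => by rw [map_add, ha.χ, hb.χ, add_zero]⟩
theorem neg {a : A} (ha : X.IsScalar a) : X.IsScalar (-a) :=
  ⟨by rw [map_neg, ha.par], fun i => by rw [map_neg, ha.θ, neg_zero],
    fun i => by rw [map_neg, ha.ζ, neg_zero], fun i => by rw [map_neg, ha.χ, neg_zero]⟩
theorem sub {a b : A} (ha : X.IsScalar a) (hb : X.IsScalar b) : X.IsScalar (a - b) := by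
  rw [sub_eq_add_neg]; exact ha.add hb.neg
theorem mul {a b : A} (ha : X.IsScalar a) (hb : X.IsScalar b) : X.IsScalar (a * b) :=
  ⟨by rw [map_mul, ha.par, hb.par], fun i => by rw [X.θ_mul, ha.θ, hb.θ, zero_mul, mul_zero, add_zero],
    fun i => by rw [X.ζ_mul, ha.ζ, hb.ζ, zero_mul, mul_zero, add_zero],
    fun i => by rw [X.χ_mul, ha.χ, hb.χ, zero_mul, mul_zero, add_zero]⟩
theorem zero : X.IsScalar 0 := ⟨by simp, by simp, by simp, by simp⟩
theorem sum {J : Type*} {s : Finset J} {f : J → A} (h : ∀ j ∈ s, X.IsScalar (f j)) :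
    X.IsScalar (∑ j ∈ s, f j) :=
  Finset.sum_induction f X.IsScalar (fun _ _ => add) zero h
theorem comm {a : A} (ha : X.IsScalar a) (b : A) : a * b = b * a := X.even_comm ha.par b

theorem θ_lm {a : A} (ha : X.IsScalar a) (i : I) : X.θ i * lm a = lm a * X.θ i := by
  ext b; simp [X.θ_mul, ha.θ, ha.par]
theorem ζ_lm {a : A} (ha : X.IsScalar a) (i : κ) : X.ζ i * lm a = lm a * X.ζ i := by
  ext b; simp [X.ζ_mul, ha.ζ, ha.par]
theorem χ_lm {a : A} (ha : X.IsScalar a) (i : κ) : X.χ i * lm a = lm a * X.χ i := by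
  ext b; simp [X.χ_mul, ha.χ]
theorem lm_comm {a : A} (ha : X.IsScalar a) (b : A) : lm a * lm b = lm b * lm a := by
  rw [← lm_mul, ← lm_mul, ha.comm]

end IsScalar

variable (X)

/-- The derivations `z*_C ∂/∂z*_B - z^B ∂/∂z^C` of the linear group. -/
def glUnit (B C : κ) : Module.End ℝ A := lm (X.y C) * X.χ B - lm (X.z B) * X.ζ C

/-- The derivation given by a matrix of scalars. -/
def glOp (G : κ → κ → A) : Module.End ℝ A := ∑ B, ∑ C, lm (G B C) * X.glUnit B C

/-- The pairing of `z` and `z*` with a matrix of scalars. -/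
def glFun (G : κ → κ → A) : A := ∑ B, ∑ C, X.z B * G B C * X.y C

/-- The operator `∑ ∂/∂z^A ∂/∂z*_A`. -/
def lap : Module.End ℝ A := ∑ B, X.ζ B * X.χ B

variable {X}

theorem glUnit_mul (B C : κ) (a b : A) :
    X.glUnit B C (a * b) = X.glUnit B C a * b + a * X.glUnit B C b := by
  have hz := X.odd_comm (X.par_z B) (X.par a)
  rw [X.par_par] at hz
  have hy := X.even_comm (X.par_y C) a
  simp only [glUnit, LinearMap.sub_apply, Module.End.mul_apply, LinearMap.mulLeft_apply, X.χ_mul,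
    X.ζ_mul, mul_add, sub_mul, mul_sub]
  rw [← mul_assoc (X.z B) (X.par a), hz, ← mul_assoc (X.y C) a, hy]
  noncomm_ring

theorem glUnit_scalar (B C : κ) {a : A} (ha : X.IsScalar a) : X.glUnit B C a = 0 := by
  simp [glUnit, ha.χ, ha.ζ]

theorem glUnit_lm (B C : κ) {a : A} (ha : X.IsScalar a) :
    X.glUnit B C * lm a = lm a * X.glUnit B C := by
  ext b; simp [glUnit_mul, glUnit_scalar B C ha]

theorem par_glUnit (B C : κ) (a : A) : X.par (X.glUnit B C a) = X.glUnit B C (X.par a) := by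
  simp [glUnit, X.par_y, X.par_z, X.par_χ, X.par_ζ]

theorem glUnit_y (B C D : κ) : X.glUnit B C (X.y D) = if B = D then X.y C else 0 := by
  simp [glUnit, X.χ_y, X.ζ_y]

theorem glUnit_z (B C D : κ) : X.glUnit B C (X.z D) = if C = D then -X.z B else 0 := by
  simp [glUnit, X.χ_z, X.ζ_z]; split_ifs <;> simp

theorem lm_y_comm (B C : κ) : lm (X.y B) * lm (X.y C) = lm (X.y C) * lm (X.y B) := by
  rw [← lm_mul, ← lm_mul, X.even_comm (X.par_y B)]
theorem lm_z_comm (B C : κ) : lm (X.z B) * lm (X.z C) = -(lm (X.z C) * lm (X.z B)) := by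
  rw [← lm_mul, ← lm_mul, X.odd_comm (X.par_z B), X.par_z, neg_mul, lm_neg]
theorem lm_yz_comm (B C : κ) : lm (X.y B) * lm (X.z C) = lm (X.z C) * lm (X.y B) := by
  rw [← lm_mul, ← lm_mul, X.even_comm (X.par_y B)]
theorem χ_lm_y (B C : κ) : X.χ B * lm (X.y C) = lm (X.y C) * X.χ B + if B = C then 1 else 0 := by
  ext b; simp only [Module.End.mul_apply, LinearMap.mulLeft_apply, X.χ_mul, X.χ_y,
    LinearMap.add_apply]; split_ifs <;> simp [add_comm]
theorem χ_lm_z (B C : κ) : X.χ B * lm (X.z C) = lm (X.z C) * X.χ B := by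
  ext b; simp [X.χ_mul, X.χ_z]
theorem ζ_lm_y (B C : κ) : X.ζ B * lm (X.y C) = lm (X.y C) * X.ζ B := by
  ext b; simp [X.ζ_mul, X.ζ_y, X.par_y]
theorem ζ_lm_z (B C : κ) : X.ζ B * lm (X.z C) = -(lm (X.z C) * X.ζ B) + if B = C then 1 else 0 := by
  ext b; simp only [Module.End.mul_apply, LinearMap.mulLeft_apply, X.ζ_mul, X.ζ_z,
    LinearMap.add_apply, LinearMap.neg_apply, X.par_z]; split_ifs <;> simp [add_comm]

/-- Normal ordering in an abstract ring. With Y, Z for multiplications and w, v for derivatives,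
only the contractions d and e survive in the commutator. -/
theorem commutator_aux {R : Type*} [Ring R] {Y Y' Z Z' w w' v v' d e : R}
    (h1 : w * Y' = Y' * w + d) (h2 : w' * Y = Y * w' + e) (h3 : v * Z' = -(Z' * v) + e)
    (h4 : v' * Z = -(Z * v') + d) (hYY : Y * Y' = Y' * Y) (hZZ : Z * Z' = -(Z' * Z))
    (hww : w * w' = w' * w) (hvv : v * v' = -(v' * v)) (hwZ : w * Z' = Z' * w)
    (hwZ' : w' * Z = Z * w') (hvY : v * Y' = Y' * v) (hvY' : v' * Y = Y * v')
    (hwv : w * v' = v' * w) (hwv' : w' * v = v * w') (hYZ : Y * Z' = Z' * Y)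
    (hYZ' : Y' * Z = Z * Y') :
    (Y * w - Z * v) * (Y' * w' - Z' * v') - (Y' * w' - Z' * v') * (Y * w - Z * v) =
      Y * d * w' - Y' * e * w + Z * e * v' - Z' * d * v := by
  have a1 : Y * w * (Y' * w') = Y * Y' * (w * w') + Y * d * w' := by
    rw [mul_assoc, ← mul_assoc w, h1]; noncomm_ring
  have a2 : Y' * w' * (Y * w) = Y * Y' * (w * w') + Y' * e * w := by
    rw [mul_assoc, ← mul_assoc w', h2, hYY, hww]; noncomm_ring
  have a3 : Z * v * (Z' * v') = -(Z * Z' * (v * v')) + Z * e * v' := by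
    rw [mul_assoc, ← mul_assoc v, h3]; noncomm_ring
  have a4 : Z' * v' * (Z * v) = -(Z * Z' * (v * v')) + Z' * d * v := by
    rw [mul_assoc, ← mul_assoc v', h4, hZZ, hvv]; noncomm_ring
  have a5 : Y * w * (Z' * v') = Z' * v' * (Y * w) := by
    rw [mul_assoc, ← mul_assoc w, hwZ, mul_assoc, hwv, ← mul_assoc, hYZ, mul_assoc, ← mul_assoc Y,
      ← hvY', mul_assoc, mul_assoc]
  have a6 : Z * v * (Y' * w') = Y' * w' * (Z * v) := by
    rw [mul_assoc, ← mul_assoc v, hvY, mul_assoc, ← hwv', ← mul_assoc, ← hYZ', mul_assoc,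
      ← mul_assoc Z, ← hwZ', mul_assoc, mul_assoc]
  rw [sub_mul, mul_sub, mul_sub, sub_mul, mul_sub, mul_sub, a1, a2, a3, a4, a5, a6]
  abel

/-- These are the relations of the elementary matrices: the operators act on the z* by the standard
representation and on the z by its dual. -/
theorem glUnit_glUnit (B C D E : κ) : X.glUnit B C * X.glUnit D E - X.glUnit D E * X.glUnit B C =
    (if B = E then X.glUnit D C else 0) - if D = C then X.glUnit B E else 0 := by
  have h3 := X.ζ_lm_z C D
  have h4 := X.ζ_lm_z E B
  simp only [eq_comm (a := C), eq_comm (a := E)] at h3 h4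
  rw [glUnit, glUnit, commutator_aux (X.χ_lm_y B E) (X.χ_lm_y D C) h3 h4
    (lm_y_comm _ _) (lm_z_comm _ _) (X.χ_χ _ _) (X.ζ_ζ _ _) (χ_lm_z _ _) (χ_lm_z _ _) (ζ_lm_y _ _)
    (ζ_lm_y _ _) (X.χ_ζ _ _) (X.χ_ζ _ _) (lm_yz_comm _ _) (lm_yz_comm _ _)]
  split_ifs with h5 h6 h6 <;> simp [glUnit] <;> try subst h5 <;> try subst h6
  all_goals abel

end SuperCoord

/-! ### Matrices of scalars acting as derivations, and the Laplacian in z and z* -/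

namespace SuperCoord

variable {A : Type*} [Ring A] [Algebra ℝ A] {I κ : Type*} [DecidableEq I] [DecidableEq κ]
  [Fintype I] [Fintype κ] {X : SuperCoord A I κ}

theorem end_neg_mul (a b : Module.End ℝ A) : -a * b = -(a * b) := neg_mul a b

theorem end_mul_neg (a b : Module.End ℝ A) : a * -b = -(a * b) := mul_neg a b

theorem glOp_apply (G : κ → κ → A) (a : A) :
    X.glOp G a = ∑ B, ∑ C, G B C * X.glUnit B C a := by
  simp [glOp]

theorem glOp_mul (G : κ → κ → A) (hG : ∀ B C, X.IsScalar (G B C)) (a b : A) :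
    X.glOp G (a * b) = X.glOp G a * b + a * X.glOp G b := by
  simp only [glOp_apply, Finset.sum_mul, Finset.mul_sum, ← Finset.sum_add_distrib]
  refine Finset.sum_congr rfl fun B _ => Finset.sum_congr rfl fun C _ => ?_
  rw [glUnit_mul, mul_add, ← mul_assoc a, ← (hG B C).comm a]
  noncomm_ring

theorem glOp_scalar (G : κ → κ → A) {a : A} (ha : X.IsScalar a) : X.glOp G a = 0 := by
  simp [glOp_apply, glUnit_scalar _ _ ha]

theorem par_glOp (G : κ → κ → A) (hG : ∀ B C, X.IsScalar (G B C)) (a : A) :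
    X.par (X.glOp G a) = X.glOp G (X.par a) := by
  simp only [glOp_apply, map_sum, map_mul, (hG _ _).par, par_glUnit]

theorem glOp_y (G : κ → κ → A) (B : κ) : X.glOp G (X.y B) = ∑ C, G B C * X.y C := by
  simp [glOp_apply, glUnit_y]

theorem glOp_z (G : κ → κ → A) (C : κ) : X.glOp G (X.z C) = -∑ B, G B C * X.z B := by
  simp [glOp_apply, glUnit_z]

theorem glOp_x (G : κ → κ → A) (i : I) : X.glOp G (X.x i) = 0 := by
  simp [glOp_apply, glUnit, X.χ_x, X.ζ_x]

theorem glUnit_θ (B C : κ) (i : I) : X.glUnit B C * X.θ i = X.θ i * X.glUnit B C := by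
  ext a
  have h1 := DFunLike.congr_fun (X.χ_θ B i) a
  have h2 := DFunLike.congr_fun (X.θ_ζ i C) a
  simp only [Module.End.mul_apply, LinearMap.neg_apply] at h1 h2
  simp [glUnit, X.θ_mul, X.θ_y, X.θ_z, X.par_y, X.par_z, h1, h2]

theorem χ_glUnit (D B C : κ) :
    X.χ D * X.glUnit B C = X.glUnit B C * X.χ D + if D = C then X.χ B else 0 := by
  have h1 := X.χ_χ D B
  have h2 := X.χ_ζ D C
  rw [glUnit, mul_sub, ← mul_assoc, ← mul_assoc, χ_lm_y, χ_lm_z, add_mul, sub_mul, mul_assoc,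
    h1, mul_assoc, h2, mul_assoc, mul_assoc]
  split_ifs <;> simp; abel

theorem ζ_glUnit (D B C : κ) :
    X.ζ D * X.glUnit B C = X.glUnit B C * X.ζ D - if D = B then X.ζ C else 0 := by
  have h1 := X.χ_ζ B D
  have h2 := X.ζ_ζ D C
  rw [glUnit, mul_sub, ← mul_assoc, ← mul_assoc, ζ_lm_y, ζ_lm_z, add_mul, sub_mul, mul_assoc,
    ← h1, end_neg_mul, mul_assoc, h2, end_mul_neg, mul_assoc, mul_assoc]
  split_ifs <;> simp; abel

/-- The operator `lap` contracts dual indices and is therefore invariant under the linear group. In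
the computation each summand has two corrections, and these cancel only after summation over D. -/
theorem lap_glUnit (B C : κ) : X.lap * X.glUnit B C = X.glUnit B C * X.lap := by
  have h : ∀ D, X.ζ D * X.χ D * X.glUnit B C = X.glUnit B C * (X.ζ D * X.χ D) -
      (if D = B then X.ζ C * X.χ D else 0) + if D = C then X.ζ D * X.χ B else 0 := by
    intro D
    rw [mul_assoc, χ_glUnit, mul_add, ← mul_assoc, ζ_glUnit, sub_mul, mul_assoc]
    split_ifs <;> simp
  simp only [lap, Finset.sum_mul, h, Finset.mul_sum, Finset.sum_add_distrib, Finset.sum_sub_distrib]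
  simp

theorem lap_lm {g : A} (hg : X.IsScalar g) : X.lap * lm g = lm g * X.lap := by
  simp only [lap, Finset.sum_mul, Finset.mul_sum]
  exact Finset.sum_congr rfl fun B _ => by
    rw [mul_assoc, hg.χ_lm, ← mul_assoc, hg.ζ_lm, mul_assoc]

theorem lap_glOp (G : κ → κ → A) (hG : ∀ B C, X.IsScalar (G B C)) :
    X.lap * X.glOp G = X.glOp G * X.lap := by
  simp only [glOp, Finset.sum_mul, Finset.mul_sum]
  refine Finset.sum_congr rfl fun B _ => Finset.sum_congr rfl fun C _ => ?_
  rw [← mul_assoc, lap_lm (hG B C), mul_assoc, lap_glUnit, mul_assoc]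

theorem lap_lap : X.lap * X.lap = 0 := by
  rw [lap, Finset.sum_mul_sum]
  refine sum_eq_zero_of_antisymm fun B C => ?_
  rw [mul_assoc, ← mul_assoc (X.χ B), X.χ_ζ, mul_assoc, ← mul_assoc, X.ζ_ζ, X.χ_χ, end_neg_mul]
  congr 1
  rw [mul_assoc, ← mul_assoc (X.ζ B), ← X.χ_ζ]
  simp only [mul_assoc]

theorem θ_lap (i : I) : X.θ i * X.lap = -(X.lap * X.θ i) := by
  simp only [lap, Finset.sum_mul, Finset.mul_sum, ← Finset.sum_neg_distrib]
  refine Finset.sum_congr rfl fun B _ => ?_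
  rw [← mul_assoc, X.θ_ζ, end_neg_mul, mul_assoc, ← X.χ_θ, mul_assoc]

theorem par_glFun (G : κ → κ → A) (hG : ∀ B C, X.IsScalar (G B C)) :
    X.par (X.glFun G) = -X.glFun G := by
  simp [glFun, X.par_z, X.par_y, (hG _ _).par]

theorem θ_glFun (G : κ → κ → A) (hG : ∀ B C, X.IsScalar (G B C)) (i : I) :
    X.θ i (X.glFun G) = 0 := by
  simp [glFun, X.θ_mul, X.θ_z, X.θ_y, (hG _ _).θ]

theorem glFun_eq (G : κ → κ → A) : X.glFun G = ∑ B, X.z B * X.glOp G (X.y B) := by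
  simp only [glFun, glOp_y, Finset.mul_sum, mul_assoc]

/-- For a second order operator and a bilinear function, the anticommutator has a first order part,
in which one derivative hits the function, and a zeroth order part, in which both do. The latter is
the trace. -/
theorem lap_glFun (G : κ → κ → A) (hG : ∀ B C, X.IsScalar (G B C)) :
    X.lap * lm (X.glFun G) + lm (X.glFun G) * X.lap = X.glOp G + lm (∑ B, G B B) := by
  have key : ∀ D B C, X.ζ D * X.χ D * lm (X.z B * G B C * X.y C) +
      lm (X.z B * G B C * X.y C) * (X.ζ D * X.χ D) =
      (if D = C then (if D = B then lm (G B C) else 0) - lm (G B C) * (lm (X.z B) * X.ζ D) else 0) +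
      if D = B then lm (G B C) * (lm (X.y C) * X.χ D) else 0 := by
    intro D B C
    have hG' := hG B C
    have e1 : X.z B * G B C * X.y C = G B C * (X.z B * X.y C) := by
      rw [← hG'.comm (X.z B), mul_assoc]
    rw [e1, lm_mul]
    have e2 : X.ζ D * X.χ D * (lm (G B C) * lm (X.z B * X.y C)) =
        lm (G B C) * (X.ζ D * X.χ D * lm (X.z B * X.y C)) := by
      rw [← mul_assoc, mul_assoc (X.ζ D), hG'.χ_lm, ← mul_assoc (X.ζ D), hG'.ζ_lm]
      simp only [mul_assoc]
    have e3 : X.ζ D * X.χ D * lm (X.z B * X.y C) + lm (X.z B * X.y C) * (X.ζ D * X.χ D) =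
        (if D = C then (if D = B then 1 else 0) - (lm (X.z B) * X.ζ D) else 0) +
        if D = B then (lm (X.y C) * X.χ D) else 0 := by
      rw [lm_mul]
      have : X.ζ D * X.χ D * (lm (X.z B) * lm (X.y C)) =
          (X.ζ D * lm (X.z B)) * (X.χ D * lm (X.y C)) := by
        rw [mul_assoc, ← mul_assoc (X.χ D), χ_lm_z]; simp only [mul_assoc]
      rw [this, χ_lm_y, ζ_lm_z]
      have h2 : X.ζ D * lm (X.y C) = lm (X.y C) * X.ζ D := ζ_lm_y _ _
      have h3 : lm (X.z B) * X.ζ D * (lm (X.y C) * X.χ D) =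
        lm (X.z B) * lm (X.y C) * (X.ζ D * X.χ D) := by
        rw [mul_assoc, ← mul_assoc (X.ζ D), h2]; simp only [mul_assoc]
      split_ifs <;> simp [add_mul, mul_add, h3, end_neg_mul] <;> abel
    rw [e2, mul_assoc (lm (G B C)), ← mul_add, e3]
    split_ifs <;> simp [mul_add, mul_sub, end_mul_neg]
  simp only [glFun, lm_sum, lap, Finset.sum_mul, Finset.mul_sum, glOp]
  have : ∀ B, ∑ C, ∑ D, X.ζ D * X.χ D * lm (X.z B * G B C * X.y C) +
      ∑ C, ∑ D, lm (X.z B * G B C * X.y C) * (X.ζ D * X.χ D) =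
      lm (G B B) + ∑ C, lm (G B C) * X.glUnit B C := by
    intro B
    rw [← Finset.sum_add_distrib]
    simp only [← Finset.sum_add_distrib, key]
    simp only [Finset.sum_add_distrib]
    simp [glUnit, mul_sub, Finset.sum_sub_distrib]
    abel
  have hc : ∀ f : κ → κ → κ → Module.End ℝ A, ∑ D, ∑ B, ∑ C, f D B C = ∑ B, ∑ C, ∑ D, f D B C := by
    intro f
    rw [Finset.sum_comm]
    exact Finset.sum_congr rfl fun B _ => Finset.sum_comm
  rw [hc fun D B C => lm (X.z B * G B C * X.y C) * (X.ζ D * X.χ D)]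
  rw [← Finset.sum_add_distrib]
  simp only [this, Finset.sum_add_distrib]
  abel

theorem glOp_glOp (G H : κ → κ → A) (hG : ∀ B C, X.IsScalar (G B C))
    (hH : ∀ B C, X.IsScalar (H B C)) :
    X.glOp G * X.glOp H - X.glOp H * X.glOp G =
      X.glOp fun B C => ∑ e, (G e C * H B e - H e C * G B e) := by
  have key : ∀ B C D E, lm (G B C) * X.glUnit B C * (lm (H D E) * X.glUnit D E) -
      lm (H D E) * X.glUnit D E * (lm (G B C) * X.glUnit B C) =
      (if B = E then lm (G B C * H D B) * X.glUnit D C else 0) -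
        if D = C then lm (H D E * G B D) * X.glUnit B E else 0 := by
    intro B C D E
    have h1 : lm (G B C) * X.glUnit B C * (lm (H D E) * X.glUnit D E) =
        lm (G B C * H D E) * (X.glUnit B C * X.glUnit D E) := by
      rw [mul_assoc, ← mul_assoc (X.glUnit B C), glUnit_lm _ _ (hH D E), lm_mul]
      simp only [mul_assoc]
    have h2 : lm (H D E) * X.glUnit D E * (lm (G B C) * X.glUnit B C) =
        lm (G B C * H D E) * (X.glUnit D E * X.glUnit B C) := by
      rw [mul_assoc, ← mul_assoc (X.glUnit D E), glUnit_lm _ _ (hG B C), (hG B C).comm, lm_mul]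
      simp only [mul_assoc]
    rw [h1, h2, ← mul_sub, glUnit_glUnit, mul_sub]
    congr 1
    · split_ifs with h
      · subst h; rfl
      · simp
    · split_ifs with h
      · subst h; rw [(hG B D).comm]
      · simp
  have e1 : X.glOp G * X.glOp H - X.glOp H * X.glOp G =
      ∑ B, ∑ C, ∑ D, ∑ E, (lm (G B C) * X.glUnit B C * (lm (H D E) * X.glUnit D E) -
      lm (H D E) * X.glUnit D E * (lm (G B C) * X.glUnit B C)) := by
    simp only [glOp, Finset.sum_sub_distrib]
    congr 1
    · rw [Finset.sum_mul]
      refine Finset.sum_congr rfl fun B _ => ?_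
      rw [Finset.sum_mul]
      simp only [Finset.mul_sum]
    · rw [Finset.mul_sum]
      refine Finset.sum_congr rfl fun B _ => ?_
      rw [Finset.mul_sum]
      simp only [Finset.sum_mul]
  rw [e1]
  simp only [key, Finset.sum_sub_distrib]
  have e2 : ∑ B, ∑ C, ∑ D, ∑ E, (if B = E then lm (G B C * H D B) * X.glUnit D C else 0) =
      ∑ D, ∑ C, lm (∑ B, G B C * H D B) * X.glUnit D C := by
    simp only [Finset.sum_ite_eq, Finset.mem_univ, if_true, lm_sum, Finset.sum_mul]
    calc _ = ∑ C, ∑ B, ∑ D, lm (G B C * H D B) * X.glUnit D C := Finset.sum_comm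
      _ = ∑ C, ∑ D, ∑ B, lm (G B C * H D B) * X.glUnit D C :=
          Finset.sum_congr rfl fun _ _ => Finset.sum_comm
      _ = _ := Finset.sum_comm
  have e3 : ∑ B, ∑ C, ∑ D, ∑ E, (if D = C then lm (H D E * G B D) * X.glUnit B E else 0) =
      ∑ B, ∑ E, lm (∑ C, H C E * G B C) * X.glUnit B E := by
    refine Finset.sum_congr rfl fun B _ => ?_
    simp only [lm_sum, Finset.sum_mul]
    rw [Finset.sum_comm (s := Finset.univ (α := κ)) (t := Finset.univ (α := κ))
      (f := fun E C => lm (H C E * G B C) * X.glUnit B E)]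
    refine Finset.sum_congr rfl fun C _ => ?_
    rw [Finset.sum_comm]
    simp
  rw [e2, e3]
  simp only [glOp, lm_sub, sub_mul, Finset.sum_sub_distrib]

end SuperCoord

/-! ### Connections, the odd operator Δ and the Jacobi identity -/

namespace SuperCoord

variable {A : Type*} [Ring A] [Algebra ℝ A] {I κ : Type*} [DecidableEq I] [DecidableEq κ]

/-- Commuting derivations `∂/∂x^i` of the scalars and a linear connection. -/
structure Conn (X : SuperCoord A I κ) where
  pd : I → Module.End ℝ A
  Γ : I → κ → κ → A
  pd_mul : ∀ i a b, pd i (a * b) = pd i a * b + a * pd i b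
  par_pd : ∀ i a, X.par (pd i a) = pd i (X.par a)
  pd_θ : ∀ i j, pd i * X.θ j = X.θ j * pd i
  pd_ζ : ∀ i B, pd i * X.ζ B = X.ζ B * pd i
  pd_χ : ∀ i B, pd i * X.χ B = X.χ B * pd i
  pd_pd : ∀ i j, pd i * pd j = pd j * pd i
  pd_x : ∀ i j, pd i (X.x j) = 0
  pd_z : ∀ i B, pd i (X.z B) = 0
  pd_y : ∀ i B, pd i (X.y B) = 0
  isScalar : ∀ i B C, X.IsScalar (Γ i B C)

theorem jacobi_identity {R : Type*} [Ring R] (a b c : R) :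
    a * (b * c - c * b) - (b * c - c * b) * a + (b * (c * a - a * c) - (c * a - a * c) * b) +
      (c * (a * b - b * a) - (a * b - b * a) * c) = 0 := by
  noncomm_ring

namespace Conn

variable [Fintype I] [Fintype κ] {X : SuperCoord A I κ} (N : X.Conn)

theorem pd_isScalar (i : I) {a : A} (ha : X.IsScalar a) : X.IsScalar (N.pd i a) := by
  refine ⟨by rw [N.par_pd, ha.par], fun j => ?_, fun j => ?_, fun j => ?_⟩
  · rw [← Module.End.mul_apply, ← N.pd_θ, Module.End.mul_apply, ha.θ, map_zero]
  · rw [← Module.End.mul_apply, ← N.pd_ζ, Module.End.mul_apply, ha.ζ, map_zero]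
  · rw [← Module.End.mul_apply, ← N.pd_χ, Module.End.mul_apply, ha.χ, map_zero]

/-- The covariant derivative along `x^i`. -/
def D (i : I) : Module.End ℝ A := N.pd i + X.glOp (N.Γ i)

/-- The curvature. -/
def K (i j : I) (B C : κ) : A :=
  N.pd i (N.Γ j B C) - N.pd j (N.Γ i B C) +
    ∑ e, (N.Γ i e C * N.Γ j B e - N.Γ j e C * N.Γ i B e)

theorem K_isScalar (i j : I) (B C : κ) : X.IsScalar (N.K i j B C) :=
  ((N.pd_isScalar i (N.isScalar j B C)).sub (N.pd_isScalar j (N.isScalar i B C))).add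
    (IsScalar.sum fun _ _ => ((N.isScalar _ _ _).mul (N.isScalar _ _ _)).sub
      ((N.isScalar _ _ _).mul (N.isScalar _ _ _)))

/-- The curvature as a function. -/
def ρ (i j : I) : A := X.glFun (N.K i j)

theorem D_mul (i : I) (a b : A) : N.D i (a * b) = N.D i a * b + a * N.D i b := by
  simp only [D, LinearMap.add_apply, N.pd_mul, glOp_mul _ (N.isScalar i)]
  noncomm_ring

theorem par_D (i : I) (a : A) : X.par (N.D i a) = N.D i (X.par a) := by
  simp only [D, LinearMap.add_apply, map_add, N.par_pd, par_glOp _ (N.isScalar i)]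

theorem D_scalar (i : I) {a : A} (ha : X.IsScalar a) : N.D i a = N.pd i a := by
  simp [D, glOp_scalar _ ha]

theorem D_y (i : I) (B : κ) : N.D i (X.y B) = ∑ C, N.Γ i B C * X.y C := by
  simp [D, glOp_y, N.pd_y]

theorem D_z (i : I) (C : κ) : N.D i (X.z C) = -∑ B, N.Γ i B C * X.z B := by
  simp [D, glOp_z, N.pd_z]

theorem D_x (i j : I) : N.D i (X.x j) = 0 := by
  simp [D, glOp_x, N.pd_x]

theorem D_lm (i : I) (a : A) : N.D i * lm a = lm a * N.D i + lm (N.D i a) := by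
  ext b; simp [D_mul, add_comm]

theorem D_θ (i j : I) : N.D i * X.θ j = X.θ j * N.D i := by
  have : X.glOp (N.Γ i) * X.θ j = X.θ j * X.glOp (N.Γ i) := by
    simp only [glOp, Finset.sum_mul, Finset.mul_sum]
    refine Finset.sum_congr rfl fun B _ => Finset.sum_congr rfl fun C _ => ?_
    rw [mul_assoc, glUnit_θ, ← mul_assoc, ← (N.isScalar i B C).θ_lm, mul_assoc]
  rw [D, add_mul, mul_add, N.pd_θ, this]

theorem pd_lap (i : I) : N.pd i * X.lap = X.lap * N.pd i := by
  simp only [lap, Finset.sum_mul, Finset.mul_sum]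
  refine Finset.sum_congr rfl fun B _ => ?_
  rw [← mul_assoc, N.pd_ζ, mul_assoc, N.pd_χ, mul_assoc]

theorem D_lap (i : I) : N.D i * X.lap = X.lap * N.D i := by
  rw [D, add_mul, mul_add, N.pd_lap, lap_glOp _ (N.isScalar i)]

theorem pd_glUnit (i : I) (B C : κ) : N.pd i * X.glUnit B C = X.glUnit B C * N.pd i := by
  ext a
  have h1 := DFunLike.congr_fun (N.pd_χ i B) a
  have h2 := DFunLike.congr_fun (N.pd_ζ i C) a
  simp only [Module.End.mul_apply] at h1 h2
  simp [glUnit, N.pd_mul, N.pd_y, N.pd_z, h1, h2]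

theorem pd_glOp (i : I) (G : κ → κ → A) :
    N.pd i * X.glOp G = X.glOp G * N.pd i + X.glOp fun B C => N.pd i (G B C) := by
  simp only [glOp, Finset.sum_mul, Finset.mul_sum, ← Finset.sum_add_distrib]
  refine Finset.sum_congr rfl fun B _ => Finset.sum_congr rfl fun C _ => ?_
  rw [mul_assoc, ← N.pd_glUnit]
  ext a
  simp [N.pd_mul, add_comm]

theorem D_D (i j : I) : N.D i * N.D j - N.D j * N.D i = X.glOp (N.K i j) := by
  have h1 : X.glOp (N.K i j) = (X.glOp fun B C => N.pd i (N.Γ j B C)) -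
      (X.glOp fun B C => N.pd j (N.Γ i B C)) +
      (X.glOp (N.Γ i) * X.glOp (N.Γ j) - X.glOp (N.Γ j) * X.glOp (N.Γ i)) := by
    rw [glOp_glOp _ _ (N.isScalar i) (N.isScalar j)]
    simp only [glOp, ← Finset.sum_sub_distrib, ← Finset.sum_add_distrib, ← sub_mul, ← add_mul,
      ← lm_sub, ← lm_add, K]
  rw [h1]
  simp only [D, add_mul, mul_add, N.pd_glOp, N.pd_pd j i]
  abel

/-- The form of ρ used below for the Bianchi identity and for changes of coordinates: only
commutators of covariant derivatives enter, never the explicit coefficients of the curvature. -/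
theorem ρ_eq (i j : I) : N.ρ i j = ∑ B, X.z B * (N.D i * N.D j - N.D j * N.D i) (X.y B) := by
  rw [ρ, glFun_eq, N.D_D]

theorem par_ρ (i j : I) : X.par (N.ρ i j) = -N.ρ i j := par_glFun _ (N.K_isScalar i j)

theorem θ_ρ (k i j : I) : X.θ k (N.ρ i j) = 0 := θ_glFun _ (N.K_isScalar i j) k

theorem ρ_antisymm (i j : I) : N.ρ i j = -N.ρ j i := by
  rw [N.ρ_eq, N.ρ_eq, ← Finset.sum_neg_distrib]
  refine Finset.sum_congr rfl fun B _ => ?_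
  rw [← mul_neg, ← LinearMap.neg_apply]
  congr 2
  abel

/-- The pairing of the dual coordinates z and z* is covariantly constant: the connection terms from
D z cancel those needed to move D past the curvature operator. -/
theorem D_ρ (k i j : I) : N.D k (N.ρ i j) =
    ∑ B, X.z B * (N.D k * X.glOp (N.K i j) - X.glOp (N.K i j) * N.D k) (X.y B) := by
  have h1 : ∑ B, X.z B * X.glOp (N.K i j) (N.D k (X.y B)) =
      -∑ B, N.D k (X.z B) * X.glOp (N.K i j) (X.y B) := by
    simp only [N.D_y, N.D_z, map_sum, Finset.mul_sum, Finset.sum_mul, neg_mul,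
      Finset.sum_neg_distrib, neg_neg]
    rw [Finset.sum_comm]
    refine Finset.sum_congr rfl fun B _ => Finset.sum_congr rfl fun C _ => ?_
    rw [glOp_mul _ (N.K_isScalar i j), glOp_scalar _ (N.isScalar k C B), zero_mul, zero_add,
      ← mul_assoc, (N.isScalar k C B).comm]
  rw [ρ, glFun_eq, map_sum]
  simp only [N.D_mul, LinearMap.sub_apply, Module.End.mul_apply, mul_sub, Finset.sum_sub_distrib,
    Finset.sum_add_distrib]
  rw [h1]; abel

/-- By `D_ρ` the cyclic sum becomes the cyclic sum of double commutators of the D_i, which vanishes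
by the Jacobi identity for operators. -/
theorem bianchi (k i j : I) : N.D k (N.ρ i j) + N.D i (N.ρ j k) + N.D j (N.ρ k i) = 0 := by
  simp only [N.D_ρ, ← Finset.sum_add_distrib, ← mul_add, ← LinearMap.add_apply, ← N.D_D]
  refine Finset.sum_eq_zero fun B _ => ?_
  rw [jacobi_identity, LinearMap.zero_apply, mul_zero]

/-- The quadratic term of the curvature is a commutator of matrices and has no trace, so the trace
of the curvature is the exterior derivative of the trace of the connection. -/
theorem trace_K (i j : I) : ∑ B, N.K i j B B =
    N.pd i (∑ B, N.Γ j B B) - N.pd j (∑ B, N.Γ i B B) := by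
  simp only [K, Finset.sum_add_distrib, Finset.sum_sub_distrib, map_sum]
  have : ∑ B, ∑ e, N.Γ i e B * N.Γ j B e = ∑ B, ∑ e, N.Γ j e B * N.Γ i B e := by
    rw [Finset.sum_comm]
    exact Finset.sum_congr rfl fun B _ => Finset.sum_congr rfl fun C _ => (N.isScalar _ _ _).comm _
  rw [this]; abel

/-- An odd second order operator with square zero. -/
def Δ : Module.End ℝ A :=
  -∑ i, X.θ i * N.D i + X.lap - (1 / 2 : ℝ) • ∑ i, ∑ j, lm (N.ρ i j) * (X.θ i * X.θ j) +
    ∑ i, lm (-∑ B, N.Γ i B B) * X.θ i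

theorem trace_isScalar (i : I) : X.IsScalar (-∑ B, N.Γ i B B) :=
  (IsScalar.sum fun B _ => N.isScalar i B B).neg

/-- The trace term in Δ is present for this identity: its covariant curl is -tr K, which compensates
the trace that `lap` produces when it meets ρ. -/
theorem Δ_Δ : N.Δ * N.Δ = 0 := by
  refine delta_sq_eq_zero (N := fun i j => X.glOp (N.K i j))
    (tr := fun i j => lm (∑ B, N.K i j B B)) X.θ_θ N.D_θ N.D_D N.D_lap θ_lap lap_lap ?_ ?_
    (fun i j => lap_glFun _ (N.K_isScalar i j)) ?_ ?_ ?_ ?_ ?_ ?_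
  · intro k i j
    ext a
    simp [X.θ_mul, N.θ_ρ, N.par_ρ]
  · intro i j k l
    rw [← lm_mul, ← lm_mul, X.odd_comm (N.par_ρ i j), N.par_ρ, neg_mul, lm_neg]
  · intro k i j
    simp only [N.D_lm, add_sub_cancel_left, ← lm_add, N.bianchi, lm_zero]
  · exact fun i j => (N.trace_isScalar j).θ_lm i
  · exact fun i j => (N.trace_isScalar i).lm_comm _
  · exact fun k i j => (N.trace_isScalar k).lm_comm _
  · exact fun i => (lap_lm (N.trace_isScalar i)).symm
  · intro i j
    simp only [N.D_lm, add_sub_cancel_left, ← lm_sub, ← lm_neg, N.D_scalar _ (N.trace_isScalar _),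
      N.trace_K, map_neg]
    congr 1; abel

/-- The odd Hamiltonian vector field of an even function. -/
def LQ (S : A) : Module.End ℝ A :=
  ∑ i, (-(lm (X.θ i S) * N.D i) - lm (N.D i S) * X.θ i) +
    ∑ B, (lm (X.χ B S) * X.ζ B + lm (X.ζ B S) * X.χ B) +
    ∑ i, ∑ j, lm (X.θ i S * N.ρ i j) * X.θ j

theorem LQ_apply (S f : A) : N.LQ S f =
    ∑ i, (-(X.θ i S * N.D i f) - N.D i S * X.θ i f) +
    ∑ B, (X.χ B S * X.ζ B f + X.ζ B S * X.χ B f) +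
    ∑ i, ∑ j, X.θ i S * N.ρ i j * X.θ j f := by
  simp [LQ, mul_assoc]

theorem LQ_mul {S : A} (hS : X.par S = S) (a b : A) :
    N.LQ S (a * b) = N.LQ S a * b + X.par a * N.LQ S b := by
  have odd : ∀ {w}, X.par w = -w → ∀ u, w * (a * u) = X.par a * (w * u) := by
    intro w hw u
    rw [← mul_assoc, X.odd_comm hw, mul_assoc]
  have even : ∀ {w}, X.par w = w → ∀ u, w * (X.par a * u) = X.par a * (w * u) := by
    intro w hw u
    rw [← mul_assoc, X.even_comm hw, mul_assoc]
  have h1 : ∀ i, X.par (X.θ i S) = -X.θ i S := fun i => by rw [X.par_θ, hS]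
  have h2 : ∀ i, X.par (X.ζ i S) = -X.ζ i S := fun i => by rw [X.par_ζ, hS]
  have h3 : ∀ i, X.par (N.D i S) = N.D i S := fun i => by rw [N.par_D, hS]
  have h4 : ∀ i, X.par (X.χ i S) = X.χ i S := fun i => by rw [X.par_χ, hS]
  have h5 : ∀ i j, X.par (X.θ i S * N.ρ i j) = X.θ i S * N.ρ i j := fun i j => by
    rw [map_mul, h1, N.par_ρ, neg_mul_neg]
  simp only [N.LQ_apply, N.D_mul, X.θ_mul, X.ζ_mul, X.χ_mul, add_mul, Finset.sum_mul, mul_add,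
    Finset.mul_sum, sub_mul, mul_sub, odd (h1 _), odd (h2 _), even (h3 _), even (h4 _),
    even (h5 _ _), Finset.sum_add_distrib, Finset.sum_sub_distrib, neg_add, neg_mul, mul_neg,
    mul_assoc]
  simp only [← mul_assoc (X.θ _ S) (N.ρ _ _), even (h5 _ _), Finset.sum_neg_distrib]
  abel

theorem LQ_one {S : A} (hS : X.par S = S) : N.LQ S 1 = 0 := by
  have := N.LQ_mul hS 1 1
  simpa using this

/-- The bracket measures the failure of the second order operator Δ to be a derivation. The terms in
which both derivatives hit S form ΔS, and the mixed terms form the bracket. The factor 1/2 in front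
of the curvature term disappears because it is hit from either side. -/
theorem LQ_eq {S : A} (hS : X.par S = S) : N.LQ S = N.Δ * lm S - lm S * N.Δ - lm (N.Δ S) := by
  have h1 : ∀ i, X.par (X.θ i S) = -X.θ i S := fun i => by rw [X.par_θ, hS]
  have h3 : ∀ i, X.par (N.D i S) = N.D i S := fun i => by rw [N.par_D, hS]
  have h4 : ∀ i, X.par (X.χ i S) = X.χ i S := fun i => by rw [X.par_χ, hS]
  have e1 : ∀ i, X.θ i * N.D i * lm S = lm S * (X.θ i * N.D i) + lm (X.θ i (N.D i S)) +
      lm (X.θ i S) * N.D i + lm (N.D i S) * X.θ i := by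
    intro i; ext f
    simp only [Module.End.mul_apply, LinearMap.mulLeft_apply, N.D_mul, map_add, X.θ_mul, h3, hS,
      LinearMap.add_apply]
    abel
  have e2 : ∀ B, X.ζ B * X.χ B * lm S = lm S * (X.ζ B * X.χ B) + lm (X.ζ B (X.χ B S)) +
      lm (X.χ B S) * X.ζ B + lm (X.ζ B S) * X.χ B := by
    intro i; ext f
    simp only [Module.End.mul_apply, LinearMap.mulLeft_apply, X.χ_mul, map_add, X.ζ_mul, h4, hS,
      LinearMap.add_apply]
    abel
  have e3 : ∀ i j, lm (N.ρ i j) * (X.θ i * X.θ j) * lm S = lm S * (lm (N.ρ i j) * (X.θ i * X.θ j)) +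
      lm (N.ρ i j * X.θ i (X.θ j S)) - (lm (X.θ i S * N.ρ i j) * X.θ j +
      lm (X.θ j S * N.ρ j i) * X.θ i) := by
    intro i j
    have a1 : N.ρ i j * X.θ i S = -(X.θ i S * N.ρ i j) := by
      rw [X.odd_comm (N.par_ρ i j), h1, neg_mul]
    have a2 : N.ρ i j * X.θ j S = X.θ j S * N.ρ j i := by
      rw [X.odd_comm (N.par_ρ i j), h1, N.ρ_antisymm i j, mul_neg, neg_mul, neg_neg]
    ext f
    simp only [Module.End.mul_apply, LinearMap.mulLeft_apply, map_add, X.θ_mul, h1, hS,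
      LinearMap.add_apply, LinearMap.sub_apply, mul_add, ← mul_assoc, a1, a2, neg_mul, mul_neg,
      X.even_comm hS (N.ρ i j)]
    abel
  have e4 : ∀ i, lm (-∑ B, N.Γ i B B) * X.θ i * lm S = lm S * (lm (-∑ B, N.Γ i B B) * X.θ i) +
      lm ((-∑ B, N.Γ i B B) * X.θ i S) := by
    intro i
    ext f
    simp only [Module.End.mul_apply, LinearMap.mulLeft_apply, map_add, X.θ_mul, hS,
      LinearMap.add_apply, mul_add, ← mul_assoc, X.even_comm hS (-∑ B, N.Γ i B B)]
    abel
  have e5 : lm (N.Δ S) = -∑ i, lm (X.θ i (N.D i S)) + ∑ B, lm (X.ζ B (X.χ B S)) -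
      (1 / 2 : ℝ) • ∑ i, ∑ j, lm (N.ρ i j * X.θ i (X.θ j S)) +
      ∑ i, lm ((-∑ B, N.Γ i B B) * X.θ i S) := by
    ext f
    simp only [Δ, lap, LinearMap.mulLeft_apply, LinearMap.add_apply, LinearMap.sub_apply,
      LinearMap.neg_apply, LinearMap.smul_apply, LinearMap.sum_apply, Module.End.mul_apply, add_mul,
      sub_mul, neg_mul, Finset.sum_mul, smul_mul_assoc]
  have e6 : ∑ i, ∑ j, (lm (X.θ i S * N.ρ i j) * X.θ j + lm (X.θ j S * N.ρ j i) * X.θ i) =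
      (2 : ℝ) • ∑ i, ∑ j, lm (X.θ i S * N.ρ i j) * X.θ j := by
    rw [← sum_eq_half_sum_sub]
    simp only [Finset.sum_add_distrib]
  have e7 : N.Δ * lm S = lm S * N.Δ + lm (N.Δ S) + N.LQ S := by
    rw [e5, LQ]
    nth_rewrite 1 [Δ]
    simp only [lap, add_mul, sub_mul, end_neg_mul, Finset.sum_mul, smul_mul_assoc, e1, e2, e3, e4,
      Finset.sum_add_distrib, Finset.sum_sub_distrib]
    simp only [Finset.sum_add_distrib] at e6
    rw [e6, Δ]
    simp only [lap, mul_add, mul_sub, end_mul_neg, Finset.mul_sum, mul_smul_comm,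
      Finset.sum_neg_distrib]
    module
  rw [e7]; abel

/-- The Jacobi identity for S with itself. The derivation property together with (S, S) = 0 shows
that the bracket operator commutes with multiplication by S, and Δ² = 0 then makes its square a
multiplication operator. -/
theorem LQ_LQ {S : A} (hS : X.par S = S) (h : N.LQ S S = 0) (f : A) :
    N.LQ S (N.LQ S f) = 0 := by
  have hq : N.LQ S * lm S = lm S * N.LQ S := by
    ext f; simp [N.LQ_mul hS, h, hS]
  have hΔ : X.par (N.Δ S) = -N.Δ S := by
    simp only [Δ, lap, LinearMap.add_apply, LinearMap.sub_apply,
      LinearMap.neg_apply, LinearMap.smul_apply, LinearMap.sum_apply, Module.End.mul_apply,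
      map_add, map_sub, map_smul, map_sum, LinearMap.mulLeft_apply, map_mul, map_neg, X.par_θ,
      X.par_ζ, X.par_χ, N.par_D, hS, N.par_ρ, (N.isScalar _ _ _).par]
    simp only [mul_neg, neg_mul, neg_neg, smul_neg, Finset.sum_neg_distrib]
    abel
  have hm : N.LQ S * lm (N.Δ S) + lm (N.Δ S) * N.LQ S = lm (N.LQ S (N.Δ S)) := by
    ext f; simp [N.LQ_mul hS, hΔ]
  have hδ : lm (N.Δ S) * lm (N.Δ S) = 0 := by
    have : N.Δ S * N.Δ S = -(N.Δ S * N.Δ S) := by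
      nth_rewrite 1 [X.odd_comm hΔ, hΔ]; rw [neg_mul]
    have h2 : (2 : ℝ) • (N.Δ S * N.Δ S) = 0 := by
      rw [two_smul]; nth_rewrite 1 [this]; exact neg_add_cancel _
    rw [← lm_mul, (smul_eq_zero.1 h2).resolve_left two_ne_zero, lm_zero]
  have key := N.LQ_eq hS
  have := square_eq_of_delta N.Δ_Δ (s := lm S) (δ := lm (N.Δ S)) (m := lm (N.LQ S (N.Δ S)))
    (by rw [← lm_mul, ← lm_mul, X.even_comm hS]) hδ (by rw [← key]; exact hq)
    (by rw [← key]; exact hm)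
  rw [← key] at this
  -- A derivation kills constants, so evaluating the square at 1 shows that the multiplier is zero.
  have h1 := DFunLike.congr_fun this 1
  simp only [Module.End.mul_apply, N.LQ_one hS, map_zero, LinearMap.neg_apply,
    LinearMap.mulLeft_apply, mul_one] at h1
  have h2 := DFunLike.congr_fun this f
  simp only [Module.End.mul_apply, LinearMap.neg_apply, LinearMap.mulLeft_apply] at h2
  rw [h2, neg_eq_zero.1 h1.symm, zero_mul, neg_zero]

end Conn
end SuperCoord

/-! ### Invariance of the bracket under changes of coordinates -/

namespace SuperCoord

/-- Contraction of a lower with an upper index does not depend on the frame. Centrality of the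
second matrix is needed to move it past the noncommuting factor P. -/
theorem sum_contract {R J : Type*} [Ring R] [Fintype J] [DecidableEq J] {a b : J → J → R}
    (hb : ∀ i l u, b i l * u = u * b i l)
    (hab : ∀ k l, ∑ i, a k i * b i l = if k = l then 1 else 0) (P Q : J → R) :
    ∑ i, (∑ k, a k i * P k) * (∑ l, b i l * Q l) = ∑ k, P k * Q k := by
  calc ∑ i, (∑ k, a k i * P k) * (∑ l, b i l * Q l)
      = ∑ i, ∑ k, ∑ l, a k i * b i l * (P k * Q l) := by
        refine Finset.sum_congr rfl fun i _ => ?_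
        rw [Finset.sum_mul_sum]
        refine Finset.sum_congr rfl fun k _ => Finset.sum_congr rfl fun l _ => ?_
        rw [mul_assoc, ← mul_assoc (P k), ← hb, mul_assoc (b i l), mul_assoc]
    _ = ∑ k, ∑ l, ∑ i, a k i * b i l * (P k * Q l) := by
        rw [Finset.sum_comm]
        exact Finset.sum_congr rfl fun k _ => Finset.sum_comm
    _ = ∑ k, ∑ l, (if k = l then 1 else 0) * (P k * Q l) := by
        simp only [← Finset.sum_mul, hab]
    _ = ∑ k, P k * Q k := by simp

variable {A : Type*} [Ring A] [Algebra ℝ A] {I κ : Type*} [DecidableEq I] [DecidableEq κ]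
  [Fintype I] [Fintype κ] {X : SuperCoord A I κ}

/-- A change of coordinates that relates two connections. -/
structure Transition (N N' : X.Conn) (Φ : A →ₐ[ℝ] A) where
  j : I → I → A
  J : I → I → A
  h : κ → κ → A
  h' : κ → κ → A
  g : I → I → I → A
  j_scalar : ∀ k i, X.IsScalar (j k i)
  J_scalar : ∀ i k, X.IsScalar (J i k)
  h_scalar : ∀ B C, X.IsScalar (h B C)
  h'_scalar : ∀ B C, X.IsScalar (h' B C)
  g_scalar : ∀ k i l, X.IsScalar (g k i l)
  j_J : ∀ k l, ∑ i, j k i * J i l = if k = l then 1 else 0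
  h_h' : ∀ B D, ∑ C, h B C * h' C D = if B = D then 1 else 0
  h'_h : ∀ B D, ∑ C, h' B C * h C D = if B = D then 1 else 0
  Φ_y : ∀ B, Φ (X.y B) = ∑ C, h B C * X.y C
  Φ_z : ∀ B, Φ (X.z B) = ∑ C, h' C B * X.z C
  g_symm : ∀ k i l, g k i l = g i k l
  J_symm : ∀ i k l, N'.pd i (J k l) = N'.pd k (J i l)
  θ_Φ : ∀ i a, X.θ i (Φ a) = ∑ k, j k i * Φ (X.θ k a)
  ζ_Φ : ∀ B a, X.ζ B (Φ a) = ∑ C, h' B C * Φ (X.ζ C a)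
  χ_Φ : ∀ B a, X.χ B (Φ a) = ∑ C, h C B * Φ (X.χ C a)
  D_Φ : ∀ i a, N'.D i (Φ a) =
    ∑ k, J i k * Φ (N.D k a + ∑ n, ∑ l, g k n l * (X.x l * X.θ n a))

namespace Transition

variable {N N' : X.Conn} {Φ : A →ₐ[ℝ] A} (t : Transition N N' Φ)

include t

/-- Differentiating the Jacobian produces second derivatives of the coordinates. These are symmetric
by `J_symm` and drop out of the commutator. The Hessian term in `D_Φ` differentiates along x* and
does not act on the z*. -/
theorem D_D_Φ_y (i k : I) (B : κ) : (N'.D i * N'.D k - N'.D k * N'.D i) (Φ (X.y B)) =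
    ∑ l, ∑ n, J t i l * (J t k n * Φ ((N.D l * N.D n - N.D n * N.D l) (X.y B))) := by
  have h0 : ∀ n l, X.θ n (N.D l (X.y B)) = 0 := by
    intro n l
    rw [← Module.End.mul_apply, ← N.D_θ, Module.End.mul_apply, X.θ_y, map_zero]
  have h1 : ∀ i k, N'.D i (N'.D k (Φ (X.y B))) =
      ∑ n, N'.pd i (t.J k n) * Φ (N.D n (X.y B)) +
      ∑ n, ∑ l, t.J k n * (t.J i l * Φ (N.D l (N.D n (X.y B)))) := by
    intro i k
    rw [t.D_Φ k]
    simp only [X.θ_y, mul_zero, Finset.sum_const_zero, add_zero, map_sum, N'.D_mul, t.D_Φ, h0,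
      N'.D_scalar _ (t.J_scalar _ _), Finset.sum_add_distrib, Finset.mul_sum]
  simp only [LinearMap.sub_apply, Module.End.mul_apply, h1, map_sub, mul_sub,
    Finset.sum_sub_distrib]
  have h2 : ∑ n, N'.pd k (t.J i n) * Φ (N.D n (X.y B)) =
      ∑ n, N'.pd i (t.J k n) * Φ (N.D n (X.y B)) := by
    simp only [t.J_symm k i]
  have h3 : ∑ n, ∑ l, t.J k n * (t.J i l * Φ (N.D l (N.D n (X.y B)))) =
      ∑ l, ∑ n, t.J i l * (t.J k n * Φ (N.D l (N.D n (X.y B)))) := by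
    rw [Finset.sum_comm]
    refine Finset.sum_congr rfl fun l _ => Finset.sum_congr rfl fun n _ => ?_
    rw [← mul_assoc, (t.J_scalar k n).comm, mul_assoc]
  rw [h2, h3]; abel

/-- The tensor law of the curvature. It follows from the law for commutators of covariant
derivatives, because the z and z* transform by mutually inverse matrices. -/
theorem ρ_Φ (i k : I) : N'.ρ i k = ∑ l, J t i l * ∑ n, t.J k n * Φ (N.ρ l n) := by
  have h1 : N'.ρ i k =
      ∑ B, Φ (X.z B) * (N'.D i * N'.D k - N'.D k * N'.D i) (Φ (X.y B)) := by
    have : ∀ B, (N'.D i * N'.D k - N'.D k * N'.D i) (Φ (X.y B)) =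
        ∑ C, t.h B C * (N'.D i * N'.D k - N'.D k * N'.D i) (X.y C) := by
      intro B
      rw [t.Φ_y, N'.D_D, map_sum]
      refine Finset.sum_congr rfl fun C _ => ?_
      rw [glOp_mul _ (N'.K_isScalar i k), glOp_scalar _ (t.h_scalar B C), zero_mul, zero_add]
    simp only [this, t.Φ_z, N'.ρ_eq]
    rw [sum_contract (fun B C u => (t.h_scalar B C).comm u) t.h'_h]
  rw [h1]
  simp only [t.D_D_Φ_y, N.ρ_eq, map_sum, map_mul, Finset.mul_sum]
  rw [Finset.sum_comm]
  refine Finset.sum_congr rfl fun l _ => ?_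
  rw [Finset.sum_comm]
  refine Finset.sum_congr rfl fun n _ => Finset.sum_congr rfl fun B _ => ?_
  rw [← mul_assoc, ← (t.J_scalar i l).comm, mul_assoc, ← mul_assoc (Φ _),
    ← (t.J_scalar k n).comm, mul_assoc]

/-- All terms of the bracket are contractions over dual indices. The only inhomogeneous terms come
from the Hessian in `D_Φ`, which is there because the x* transform by a matrix that depends on the
base point. -/
theorem LQ_Φ {S : A} (hS : X.par S = S) (f : A) : N'.LQ (Φ S) (Φ f) = Φ (N.LQ S f) := by
  have h1 : ∀ i, X.par (X.θ i S) = -X.θ i S := fun i => by rw [X.par_θ, hS]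
  have hJj : ∀ k l, ∑ i, t.J i k * t.j l i = if k = l then 1 else 0 := by
    intro k l
    simp only [(t.J_scalar _ _).comm, t.j_J, eq_comm]
  have hhh : ∀ B D, ∑ C, t.h' C B * t.h D C = if B = D then 1 else 0 := by
    intro k l
    simp only [(t.h'_scalar _ _).comm, t.h_h', eq_comm]
  have a1 : ∑ i, X.θ i (Φ S) * N'.D i (Φ f) =
      ∑ k, Φ (X.θ k S) * Φ (N.D k f + ∑ n, ∑ l, t.g k n l * (X.x l * X.θ n f)) := by
    simp only [t.θ_Φ, t.D_Φ]
    exact sum_contract (fun i l => (t.J_scalar i l).comm) t.j_J _ _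
  have a2 : ∑ i, N'.D i (Φ S) * X.θ i (Φ f) =
      ∑ k, Φ (N.D k S + ∑ n, ∑ l, t.g k n l * (X.x l * X.θ n S)) * Φ (X.θ k f) := by
    simp only [t.θ_Φ, t.D_Φ]
    exact sum_contract (a := fun k i => t.J i k) (b := fun i l => t.j l i)
      (fun i l => (t.j_scalar l i).comm) hJj _ _
  have a3 : ∑ B, X.χ B (Φ S) * X.ζ B (Φ f) = ∑ B, Φ (X.χ B S) * Φ (X.ζ B f) := by
    simp only [t.χ_Φ, t.ζ_Φ]
    exact sum_contract (fun i l => (t.h'_scalar i l).comm) t.h_h' _ _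
  have a4 : ∑ B, X.ζ B (Φ S) * X.χ B (Φ f) = ∑ B, Φ (X.ζ B S) * Φ (X.χ B f) := by
    simp only [t.χ_Φ, t.ζ_Φ]
    exact sum_contract (a := fun k i => t.h' i k) (b := fun i l => t.h l i)
      (fun i l => (t.h_scalar l i).comm) hhh _ _
  have a5 : ∑ i, ∑ k, X.θ i (Φ S) * N'.ρ i k * X.θ k (Φ f) =
      ∑ i, ∑ k, Φ (X.θ i S) * Φ (N.ρ i k) * Φ (X.θ k f) := by
    have e1 : ∀ k, ∑ i, X.θ i (Φ S) * N'.ρ i k =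
        ∑ n, t.J k n * ∑ l, Φ (X.θ l S) * Φ (N.ρ l n) := by
      intro k
      simp only [t.θ_Φ, t.ρ_Φ]
      rw [sum_contract (fun i l => (t.J_scalar i l).comm) t.j_J]
      simp only [Finset.mul_sum]
      rw [Finset.sum_comm]
      refine Finset.sum_congr rfl fun l _ => Finset.sum_congr rfl fun n _ => ?_
      rw [← mul_assoc, ← (t.J_scalar _ _).comm, mul_assoc]
    rw [Finset.sum_comm]
    simp only [← Finset.sum_mul, e1]
    simp only [t.θ_Φ]
    rw [sum_contract (a := fun k i => t.J i k) (b := fun i l => t.j l i)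
      (fun i l => (t.j_scalar l i).comm) hJj]
    simp only [Finset.sum_mul]
    exact Finset.sum_comm
  -- The Hessian is symmetric in k and n, while the odd factor x* picks up a sign when it passes the
  -- odd derivative of S. The two inhomogeneous contributions are therefore opposite.
  have a6 : ∑ k, (X.θ k S * ∑ n, ∑ l, t.g k n l * (X.x l * X.θ n f)) =
      -∑ k, (∑ n, ∑ l, t.g k n l * (X.x l * X.θ n S)) * X.θ k f := by
    simp only [Finset.mul_sum, Finset.sum_mul, ← Finset.sum_neg_distrib]
    rw [Finset.sum_comm]
    refine Finset.sum_congr rfl fun n _ => Finset.sum_congr rfl fun k _ =>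
      Finset.sum_congr rfl fun l _ => ?_
    rw [← mul_assoc, ← (t.g_scalar k n l).comm, mul_assoc, ← mul_assoc (X.θ k S),
      X.odd_comm (h1 k), X.par_x, t.g_symm]
    noncomm_ring
  simp only [N'.LQ_apply, N.LQ_apply, Finset.sum_add_distrib, Finset.sum_sub_distrib,
    Finset.sum_neg_distrib, a1, a2, a3, a4, a5]
  have a7 := congrArg Φ a6
  simp only [map_sum, map_mul, map_add, map_sub, map_neg, mul_add, add_mul,
    Finset.sum_add_distrib] at a7 ⊢
  rw [a7]; abel

end Transition
end SuperCoord

/-! ### Derivatives of smooth functions in a chart -/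

section ScalarCalculus

variable {d : ℕ}
  {M : Type*} [TopologicalSpace M] [ChartedSpace (EuclideanSpace ℝ (Fin d)) M]

variable (d) in
/-- Smooth real functions on a set. -/
abbrev SmoothOn (U : Set M) (a : M → ℝ) : Prop := ContMDiffOn (𝓡 d) 𝓘(ℝ, ℝ) ∞ a U

variable (d) in
/-- The domain of the preferred chart at `q`. -/
abbrev chartDom (q : M) : Set M := (chartAt (EuclideanSpace ℝ (Fin d)) q).source

/-- The derivative along `x^i` in the preferred chart at `q`. -/
def sd [IsManifold (𝓡 d) ∞ M] (q : M) (i : Fin d) (a : M → ℝ) (x : M) : ℝ :=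
  mvfderiv (𝓡 d) a x (coordVec q i x)

/-- The coordinate `x^k` of the preferred chart at `q`. -/
def chartCoord (q : M) (k : Fin d) (x : M) : ℝ := extChartAt (𝓡 d) q x k

variable [IsManifold (𝓡 d) ∞ M] {U : Set M} {a b : M → ℝ} {q p x : M}

theorem isManifold_one : IsManifold (𝓡 d) 1 M := IsManifold.of_le (n := ∞) (by norm_cast)

theorem mem_tangent_baseSet (hx : x ∈ chartDom d q) : x ∈
    (trivializationAt (EuclideanSpace ℝ (Fin d)) (TangentSpace (𝓡 d) : M → Type _) q).baseSet := by
  rw [TangentBundle.trivializationAt_baseSet]; exact hx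

theorem mfderiv_extChartAt_coordVec (hx : x ∈ chartDom d q) (i : Fin d) :
    mfderiv (𝓡 d) 𝓘(ℝ, EuclideanSpace ℝ (Fin d)) (extChartAt (𝓡 d) q) x (coordVec q i x) =
      EuclideanSpace.single i (1 : ℝ) := by
  have : IsManifold (𝓡 d) 1 M := isManifold_one
  rw [← TangentBundle.continuousLinearMapAt_trivializationAt hx]
  exact (trivializationAt (EuclideanSpace ℝ (Fin d))
    (TangentSpace (𝓡 d) : M → Type _) q).continuousLinearMapAt_symmL (mem_tangent_baseSet hx) _

theorem mvfderiv_congr {f g : M → ℝ} (h : f =ᶠ[nhds x] g) :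
    mvfderiv (𝓡 d) f x = mvfderiv (𝓡 d) g x := by
  unfold mvfderiv
  rw [h.mfderiv_eq, h.eq_of_nhds]

theorem mvfderiv_eq_fderiv (g : EuclideanSpace ℝ (Fin d) → ℝ) (y v : EuclideanSpace ℝ (Fin d)) :
    mvfderiv 𝓘(ℝ, EuclideanSpace ℝ (Fin d)) g y v = fderiv ℝ g y v := by
  unfold mvfderiv
  rw [mfderiv_eq_fderiv]
  rfl

theorem eventuallyEq_chart (hx : x ∈ chartDom d q) (a : M → ℝ) :
    a =ᶠ[nhds x] (a ∘ (extChartAt (𝓡 d) q).symm) ∘ extChartAt (𝓡 d) q := by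
  have hx' : x ∈ (extChartAt (𝓡 d) q).source := by rwa [extChartAt_source]
  filter_upwards [(isOpen_extChartAt_source (I := 𝓡 d) q).mem_nhds hx'] with y hy
  rw [Function.comp_apply, Function.comp_apply, (extChartAt (𝓡 d) q).left_inv hy]

theorem sd_eq_fderiv (hx : x ∈ chartDom d q) (i : Fin d)
    (ha : MDifferentiableAt (𝓡 d) 𝓘(ℝ, ℝ) a x) :
    sd q i a x = fderiv ℝ (a ∘ (extChartAt (𝓡 d) q).symm) (extChartAt (𝓡 d) q x)
      (EuclideanSpace.single i 1) := by
  have : IsManifold (𝓡 d) 1 M := isManifold_one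
  have hx' : x ∈ (extChartAt (𝓡 d) q).source := by rwa [extChartAt_source]
  have h2 : MDifferentiableAt 𝓘(ℝ, EuclideanSpace ℝ (Fin d)) 𝓘(ℝ, ℝ)
      (a ∘ (extChartAt (𝓡 d) q).symm) (extChartAt (𝓡 d) q x) := by
    have h3 : MDifferentiableAt 𝓘(ℝ, EuclideanSpace ℝ (Fin d)) (𝓡 d) (extChartAt (𝓡 d) q).symm
        (extChartAt (𝓡 d) q x) := by
      have := (contMDiffOn_extChartAt_symm (I := 𝓡 d) (n := 1) q).mdifferentiableOn one_ne_zero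
      refine (this _ ((extChartAt (𝓡 d) q).map_source hx')).mdifferentiableAt ?_
      exact (isOpen_extChartAt_target (I := 𝓡 d) q).mem_nhds
        ((extChartAt (𝓡 d) q).map_source hx')
    refine MDifferentiableAt.comp _ ?_ h3
    rw [(extChartAt (𝓡 d) q).left_inv hx']; exact ha
  rw [sd, mvfderiv_congr (eventuallyEq_chart hx a),
    mvfderiv_comp_apply x h2 (mdifferentiableAt_extChartAt hx), mfderiv_extChartAt_coordVec hx]
  exact mvfderiv_eq_fderiv _ _ _

theorem SmoothOn.mdifferentiableAt (hU : IsOpen U) (hx : x ∈ U) (ha : SmoothOn d U a) :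
    MDifferentiableAt (𝓡 d) 𝓘(ℝ, ℝ) a x :=
  (ha.contMDiffAt (hU.mem_nhds hx)).mdifferentiableAt (by simp)

theorem sd_mul (hU : IsOpen U) (hx : x ∈ U) (ha : SmoothOn d U a) (hb : SmoothOn d U b) (i : Fin d) :
    sd q i (a * b) x = sd q i a x * b x + a x * sd q i b x := by
  rw [sd, mvfderiv_mul (ha.mdifferentiableAt hU hx) (hb.mdifferentiableAt hU hx)]
  simp [sd, mul_comm, add_comm]

theorem sd_congr (h : a =ᶠ[nhds x] b) (i : Fin d) : sd q i a x = sd q i b x := by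
  rw [sd, mvfderiv_congr h, sd]

theorem SmoothOn.comp_symm (ha : SmoothOn d U a) (q : M) :
    ContDiffOn ℝ ∞ (a ∘ (extChartAt (𝓡 d) q).symm)
      ((extChartAt (𝓡 d) q).target ∩ (extChartAt (𝓡 d) q).symm ⁻¹' U) := by
  rw [← contMDiffOn_iff_contDiffOn]
  exact ContMDiffOn.comp ha ((contMDiffOn_extChartAt_symm q).mono Set.inter_subset_left)
    Set.inter_subset_right

theorem isOpen_chart_image (hU : IsOpen U) (q : M) :
    IsOpen ((extChartAt (𝓡 d) q).target ∩ (extChartAt (𝓡 d) q).symm ⁻¹' U) :=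
  (continuousOn_extChartAt_symm q).isOpen_inter_preimage (isOpen_extChartAt_target q) hU

theorem mem_chart_image (hUq : U ⊆ chartDom d q) (hx : x ∈ U) : extChartAt (𝓡 d) q x ∈
    (extChartAt (𝓡 d) q).target ∩ (extChartAt (𝓡 d) q).symm ⁻¹' U := by
  have hx' : x ∈ (extChartAt (𝓡 d) q).source := by rw [extChartAt_source]; exact hUq hx
  refine ⟨(extChartAt (𝓡 d) q).map_source hx', ?_⟩
  rw [Set.mem_preimage, (extChartAt (𝓡 d) q).left_inv hx']; exact hx

theorem SmoothOn.of_comp_symm (hUq : U ⊆ chartDom d q)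
    {g : EuclideanSpace ℝ (Fin d) → ℝ}
    (hg : ContDiffOn ℝ ∞ g ((extChartAt (𝓡 d) q).target ∩ (extChartAt (𝓡 d) q).symm ⁻¹' U))
    (h : ∀ x ∈ U, a x = g (extChartAt (𝓡 d) q x)) : SmoothOn d U a := by
  have h1 : ContMDiffOn (𝓡 d) 𝓘(ℝ, ℝ) ∞ (g ∘ extChartAt (𝓡 d) q) U :=
    ContMDiffOn.comp (contMDiffOn_iff_contDiffOn.2 hg)
      ((contMDiffOn_extChartAt (I := 𝓡 d) (x := q)).mono hUq) fun x hx => mem_chart_image hUq hx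
  exact h1.congr h

theorem SmoothOn.sd (hU : IsOpen U) (hUq : U ⊆ chartDom d q) (ha : SmoothOn d U a) (i : Fin d) :
    SmoothOn d U (sd q i a) := by
  refine SmoothOn.of_comp_symm hUq (g := fun y => fderiv ℝ (a ∘ (extChartAt (𝓡 d) q).symm) y
    (EuclideanSpace.single i 1)) ?_ fun x hx => sd_eq_fderiv (hUq hx) i (ha.mdifferentiableAt hU hx)
  exact ((ha.comp_symm q).fderiv_of_isOpen (isOpen_chart_image hU q) (m := ∞)
    (by simp)).clm_apply contDiffOn_const

/-- In the chart this is the symmetry of the second derivative. Smoothness near the point is used,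
since the inner derivative has to be identified on a neighbourhood. -/
theorem sd_comm (hU : IsOpen U) (hUq : U ⊆ chartDom d q) (hx : x ∈ U) (ha : SmoothOn d U a)
    (i j : Fin d) : sd q i (sd q j a) x = sd q j (sd q i a) x := by
  set V := (extChartAt (𝓡 d) q).target ∩ (extChartAt (𝓡 d) q).symm ⁻¹' U with hV
  set g := a ∘ (extChartAt (𝓡 d) q).symm with hg
  have hVo : IsOpen V := isOpen_chart_image hU q
  have hxV : extChartAt (𝓡 d) q x ∈ V := mem_chart_image hUq hx
  have hgV : ContDiffAt ℝ ∞ g (extChartAt (𝓡 d) q x) :=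
    (ha.comp_symm q).contDiffAt (hVo.mem_nhds hxV)
  have hd : DifferentiableAt ℝ (fderiv ℝ g) (extChartAt (𝓡 d) q x) :=
    ((hgV.fderiv_right (m := 1) (by norm_cast)).differentiableAt one_ne_zero)
  have key : ∀ i j, sd q i (sd q j a) x = fderiv ℝ (fderiv ℝ g) (extChartAt (𝓡 d) q x)
      (EuclideanSpace.single i 1) (EuclideanSpace.single j 1) := by
    intro i j
    rw [sd_eq_fderiv (hUq hx) i ((ha.sd hU hUq j).mdifferentiableAt hU hx)]
    have : (sd q j a ∘ (extChartAt (𝓡 d) q).symm) =ᶠ[nhds (extChartAt (𝓡 d) q x)]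
        fun y => fderiv ℝ g y (EuclideanSpace.single j 1) := by
      filter_upwards [hVo.mem_nhds hxV] with y hy
      rw [Function.comp_apply, sd_eq_fderiv (hUq hy.2) j (ha.mdifferentiableAt hU hy.2),
        (extChartAt (𝓡 d) q).right_inv hy.1]
    rw [this.fderiv_eq, fderiv_clm_apply hd (differentiableAt_const _)]
    simp
  have hs : IsSymmSndFDerivAt ℝ g (extChartAt (𝓡 d) q x) := by
    apply hgV.isSymmSndFDerivAt
    simp only [minSmoothness_of_isRCLikeNormedField]
    exact ENat.LEInfty.out
  rw [key, key, hs]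

theorem smoothOn_chartCoord (hUq : U ⊆ chartDom d q) (k : Fin d) : SmoothOn d U (chartCoord q k) := by
  have h := (contMDiffOn_extChartAt (I := 𝓡 d) (n := ∞) (x := q)).mono hUq
  have h2 : ContMDiff 𝓘(ℝ, EuclideanSpace ℝ (Fin d)) 𝓘(ℝ, ℝ) ∞
      (EuclideanSpace.proj k : EuclideanSpace ℝ (Fin d) →L[ℝ] ℝ) :=
    (EuclideanSpace.proj k : EuclideanSpace ℝ (Fin d) →L[ℝ] ℝ).contMDiff
  exact h2.comp_contMDiffOn h

theorem mvfderiv_chartCoord (hx : x ∈ chartDom d q) (k : Fin d) (v : TangentSpace (𝓡 d) x) :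
    mvfderiv (𝓡 d) (chartCoord q k) x v =
      (trivializationAt (EuclideanSpace ℝ (Fin d)) (TangentSpace (𝓡 d) : M → Type _)
        q).linearMapAt ℝ x v k := by
  have : IsManifold (𝓡 d) 1 M := isManifold_one
  have h2 : MDifferentiableAt 𝓘(ℝ, EuclideanSpace ℝ (Fin d)) 𝓘(ℝ, ℝ)
      (EuclideanSpace.proj k : EuclideanSpace ℝ (Fin d) →L[ℝ] ℝ) (extChartAt (𝓡 d) q x) :=
    (EuclideanSpace.proj k : EuclideanSpace ℝ (Fin d) →L[ℝ] ℝ).mdifferentiableAt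
  have h3 : chartCoord q k = (EuclideanSpace.proj k : EuclideanSpace ℝ (Fin d) →L[ℝ] ℝ) ∘
    extChartAt (𝓡 d) q := rfl
  rw [h3, mvfderiv_comp_apply x h2 (mdifferentiableAt_extChartAt hx),
    ← TangentBundle.continuousLinearMapAt_trivializationAt hx]
  refine (mvfderiv_eq_fderiv _ _ _).trans ?_
  rw [ContinuousLinearMap.fderiv]
  rfl

theorem eq_sum_coordVec (hx : x ∈ chartDom d q) (v : TangentSpace (𝓡 d) x) :
    v = ∑ k, mvfderiv (𝓡 d) (chartCoord q k) x v • coordVec q k x := by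
  simp only [mvfderiv_chartCoord hx, coordVec, ← map_smul, ← map_sum]
  set w := (trivializationAt (EuclideanSpace ℝ (Fin d)) (TangentSpace (𝓡 d) : M → Type _)
        q).linearMapAt ℝ x v with hw
  have : ∑ k, w k • EuclideanSpace.single k (1 : ℝ) = w := by
    ext i; simp [Pi.single_apply]
  rw [this, hw]
  exact ((trivializationAt (EuclideanSpace ℝ (Fin d)) (TangentSpace (𝓡 d) : M → Type _)
    q).symmₗ_linearMapAt (mem_tangent_baseSet hx) v).symm

theorem coordVec_eq_sum (hq : x ∈ chartDom d q) (i : Fin d) :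
    coordVec p i x = ∑ k : Fin d, sd p i (chartCoord q k) x • coordVec q k x :=
  eq_sum_coordVec hq _

theorem sd_eq_sum (hq : x ∈ chartDom d q) (i : Fin d) (a : M → ℝ) :
    sd p i a x = ∑ k : Fin d, sd p i (chartCoord q k) x * sd q k a x := by
  simp only [sd]
  conv_lhs => rw [coordVec_eq_sum (d := d) (p := p) hq i]
  simp [sd]

theorem sd_chartCoord (hx : x ∈ chartDom d q) (i k : Fin d) :
    sd q i (chartCoord q k) x = if i = k then 1 else 0 := by
  rw [sd, mvfderiv_chartCoord hx, coordVec,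
    (trivializationAt (EuclideanSpace ℝ (Fin d)) (TangentSpace (𝓡 d) : M → Type _)
      q).linearMapAt_symmₗ (mem_tangent_baseSet hx)]
  simp [eq_comm]

end ScalarCalculus

/-! ### Smooth families in a vector space of infinite dimension -/

section Families

variable {d : ℕ}
  {M : Type*} [TopologicalSpace M] [ChartedSpace (EuclideanSpace ℝ (Fin d)) M] [IsManifold (𝓡 d) ∞ M]
  {W W' : Type*} [AddCommGroup W] [Module ℝ W] [AddCommGroup W'] [Module ℝ W']
  {f g : M → W} {x : M} {v : TangentSpace (𝓡 d) x} {w w' : W}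

/-- Linear forms separate the points of any real vector space, so weak derivatives determine their
values without any topology on `W`. -/
theorem HasVecDeriv.unique (h : HasVecDeriv f x v w) (h' : HasVecDeriv f x v w') : w = w' := by
  rw [← sub_eq_zero, ← Module.forall_dual_apply_eq_zero_iff ℝ]
  intro φ
  rw [map_sub, ← (h φ).2, ← (h' φ).2, sub_self]

theorem HasVecDeriv.vecDeriv_eq (h : HasVecDeriv f x v w) : vecDeriv f x v = w := by
  have h' : ∃ w, HasVecDeriv f x v w := ⟨w, h⟩
  rw [vecDeriv, dif_pos h']
  exact h'.choose_spec.unique h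

theorem HasVecDeriv.add (hf : HasVecDeriv f x v w) (hg : HasVecDeriv g x v w') :
    HasVecDeriv (f + g) x v (w + w') := fun φ => by
  have h : (fun q => φ ((f + g) q)) = (fun q => φ (f q)) + fun q => φ (g q) := by
    funext q; simp
  rw [h, mvfderiv_add (hf φ).1 (hg φ).1]
  exact ⟨(hf φ).1.add (hg φ).1, by simp [(hf φ).2, (hg φ).2]⟩

theorem HasVecDeriv.map (hf : HasVecDeriv f x v w) (L : W →ₗ[ℝ] W') :
    HasVecDeriv (fun y => L (f y)) x v (L w) := fun φ => hf (φ ∘ₗ L)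

theorem HasVecDeriv.const_smul (hf : HasVecDeriv f x v w) (r : ℝ) :
    HasVecDeriv (r • f) x v (r • w) := hf.map (r • LinearMap.id)

theorem HasVecDeriv.congr (hf : HasVecDeriv f x v w) (h : g =ᶠ[nhds x] f) :
    HasVecDeriv g x v w := fun φ => by
  have h' : (fun q => φ (g q)) =ᶠ[nhds x] fun q => φ (f q) := h.fun_comp φ
  exact ⟨(hf φ).1.congr_of_eventuallyEq h', by rw [mvfderiv_congr h', (hf φ).2]⟩

theorem hasVecDeriv_smul_const {a : M → ℝ} (ha : MDifferentiableAt (𝓡 d) 𝓘(ℝ, ℝ) a x) (e : W) :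
    HasVecDeriv (fun y => a y • e) x v (mvfderiv (𝓡 d) a x v • e) := fun φ => by
  have h : (fun q => φ (a q • e)) = a * fun _ => φ e := by
    funext q; simp
  have hc : MDifferentiableAt (𝓡 d) 𝓘(ℝ, ℝ) (fun _ : M => φ e) x := mdifferentiableAt_const
  rw [h, mvfderiv_mul ha hc, mvfderiv_const]
  exact ⟨ha.mul hc, by simp [mul_comm]⟩

variable (d W) in
/-- The families on `M` with values in `W` that are finite sums of constant vectors with
coefficients that are smooth on `U`. -/
def Fam (U : Set M) : Submodule ℝ (M → W) :=
  Submodule.span ℝ {f | ∃ (a : M → ℝ) (e : W), SmoothOn d U a ∧ f = fun x => a x • e}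

variable {U : Set M}

theorem smul_mem_Fam {a : M → ℝ} (ha : SmoothOn d U a) (e : W) :
    (fun x => a x • e) ∈ Fam d W U := Submodule.subset_span ⟨a, e, ha, rfl⟩

theorem const_mem_Fam (e : W) : (fun _ => e) ∈ Fam d W U := by
  simpa using smul_mem_Fam (contMDiffOn_const (c := (1 : ℝ))) e

theorem Fam.mono {V : Set M} (h : V ⊆ U) (hf : f ∈ Fam d W U) : f ∈ Fam d W V := by
  induction hf using Submodule.span_induction with
  | mem f hf => obtain ⟨a, e, ha, rfl⟩ := hf; exact smul_mem_Fam (ha.mono h) e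
  | zero => exact zero_mem _
  | add f g _ _ hf hg => exact add_mem hf hg
  | smul r f _ hf => exact Submodule.smul_mem _ _ hf

theorem Fam.map (L : W →ₗ[ℝ] W') (hf : f ∈ Fam d W U) : (fun x => L (f x)) ∈ Fam d W' U := by
  induction hf using Submodule.span_induction with
  | mem f hf => obtain ⟨a, e, ha, rfl⟩ := hf; simpa using smul_mem_Fam ha (L e)
  | zero => simpa using const_mem_Fam (0 : W')
  | add f g _ _ hf hg => simpa using! add_mem hf hg
  | smul r f _ hf => simpa using! Submodule.smul_mem _ r hf

theorem Fam.smul {a : M → ℝ} (ha : SmoothOn d U a) (hf : f ∈ Fam d W U) :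
    (fun x => a x • f x) ∈ Fam d W U := by
  induction hf using Submodule.span_induction with
  | mem f hf =>
    obtain ⟨b, e, hb, rfl⟩ := hf
    simpa [smul_smul] using smul_mem_Fam (ha.mul hb) e
  | zero => simpa using const_mem_Fam (0 : W)
  | add f g _ _ hf hg => simpa using! add_mem hf hg
  | smul r f _ hf =>
    have h : (fun x => a x • (r • f) x) = r • fun x => a x • f x := by
      funext x; simp [smul_comm r]
    rw [h]; exact Submodule.smul_mem _ r hf

theorem Fam.smooth (hf : f ∈ Fam d W U) (φ : Dual ℝ W) : SmoothOn d U fun x => φ (f x) := by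
  induction hf using Submodule.span_induction with
  | mem f hf =>
    obtain ⟨a, e, ha, rfl⟩ := hf
    simpa using! ha.mul (contMDiffOn_const (c := φ e))
  | zero => simpa using contMDiffOn_const
  | add f g _ _ hf hg => simpa using! hf.add hg
  | smul r f _ hf => simpa using! (contMDiffOn_const (c := r)).mul hf

/-- The coordinates with respect to a basis of Y extend to linear forms on the whole space, and
these supply smooth coefficients. Weak smoothness is thus strong enough in a fixed momentum and
ghost degree. -/
theorem mem_Fam_of_finiteDimensional {Y : Submodule ℝ W} [FiniteDimensional ℝ Y]
    (hY : ∀ x, f x ∈ Y) (hf : ∀ φ : Dual ℝ W, SmoothOn d U fun x => φ (f x)) :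
    f ∈ Fam d W U := by
  let b := Module.finBasis ℝ Y
  choose ψ hψ using fun k => (b.coord k).exists_extend
  have : f = ∑ k, fun x => ψ k (f x) • (b k : W) := by
    funext x
    have h := congrArg Subtype.val (b.sum_repr ⟨f x, hY x⟩)
    simp only [Submodule.coe_sum, Submodule.coe_smul] at h
    rw [Finset.sum_apply]
    nth_rewrite 1 [← h]
    refine Finset.sum_congr rfl fun k _ => ?_
    have := DFunLike.congr_fun (hψ k) ⟨f x, hY x⟩
    simp at this
    rw [this]
  rw [this]
  exact sum_mem fun k _ => smul_mem_Fam (hf _) _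

theorem Fam.hasVecDeriv (hU : IsOpen U) (hf : f ∈ Fam d W U) (hx : x ∈ U)
    (v : TangentSpace (𝓡 d) x) : HasVecDeriv f x v (vecDeriv f x v) := by
  have h : ∃ w, HasVecDeriv f x v w := by
    induction hf using Submodule.span_induction with
    | mem f hf =>
      obtain ⟨a, e, ha, rfl⟩ := hf
      exact ⟨_, hasVecDeriv_smul_const
        ((ha.contMDiffAt (hU.mem_nhds hx)).mdifferentiableAt (by simp)) e⟩
    | zero => exact ⟨0, by simpa using! hasVecDeriv_smul_const (mdifferentiableAt_const (c := (0 : ℝ))) (0 : W)⟩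
    | add f g _ _ hf hg =>
      obtain ⟨w, hw⟩ := hf
      obtain ⟨w', hw'⟩ := hg
      exact ⟨_, hw.add hw'⟩
    | smul r f _ hf =>
      obtain ⟨w, hw⟩ := hf
      exact ⟨_, hw.const_smul r⟩
  obtain ⟨w, hw⟩ := h
  rwa [hw.vecDeriv_eq]

variable {q : M}

/-- The derivative of a family along `x^i` in the preferred chart at `q`. -/
def pdFam (U : Set M) (q : M) (i : Fin d) (f : M → W) : M → W :=
  U.indicator fun x => vecDeriv f x (coordVec q i x)

theorem pdFam_add (hU : IsOpen U) (i : Fin d) (hf : f ∈ Fam d W U) (hg : g ∈ Fam d W U) :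
    pdFam U q i (f + g) = pdFam U q i f + pdFam U q i g := by
  rw [pdFam, pdFam, pdFam, ← Set.indicator_add']
  refine Set.indicator_congr fun x hx => ?_
  exact ((Fam.hasVecDeriv hU hf hx _).add (Fam.hasVecDeriv hU hg hx _)).vecDeriv_eq

theorem pdFam_map (hU : IsOpen U) (i : Fin d) (L : W →ₗ[ℝ] W') (hf : f ∈ Fam d W U) :
    (pdFam U q i fun x => L (f x)) = fun x => L (pdFam U q i f x) := by
  funext x
  by_cases hx : x ∈ U
  · rw [pdFam, pdFam, Set.indicator_of_mem hx, Set.indicator_of_mem hx]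
    exact ((Fam.hasVecDeriv hU hf hx _).map L).vecDeriv_eq
  · rw [pdFam, pdFam, Set.indicator_of_notMem hx, Set.indicator_of_notMem hx, map_zero]

theorem pdFam_const_smul (hU : IsOpen U) (i : Fin d) (r : ℝ) (hf : f ∈ Fam d W U) :
    pdFam U q i (r • f) = r • pdFam U q i f := pdFam_map hU i (r • LinearMap.id) hf

theorem pdFam_smul_const (hU : IsOpen U) (i : Fin d) {a : M → ℝ} (ha : SmoothOn d U a) (e : W) :
    (pdFam U q i fun x => a x • e) = fun x => U.indicator (sd q i a) x • e := by
  funext x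
  by_cases hx : x ∈ U
  · rw [pdFam, Set.indicator_of_mem hx, Set.indicator_of_mem hx]
    exact (hasVecDeriv_smul_const (ha.mdifferentiableAt hU hx) e).vecDeriv_eq
  · rw [pdFam, Set.indicator_of_notMem hx, Set.indicator_of_notMem hx, zero_smul]

theorem pdFam_const (hU : IsOpen U) (i : Fin d) (e : W) : (pdFam U q i fun _ : M => e) = 0 := by
  have h := pdFam_smul_const (q := q) hU i (contMDiffOn_const (c := (1 : ℝ))) e
  simp only [one_smul] at h
  rw [h]
  funext x
  have : sd q i (fun _ : M => (1 : ℝ)) x = 0 := by rw [sd, mvfderiv_const]; rfl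
  by_cases hx : x ∈ U
  · rw [Set.indicator_of_mem hx, this, zero_smul, Pi.zero_apply]
  · rw [Set.indicator_of_notMem hx, zero_smul, Pi.zero_apply]

theorem smoothOn_indicator {a : M → ℝ} (ha : SmoothOn d U a) : SmoothOn d U (U.indicator a) :=
  ha.congr fun _ hx => Set.indicator_of_mem hx a

theorem pdFam_mem (hU : IsOpen U) (hUq : U ⊆ chartDom d q) (i : Fin d) (hf : f ∈ Fam d W U) :
    pdFam U q i f ∈ Fam d W U := by
  induction hf using Submodule.span_induction with
  | mem f hf =>
    obtain ⟨a, e, ha, rfl⟩ := hf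
    rw [pdFam_smul_const hU i ha]
    exact smul_mem_Fam (smoothOn_indicator (ha.sd hU hUq i)) e
  | zero =>
    have : pdFam U q i (0 : M → W) = 0 := pdFam_const hU i 0
    rw [this]; exact zero_mem _
  | add f g hf' hg' hf hg => rw [pdFam_add hU i hf' hg']; exact add_mem hf hg
  | smul r f hf' hf => rw [pdFam_const_smul hU i r hf']; exact Submodule.smul_mem _ r hf

theorem sd_indicator (hU : IsOpen U) {x : M} (hx : x ∈ U) (i : Fin d) (a : M → ℝ) :
    sd q i (U.indicator a) x = sd q i a x :=
  sd_congr (by filter_upwards [hU.mem_nhds hx] with y hy using Set.indicator_of_mem hy a) i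

/-- Off U the families are arbitrary. Since the derivative is cut off to zero there, the identity
holds as an equality of functions on all of M, as the operator calculus requires. -/
theorem pdFam_comm (hU : IsOpen U) (hUq : U ⊆ chartDom d q) (i j : Fin d) (hf : f ∈ Fam d W U) :
    pdFam U q i (pdFam U q j f) = pdFam U q j (pdFam U q i f) := by
  induction hf using Submodule.span_induction with
  | mem f hf =>
    obtain ⟨a, e, ha, rfl⟩ := hf
    rw [pdFam_smul_const hU j ha, pdFam_smul_const hU i ha,
      pdFam_smul_const hU i (smoothOn_indicator (ha.sd hU hUq j)),
      pdFam_smul_const hU j (smoothOn_indicator (ha.sd hU hUq i))]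
    funext x
    by_cases hx : x ∈ U
    · rw [Set.indicator_of_mem hx, Set.indicator_of_mem hx, sd_indicator hU hx,
        sd_indicator hU hx, sd_comm hU hUq hx ha]
    · rw [Set.indicator_of_notMem hx, Set.indicator_of_notMem hx]
  | zero =>
    have : ∀ i, pdFam (d := d) U q i (0 : M → W) = 0 := fun i => pdFam_const hU i 0
    simp [this]
  | add f g hf' hg' hf hg =>
    rw [pdFam_add hU j hf' hg', pdFam_add hU i hf' hg',
      pdFam_add hU i (pdFam_mem hU hUq j hf') (pdFam_mem hU hUq j hg'),
      pdFam_add hU j (pdFam_mem hU hUq i hf') (pdFam_mem hU hUq i hg'), hf, hg]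
  | smul r f hf' hf =>
    rw [pdFam_const_smul hU j r hf', pdFam_const_smul hU i r hf',
      pdFam_const_smul hU i r (pdFam_mem hU hUq j hf'),
      pdFam_const_smul hU j r (pdFam_mem hU hUq i hf'), hf]

end Families

/-! ### The algebra of smooth families and its derivations -/

section FamilyAlgebra

variable {d : ℕ}
  {M : Type*} [TopologicalSpace M] [ChartedSpace (EuclideanSpace ℝ (Fin d)) M] [IsManifold (𝓡 d) ∞ M]
  {W : Type*} [Ring W] [Algebra ℝ W] {f g : M → W} {U : Set M}

theorem Fam.mul (hf : f ∈ Fam d W U) (hg : g ∈ Fam d W U) : f * g ∈ Fam d W U := by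
  induction hf using Submodule.span_induction with
  | mem f hf =>
    obtain ⟨a, e, ha, rfl⟩ := hf
    have := Fam.smul ha (Fam.map (LinearMap.mulLeft ℝ e) hg)
    have h : (fun x => a x • e) * g = fun x => a x • (e * g x) := by
      funext x; simp
    rw [h]; exact this
  | zero => rw [zero_mul]; exact zero_mem _
  | add f f' _ _ hf hf' => rw [add_mul]; exact add_mem hf hf'
  | smul r f _ hf => rw [smul_mul_assoc]; exact Submodule.smul_mem _ r hf

variable (d W U) in
/-- The algebra of smooth families. -/
def FamAlg : Subalgebra ℝ (M → W) :=
  { Fam d W U with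
    mul_mem' := Fam.mul
    algebraMap_mem' := fun r => const_mem_Fam (algebraMap ℝ W r) }

variable {q : M}

theorem pdFam_mul (hU : IsOpen U) (i : Fin d) (hf : f ∈ Fam d W U) (hg : g ∈ Fam d W U) :
    pdFam U q i (f * g) = pdFam U q i f * g + f * pdFam U q i g := by
  have key : ∀ (a : M → ℝ) (e : W), SmoothOn d U a → pdFam U q i ((fun x => a x • e) * g) =
      (pdFam U q i fun x => a x • e) * g + (fun x => a x • e) * pdFam U q i g := by
    intro a e ha
    induction hg using Submodule.span_induction with
    | mem g hg =>
      obtain ⟨b, e', hb, rfl⟩ := hg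
      have h : ((fun x => a x • e) * fun x => b x • e') = fun x => (a * b) x • (e * e') := by
        funext x; simp [smul_smul, mul_comm]
      rw [h, pdFam_smul_const hU i (ha.mul hb), pdFam_smul_const hU i ha,
        pdFam_smul_const hU i hb]
      funext x
      by_cases hx : x ∈ U
      · simp only [Pi.add_apply, Pi.mul_apply, Set.indicator_of_mem hx]
        rw [sd_mul hU hx ha hb]
        simp only [smul_mul_smul_comm, ← add_smul]
      · simp only [Pi.add_apply, Pi.mul_apply, Set.indicator_of_notMem hx]
        simp
    | zero =>
      have : pdFam U q i (0 : M → W) = 0 := pdFam_const hU i 0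
      simp [this]
    | add g g' hg hg' h h' =>
      have ha' := smul_mem_Fam ha e
      rw [mul_add, pdFam_add hU i (Fam.mul ha' hg) (Fam.mul ha' hg'), pdFam_add hU i hg hg', h, h']
      noncomm_ring
    | smul r g hg h =>
      rw [mul_smul_comm, pdFam_const_smul hU i r (Fam.mul (smul_mem_Fam ha e) hg),
        pdFam_const_smul hU i r hg, h]
      simp
  induction hf using Submodule.span_induction with
  | mem f hf =>
    obtain ⟨a, e, ha, rfl⟩ := hf
    exact key a e ha
  | zero =>
    have : pdFam U q i (0 : M → W) = 0 := pdFam_const hU i 0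
    simp [this]
  | add f f' hf hf' h h' =>
    rw [add_mul, pdFam_add hU i (Fam.mul hf hg) (Fam.mul hf' hg), pdFam_add hU i hf hf', h, h']
    noncomm_ring
  | smul r f hf h =>
    rw [smul_mul_assoc, pdFam_const_smul hU i r (Fam.mul hf hg), pdFam_const_smul hU i r hf, h]
    simp

/-- A linear operator, applied to families. -/
def FamAlg.lift (L : W →ₗ[ℝ] W) : Module.End ℝ (FamAlg d W U) where
  toFun f := ⟨fun x => L (f.1 x), Fam.map L f.2⟩
  map_add' f g := by ext x; simp
  map_smul' r f := by ext x; simp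

/-- An endomorphism, applied to families. -/
def FamAlg.liftHom (L : W →ₐ[ℝ] W) : FamAlg d W U →ₐ[ℝ] FamAlg d W U :=
  AlgHom.ofLinearMap (FamAlg.lift L.toLinearMap) (by ext x; simp [FamAlg.lift])
    (fun f g => by ext x; simp [FamAlg.lift])

/-- Constant families. -/
def FamAlg.const (e : W) : FamAlg d W U := ⟨fun _ => e, const_mem_Fam e⟩

/-- Families of scalars. -/
def FamAlg.scalar {a : M → ℝ} (ha : SmoothOn d U a) : FamAlg d W U :=
  ⟨fun x => a x • 1, smul_mem_Fam ha 1⟩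

@[simp] theorem FamAlg.lift_apply (L : W →ₗ[ℝ] W) (f : FamAlg d W U) (x : M) :
    (FamAlg.lift L f).1 x = L (f.1 x) := rfl
@[simp] theorem FamAlg.liftHom_apply (L : W →ₐ[ℝ] W) (f : FamAlg d W U) (x : M) :
    (FamAlg.liftHom L f).1 x = L (f.1 x) := rfl
@[simp] theorem FamAlg.const_apply (e : W) (x : M) :
    (FamAlg.const e : FamAlg d W U).1 x = e := rfl
@[simp] theorem FamAlg.scalar_apply {a : M → ℝ} (ha : SmoothOn d U a) (x : M) :
    (FamAlg.scalar ha : FamAlg d W U).1 x = a x • 1 := rfl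

/-- The derivative along `x^i`. -/
def FamAlg.pd (hU : IsOpen U) (hUq : U ⊆ chartDom d q) (i : Fin d) :
    Module.End ℝ (FamAlg d W U) where
  toFun f := ⟨pdFam U q i f.1, pdFam_mem hU hUq i f.2⟩
  map_add' f g := Subtype.ext (pdFam_add hU i f.2 g.2)
  map_smul' r f := Subtype.ext (pdFam_const_smul hU i r f.2)

end FamilyAlgebra

/-! ### The bracket in local coordinates -/

section LocalBracket

variable {d m n : ℕ}

/-- Polynomial functions of the local fibre coordinates. -/
abbrev LocPol (d m n : ℕ) : Type := Pol (Fin m → ℝ) (Fin n → ℝ) (EuclideanSpace ℝ (Fin d))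

/-- The coordinates `x*_i`. -/
def xsP (i : Fin d) : LocPol d m n := Pol.od (0, 0, EuclideanSpace.single i 1)
/-- The coordinates `z^A`. -/
def zP (B : Fin m ⊕ Fin n) : LocPol d m n := toPol (zFun B)
/-- The coordinates `z*_A`. -/
def zsP (B : Fin m ⊕ Fin n) : LocPol d m n := toPol (zsFun B)

theorem zP_inl (a : Fin m) : (zP (.inl a) : LocPol d m n) = Pol.od (LinearMap.proj a, 0, 0) := rfl
theorem zP_inr (a : Fin n) : (zP (.inr a) : LocPol d m n) = Pol.od (0, LinearMap.proj a, 0) := rfl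
theorem zsP_inl (a : Fin m) : (zsP (.inl a) : LocPol d m n) = Pol.ev (Pi.single a 1, 0) := rfl
theorem zsP_inr (a : Fin n) : (zsP (.inr a) : LocPol d m n) = Pol.ev (0, Pi.single a 1) := rfl

theorem parity_zP (B : Fin m ⊕ Fin n) : Pol.parity (zP B : LocPol d m n) = -zP B := by
  cases B <;> simp [zP_inl, zP_inr]
theorem parity_zsP (B : Fin m ⊕ Fin n) : Pol.parity (zsP B : LocPol d m n) = zsP B := by
  cases B <;> simp [zsP_inl, zsP_inr]

theorem odD_xsForm_xsP (i j : Fin d) :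
    Pol.odD (xsForm i) (xsP j : LocPol d m n) = if i = j then 1 else 0 := by
  simp [xsP, xsForm]
theorem odD_xsForm_zP (i : Fin d) (B : Fin m ⊕ Fin n) :
    Pol.odD (xsForm i) (zP B : LocPol d m n) = 0 := by
  cases B <;> simp [zP_inl, zP_inr, xsForm]
theorem odD_zsP (ℓ) (B : Fin m ⊕ Fin n) : Pol.odD ℓ (zsP B : LocPol d m n) = 0 := by
  cases B <;> simp [zsP_inl, zsP_inr]
theorem odD_zForm_xsP (B : Fin m ⊕ Fin n) (i : Fin d) :
    Pol.odD (zForm B) (xsP i : LocPol d m n) = 0 := by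
  cases B <;> simp [xsP, zForm]
theorem odD_zForm_zP (B C : Fin m ⊕ Fin n) :
    Pol.odD (zForm B) (zP C : LocPol d m n) = if B = C then 1 else 0 := by
  cases B <;> cases C <;> simp [zP_inl, zP_inr, zForm, Pi.single_apply, eq_comm]
theorem evD_xsP (ℓ) (i : Fin d) : Pol.evD ℓ (xsP i : LocPol d m n) = 0 := by
  simp [xsP]
theorem evD_zP (ℓ) (B : Fin m ⊕ Fin n) : Pol.evD ℓ (zP B : LocPol d m n) = 0 := by
  cases B <;> simp [zP_inl, zP_inr]
theorem evD_zsForm_zsP (B C : Fin m ⊕ Fin n) :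
    Pol.evD (zsForm B) (zsP C : LocPol d m n) = if B = C then 1 else 0 := by
  cases B <;> cases C <;> simp [zsP_inl, zsP_inr, zsForm, Pi.single_apply]

variable {M : Type*} [TopologicalSpace M] [ChartedSpace (EuclideanSpace ℝ (Fin d)) M]
  [IsManifold (𝓡 d) ∞ M] {U : Set M} {q : M}

variable (d m n U) in
/-- The superalgebra of smooth families of functions of the fibre coordinates. -/
def locCoord : SuperCoord (FamAlg d (LocPol d m n) U) (Fin d) (Fin m ⊕ Fin n) where
  par := FamAlg.liftHom Pol.parity
  θ i := FamAlg.lift (Pol.odD (xsForm i))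
  ζ B := FamAlg.lift (Pol.odD (zForm B))
  χ B := FamAlg.lift (Pol.evD (zsForm B))
  x i := FamAlg.const (xsP i)
  z B := FamAlg.const (zP B)
  y B := FamAlg.const (zsP B)
  even_comm {a} ha b := by
    ext x; exact Pol.mul_comm_of_even (congrFun (congrArg Subtype.val ha) x) (b.1 x)
  odd_comm {a} ha b := by
    ext x; exact Pol.mul_comm_of_odd (congrFun (congrArg Subtype.val ha) x) (b.1 x)
  θ_mul i a b := by ext x; exact Pol.odD_mul _ _ _
  ζ_mul i a b := by ext x; exact Pol.odD_mul _ _ _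
  χ_mul i a b := by ext x; exact Pol.evD_mul _ _ _
  par_par a := by ext x; exact Pol.parity_parity _
  par_θ i a := by ext x; exact Pol.parity_odD _ _
  par_ζ i a := by ext x; exact Pol.parity_odD _ _
  par_χ i a := by ext x; exact Pol.parity_evD _ _
  θ_θ i j := by ext a x; exact Pol.odD_odD _ _ _
  θ_ζ i j := by ext a x; exact Pol.odD_odD _ _ _
  ζ_ζ i j := by ext a x; exact Pol.odD_odD _ _ _
  χ_χ i j := by ext a x; exact Pol.evD_evD _ _ _
  χ_θ i j := by ext a x; exact Pol.evD_odD _ _ _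
  χ_ζ i j := by ext a x; exact Pol.evD_odD _ _ _
  par_x i := by ext x; exact Pol.parity_od _
  par_z i := by ext x; exact parity_zP _
  par_y i := by ext x; exact parity_zsP _
  θ_x i j := by
    ext x; refine (odD_xsForm_xsP i j).trans ?_; split_ifs <;> rfl
  θ_z i j := by ext x; exact odD_xsForm_zP _ _
  θ_y i j := by ext x; exact odD_zsP _ _
  ζ_x i j := by ext x; exact odD_zForm_xsP _ _
  ζ_z i j := by
    ext x; refine (odD_zForm_zP i j).trans ?_; split_ifs <;> rfl
  ζ_y i j := by ext x; exact odD_zsP _ _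
  χ_x i j := by ext x; exact evD_xsP _ _
  χ_z i j := by ext x; exact evD_zP _ _
  χ_y i j := by
    ext x; refine (evD_zsForm_zsP i j).trans ?_; split_ifs <;> rfl

theorem isScalar_scalar {a : M → ℝ} (ha : SmoothOn d U a) :
    (locCoord d m n U).IsScalar (FamAlg.scalar ha) where
  par := by ext x; exact (map_smul Pol.parity _ _).trans (by rw [map_one]; rfl)
  θ i := by ext x; exact (map_smul _ _ _).trans (by rw [Pol.odD_one, smul_zero]; rfl)
  ζ i := by ext x; exact (map_smul _ _ _).trans (by rw [Pol.odD_one, smul_zero]; rfl)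
  χ i := by ext x; exact (map_smul _ _ _).trans (by rw [Pol.evD_one, smul_zero]; rfl)

/-- The connection with coefficients `A` in the chart at `q`. -/
def locConn (hU : IsOpen U) (hUq : U ⊆ chartDom d q)
    {A : Fin d → Fin m ⊕ Fin n → Fin m ⊕ Fin n → M → ℝ} (hA : ∀ i B C, SmoothOn d U (A i B C)) :
    (locCoord d m n U).Conn where
  pd i := FamAlg.pd hU hUq i
  Γ i B C := FamAlg.scalar (smoothOn_indicator (hA i B C))
  pd_mul i a b := Subtype.ext (pdFam_mul hU i a.2 b.2)
  par_pd i a := Subtype.ext (pdFam_map hU i (Pol.parity).toLinearMap a.2).symm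
  pd_θ i j := by ext1 a; exact Subtype.ext (pdFam_map hU i (Pol.odD (xsForm j)) a.2)
  pd_ζ i j := by ext1 a; exact Subtype.ext (pdFam_map hU i (Pol.odD (zForm j)) a.2)
  pd_χ i j := by ext1 a; exact Subtype.ext (pdFam_map hU i (Pol.evD (zsForm j)) a.2)
  pd_pd i j := by ext1 a; exact Subtype.ext (pdFam_comm hU hUq i j a.2)
  pd_x i j := Subtype.ext (pdFam_const hU i _)
  pd_z i j := Subtype.ext (pdFam_const hU i _)
  pd_y i j := Subtype.ext (pdFam_const hU i _)
  isScalar i B C := isScalar_scalar _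

/-- The covariant derivative of a function with value `f` and derivative `f'`. -/
def covP (A : Fin m ⊕ Fin n → Fin m ⊕ Fin n → ℝ) (f f' : LocPol d m n) : LocPol d m n :=
  f' + ∑ B, ∑ C, A B C • (zsP C * Pol.evD (zsForm B) f - zP B * Pol.odD (zForm C) f)

/-- The bracket `(S, f)` of an even function `S` with `f`. -/
def braP (A : Fin d → Fin m ⊕ Fin n → Fin m ⊕ Fin n → ℝ)
    (K : Fin d → Fin d → Fin m ⊕ Fin n → Fin m ⊕ Fin n → ℝ)
    (S : LocPol d m n) (S' : Fin d → LocPol d m n) (f : LocPol d m n) (f' : Fin d → LocPol d m n) :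
    LocPol d m n :=
  ∑ i, (-(Pol.odD (xsForm i) S * covP (A i) f (f' i)) - covP (A i) S (S' i) * Pol.odD (xsForm i) f) +
    ∑ B, (Pol.evD (zsForm B) S * Pol.odD (zForm B) f + Pol.odD (zForm B) S * Pol.evD (zsForm B) f) +
    ∑ i, ∑ j, Pol.odD (xsForm i) S * (∑ B, ∑ C, K i j B C • (zP B * zsP C)) * Pol.odD (xsForm j) f

/-- The curvature of a matrix of connection coefficients in the chart at `q`. -/
def curvP (q : M) (A : Fin d → Fin m ⊕ Fin n → Fin m ⊕ Fin n → M → ℝ) (x : M) (i j : Fin d)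
    (B C : Fin m ⊕ Fin n) : ℝ :=
  sd q i (A j B C) x - sd q j (A i B C) x + ∑ e, (A i e C x * A j B e x - A j e C x * A i B e x)

variable (hU : IsOpen U) (hUq : U ⊆ chartDom d q)
    {A : Fin d → Fin m ⊕ Fin n → Fin m ⊕ Fin n → M → ℝ} (hA : ∀ i B C, SmoothOn d U (A i B C))

theorem FamAlg.add_apply {W : Type*} [Ring W] [Algebra ℝ W] (u v : FamAlg d W U) (x : M) :
    (u + v).1 x = u.1 x + v.1 x := rfl
theorem FamAlg.sub_apply {W : Type*} [Ring W] [Algebra ℝ W] (u v : FamAlg d W U) (x : M) :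
    (u - v).1 x = u.1 x - v.1 x := rfl
theorem FamAlg.neg_apply {W : Type*} [Ring W] [Algebra ℝ W] (u : FamAlg d W U) (x : M) :
    (-u).1 x = -u.1 x := rfl
theorem FamAlg.mul_apply {W : Type*} [Ring W] [Algebra ℝ W] (u v : FamAlg d W U) (x : M) :
    (u * v).1 x = u.1 x * v.1 x := rfl

theorem FamAlg.coe_sum {W J : Type*} [Ring W] [Algebra ℝ W] (s : Finset J)
    (f : J → FamAlg d W U) (x : M) : (∑ j ∈ s, f j).1 x = ∑ j ∈ s, (f j).1 x := by
  have := map_sum (FamAlg d W U).val f s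
  exact (congrFun this x).trans (by rw [Finset.sum_apply]; rfl)

theorem FamAlg.pd_scalar {W : Type*} [Ring W] [Algebra ℝ W] (i : Fin d) {a : M → ℝ}
    (ha : SmoothOn d U a) {x : M} (hx : x ∈ U) :
    (FamAlg.pd hU hUq i (FamAlg.scalar ha : FamAlg d W U)).1 x = sd q i a x • 1 := by
  refine (congrFun (pdFam_smul_const hU i ha 1) x).trans ?_
  rw [Set.indicator_of_mem hx]

theorem locConn_D_apply (i : Fin d) (f : FamAlg d (LocPol d m n) U) {x : M} (hx : x ∈ U) :
    ((locConn hU hUq hA).D i f).1 x =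
      covP (fun B C => A i B C x) (f.1 x) (vecDeriv f.1 x (coordVec q i x)) := by
  have h1 : ((locConn hU hUq hA).D i f) = FamAlg.pd hU hUq i f +
      ∑ B, ∑ C, FamAlg.scalar (smoothOn_indicator (hA i B C)) *
        (FamAlg.const (zsP C) * FamAlg.lift (Pol.evD (zsForm B)) f -
        FamAlg.const (zP B) * FamAlg.lift (Pol.odD (zForm C)) f) := by
    rw [SuperCoord.Conn.D, LinearMap.add_apply, SuperCoord.glOp_apply]
    rfl
  have h2 : (FamAlg.pd hU hUq i f).1 x = vecDeriv f.1 x (coordVec q i x) :=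
    Set.indicator_of_mem hx fun x => vecDeriv f.1 x (coordVec q i x)
  have h3 : ∀ B C, (FamAlg.scalar (smoothOn_indicator (hA i B C)) *
        (FamAlg.const (zsP C) * FamAlg.lift (Pol.evD (zsForm B)) f -
        FamAlg.const (zP B) * FamAlg.lift (Pol.odD (zForm C)) f)).1 x =
      A i B C x • (zsP C * Pol.evD (zsForm B) (f.1 x) - zP B * Pol.odD (zForm C) (f.1 x)) := by
    intro B C
    refine (smul_mul_assoc _ _ _).trans ?_
    rw [one_mul, Set.indicator_of_mem hx]
    rfl
  simp only [h1, FamAlg.add_apply, h2, FamAlg.coe_sum, h3, covP]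

theorem locConn_K_apply (i j : Fin d) (B C : Fin m ⊕ Fin n) {x : M} (hx : x ∈ U) :
    ((locConn hU hUq hA).K i j B C).1 x = curvP q A x i j B C • 1 := by
  have h1 : (locConn hU hUq hA).K i j B C =
      FamAlg.pd hU hUq i (FamAlg.scalar (smoothOn_indicator (hA j B C))) -
      FamAlg.pd hU hUq j (FamAlg.scalar (smoothOn_indicator (hA i B C))) +
      ∑ e, (FamAlg.scalar (smoothOn_indicator (hA i e C)) *
        FamAlg.scalar (smoothOn_indicator (hA j B e)) -
        FamAlg.scalar (smoothOn_indicator (hA j e C)) *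
        FamAlg.scalar (smoothOn_indicator (hA i B e))) := rfl
  have h2 : ∀ (i j : Fin d) (B C D E : Fin m ⊕ Fin n), (FamAlg.scalar (smoothOn_indicator (hA i B C)) *
      FamAlg.scalar (smoothOn_indicator (hA j D E)) : FamAlg d (LocPol d m n) U).1 x =
      (A i B C x * A j D E x) • 1 := by
    intro i j B C D E
    refine (smul_mul_smul_comm _ _ _ _).trans ?_
    rw [one_mul, Set.indicator_of_mem hx, Set.indicator_of_mem hx]
  rw [h1]
  simp only [FamAlg.add_apply, FamAlg.sub_apply, FamAlg.coe_sum, h2,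
    FamAlg.pd_scalar hU hUq _ _ hx, sd_indicator hU hx, curvP, add_smul, sub_smul, Finset.sum_smul]

theorem locConn_ρ_apply (i j : Fin d) {x : M} (hx : x ∈ U) :
    ((locConn hU hUq hA).ρ i j).1 x = ∑ B, ∑ C, curvP q A x i j B C • (zP B * zsP C) := by
  rw [SuperCoord.Conn.ρ, SuperCoord.glFun]
  simp only [FamAlg.coe_sum]
  refine Finset.sum_congr rfl fun B _ => Finset.sum_congr rfl fun C _ => ?_
  have : (((locCoord d m n U).z B * (locConn hU hUq hA).K i j B C * (locCoord d m n U).y C)).1 x =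
    zP B * ((locConn hU hUq hA).K i j B C).1 x * zsP C := rfl
  rw [this, locConn_K_apply hU hUq hA i j B C hx, mul_smul_comm, mul_one, smul_mul_assoc]

theorem locConn_LQ_apply (S f : FamAlg d (LocPol d m n) U) {x : M} (hx : x ∈ U) :
    ((locConn hU hUq hA).LQ S f).1 x =
      braP (fun i B C => A i B C x) (curvP q A x) (S.1 x)
        (fun i => vecDeriv S.1 x (coordVec q i x)) (f.1 x)
        (fun i => vecDeriv f.1 x (coordVec q i x)) := by
  rw [SuperCoord.Conn.LQ_apply, braP]
  simp only [FamAlg.add_apply, FamAlg.sub_apply, FamAlg.neg_apply, FamAlg.mul_apply, FamAlg.coe_sum, locConn_D_apply hU hUq hA _ _ hx,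
    locConn_ρ_apply hU hUq hA _ _ hx]
  rfl

end LocalBracket

/-! ### The bracket as a sum over pairs of coordinates -/

section CoordinateSums

variable {d m n : ℕ}

theorem sum_coord {V : Type*} [AddCommMonoid V] (F : Coord d m n → V) :
    ∑ u, F u = ∑ i, F (.x i) + ∑ B, F (.z B) + ∑ i, F (.xs i) + ∑ B, F (.zs B) := by
  let e : (Fin d ⊕ (Fin m ⊕ Fin n)) ⊕ (Fin d ⊕ (Fin m ⊕ Fin n)) ≃ Coord d m n :=
    { toFun := Sum.elim (Sum.elim .x .z) (Sum.elim .xs .zs)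
      invFun := fun u => match u with
        | .x i => .inl (.inl i)
        | .z B => .inl (.inr B)
        | .xs i => .inr (.inl i)
        | .zs B => .inr (.inr B)
      left_inv := by rintro ((_ | _) | (_ | _)) <;> rfl
      right_inv := by rintro (_ | _ | _ | _) <;> rfl }
  rw [← e.sum_comp, Fintype.sum_sum_type, Fintype.sum_sum_type,
    Fintype.sum_sum_type (f := fun a => F (e (.inr a)))]
  simp only [e, Equiv.coe_fn_mk, Sum.elim_inl, Sum.elim_inr, add_assoc]

/-- For even S the right derivative along an odd coordinate is minus the left one. The brackets of
x* with z and z* then combine with the derivatives along x into covariant derivatives, on either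
side of the bracket. -/
theorem sum_coordBracket (A : Fin d → Fin m ⊕ Fin n → Fin m ⊕ Fin n → ℝ)
    (K : Fin d → Fin d → Fin m ⊕ Fin n → Fin m ⊕ Fin n → ℝ) (S : LocAlg d m n)
    (S' : Fin d → LocAlg d m n) (f : LocAlg d m n) (f' : Fin d → LocAlg d m n)
    (hS : Pol.parity (toPol S) = toPol S) :
    toPol (∑ u : Coord d m n, ∑ v : Coord d m n,
      coordDerivR S S' u * coordBracket A K u v * coordDerivL f f' v) =
    braP A K (toPol S) (fun i => toPol (S' i)) (toPol f) (fun i => toPol (f' i)) := by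
  have hz : ∀ B C, zP B * Pol.odD (zForm C) (toPol S) = -(Pol.odD (zForm C) (toPol S) * zP B) := by
    intro B C
    rw [Pol.mul_comm_of_odd (parity_zP B), Pol.parity_odD, hS, neg_mul]
  have hy : ∀ B C, zsP C * Pol.evD (zsForm B) (toPol S) = Pol.evD (zsForm B) (toPol S) * zsP C :=
    fun B C => Pol.mul_comm_of_even (parity_zsP C) _
  simp only [sum_coord, coordDerivR, coordDerivL, coordBracket, map_add, map_sum, map_mul, map_neg,
    Pol.toPol_evenDeriv, Pol.toPol_oddDerivL, Pol.toPol_oddDerivR, hS, map_zero, mul_zero, zero_mul,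
    Finset.sum_const_zero, add_zero, zero_add, apply_ite toPol, map_one, map_smul]
  have e1 : ∀ B, toPol (zFun B) = (zP B : LocPol d m n) := fun _ => rfl
  have e2 : ∀ B, toPol (zsFun B) = (zsP B : LocPol d m n) := fun _ => rfl
  simp only [e1, e2, mul_ite, ite_mul, mul_one, mul_zero, zero_mul, mul_neg, neg_mul, neg_neg,
    Finset.sum_ite_eq, Finset.sum_ite_eq', Finset.mem_univ, if_true, Finset.sum_neg_distrib]
  simp only [braP, covP, mul_add, add_mul, mul_sub, sub_mul, smul_sub, Finset.mul_sum,
    Finset.sum_mul, Finset.sum_add_distrib, Finset.sum_sub_distrib, mul_smul_comm, smul_mul_assoc,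
    hz, hy, neg_mul, smul_neg, Finset.sum_neg_distrib, neg_add, ← mul_assoc]
  rw [Finset.sum_comm (s := Finset.univ (α := Fin m ⊕ Fin n)) (t := Finset.univ (α := Fin d))
      (f := fun x y => ∑ w, A y w x • (Pol.odD (zForm x) (toPol S) * zP w *
        Pol.odD (xsForm y) (toPol f))),
    Finset.sum_comm (s := Finset.univ (α := Fin m ⊕ Fin n)) (t := Finset.univ (α := Fin d))
      (f := fun x y => ∑ w, A y x w • (Pol.evD (zsForm x) (toPol S) * zsP w *
        Pol.odD (xsForm y) (toPol f)))]
  have e3 : ∀ y, ∑ x, ∑ w, A y w x • (Pol.odD (zForm x) (toPol S) * zP w *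
        Pol.odD (xsForm y) (toPol f)) = ∑ w, ∑ x, A y w x • (Pol.odD (zForm x) (toPol S) * zP w *
        Pol.odD (xsForm y) (toPol f)) := fun y => Finset.sum_comm
  have e4 : ∀ y, ∑ x, ∑ w, A y w x • (Pol.odD (xsForm y) (toPol S) * zP w *
        Pol.odD (zForm x) (toPol f)) = ∑ w, ∑ x, A y w x • (Pol.odD (xsForm y) (toPol S) * zP w *
        Pol.odD (zForm x) (toPol f)) := fun y => Finset.sum_comm
  simp only [e3, e4]
  abel

end CoordinateSums

/-! ### Frames and connection coefficients -/

section Frames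

variable {d r : ℕ}
  {M : Type*} [TopologicalSpace M] [ChartedSpace (EuclideanSpace ℝ (Fin d)) M]
  [IsManifold (𝓡 d) ∞ M] {V : M → Type*} [TopologicalSpace (TotalSpace (Fin r → ℝ) V)]
  [∀ p, AddCommGroup (V p)] [∀ p, Module ℝ (V p)] [∀ p, TopologicalSpace (V p)]
  [FiberBundle (Fin r → ℝ) V] [VectorBundle ℝ (Fin r → ℝ) V]
  [ContMDiffVectorBundle ∞ (Fin r → ℝ) V (𝓡 d)]
  {q p x : M} {U : Set M}

variable (r V) in
/-- The domain of the preferred frame at `q`. -/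
abbrev frameDom (q : M) : Set M := (trivializationAt (Fin r → ℝ) V q).baseSet

variable (r) in
/-- The components of a vector in the preferred frame at `q`. -/
abbrev comps (q x : M) : V x →ₗ[ℝ] (Fin r → ℝ) :=
  (trivializationAt (Fin r → ℝ) V q).linearMapAt ℝ x

variable (V) in
/-- The transition functions, `frame q a = ∑ b, trans q p a b • frame p b`. -/
def trans (q p : M) (a b : Fin r) (x : M) : ℝ := comps r p x (frame (V := V) q a x) b

theorem comps_frame (hx : x ∈ frameDom r V q) (a : Fin r) :
    comps r q x (frame (V := V) q a x) = Pi.single a 1 :=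
  (trivializationAt (Fin r → ℝ) V q).linearMapAt_symmₗ hx _

theorem eq_sum_frame (hx : x ∈ frameDom r V q) (v : V x) :
    v = ∑ b, comps r q x v b • frame q b x := by
  simp only [frame, ← map_smul, ← map_sum]
  have : ∑ b, comps r q x v b • Pi.single b (1 : ℝ) = comps r q x v := by
    ext i; simp [Pi.single_apply]
  rw [this]
  exact ((trivializationAt (Fin r → ℝ) V q).symmₗ_linearMapAt hx v).symm

theorem frame_eq_sum (hx : x ∈ frameDom r V p) (a : Fin r) :
    frame (V := V) q a x = ∑ b, trans V q p a b x • frame p b x := eq_sum_frame hx _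

theorem trans_self (hx : x ∈ frameDom r V q) (a b : Fin r) :
    trans V q q a b x = if a = b then 1 else 0 := by
  rw [trans, comps_frame hx]; simp [Pi.single_apply, eq_comm]

theorem comps_eq_sum_trans (hx : x ∈ frameDom r V q) (v : V x) (b : Fin r) :
    comps r p x v b = ∑ a, comps r q x v a * trans V q p a b x := by
  conv_lhs => rw [eq_sum_frame hx v]
  simp [trans]

theorem trans_mul_trans (hx : x ∈ frameDom r V p) (q q' : M) (a c : Fin r) :
    ∑ b, trans V q p a b x * trans V p q' b c x = trans V q q' a c x :=
  (comps_eq_sum_trans hx _ c).symm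

theorem smoothOn_comps {s : (x : M) → V x} (hU : IsOpen U) (hUq : U ⊆ frameDom r V q)
    (hs : ContMDiffOn (𝓡 d) ((𝓡 d).prod 𝓘(ℝ, Fin r → ℝ)) ∞
      (fun x => TotalSpace.mk' (Fin r → ℝ) x (s x)) U) (b : Fin r) :
    SmoothOn d U fun x => comps r q x (s x) b := by
  rw [(trivializationAt (Fin r → ℝ) V q).contMDiffOn_section_iff hU hUq] at hs
  have h2 : ContMDiff 𝓘(ℝ, Fin r → ℝ) 𝓘(ℝ, ℝ) ∞
      (ContinuousLinearMap.proj b : (Fin r → ℝ) →L[ℝ] ℝ) := ContinuousLinearMap.contMDiff _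
  refine (h2.comp_contMDiffOn hs).congr fun x hx => ?_
  rw [comps, Trivialization.coe_linearMapAt_of_mem _ (hUq hx)]
  rfl

variable (V) in
theorem contMDiffOn_frame (q : M) (a : Fin r) :
    ContMDiffOn (𝓡 d) ((𝓡 d).prod 𝓘(ℝ, Fin r → ℝ)) ∞
      (fun x => TotalSpace.mk' (Fin r → ℝ) x (frame (V := V) q a x)) (frameDom r V q) := by
  rw [(trivializationAt (Fin r → ℝ) V q).contMDiffOn_section_baseSet_iff]
  refine (contMDiffOn_const (c := (Pi.single a 1 : Fin r → ℝ))).congr fun x hx => ?_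
  rw [← comps_frame hx, comps, Trivialization.coe_linearMapAt_of_mem _ hx]

theorem smoothOn_trans (hU : IsOpen U) (hUq : U ⊆ frameDom r V q) (hUp : U ⊆ frameDom r V p)
    (a b : Fin r) : SmoothOn d U (trans V q p a b) :=
  smoothOn_comps hU hUp ((contMDiffOn_frame V q a).mono hUq) b

theorem mdifferentiableAt_frame (hx : x ∈ frameDom r V q) (a : Fin r) :
    MDifferentiableAt (𝓡 d) ((𝓡 d).prod 𝓘(ℝ, Fin r → ℝ))
      (fun x => TotalSpace.mk' (Fin r → ℝ) x (frame (V := V) q a x)) x :=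
  ((contMDiffOn_frame V q a).contMDiffAt ((trivializationAt (Fin r → ℝ) V q).open_baseSet.mem_nhds
    hx)).mdifferentiableAt (by simp)

theorem contMDiffOn_coordVec (q : M) (i : Fin d) :
    ContMDiffOn (𝓡 d) ((𝓡 d).prod 𝓘(ℝ, EuclideanSpace ℝ (Fin d))) ∞
      (fun x => TotalSpace.mk' (EuclideanSpace ℝ (Fin d)) (E := TangentSpace (𝓡 d)) x
        (coordVec q i x)) (chartDom d q) := by
  have : IsManifold (𝓡 d) (∞ + 1) M := by simpa using ‹IsManifold (𝓡 d) ∞ M›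
  have : IsManifold (𝓡 d) 1 M := isManifold_one
  rw [(trivializationAt (EuclideanSpace ℝ (Fin d)) (TangentSpace (𝓡 d) : M → Type _)
    q).contMDiffOn_section_iff (chartAt (EuclideanSpace ℝ (Fin d)) q).open_source
      (fun x hx => mem_tangent_baseSet hx)]
  refine (contMDiffOn_const (c := (EuclideanSpace.single i 1 : EuclideanSpace ℝ (Fin d)))).congr
    fun x hx => ?_
  have h := (trivializationAt (EuclideanSpace ℝ (Fin d)) (TangentSpace (𝓡 d) : M → Type _)
      q).linearMapAt_symmₗ (R := ℝ) (mem_tangent_baseSet hx) (EuclideanSpace.single i 1)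
  rw [Trivialization.coe_linearMapAt_of_mem _ (mem_tangent_baseSet hx)] at h
  exact h

variable [∀ p, IsTopologicalAddGroup (V p)] [∀ p, ContinuousSMul ℝ (V p)]
  (cov : CovariantDerivative (𝓡 d) (Fin r → ℝ) V)

theorem cov_congr {s s' : (x : M) → V x}
    (hs : MDifferentiableAt (𝓡 d) ((𝓡 d).prod 𝓘(ℝ, Fin r → ℝ))
      (fun x => TotalSpace.mk' (Fin r → ℝ) x (s x)) x)
    (hs' : MDifferentiableAt (𝓡 d) ((𝓡 d).prod 𝓘(ℝ, Fin r → ℝ))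
      (fun x => TotalSpace.mk' (Fin r → ℝ) x (s' x)) x)
    (h : ∀ᶠ y in nhds x, s y = s' y) : cov s x = cov s' x :=
  cov.isCovariantDerivativeOnUniv.congr_of_eventuallyEq hs hs' Filter.univ_mem h

/-- The smoothness of the connection is applied to a global section: the frame times a bump function
that equals 1 near the point. By locality of the connection the coefficients near the point are
unchanged. -/
theorem smoothOn_connCoeff [T2Space M] (hcov : CovariantDerivative.ContMDiffCovariantDerivative cov ∞)
    (q : M) (i : Fin d) (a b : Fin r) :
    SmoothOn d (chartDom d q ∩ frameDom r V q) (connCoeff cov q i a b) := by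
  have : IsManifold (𝓡 d) (∞ + 1) M := by simpa using ‹IsManifold (𝓡 d) ∞ M›
  have : IsManifold (𝓡 d) 1 M := isManifold_one
  intro x₀ hx₀
  refine ContMDiffAt.contMDiffWithinAt ?_
  have hfo : IsOpen (frameDom r V q) := (trivializationAt (Fin r → ℝ) V q).open_baseSet
  have hco : IsOpen (chartDom d q) := (chartAt (EuclideanSpace ℝ (Fin d)) q).open_source
  obtain ⟨ψ, -, hψ⟩ := (SmoothBumpFunction.nhds_basis_tsupport (I := 𝓡 d) x₀).mem_iff.1
    (hfo.mem_nhds hx₀.2)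
  set s : (x : M) → V x := fun x => ψ x • frame q a x with hs
  have hsm : ContMDiff (𝓡 d) ((𝓡 d).prod 𝓘(ℝ, Fin r → ℝ)) ∞
      (fun x => TotalSpace.mk' (Fin r → ℝ) x (s x)) :=
    ContMDiffOn.smul_section_of_tsupport ψ.contMDiff.contMDiffOn hfo hψ (contMDiffOn_frame V q a)
  have hcs := hcov.contMDiff.contMDiff (σ := s) (by simpa using! hsm.contMDiffOn)
  have hcs' := (hcs x₀ trivial).contMDiffAt Filter.univ_mem
  have hcv : ContMDiffAt (𝓡 d) ((𝓡 d).prod 𝓘(ℝ, Fin r → ℝ)) ∞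
      (fun x => TotalSpace.mk' (Fin r → ℝ) x (cov s x (coordVec q i x))) x₀ :=
    ContMDiffAt.clm_bundle_apply (b := fun x => x) hcs'
      ((contMDiffOn_coordVec q i).contMDiffAt (hco.mem_nhds hx₀.1))
  rw [(trivializationAt (Fin r → ℝ) V q).contMDiffAt_section_iff hx₀.2] at hcv
  have h2 : ContMDiff 𝓘(ℝ, Fin r → ℝ) 𝓘(ℝ, ℝ) ∞
      (ContinuousLinearMap.proj b : (Fin r → ℝ) →L[ℝ] ℝ) := ContinuousLinearMap.contMDiff _
  refine (h2.contMDiffAt.comp x₀ hcv).congr_of_eventuallyEq ?_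
  have he : ∀ᶠ y in nhds x₀, ∀ᶠ z in nhds y, ψ z = 1 :=
    ψ.eventuallyEq_one.eventually_nhds
  filter_upwards [hfo.mem_nhds hx₀.2, he] with y hy hye
  rw [connCoeff, Trivialization.coe_linearMapAt_of_mem _ hy,
    cov_congr cov (mdifferentiableAt_frame hy a) (hsm.mdifferentiable (by simp) y)
      (hye.mono fun z hz => by rw [hs]; simp [hz])]
  rfl

theorem cov_eq_sum {s : (x : M) → V x} (hx : x ∈ frameDom r V p) (hU : IsOpen U) (hxU : x ∈ U)
    (hUp : U ⊆ frameDom r V p) (hs : ContMDiffOn (𝓡 d) ((𝓡 d).prod 𝓘(ℝ, Fin r → ℝ)) ∞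
      (fun x => TotalSpace.mk' (Fin r → ℝ) x (s x)) U) (v : TangentSpace (𝓡 d) x) :
    cov s x v = ∑ c, (comps r p x (s x) c • cov (frame p c) x v +
      mvfderiv (𝓡 d) (fun y => comps r p y (s y) c) x v • frame p c x) := by
  have hc : ∀ c, MDifferentiableAt (𝓡 d) 𝓘(ℝ, ℝ) (fun y => comps r p y (s y) c) x := fun c =>
    (smoothOn_comps hU hUp hs c).mdifferentiableAt hU hxU
  have hl : ∀ c, MDifferentiableAt (𝓡 d) ((𝓡 d).prod 𝓘(ℝ, Fin r → ℝ))
      (fun y => TotalSpace.mk' (Fin r → ℝ) y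
        (((fun y => comps r p y (s y) c) • frame p c : (y : M) → V y) y)) x := fun c =>
    MDifferentiableAt.smul_section (hc c) (mdifferentiableAt_frame hx c)
  have key : ∀ T : Finset (Fin r),
      cov (∑ c ∈ T, (fun y => comps r p y (s y) c) • frame p c : (y : M) → V y) x v =
      ∑ c ∈ T, (comps r p x (s x) c • cov (frame p c) x v +
      mvfderiv (𝓡 d) (fun y => comps r p y (s y) c) x v • frame p c x) ∧
      MDifferentiableAt (𝓡 d) ((𝓡 d).prod 𝓘(ℝ, Fin r → ℝ))
      (fun y => TotalSpace.mk' (Fin r → ℝ) y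
        ((∑ c ∈ T, (fun y => comps r p y (s y) c) • frame p c : (y : M) → V y) y)) x := by
    intro T
    induction T using Finset.induction_on with
    | empty =>
      simp only [Finset.sum_empty]
      exact ⟨by rw [cov.zero]; rfl, mdifferentiableAt_zeroSection ..⟩
    | insert c T hcT ih =>
      simp only [Finset.sum_insert hcT]
      refine ⟨?_, mdifferentiableAt_add_section (hl c) ih.2⟩
      rw [cov.isCovariantDerivativeOnUniv.add (hl c) ih.2,
        cov.isCovariantDerivativeOnUniv.leibniz (mdifferentiableAt_frame hx c) (hc c)]
      simp [ih.1]
  rw [← (key Finset.univ).1]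
  refine congrFun (congrArg DFunLike.coe (cov_congr cov ?_ (key Finset.univ).2 ?_)) v
  · exact (hs.contMDiffAt (hU.mem_nhds hxU)).mdifferentiableAt (by simp)
  · filter_upwards [hU.mem_nhds hxU] with y hy
    rw [Finset.sum_apply]
    exact eq_sum_frame (hUp hy) (s y)

/-- Expand the covariant derivative of a frame vector at q in the frame at p by the Leibniz rule,
and compare with its definition at q after writing the direction in the chart at q. This is the
gauge transformation law. -/
theorem connCoeff_trans (hU : IsOpen U) (hxU : x ∈ U) (hUp : U ⊆ frameDom r V p)
    (hUq : U ⊆ frameDom r V q) (hq : x ∈ chartDom d q) (i : Fin d) (a b : Fin r) :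
    sd p i (trans V q p a b) x + ∑ c, trans V q p a c x * connCoeff cov p i c b x =
      ∑ k, sd p i (chartCoord q k) x * ∑ e, connCoeff cov q k a e x * trans V q p e b x := by
  have h1 := cov_eq_sum cov (hUp hxU) hU hxU hUp ((contMDiffOn_frame V q a).mono hUq)
    (coordVec p i x)
  have h2 := congrArg (fun w => comps r p x w b) h1
  simp only [map_sum, map_add, map_smul, Finset.sum_apply, Pi.add_apply, Pi.smul_apply,
    smul_eq_mul, comps_frame (hUp hxU), Finset.sum_add_distrib] at h2
  have h3 : ∑ c, mvfderiv (𝓡 d) (fun y => comps r p y (frame (V := V) q a y) c) x (coordVec p i x) *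
      (Pi.single c 1 : Fin r → ℝ) b = sd p i (trans V q p a b) x := by
    simp [Pi.single_apply, sd]; rfl
  rw [h3, add_comm] at h2
  refine Eq.trans h2.symm ?_
  rw [coordVec_eq_sum (p := p) hq i]
  simp only [map_sum, map_smul, Finset.sum_apply, Pi.smul_apply, smul_eq_mul]
  refine Finset.sum_congr rfl fun k _ => ?_
  rw [comps_eq_sum_trans (hUq hxU)]
  rfl

end Frames

/-! ### Reduction of identities to scalars and coordinates -/

section Induction

variable {d m n : ℕ}

theorem LocPol.induction {C : LocPol d m n → Prop} (scalar : ∀ r : ℝ, C (r • 1))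
    (zs : ∀ B, C (zsP B)) (z : ∀ B, C (zP B)) (xs : ∀ i, C (xsP i))
    (mul : ∀ a b, C a → C b → C (a * b)) (add : ∀ a b, C a → C b → C (a + b)) (a : LocPol d m n) :
    C a := by
  have h0 : C 0 := by simpa using scalar 0
  have hsmul : ∀ (r : ℝ) (a : LocPol d m n), C a → C (r • a) := by
    intro r a ha
    have := mul _ _ (scalar r) ha
    rwa [smul_mul_assoc, one_mul] at this
  have hsum : ∀ {J : Type} (s : Finset J) (f : J → LocPol d m n), (∀ j ∈ s, C (f j)) →
      C (∑ j ∈ s, f j) := fun s f hf => Finset.sum_induction f C add h0 hf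
  refine Pol.induction scalar ?_ ?_ mul add a
  · intro v
    have hv : v = ∑ a, v.1 a • (Pi.single a 1, 0) + ∑ a, v.2 a • (0, Pi.single a 1) := by
      ext i <;> simp [Prod.fst_sum, Prod.snd_sum, Pi.single_apply]
    rw [hv, map_add, map_sum, map_sum]
    refine add _ _ (hsum _ _ fun a _ => ?_) (hsum _ _ fun a _ => ?_)
    · rw [map_smul]; exact hsmul _ _ (zs (.inl a))
    · rw [map_smul]; exact hsmul _ _ (zs (.inr a))
  · intro w
    have hw : w = ∑ a, w.1 (Pi.single a 1) • (LinearMap.proj a, 0, 0) +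
        ∑ a, w.2.1 (Pi.single a 1) • (0, LinearMap.proj a, 0) +
        ∑ i, w.2.2 i • (0, 0, EuclideanSpace.single i 1) := by
      refine Prod.ext ?_ (Prod.ext ?_ ?_)
      · refine LinearMap.pi_ext' fun i => LinearMap.ext_ring ?_
        simp [Prod.fst_sum, Pi.single_apply]
      · refine LinearMap.pi_ext' fun i => LinearMap.ext_ring ?_
        simp [Prod.fst_sum, Prod.snd_sum, Pi.single_apply]
      · ext i
        simp [Prod.snd_sum, Pi.single_apply]
    rw [hw, map_add, map_add, map_sum, map_sum, map_sum]
    refine add _ _ (add _ _ (hsum _ _ fun a _ => ?_) (hsum _ _ fun a _ => ?_))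
      (hsum _ _ fun a _ => ?_)
    · rw [map_smul]; exact hsmul _ _ (z (.inl a))
    · rw [map_smul]; exact hsmul _ _ (z (.inr a))
    · rw [map_smul]; exact hsmul _ _ (xs a)

variable {M : Type*} [TopologicalSpace M] [ChartedSpace (EuclideanSpace ℝ (Fin d)) M]
  [IsManifold (𝓡 d) ∞ M] {U : Set M}

theorem FamAlg.induction {C : FamAlg d (LocPol d m n) U → Prop}
    (scalar : ∀ (a : M → ℝ) (ha : SmoothOn d U a), C (FamAlg.scalar ha))
    (zs : ∀ B, C (FamAlg.const (zsP B))) (z : ∀ B, C (FamAlg.const (zP B)))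
    (xs : ∀ i, C (FamAlg.const (xsP i)))
    (mul : ∀ a b, C a → C b → C (a * b)) (add : ∀ a b, C a → C b → C (a + b))
    (f : FamAlg d (LocPol d m n) U) : C f := by
  have hconst : ∀ e : LocPol d m n, C (FamAlg.const e) := by
    intro e
    induction e using LocPol.induction with
    | scalar r => exact scalar (fun _ => r) contMDiffOn_const
    | zs B => exact zs B
    | z B => exact z B
    | xs i => exact xs i
    | mul a b ha hb => exact mul _ _ ha hb
    | add a b ha hb => exact add _ _ ha hb
  obtain ⟨f, hf⟩ := f
  induction hf using Submodule.span_induction with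
  | mem f hf =>
    obtain ⟨a, e, ha, rfl⟩ := hf
    have := mul _ _ (scalar a ha) (hconst e)
    convert this using 1
    ext x
    exact ((smul_mul_assoc _ _ _).trans (by rw [one_mul]; rfl)).symm
  | zero => exact hconst 0
  | add f g hf hg h h' => exact add _ _ h h'
  | smul r f hf h =>
    have := mul _ _ (hconst (r • 1)) h
    convert this using 1
    ext x
    exact ((smul_mul_assoc _ _ _).trans (by rw [one_mul]; rfl)).symm

/-- Twisted derivations that agree on the coordinates are equal. -/
theorem FamAlg.twisted_ext {τ Φ : FamAlg d (LocPol d m n) U → FamAlg d (LocPol d m n) U}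
    {T T' : FamAlg d (LocPol d m n) U → FamAlg d (LocPol d m n) U}
    (hT : ∀ a b, T (a * b) = T a * Φ b + Φ (τ a) * T b)
    (hT' : ∀ a b, T' (a * b) = T' a * Φ b + Φ (τ a) * T' b)
    (hadd : ∀ a b, T (a + b) = T a + T b) (hadd' : ∀ a b, T' (a + b) = T' a + T' b)
    (scalar : ∀ (a : M → ℝ) (ha : SmoothOn d U a), T (FamAlg.scalar ha) = T' (FamAlg.scalar ha))
    (zs : ∀ B, T (FamAlg.const (zsP B)) = T' (FamAlg.const (zsP B)))
    (z : ∀ B, T (FamAlg.const (zP B)) = T' (FamAlg.const (zP B)))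
    (xs : ∀ i, T (FamAlg.const (xsP i)) = T' (FamAlg.const (xsP i)))
    (f : FamAlg d (LocPol d m n) U) : T f = T' f := by
  induction f using FamAlg.induction with
  | scalar a ha => exact scalar a ha
  | zs B => exact zs B
  | z B => exact z B
  | xs i => exact xs i
  | mul a b ha hb => rw [hT, hT', ha, hb]
  | add a b ha hb => rw [hadd, hadd', ha, hb]

end Induction

/-! ### Changes of coordinates over an open set -/

section Transition

variable {d m n : ℕ} {M : Type*} [TopologicalSpace M] [ChartedSpace (EuclideanSpace ℝ (Fin d)) M]
  [IsManifold (𝓡 d) ∞ M] {U : Set M}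

/-- Block diagonal matrices. -/
def blk {R : Type*} [Zero R] (f : Fin m → Fin m → R) (g : Fin n → Fin n → R) :
    Fin m ⊕ Fin n → Fin m ⊕ Fin n → R
  | .inl a, .inl b => f a b
  | .inr a, .inr b => g a b
  | _, _ => 0

theorem smoothOn_blk {f : Fin m → Fin m → M → ℝ} {g : Fin n → Fin n → M → ℝ}
    (hf : ∀ a b, SmoothOn d U (f a b)) (hg : ∀ a b, SmoothOn d U (g a b)) (B C : Fin m ⊕ Fin n) :
    SmoothOn d U (blk f g B C) := by
  cases B <;> cases C
  · exact hf _ _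
  · exact contMDiffOn_const
  · exact contMDiffOn_const
  · exact hg _ _

/-- Pointwise data of a change of coordinates over `U`. -/
structure CoordChange (q p : M) (U : Set M) (A A' : Fin d → Fin m ⊕ Fin n → Fin m ⊕ Fin n → M → ℝ)
    (h h' : Fin m ⊕ Fin n → Fin m ⊕ Fin n → M → ℝ) (Φ : M → LocPol d m n →ₐ[ℝ] LocPol d m n) :
    Prop where
  isOpen : IsOpen U
  dom : U ⊆ chartDom d q
  dom' : U ⊆ chartDom d p
  smooth_A : ∀ i B C, SmoothOn d U (A i B C)
  smooth_A' : ∀ i B C, SmoothOn d U (A' i B C)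
  smooth_h : ∀ B C, SmoothOn d U (h B C)
  smooth_h' : ∀ B C, SmoothOn d U (h' B C)
  h_h' : ∀ x ∈ U, ∀ B D, ∑ C, h B C x * h' C D x = if B = D then 1 else 0
  h'_h : ∀ x ∈ U, ∀ B D, ∑ C, h' B C x * h C D x = if B = D then 1 else 0
  Φ_zs : ∀ x ∈ U, ∀ B, Φ x (zsP B) = ∑ C, h B C x • zsP C
  Φ_z : ∀ x ∈ U, ∀ B, Φ x (zP B) = ∑ C, h' C B x • zP C
  Φ_xs : ∀ x ∈ U, ∀ i, Φ x (xsP i) = ∑ k, sd q i (chartCoord p k) x • xsP k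
  conn : ∀ x ∈ U, ∀ i B D, sd p i (h B D) x + ∑ C, h B C x * A' i C D x =
    ∑ k, sd p i (chartCoord q k) x * ∑ C, A k B C x * h C D x
  conn' : ∀ x ∈ U, ∀ i B D, sd p i (h' B D) x +
      ∑ C, h' B C x * ∑ k, sd p i (chartCoord q k) x * A k C D x = ∑ C, A' i B C x * h' C D x

namespace CoordChange

variable {q p : M} {A A' : Fin d → Fin m ⊕ Fin n → Fin m ⊕ Fin n → M → ℝ}
  {h h' : Fin m ⊕ Fin n → Fin m ⊕ Fin n → M → ℝ} {Φ : M → LocPol d m n →ₐ[ℝ] LocPol d m n}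
  (t : CoordChange q p U A A' h h' Φ)

open Classical in
/-- The substitution at a point, trivial outside of `U`. -/
def sub (U : Set M) (Φ : M → LocPol d m n →ₐ[ℝ] LocPol d m n) (x : M) :
    LocPol d m n →ₐ[ℝ] LocPol d m n := if x ∈ U then Φ x else AlgHom.id ℝ _

theorem sub_of_mem {x : M} (hx : x ∈ U) : sub U Φ x = Φ x := if_pos hx
theorem sub_of_notMem {x : M} (hx : x ∉ U) : sub U Φ x = AlgHom.id ℝ _ := if_neg hx

open Classical in
/-- A matrix of functions, the unit matrix outside of `U`. -/
def ext {J : Type*} (U : Set M) (f : J → J → M → ℝ) (a b : J) (x : M) : ℝ :=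
  if x ∈ U then f a b x else if a = b then 1 else 0

theorem ext_of_mem {J : Type*} {f : J → J → M → ℝ} {a b : J} {x : M} (hx : x ∈ U) :
    ext U f a b x = f a b x := if_pos hx
open Classical in
theorem ext_of_notMem {J : Type*} {f : J → J → M → ℝ} {a b : J} {x : M} (hx : x ∉ U) :
    ext U f a b x = if a = b then 1 else 0 := if_neg hx

theorem smoothOn_ext {J : Type*} {f : J → J → M → ℝ} {a b : J} (hf : SmoothOn d U (f a b)) :
    SmoothOn d U (ext U f a b) := hf.congr fun _ hx => ext_of_mem hx

theorem sd_ext {J : Type*} {f : J → J → M → ℝ} {a b : J} (hU : IsOpen U) {x : M} (hx : x ∈ U)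
    (i : Fin d) : sd q i (ext U f a b) x = sd q i (f a b) x :=
  sd_congr (by filter_upwards [hU.mem_nhds hx] with y hy using ext_of_mem hy) i

include t

/-- The coordinates are sent to combinations with smooth coefficients, and smooth families form an
algebra. Extending the matrices by the unit matrix off U matches the extension of the substitution
by the identity. -/
theorem sub_mem (e : LocPol d m n) : (fun x => sub U Φ x e) ∈ FamAlg d (LocPol d m n) U := by
  have hsum : ∀ {J : Type} [Fintype J] [DecidableEq J] (c : J → J → M → ℝ) (y : J → LocPol d m n) (B : J),
      (∀ C, SmoothOn d U (c B C)) → (∀ x ∈ U, Φ x (y B) = ∑ C, c B C x • y C) →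
      (fun x => sub U Φ x (y B)) ∈ FamAlg d (LocPol d m n) U := by
    intro J _ _ c y B hc hy
    have : (fun x => sub U Φ x (y B)) = ∑ C, fun x => ext U c B C x • y C := by
      funext x
      rw [Finset.sum_apply]
      by_cases hx : x ∈ U
      · rw [sub_of_mem hx, hy x hx]
        simp only [ext_of_mem hx]
      · rw [sub_of_notMem hx]
        simp [ext_of_notMem hx]
    rw [this]
    exact sum_mem fun C _ => smul_mem_Fam (smoothOn_ext (hc C)) _
  induction e using LocPol.induction with
  | scalar r =>
    have : (fun x : M => sub U Φ x (r • 1)) = fun _ => r • 1 := by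
      funext x; rw [map_smul, map_one]
    rw [this]; exact const_mem_Fam _
  | zs B => exact hsum h zsP B (t.smooth_h B) fun x hx => t.Φ_zs x hx B
  | z B => exact hsum (fun B C => h' C B) zP B (fun C => t.smooth_h' C B) fun x hx => t.Φ_z x hx B
  | xs i =>
    refine hsum (fun i k => sd q i (chartCoord p k)) xsP i (fun k => ?_) fun x hx => t.Φ_xs x hx i
    exact (smoothOn_chartCoord t.dom' k).sd t.isOpen t.dom i
  | mul a b ha hb => simpa using! mul_mem ha hb
  | add a b ha hb => simpa using! add_mem ha hb

/-- The substitution on families. -/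
def subst : FamAlg d (LocPol d m n) U →ₐ[ℝ] FamAlg d (LocPol d m n) U where
  toFun f := ⟨fun x => sub U Φ x (f.1 x), by
    obtain ⟨f, hf⟩ := f
    induction hf using Submodule.span_induction with
    | mem f hf =>
      obtain ⟨a, e, ha, rfl⟩ := hf
      simpa using! Fam.smul ha (t.sub_mem e)
    | zero => simpa using! (const_mem_Fam 0 : (fun _ => 0) ∈ Fam d (LocPol d m n) U)
    | add f g _ _ hf hg => simpa using! add_mem hf hg
    | smul r f _ hf => simpa using! Subalgebra.smul_mem _ hf r⟩
  map_one' := by ext x; exact map_one _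
  map_zero' := by ext x; exact map_zero _
  map_mul' f g := by ext x; exact map_mul _ _ _
  map_add' f g := by ext x; exact map_add _ _ _
  commutes' r := by ext x; exact (sub U Φ x).commutes r

theorem subst_apply (f : FamAlg d (LocPol d m n) U) (x : M) :
    (t.subst f).1 x = sub U Φ x (f.1 x) := rfl

theorem subst_scalar {a : M → ℝ} (ha : SmoothOn d U a) :
    t.subst (FamAlg.scalar ha) = FamAlg.scalar ha := by
  ext x
  rw [subst_apply, FamAlg.scalar_apply, map_smul, map_one]

end CoordChange

end Transition

/-! ### A change of coordinates intertwines derivatives and brackets -/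

namespace CoordChange

variable {d m n : ℕ} {M : Type*} [TopologicalSpace M] [ChartedSpace (EuclideanSpace ℝ (Fin d)) M]
  [IsManifold (𝓡 d) ∞ M] {U : Set M}
  {q p : M} {A A' : Fin d → Fin m ⊕ Fin n → Fin m ⊕ Fin n → M → ℝ}
  {h h' : Fin m ⊕ Fin n → Fin m ⊕ Fin n → M → ℝ} {Φ : M → LocPol d m n →ₐ[ℝ] LocPol d m n}
  (t : CoordChange q p U A A' h h' Φ)

theorem scalar_mul_apply {W : Type*} [Ring W] [Algebra ℝ W] {a : M → ℝ} (ha : SmoothOn d U a)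
    (f : FamAlg d W U) (x : M) : (FamAlg.scalar ha * f).1 x = a x • f.1 x := by
  rw [FamAlg.mul_apply, FamAlg.scalar_apply, smul_mul_assoc, one_mul]

/-- The second derivatives of the coordinates. -/
def hess (U : Set M) (q p : M) (k i l : Fin d) : M → ℝ :=
  U.indicator fun x => ∑ r : Fin d, sd q k (sd q i (chartCoord p r)) x * sd p r (chartCoord q l) x

include t

theorem parity_Φ {x : M} (hx : x ∈ U) (e : LocPol d m n) :
    Pol.parity (Φ x e) = Φ x (Pol.parity e) := by
  induction e using LocPol.induction with
  | scalar r => simp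
  | zs B => simp [-Fintype.sum_sum_type, parity_zsP, t.Φ_zs x hx]
  | z B => simp [-Fintype.sum_sum_type, parity_zP, t.Φ_z x hx]
  | xs i =>
    have hp : ∀ j, Pol.parity (xsP j : LocPol d m n) = -xsP j := fun j => Pol.parity_od _
    simp [hp, t.Φ_xs x hx]
  | mul a b ha hb => rw [map_mul, map_mul, ha, hb, map_mul, map_mul]
  | add a b ha hb => rw [map_add, map_add, ha, hb, map_add, map_add]

/-- Chain rule for a linear substitution: both sides are derivations with the same twist by parity,
so it is enough to compare them on the coordinates. The derivatives along z and z* are treated in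
the same way. -/
theorem odD_xsForm_Φ {x : M} (hx : x ∈ U) (i : Fin d) (e : LocPol d m n) :
    Pol.odD (xsForm i) (Φ x e) =
      ∑ k, sd q k (chartCoord p i) x • Φ x (Pol.odD (xsForm k) e) := by
  induction e using LocPol.induction with
  | scalar r => simp [Pol.odD_one]
  | zs B => simp [-Fintype.sum_sum_type, odD_zsP, t.Φ_zs x hx]
  | z B => simp [-Fintype.sum_sum_type, odD_xsForm_zP, t.Φ_z x hx]
  | xs j => simp [odD_xsForm_xsP, t.Φ_xs x hx, apply_ite (Φ x)]
  | mul a b ha hb =>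
    simp only [map_mul, Pol.odD_mul, ha, hb, t.parity_Φ hx, map_add, smul_add,
      Finset.sum_add_distrib, Finset.sum_mul, Finset.mul_sum, smul_mul_assoc, mul_smul_comm]
  | add a b ha hb => simp [ha, hb, Finset.sum_add_distrib]

theorem odD_zForm_Φ {x : M} (hx : x ∈ U) (B : Fin m ⊕ Fin n) (e : LocPol d m n) :
    Pol.odD (zForm B) (Φ x e) = ∑ C, h' B C x • Φ x (Pol.odD (zForm C) e) := by
  induction e using LocPol.induction with
  | scalar r => simp [Pol.odD_one]
  | zs B => simp [-Fintype.sum_sum_type, odD_zsP, t.Φ_zs x hx]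
  | z B => simp [-Fintype.sum_sum_type, odD_zForm_zP, t.Φ_z x hx, apply_ite (Φ x)]
  | xs j => simp [odD_zForm_xsP, t.Φ_xs x hx]
  | mul a b ha hb =>
    simp only [map_mul, Pol.odD_mul, ha, hb, t.parity_Φ hx, map_add, smul_add,
      Finset.sum_add_distrib, Finset.sum_mul, Finset.mul_sum, smul_mul_assoc, mul_smul_comm]
  | add a b ha hb => simp [ha, hb, Finset.sum_add_distrib]

theorem evD_zsForm_Φ {x : M} (hx : x ∈ U) (B : Fin m ⊕ Fin n) (e : LocPol d m n) :
    Pol.evD (zsForm B) (Φ x e) = ∑ C, h C B x • Φ x (Pol.evD (zsForm C) e) := by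
  induction e using LocPol.induction with
  | scalar r => simp [Pol.evD_one]
  | zs B => simp [-Fintype.sum_sum_type, evD_zsForm_zsP, t.Φ_zs x hx, apply_ite (Φ x)]
  | z B => simp [-Fintype.sum_sum_type, evD_zP, t.Φ_z x hx]
  | xs j => simp [evD_xsP, t.Φ_xs x hx]
  | mul a b ha hb =>
    simp only [map_mul, Pol.evD_mul, ha, hb, map_add, smul_add,
      Finset.sum_add_distrib, Finset.sum_mul, Finset.mul_sum, smul_mul_assoc, mul_smul_comm]
  | add a b ha hb => simp [ha, hb, Finset.sum_add_distrib]

theorem smoothOn_jac (l k : Fin d) : SmoothOn d U (ext U (fun l k => sd q l (chartCoord p k)) l k) :=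
  smoothOn_ext ((smoothOn_chartCoord t.dom' k).sd t.isOpen t.dom l)

theorem smoothOn_jac' (l k : Fin d) : SmoothOn d U (ext U (fun l k => sd p l (chartCoord q k)) l k) :=
  smoothOn_ext ((smoothOn_chartCoord t.dom k).sd t.isOpen t.dom' l)

theorem smoothOn_hess (k i l : Fin d) : SmoothOn d U (hess U q p k i l) := by
  exact smoothOn_indicator (contMDiffOn_finsetSum fun r _ =>
    (((smoothOn_chartCoord t.dom' r).sd t.isOpen t.dom i).sd t.isOpen t.dom k).smul
      ((smoothOn_chartCoord t.dom l).sd t.isOpen t.dom' r))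

theorem subst_zs (B : Fin m ⊕ Fin n) : t.subst (FamAlg.const (zsP B)) =
    ∑ C, FamAlg.scalar (smoothOn_ext (t.smooth_h B C)) * FamAlg.const (zsP C) := by
  ext x
  rw [FamAlg.coe_sum, subst_apply, FamAlg.const_apply]
  simp only [scalar_mul_apply, FamAlg.const_apply]
  by_cases hx : x ∈ U
  · simp only [sub_of_mem hx, t.Φ_zs x hx, ext_of_mem hx]
  · simp [sub_of_notMem hx, ext_of_notMem hx]

theorem subst_z (B : Fin m ⊕ Fin n) : t.subst (FamAlg.const (zP B)) =
    ∑ C, FamAlg.scalar (smoothOn_ext (t.smooth_h' C B)) * FamAlg.const (zP C) := by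
  ext x
  rw [FamAlg.coe_sum, subst_apply, FamAlg.const_apply]
  simp only [scalar_mul_apply, FamAlg.const_apply]
  by_cases hx : x ∈ U
  · simp only [sub_of_mem hx, t.Φ_z x hx, ext_of_mem hx]
  · simp [sub_of_notMem hx, ext_of_notMem hx]

theorem subst_xs (i : Fin d) : t.subst (FamAlg.const (xsP i)) =
    ∑ k, FamAlg.scalar (t.smoothOn_jac i k) * FamAlg.const (xsP k) := by
  ext x
  rw [FamAlg.coe_sum, subst_apply, FamAlg.const_apply]
  simp only [scalar_mul_apply, FamAlg.const_apply]
  by_cases hx : x ∈ U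
  · simp only [sub_of_mem hx, t.Φ_xs x hx, ext_of_mem hx]
  · simp [sub_of_notMem hx, ext_of_notMem hx]

theorem sum_inverse {J : Type*} [Fintype J] [DecidableEq J] {a b : J → J → M → ℝ}
    (ha : ∀ i j, SmoothOn d U (ext U a i j)) (hb : ∀ i j, SmoothOn d U (ext U b i j))
    (H : ∀ x ∈ U, ∀ B D, ∑ C, a B C x * b C D x = if B = D then 1 else 0) (B D : J) :
    ∑ C, FamAlg.scalar (ha B C) * (FamAlg.scalar (hb C D) : FamAlg d (LocPol d m n) U) =
      if B = D then 1 else 0 := by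
  ext x
  have e : ((if B = D then 1 else 0 : FamAlg d (LocPol d m n) U)).1 x = if B = D then 1 else 0 := by
    split_ifs <;> rfl
  rw [FamAlg.coe_sum, e]
  simp only [scalar_mul_apply, FamAlg.scalar_apply]
  by_cases hx : x ∈ U
  · simp only [ext_of_mem hx, smul_smul, ← Finset.sum_smul, H x hx]
    split_ifs <;> simp
  · simp [ext_of_notMem hx]

theorem scalar_sum_mul {J : Type*} [Fintype J] (s : J → M → ℝ) (hs : ∀ j, SmoothOn d U (s j))
    (f : J → FamAlg d (LocPol d m n) U) (x : M) :
    (∑ j, FamAlg.scalar (hs j) * f j).1 x = ∑ j, s j x • (f j).1 x := by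
  rw [FamAlg.coe_sum]; simp only [scalar_mul_apply]

/-- The transition operators. -/
def gOp (k : Fin d) (a : FamAlg d (LocPol d m n) U) : FamAlg d (LocPol d m n) U :=
  (locConn t.isOpen t.dom t.smooth_A).D k a + ∑ i, ∑ l, FamAlg.scalar (t.smoothOn_hess k i l) *
    ((locCoord d m n U).x l * (locCoord d m n U).θ i a)

/-- An odd element times an odd derivation is an even derivation, and the two signs from passing `a`
cancel. -/
theorem gOp_mul (k : Fin d) (a b : FamAlg d (LocPol d m n) U) :
    t.gOp k (a * b) = t.gOp k a * b + a * t.gOp k b := by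
  have h1 : ∀ i l, FamAlg.scalar (t.smoothOn_hess k i l) *
      ((locCoord d m n U).x l * (locCoord d m n U).θ i (a * b)) =
      FamAlg.scalar (t.smoothOn_hess k i l) * ((locCoord d m n U).x l * (locCoord d m n U).θ i a) * b +
      a * (FamAlg.scalar (t.smoothOn_hess k i l) *
        ((locCoord d m n U).x l * (locCoord d m n U).θ i b)) := by
    intro i l
    rw [(locCoord d m n U).θ_mul, mul_add, ← mul_assoc (_ : FamAlg d (LocPol d m n) U) (locCoord d m n U |>.par a),
      (locCoord d m n U).odd_comm ((locCoord d m n U).par_x l) ((locCoord d m n U).par a), (locCoord d m n U).par_par, mul_add,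
      ← mul_assoc a, ← (isScalar_scalar _).comm a]
    simp only [mul_assoc]
  simp only [gOp, SuperCoord.Conn.D_mul, h1, Finset.sum_add_distrib, add_mul, mul_add,
    Finset.sum_mul, Finset.mul_sum]
  abel

theorem gOp_add (k : Fin d) (a b : FamAlg d (LocPol d m n) U) :
    t.gOp k (a + b) = t.gOp k a + t.gOp k b := by
  simp only [gOp, map_add, mul_add, Finset.sum_add_distrib]
  abel

omit t in
theorem locConn_D_of_notMem {hU : IsOpen U} {hUq : U ⊆ chartDom d q}
    (hA : ∀ i B C, SmoothOn d U (A i B C)) (i : Fin d) (f : FamAlg d (LocPol d m n) U) {x : M}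
    (hx : x ∉ U) : ((locConn hU hUq hA).D i f).1 x = 0 := by
  have h1 : ((locConn hU hUq hA).D i f) = FamAlg.pd hU hUq i f +
      ∑ B, ∑ C, FamAlg.scalar (smoothOn_indicator (hA i B C)) *
        (FamAlg.const (zsP C) * FamAlg.lift (Pol.evD (zsForm B)) f -
        FamAlg.const (zP B) * FamAlg.lift (Pol.odD (zForm C)) f) := by
    rw [SuperCoord.Conn.D, LinearMap.add_apply, SuperCoord.glOp_apply]
    rfl
  have h2 : (FamAlg.pd hU hUq i f).1 x = 0 :=
    Set.indicator_of_notMem hx fun x => vecDeriv f.1 x (coordVec q i x)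
  simp only [h1, FamAlg.add_apply, FamAlg.coe_sum, scalar_mul_apply, h2,
    Set.indicator_of_notMem hx, zero_smul, Finset.sum_const_zero, add_zero]

theorem gOp_of_notMem (k : Fin d) (f : FamAlg d (LocPol d m n) U) {x : M}
    (hx : x ∉ U) : (t.gOp k f).1 x = 0 := by
  simp only [gOp, FamAlg.add_apply, FamAlg.coe_sum, scalar_mul_apply, hess,
    Set.indicator_of_notMem hx, zero_smul, Finset.sum_const_zero, add_zero,
    locConn_D_of_notMem t.smooth_A k f hx]

/-- On the momenta z* the claim is the gauge law `conn` of the connection coefficients; on the dual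
coordinates z it is the law `conn'` for the inverse matrices. -/
theorem D_subst_zs (i : Fin d) (B : Fin m ⊕ Fin n) {x : M} (hx : x ∈ U) :
    ((locConn t.isOpen t.dom' t.smooth_A').D i (t.subst (FamAlg.const (zsP B)))).1 x =
      (∑ k, FamAlg.scalar (t.smoothOn_jac' i k) * t.subst (t.gOp k (FamAlg.const (zsP B)))).1 x := by
  have hD := SuperCoord.Conn.D_y (locConn t.isOpen t.dom' t.smooth_A') i
  have hD' := fun k => SuperCoord.Conn.D_y (locConn t.isOpen t.dom t.smooth_A) k B
  have hg : ∀ k, t.gOp k (FamAlg.const (zsP B)) =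
      ∑ C, FamAlg.scalar (smoothOn_indicator (t.smooth_A k B C)) * FamAlg.const (zsP C) := by
    intro k
    have e1 : ∀ i, (locCoord d m n U).θ i (FamAlg.const (zsP B)) = 0 :=
      fun i => (locCoord d m n U).θ_y i B
    simp only [gOp, e1, mul_zero, Finset.sum_const_zero, add_zero]
    exact hD' k
  have hDy : ∀ C, (locConn t.isOpen t.dom' t.smooth_A').D i (FamAlg.const (zsP C)) =
      ∑ D, FamAlg.scalar (smoothOn_indicator (t.smooth_A' i C D)) * FamAlg.const (zsP D) := hD
  have hpd : ∀ C, ((locConn t.isOpen t.dom' t.smooth_A').pd i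
      (FamAlg.scalar (smoothOn_ext (t.smooth_h B C)))).1 x = sd p i (h B C) x • 1 := by
    intro C
    refine (FamAlg.pd_scalar t.isOpen t.dom' i _ hx).trans ?_
    rw [sd_ext t.isOpen hx]
  simp only [hg, subst_zs, map_sum, map_mul, subst_scalar, SuperCoord.Conn.D_mul,
    SuperCoord.Conn.D_scalar _ _ (isScalar_scalar _), hDy, FamAlg.coe_sum, FamAlg.add_apply,
    scalar_mul_apply, FamAlg.const_apply, ext_of_mem hx, Set.indicator_of_mem hx]
  simp only [FamAlg.mul_apply, hpd, FamAlg.const_apply, smul_mul_assoc, one_mul]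
  simp only [Finset.smul_sum, smul_smul]
  rw [Finset.sum_add_distrib, Finset.sum_comm (γ := Fin m ⊕ Fin n)]
  have e3 : ∀ k, ∑ C, ∑ D, (sd p i (chartCoord q k) x * (A k B C x * h C D x)) • (zsP D : LocPol d m n)
      = ∑ D, ∑ C, (sd p i (chartCoord q k) x * (A k B C x * h C D x)) • zsP D := fun k => Finset.sum_comm
  simp only [e3]
  rw [Finset.sum_comm (γ := Fin d), ← Finset.sum_add_distrib]
  refine Finset.sum_congr rfl fun D _ => ?_
  simp only [← Finset.sum_smul, ← add_smul, ← Finset.mul_sum, t.conn x hx i B D]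

theorem D_subst_z (i : Fin d) (B : Fin m ⊕ Fin n) {x : M} (hx : x ∈ U) :
    ((locConn t.isOpen t.dom' t.smooth_A').D i (t.subst (FamAlg.const (zP B)))).1 x =
      (∑ k, FamAlg.scalar (t.smoothOn_jac' i k) * t.subst (t.gOp k (FamAlg.const (zP B)))).1 x := by
  have hD := SuperCoord.Conn.D_z (locConn t.isOpen t.dom' t.smooth_A') i
  have hD' := fun k => SuperCoord.Conn.D_z (locConn t.isOpen t.dom t.smooth_A) k B
  have hg : ∀ k, t.gOp k (FamAlg.const (zP B)) =
      -∑ C, FamAlg.scalar (smoothOn_indicator (t.smooth_A k C B)) * FamAlg.const (zP C) := by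
    intro k
    have e1 : ∀ i, (locCoord d m n U).θ i (FamAlg.const (zP B)) = 0 :=
      fun i => (locCoord d m n U).θ_z i B
    simp only [gOp, e1, mul_zero, Finset.sum_const_zero, add_zero]
    exact hD' k
  have hDz : ∀ C, (locConn t.isOpen t.dom' t.smooth_A').D i (FamAlg.const (zP C)) =
      -∑ D, FamAlg.scalar (smoothOn_indicator (t.smooth_A' i D C)) * FamAlg.const (zP D) := hD
  have hpd : ∀ C, ((locConn t.isOpen t.dom' t.smooth_A').pd i
      (FamAlg.scalar (smoothOn_ext (t.smooth_h' C B)))).1 x = sd p i (h' C B) x • 1 := by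
    intro C
    refine (FamAlg.pd_scalar t.isOpen t.dom' i _ hx).trans ?_
    rw [sd_ext t.isOpen hx]
  simp only [hg, subst_z, map_sum, map_neg, map_mul, subst_scalar, SuperCoord.Conn.D_mul,
    SuperCoord.Conn.D_scalar _ _ (isScalar_scalar _), hDz, FamAlg.coe_sum, FamAlg.add_apply,
    scalar_mul_apply, FamAlg.const_apply, ext_of_mem hx, Set.indicator_of_mem hx,
    FamAlg.neg_apply]
  simp only [FamAlg.mul_apply, hpd, FamAlg.const_apply, smul_mul_assoc, one_mul]
  simp only [Finset.smul_sum, smul_smul, smul_neg]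
  rw [Finset.sum_add_distrib, Finset.sum_neg_distrib, Finset.sum_neg_distrib,
    Finset.sum_comm (γ := Fin m ⊕ Fin n)]
  have e3 : ∀ k, ∑ C, ∑ D, (sd p i (chartCoord q k) x * (A k C B x * h' D C x)) • (zP D : LocPol d m n)
      = ∑ D, ∑ C, (sd p i (chartCoord q k) x * (A k C B x * h' D C x)) • zP D := fun k => Finset.sum_comm
  simp only [e3]
  rw [Finset.sum_comm (γ := Fin d), ← sub_eq_add_neg, ← Finset.sum_sub_distrib,
    ← Finset.sum_neg_distrib]
  refine Finset.sum_congr rfl fun D _ => ?_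
  rw [Finset.sum_comm (γ := Fin d)]
  simp only [← Finset.sum_smul, ← sub_smul, ← neg_smul]
  congr 1
  have hc := t.conn' x hx i D B
  have e4 : ∑ C, h' D C x * ∑ k, sd p i (chartCoord q k) x * A k C B x =
    ∑ C, ∑ k, sd p i (chartCoord q k) x * (A k C B x * h' D C x) := by
    refine Finset.sum_congr rfl fun C _ => ?_
    rw [Finset.mul_sum]
    exact Finset.sum_congr rfl fun k _ => by ring
  have e5 : ∑ C, h' C B x * A' i D C x = ∑ C, A' i D C x * h' C B x :=
    Finset.sum_congr rfl fun C _ => by ring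
  rw [e4] at hc
  rw [e5]
  linarith

/-- The x* are constant for the connection, so only the derivative of the Jacobian matters. The
Hessian operator in `gOp` is made to reproduce it. -/
theorem D_subst_xs (i : Fin d) (j : Fin d) {x : M} (hx : x ∈ U) :
    ((locConn t.isOpen t.dom' t.smooth_A').D i (t.subst (FamAlg.const (xsP j)))).1 x =
      (∑ k, FamAlg.scalar (t.smoothOn_jac' i k) * t.subst (t.gOp k (FamAlg.const (xsP j)))).1 x := by
  have hD := SuperCoord.Conn.D_x (locConn t.isOpen t.dom' t.smooth_A') i
  have hD' := fun k => SuperCoord.Conn.D_x (locConn t.isOpen t.dom t.smooth_A) k j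
  have hg : ∀ k, t.gOp k (FamAlg.const (xsP j)) =
      ∑ l, FamAlg.scalar (t.smoothOn_hess k j l) * FamAlg.const (xsP l) := by
    intro k
    have e1 : ∀ i, (locCoord d m n U).θ i (FamAlg.const (xsP j)) = if i = j then 1 else 0 :=
      fun i => (locCoord d m n U).θ_x i j
    simp only [gOp, e1, mul_ite, mul_one, mul_zero]
    rw [Finset.sum_comm]
    simp only [Finset.sum_ite_eq', Finset.mem_univ, if_true]
    erw [hD' k, zero_add]
    rfl
  have hDx : ∀ C, (locConn t.isOpen t.dom' t.smooth_A').D i (FamAlg.const (xsP C)) = 0 := hD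
  have hpd : ∀ C, ((locConn t.isOpen t.dom' t.smooth_A').pd i
      (FamAlg.scalar (t.smoothOn_jac j C))).1 x = sd p i (sd q j (chartCoord p C)) x • 1 := by
    intro C
    refine (FamAlg.pd_scalar t.isOpen t.dom' i _ hx).trans ?_
    rw [sd_ext t.isOpen hx]
  simp only [hg, subst_xs, map_sum, map_mul, subst_scalar, SuperCoord.Conn.D_mul,
    SuperCoord.Conn.D_scalar _ _ (isScalar_scalar _), hDx, FamAlg.coe_sum, FamAlg.add_apply,
    scalar_mul_apply, FamAlg.const_apply, ext_of_mem hx, mul_zero, add_zero, hess,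
    Set.indicator_of_mem hx]
  simp only [FamAlg.mul_apply, hpd, FamAlg.const_apply, smul_mul_assoc, one_mul]
  simp only [Finset.smul_sum, smul_smul]
  -- The inverse Jacobian inside `hess` cancels the Jacobian by which the substitution acts on x*,
  -- leaving the bare second derivatives.
  have e3 : ∀ k : Fin d, ∑ l : Fin d, ∑ r : Fin d, (sd p i (chartCoord q k) x * ((∑ r : Fin d,
      sd q k (sd q j (chartCoord p r)) x * sd p r (chartCoord q l) x) *
      sd q l (chartCoord p r) x)) • (xsP r : LocPol d m n) =
      ∑ r, (sd p i (chartCoord q k) x * sd q k (sd q j (chartCoord p r)) x) • xsP r := by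
    intro k
    rw [Finset.sum_comm]
    refine Finset.sum_congr rfl fun r _ => ?_
    rw [← Finset.sum_smul, ← Finset.mul_sum]
    congr 2
    simp only [Finset.sum_mul, mul_assoc]
    rw [Finset.sum_comm]
    simp only [← Finset.mul_sum, ← sd_eq_sum (t.dom hx), sd_chartCoord (t.dom' hx)]
    simp
  simp only [e3]
  rw [Finset.sum_comm]
  refine Finset.sum_congr rfl fun r _ => ?_
  rw [sd_eq_sum (t.dom hx), Finset.sum_smul]

/-- Both sides are derivations along the substitution, so `twisted_ext` reduces the claim to
scalars, where it is the chain rule, and to the coordinates. Off U both sides vanish. -/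
theorem D_subst (i : Fin d) (a : FamAlg d (LocPol d m n) U) :
    (locConn t.isOpen t.dom' t.smooth_A').D i (t.subst a) =
      ∑ k, FamAlg.scalar (t.smoothOn_jac' i k) * t.subst (t.gOp k a) := by
  have off : ∀ a, ∀ x ∉ U, ((locConn t.isOpen t.dom' t.smooth_A').D i (t.subst a)).1 x = 
      (∑ k, FamAlg.scalar (t.smoothOn_jac' i k) * t.subst (t.gOp k a)).1 x := by
    intro a x hx
    rw [locConn_D_of_notMem _ _ _ hx, FamAlg.coe_sum]
    simp only [scalar_mul_apply, subst_apply, t.gOp_of_notMem _ _ hx, map_zero, smul_zero,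
      Finset.sum_const_zero]
  refine FamAlg.twisted_ext (τ := id) (Φ := t.subst)
    (T := fun a => (locConn t.isOpen t.dom' t.smooth_A').D i (t.subst a))
    (T' := fun a => ∑ k, FamAlg.scalar (t.smoothOn_jac' i k) * t.subst (t.gOp k a))
    ?_ ?_ ?_ ?_ ?_ ?_ ?_ ?_ a
  · intro a b
    simp only [map_mul, SuperCoord.Conn.D_mul, id]
  · intro a b
    simp only [gOp_mul, map_add, map_mul, mul_add, Finset.sum_add_distrib, Finset.sum_mul,
      Finset.mul_sum, id, mul_assoc]
    congr 1
    refine Finset.sum_congr rfl fun k _ => ?_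
    rw [← mul_assoc, (isScalar_scalar _).comm, mul_assoc]
  · intro a b; simp only [map_add]
  · intro a b; simp only [gOp_add, map_add, mul_add, Finset.sum_add_distrib]
  · intro a ha
    ext x
    by_cases hx : x ∈ U
    swap
    · exact off _ x hx
    rw [FamAlg.coe_sum, t.subst_scalar, SuperCoord.Conn.D_scalar _ _ (isScalar_scalar _)]
    simp only [scalar_mul_apply, subst_apply, gOp, SuperCoord.Conn.D_scalar _ _ (isScalar_scalar _),
      (isScalar_scalar _).θ, mul_zero, Finset.sum_const_zero, add_zero]
    have e := fun k => FamAlg.pd_scalar (W := LocPol d m n) t.isOpen t.dom k ha hx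
    refine (FamAlg.pd_scalar t.isOpen t.dom' i ha hx).trans ?_
    rw [sd_eq_sum (t.dom hx), Finset.sum_smul]
    refine Finset.sum_congr rfl fun k _ => ?_
    erw [e k]
    rw [ext_of_mem hx, map_smul, map_one, smul_smul]
  · intro B
    ext x
    by_cases hx : x ∈ U
    · exact t.D_subst_zs i B hx
    · exact off _ x hx
  · intro B
    ext x
    by_cases hx : x ∈ U
    · exact t.D_subst_z i B hx
    · exact off _ x hx
  · intro j
    ext x
    by_cases hx : x ∈ U
    · exact t.D_subst_xs i j hx
    · exact off _ x hx

/-- The transition between the two coordinate systems. -/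
def transition : SuperCoord.Transition (locConn t.isOpen t.dom t.smooth_A)
    (locConn t.isOpen t.dom' t.smooth_A') t.subst where
  j k i := FamAlg.scalar (t.smoothOn_jac k i)
  J i k := FamAlg.scalar (t.smoothOn_jac' i k)
  h B C := FamAlg.scalar (smoothOn_ext (t.smooth_h B C))
  h' B C := FamAlg.scalar (smoothOn_ext (t.smooth_h' B C))
  g k i l := FamAlg.scalar (t.smoothOn_hess k i l)
  j_scalar k i := isScalar_scalar _
  J_scalar i k := isScalar_scalar _
  h_scalar B C := isScalar_scalar _
  h'_scalar B C := isScalar_scalar _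
  g_scalar k i l := isScalar_scalar _
  j_J k l := t.sum_inverse t.smoothOn_jac t.smoothOn_jac' (fun x hx B D => by
    rw [← sd_eq_sum (t.dom' hx), sd_chartCoord (t.dom hx)]) k l
  h_h' B D := t.sum_inverse (fun i j => smoothOn_ext (t.smooth_h i j))
    (fun i j => smoothOn_ext (t.smooth_h' i j)) t.h_h' B D
  h'_h B D := t.sum_inverse (fun i j => smoothOn_ext (t.smooth_h' i j))
    (fun i j => smoothOn_ext (t.smooth_h i j)) t.h'_h B D
  Φ_y B := t.subst_zs B
  Φ_z B := t.subst_z B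
  g_symm k i l := by
    ext x
    rw [FamAlg.scalar_apply, FamAlg.scalar_apply]
    congr 1
    by_cases hx : x ∈ U
    · rw [hess, hess, Set.indicator_of_mem hx, Set.indicator_of_mem hx]
      exact Finset.sum_congr rfl fun r _ => by
        rw [sd_comm t.isOpen t.dom hx (smoothOn_chartCoord t.dom' r)]
    · rw [hess, hess, Set.indicator_of_notMem hx, Set.indicator_of_notMem hx]
  J_symm i k l := by
    refine Subtype.ext ((pdFam_smul_const t.isOpen i (t.smoothOn_jac' k l) 1).trans
      (.trans ?_ (pdFam_smul_const t.isOpen k (t.smoothOn_jac' i l) 1).symm))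
    funext x
    by_cases hx : x ∈ U
    · rw [Set.indicator_of_mem hx, Set.indicator_of_mem hx, sd_ext t.isOpen hx, sd_ext t.isOpen hx,
        sd_comm t.isOpen t.dom' hx (smoothOn_chartCoord t.dom l)]
    · rw [Set.indicator_of_notMem hx, Set.indicator_of_notMem hx]
  θ_Φ i a := by
    ext x
    rw [t.scalar_sum_mul]
    change Pol.odD (xsForm i) (sub U Φ x (a.1 x)) = ∑ k, _ • sub U Φ x (Pol.odD (xsForm k) (a.1 x))
    by_cases hx : x ∈ U
    · simp only [sub_of_mem hx, ext_of_mem hx, t.odD_xsForm_Φ hx]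
    · simp [sub_of_notMem hx, ext_of_notMem hx]
  ζ_Φ B a := by
    ext x
    rw [t.scalar_sum_mul]
    change Pol.odD (zForm B) (sub U Φ x (a.1 x)) = ∑ k, _ • sub U Φ x (Pol.odD (zForm k) (a.1 x))
    by_cases hx : x ∈ U
    · simp only [sub_of_mem hx, ext_of_mem hx, t.odD_zForm_Φ hx]
    · simp [-Fintype.sum_sum_type, sub_of_notMem hx, ext_of_notMem hx]
  χ_Φ B a := by
    ext x
    rw [t.scalar_sum_mul]
    change Pol.evD (zsForm B) (sub U Φ x (a.1 x)) = ∑ k, _ • sub U Φ x (Pol.evD (zsForm k) (a.1 x))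
    by_cases hx : x ∈ U
    · simp only [sub_of_mem hx, ext_of_mem hx, t.evD_zsForm_Φ hx]
    · simp [-Fintype.sum_sum_type, sub_of_notMem hx, ext_of_notMem hx]
  D_Φ i a := t.D_subst i a

theorem LQ_subst {S : FamAlg d (LocPol d m n) U} (hS : (locCoord d m n U).par S = S)
    (f : FamAlg d (LocPol d m n) U) :
    (locConn t.isOpen t.dom' t.smooth_A').LQ (t.subst S) (t.subst f) =
      t.subst ((locConn t.isOpen t.dom t.smooth_A).LQ S f) :=
  t.transition.LQ_Φ hS f

end CoordChange

theorem Pol.map_map {L₁ L₂ X L₁' L₂' X' L₁'' L₂'' X'' : Type*} [AddCommGroup L₁] [Module ℝ L₁]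
    [AddCommGroup L₂] [Module ℝ L₂] [AddCommGroup X] [Module ℝ X] [AddCommGroup L₁'] [Module ℝ L₁']
    [AddCommGroup L₂'] [Module ℝ L₂'] [AddCommGroup X'] [Module ℝ X'] [AddCommGroup L₁'']
    [Module ℝ L₁''] [AddCommGroup L₂''] [Module ℝ L₂''] [AddCommGroup X''] [Module ℝ X'']
    (f₁ : L₁ →ₗ[ℝ] L₁') (g₁ : L₁' →ₗ[ℝ] L₁) (f₂ : L₂ →ₗ[ℝ] L₂') (g₂ : L₂' →ₗ[ℝ] L₂)
    (f : X →ₗ[ℝ] X') (f₁' : L₁' →ₗ[ℝ] L₁'') (g₁' : L₁'' →ₗ[ℝ] L₁') (f₂' : L₂' →ₗ[ℝ] L₂'')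
    (g₂' : L₂'' →ₗ[ℝ] L₂') (f' : X' →ₗ[ℝ] X'') (a : Pol L₁ L₂ X) :
    Pol.map f₁' g₁' f₂' g₂' f' (Pol.map f₁ g₁ f₂ g₂ f a) =
      Pol.map (f₁' ∘ₗ f₁) (g₁ ∘ₗ g₁') (f₂' ∘ₗ f₂) (g₂ ∘ₗ g₂') (f' ∘ₗ f) a := by
  have : (Pol.map f₁' g₁' f₂' g₂' f').comp (Pol.map f₁ g₁ f₂ g₂ f) =
      Pol.map (f₁' ∘ₗ f₁) (g₁ ∘ₗ g₁') (f₂' ∘ₗ f₂) (g₂ ∘ₗ g₂') (f' ∘ₗ f) :=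
    Pol.algHom_ext (fun v => by simp) (fun w => by simp [LinearMap.comp_assoc])
  exact DFunLike.congr_fun this a

theorem Pol.map_id {L₁ L₂ X : Type*} [AddCommGroup L₁] [Module ℝ L₁]
    [AddCommGroup L₂] [Module ℝ L₂] [AddCommGroup X] [Module ℝ X] (a : Pol L₁ L₂ X) :
    Pol.map LinearMap.id LinearMap.id LinearMap.id LinearMap.id LinearMap.id a = a := by
  have : Pol.map LinearMap.id LinearMap.id LinearMap.id LinearMap.id LinearMap.id =
      AlgHom.id ℝ (Pol L₁ L₂ X) :=
    Pol.algHom_ext (fun v => by simp) (fun w => by simp)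
  exact DFunLike.congr_fun this a

/-! ### The preferred coordinates at different points -/

section Charts

variable {d m n : ℕ} {M : Type*} [TopologicalSpace M] [ChartedSpace (EuclideanSpace ℝ (Fin d)) M]
  [IsManifold (𝓡 d) ∞ M]

/-- The gauge law once more, with frame p expanded in frame q while the direction stays in the chart
at p. It governs the coordinates z, which are dual to the frame. -/
theorem connCoeff_trans' {r : ℕ} {V : M → Type*} [TopologicalSpace (TotalSpace (Fin r → ℝ) V)]
    [∀ p, AddCommGroup (V p)] [∀ p, Module ℝ (V p)] [∀ p, TopologicalSpace (V p)]
    [FiberBundle (Fin r → ℝ) V] [VectorBundle ℝ (Fin r → ℝ) V]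
    [ContMDiffVectorBundle ∞ (Fin r → ℝ) V (𝓡 d)]
    [∀ p, IsTopologicalAddGroup (V p)] [∀ p, ContinuousSMul ℝ (V p)]
    (cov : CovariantDerivative (𝓡 d) (Fin r → ℝ) V) {q p x : M} {U : Set M}
    (hU : IsOpen U) (hxU : x ∈ U) (hUp : U ⊆ frameDom r V p)
    (hUq : U ⊆ frameDom r V q) (hq : x ∈ chartDom d q) (i : Fin d) (a b : Fin r) :
    sd p i (trans V p q a b) x +
      ∑ c, trans V p q a c x * ∑ k, sd p i (chartCoord q k) x * connCoeff cov q k c b x =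
      ∑ c, connCoeff cov p i a c x * trans V p q c b x := by
  have h1 := cov_eq_sum cov (hUq hxU) hU hxU hUq ((contMDiffOn_frame V p a).mono hUp)
    (coordVec p i x)
  have h2 := congrArg (fun w => comps r q x w b) h1
  simp only [map_sum, map_add, map_smul, Finset.sum_apply, Pi.add_apply, Pi.smul_apply,
    smul_eq_mul, comps_frame (hUq hxU), Finset.sum_add_distrib] at h2
  have h3 : ∑ c, mvfderiv (𝓡 d) (fun y => comps r q y (frame (V := V) p a y) c) x (coordVec p i x) *
      (Pi.single c 1 : Fin r → ℝ) b = sd p i (trans V p q a b) x := by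
    simp [Pi.single_apply, sd]; rfl
  rw [h3, add_comm, comps_eq_sum_trans (hUp hxU)] at h2
  refine Eq.trans ?_ h2.symm
  congr 1
  refine Finset.sum_congr rfl fun c _ => ?_
  rw [coordVec_eq_sum (p := p) hq i]
  simp only [map_sum, map_smul, Finset.sum_apply, Pi.smul_apply, smul_eq_mul]
  rfl

variable {E : M → Type*} [TopologicalSpace (TotalSpace (Fin m → ℝ) E)]
  [∀ p, AddCommGroup (E p)] [∀ p, Module ℝ (E p)] [∀ p, TopologicalSpace (E p)]
  [FiberBundle (Fin m → ℝ) E] [VectorBundle ℝ (Fin m → ℝ) E]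
  {F : M → Type*} [TopologicalSpace (TotalSpace (Fin n → ℝ) F)]
  [∀ p, AddCommGroup (F p)] [∀ p, Module ℝ (F p)] [∀ p, TopologicalSpace (F p)]
  [FiberBundle (Fin n → ℝ) F] [VectorBundle ℝ (Fin n → ℝ) F]

variable (d m n E F) in
/-- The domain of the preferred coordinates at `q`. -/
def dom (q : M) : Set M := chartDom d q ∩ (frameDom m E q ∩ frameDom n F q)

theorem isOpen_dom (q : M) : IsOpen (dom d m n E F q) :=
  (chartAt (EuclideanSpace ℝ (Fin d)) q).open_source.inter
    ((trivializationAt (Fin m → ℝ) E q).open_baseSet.inter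
      (trivializationAt (Fin n → ℝ) F q).open_baseSet)

theorem mem_dom (q : M) : q ∈ dom d m n E F q :=
  ⟨mem_chart_source _ q, FiberBundle.mem_baseSet_trivializationAt' q, FiberBundle.mem_baseSet_trivializationAt' q⟩

/-- The components of a tangent vector in the preferred chart. -/
abbrev tcomps (q x : M) : TangentSpace (𝓡 d) x →ₗ[ℝ] EuclideanSpace ℝ (Fin d) :=
  (trivializationAt (EuclideanSpace ℝ (Fin d)) (TangentSpace (𝓡 d) : M → Type _) q).linearMapAt ℝ x

/-- The tangent vector with given components. -/
abbrev tsymm (q x : M) : EuclideanSpace ℝ (Fin d) →ₗ[ℝ] TangentSpace (𝓡 d) x :=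
  (trivializationAt (EuclideanSpace ℝ (Fin d)) (TangentSpace (𝓡 d) : M → Type _) q).symmₗ ℝ x

/-- The vector with given components. -/
abbrev csymm {r : ℕ} (V : M → Type*) [TopologicalSpace (TotalSpace (Fin r → ℝ) V)]
    [∀ p, AddCommGroup (V p)] [∀ p, Module ℝ (V p)] [∀ p, TopologicalSpace (V p)]
    [FiberBundle (Fin r → ℝ) V] [VectorBundle ℝ (Fin r → ℝ) V] (q x : M) :
    (Fin r → ℝ) →ₗ[ℝ] V x := (trivializationAt (Fin r → ℝ) V q).symmₗ ℝ x

variable (m n E F) in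
/-- The expression of a function over `x` in the preferred coordinates at `q`. -/
def toRep (q x : M) : Pol (E x) (F x) (TangentSpace (𝓡 d) x) →ₐ[ℝ] LocPol d m n :=
  Pol.map (comps m q x) (csymm E q x) (comps n q x) (csymm F q x) (tcomps q x)

variable (m n E F) in
/-- The function over `x` with a given expression in the preferred coordinates at `q`. -/
def ofRep (q x : M) : LocPol d m n →ₐ[ℝ] Pol (E x) (F x) (TangentSpace (𝓡 d) x) :=
  Pol.map (csymm E q x) (comps m q x) (csymm F q x) (comps n q x) (tsymm q x)

variable (m n E F) in
/-- The change of coordinates from `q` to `p`. -/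
def chg (q p x : M) : LocPol d m n →ₐ[ℝ] LocPol d m n := (toRep m n E F p x).comp (ofRep m n E F q x)

variable (m n) in
/-- The expression of `f` in the preferred coordinates at `q`. -/
def rep (f : PreFun (d := d) E F) (q x : M) : LocPol d m n := toRep m n E F q x (toPol (f x))

theorem toPol_localRep (f : PreFun (d := d) E F) (q x : M) :
    toPol (localRep m n f q x) = rep m n f q x := rfl

theorem csymm_comp_comps {r : ℕ} {V : M → Type*} [TopologicalSpace (TotalSpace (Fin r → ℝ) V)]
    [∀ p, AddCommGroup (V p)] [∀ p, Module ℝ (V p)] [∀ p, TopologicalSpace (V p)]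
    [FiberBundle (Fin r → ℝ) V] [VectorBundle ℝ (Fin r → ℝ) V] {q x : M}
    (hx : x ∈ frameDom r V q) : csymm V q x ∘ₗ comps r q x = LinearMap.id :=
  LinearMap.ext ((trivializationAt (Fin r → ℝ) V q).symmₗ_linearMapAt hx)

theorem comps_comp_csymm {r : ℕ} {V : M → Type*} [TopologicalSpace (TotalSpace (Fin r → ℝ) V)]
    [∀ p, AddCommGroup (V p)] [∀ p, Module ℝ (V p)] [∀ p, TopologicalSpace (V p)]
    [FiberBundle (Fin r → ℝ) V] [VectorBundle ℝ (Fin r → ℝ) V] {q x : M}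
    (hx : x ∈ frameDom r V q) : comps r q x ∘ₗ csymm V q x = LinearMap.id :=
  LinearMap.ext ((trivializationAt (Fin r → ℝ) V q).linearMapAt_symmₗ hx)

theorem tsymm_comp_tcomps {q x : M} (hx : x ∈ chartDom d q) :
    tsymm q x ∘ₗ tcomps (d := d) q x = LinearMap.id :=
  LinearMap.ext ((trivializationAt (EuclideanSpace ℝ (Fin d)) (TangentSpace (𝓡 d) : M → Type _)
    q).symmₗ_linearMapAt (mem_tangent_baseSet hx))

theorem tcomps_comp_tsymm {q x : M} (hx : x ∈ chartDom d q) :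
    tcomps q x ∘ₗ tsymm (d := d) q x = LinearMap.id :=
  LinearMap.ext ((trivializationAt (EuclideanSpace ℝ (Fin d)) (TangentSpace (𝓡 d) : M → Type _)
    q).linearMapAt_symmₗ (mem_tangent_baseSet hx))

variable {q p x : M}

theorem ofRep_toRep (hx : x ∈ dom d m n E F q) (a : Pol (E x) (F x) (TangentSpace (𝓡 d) x)) :
    ofRep m n E F q x (toRep m n E F q x a) = a := by
  rw [ofRep, toRep, Pol.map_map, csymm_comp_comps hx.2.1, csymm_comp_comps hx.2.2,
    tsymm_comp_tcomps hx.1, Pol.map_id]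

theorem toRep_ofRep (hx : x ∈ dom d m n E F q) (a : LocPol d m n) :
    toRep m n E F q x (ofRep m n E F q x a) = a := by
  rw [ofRep, toRep, Pol.map_map, comps_comp_csymm hx.2.1, comps_comp_csymm hx.2.2,
    tcomps_comp_tsymm hx.1, Pol.map_id]

theorem chg_rep (hx : x ∈ dom d m n E F q) (p : M) (f : PreFun (d := d) E F) :
    chg m n E F q p x (rep m n f q x) = rep m n f p x := by
  rw [chg, AlgHom.comp_apply, rep, ofRep_toRep hx, rep]

theorem chg_eq (q p x : M) : chg m n E F q p x = Pol.map (comps m p x ∘ₗ csymm E q x)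
    (comps m q x ∘ₗ csymm E p x) (comps n p x ∘ₗ csymm F q x) (comps n q x ∘ₗ csymm F p x)
    (tcomps p x ∘ₗ tsymm (d := d) q x) := by
  ext a
  exact Pol.map_map _ _ _ _ _ _ _ _ _ _ a

theorem chg_mem_fil (q p x : M) {k l r : ℤ} {a : LocPol d m n} (ha : a ∈ Pol.fil k l r) :
    chg m n E F q p x a ∈ Pol.fil k l r := by
  rw [chg_eq]; exact Pol.map_mem_fil _ _ _ _ _ ha

variable (E F) in
/-- The matrices of the change of frames. -/
def chgMat (q p : M) : Fin m ⊕ Fin n → Fin m ⊕ Fin n → M → ℝ := blk (trans E q p) (trans F q p)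

theorem blk_sum_mul {f f' : Fin m → Fin m → M → ℝ} {g g' : Fin n → Fin n → M → ℝ} (x : M)
    (B D : Fin m ⊕ Fin n) : ∑ C, blk f g B C x * blk f' g' C D x =
      blk (fun a b x => ∑ c, f a c x * f' c b x) (fun a b x => ∑ c, g a c x * g' c b x) B D x := by
  cases B <;> cases D <;> simp [blk]

theorem chgMat_mul (hp : x ∈ dom d m n E F p) (hq : x ∈ dom d m n E F q) (B D : Fin m ⊕ Fin n) :
    ∑ C, chgMat E F q p B C x * chgMat E F p q C D x = if B = D then 1 else 0 := by
  rw [chgMat, chgMat, blk_sum_mul]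
  cases B <;> cases D <;>
    simp [blk, trans_mul_trans hp.2.1, trans_mul_trans hp.2.2, trans_self hq.2.1, trans_self hq.2.2]

variable [ContMDiffVectorBundle ∞ (Fin m → ℝ) E (𝓡 d)]
  [ContMDiffVectorBundle ∞ (Fin n → ℝ) F (𝓡 d)]

theorem smoothOn_chgMat (q p : M) (B C : Fin m ⊕ Fin n) :
    SmoothOn d (dom d m n E F q ∩ dom d m n E F p) (chgMat E F q p B C) :=
  smoothOn_blk (fun a b => smoothOn_trans ((isOpen_dom q).inter (isOpen_dom p))
      (fun _ hx => hx.1.2.1) (fun _ hx => hx.2.2.1) a b)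
    (fun a b => smoothOn_trans ((isOpen_dom q).inter (isOpen_dom p))
      (fun _ hx => hx.1.2.2) (fun _ hx => hx.2.2.2) a b) B C

variable [∀ p, IsTopologicalAddGroup (E p)] [∀ p, ContinuousSMul ℝ (E p)]
  [∀ p, IsTopologicalAddGroup (F p)] [∀ p, ContinuousSMul ℝ (F p)]
  (covE : CovariantDerivative (𝓡 d) (Fin m → ℝ) E)
  (covF : CovariantDerivative (𝓡 d) (Fin n → ℝ) F)

/-- The connection coefficients in the preferred coordinates at `q`. -/
def conn (q : M) (i : Fin d) : Fin m ⊕ Fin n → Fin m ⊕ Fin n → M → ℝ :=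
  blk (connCoeff covE q i) (connCoeff covF q i)

variable [T2Space M] (hcovE : CovariantDerivative.ContMDiffCovariantDerivative covE ∞)
    (hcovF : CovariantDerivative.ContMDiffCovariantDerivative covF ∞)
include hcovE hcovF

theorem smoothOn_conn (q : M) (i : Fin d) (B C : Fin m ⊕ Fin n) :
    SmoothOn d (dom d m n E F q) (conn covE covF q i B C) :=
  smoothOn_blk (fun a b => (smoothOn_connCoeff covE hcovE q i a b).mono fun _ hx => ⟨hx.1, hx.2.1⟩)
    (fun a b => (smoothOn_connCoeff covF hcovF q i a b).mono fun _ hx => ⟨hx.1, hx.2.2⟩) B C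

/-- The z* are frame vectors and the z linear forms on the fibres, so they transform by inverse
matrices. The blocks that mix E and F are zero for the frames and for the connection, and there both
gauge laws reduce to the derivative of a constant. -/
theorem coordChange (q p : M) : CoordChange q p (dom d m n E F q ∩ dom d m n E F p)
    (conn covE covF q) (conn covE covF p) (chgMat E F q p) (chgMat E F p q) (chg m n E F q p) where
  isOpen := (isOpen_dom q).inter (isOpen_dom p)
  dom _ hx := hx.1.1
  dom' _ hx := hx.2.1
  smooth_A i B C := (smoothOn_conn covE covF hcovE hcovF q i B C).mono Set.inter_subset_left
  smooth_A' i B C := (smoothOn_conn covE covF hcovE hcovF p i B C).mono Set.inter_subset_right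
  smooth_h := smoothOn_chgMat q p
  smooth_h' B C := by rw [Set.inter_comm]; exact smoothOn_chgMat p q B C
  h_h' x hx := chgMat_mul hx.2 hx.1
  h'_h x hx := chgMat_mul hx.1 hx.2
  Φ_zs x hx B := by
    rw [chg_eq]
    cases B with
    | inl a =>
      simp only [Fintype.sum_sum_type, chgMat, blk, Pi.zero_apply, zero_smul, Finset.sum_const_zero, add_zero,
        zsP_inl, Pol.map_ev, ← map_smul, ← map_sum]
      congr 1
      refine Prod.ext ?_ ?_
      · ext b; simp [Prod.fst_sum, Pi.single_apply, trans, frame]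
      · simp [Prod.snd_sum]
    | inr a =>
      simp only [Fintype.sum_sum_type, chgMat, blk, Pi.zero_apply, zero_smul, Finset.sum_const_zero, zero_add,
        zsP_inr, Pol.map_ev, ← map_smul, ← map_sum]
      congr 1
      refine Prod.ext ?_ ?_
      · simp [Prod.fst_sum]
      · ext b; simp [Prod.snd_sum, Pi.single_apply, trans, frame]
  Φ_z x hx B := by
    rw [chg_eq]
    cases B with
    | inl a =>
      simp only [Fintype.sum_sum_type, chgMat, blk, Pi.zero_apply, zero_smul, Finset.sum_const_zero, add_zero,
        zP_inl, Pol.map_od, ← map_smul, ← map_sum]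
      congr 1
      refine Prod.ext ?_ (Prod.ext ?_ ?_)
      · refine LinearMap.pi_ext' fun i => LinearMap.ext_ring ?_
        simp [Prod.fst_sum, Pi.single_apply, trans, frame]
      · simp [Prod.snd_sum, Prod.fst_sum]
      · simp [Prod.snd_sum]
    | inr a =>
      simp only [Fintype.sum_sum_type, chgMat, blk, Pi.zero_apply, zero_smul, Finset.sum_const_zero, zero_add,
        zP_inr, Pol.map_od, ← map_smul, ← map_sum]
      congr 1
      refine Prod.ext ?_ (Prod.ext ?_ ?_)
      · simp [Prod.fst_sum]
      · refine LinearMap.pi_ext' fun i => LinearMap.ext_ring ?_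
        simp [Prod.snd_sum, Prod.fst_sum, Pi.single_apply, trans, frame]
      · simp [Prod.snd_sum]
  Φ_xs x hx i := by
    rw [chg_eq, xsP, Pol.map_od]
    simp only [xsP, ← map_smul, ← map_sum]
    congr 1
    refine Prod.ext ?_ (Prod.ext ?_ ?_)
    · simp [Prod.fst_sum]
    · simp [Prod.snd_sum, Prod.fst_sum]
    · ext k
      have h := mvfderiv_chartCoord (q := p) hx.2.1 k (coordVec q i x)
      simp only [Prod.snd_sum, Prod.smul_snd]
      simp [Pi.single_apply]
      exact h.symm
  conn x hx i B D := by
    have hU : IsOpen (dom d m n E F q ∩ dom d m n E F p) := (isOpen_dom q).inter (isOpen_dom p)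
    have h0 : sd p i (0 : M → ℝ) x = 0 := DFunLike.congr_fun (mvfderiv_const (c := (0 : ℝ))) _
    rcases B with a | a <;> rcases D with b | b
    · simpa [conn, chgMat, blk] using connCoeff_trans covE hU hx (fun _ hx => hx.2.2.1)
        (fun _ hx => hx.1.2.1) hx.1.1 i a b
    · simpa [conn, chgMat, blk] using h0
    · simpa [conn, chgMat, blk] using h0
    · simpa [conn, chgMat, blk] using connCoeff_trans covF hU hx (fun _ hx => hx.2.2.2)
        (fun _ hx => hx.1.2.2) hx.1.1 i a b
  conn' x hx i B D := by
    have hU : IsOpen (dom d m n E F q ∩ dom d m n E F p) := (isOpen_dom q).inter (isOpen_dom p)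
    have h0 : sd p i (0 : M → ℝ) x = 0 := DFunLike.congr_fun (mvfderiv_const (c := (0 : ℝ))) _
    rcases B with a | a <;> rcases D with b | b
    · simpa [conn, chgMat, blk] using connCoeff_trans' covE hU hx (fun _ hx => hx.2.2.1)
        (fun _ hx => hx.1.2.1) hx.1.1 i a b
    · simpa [conn, chgMat, blk] using h0
    · simpa [conn, chgMat, blk] using h0
    · simpa [conn, chgMat, blk] using connCoeff_trans' covF hU hx (fun _ hx => hx.2.2.2)
        (fun _ hx => hx.1.2.2) hx.1.1 i a b

end Charts

/-! ### The leading term of the bracket -/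

section LeadingTerm

variable {d m n : ℕ}

theorem mem_fil_of_le {L₁ L₂ X : Type*} [AddCommGroup L₁] [Module ℝ L₁]
    [AddCommGroup L₂] [Module ℝ L₂] [AddCommGroup X] [Module ℝ X] {k l r k' l' r' : ℤ}
    {a : Pol L₁ L₂ X} (ha : a ∈ Pol.fil k l r) (hk : k = k') (hl : l = l') (hr : r' ≤ r) :
    a ∈ Pol.fil k' l' r' := by
  subst hk hl; exact Pol.fil_mono hr ha

theorem mem_fil_of_gr {L₁ L₂ X : Type*} [AddCommGroup L₁] [Module ℝ L₁]
    [AddCommGroup L₂] [Module ℝ L₂] [AddCommGroup X] [Module ℝ X] {k l r : ℤ}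
    {a : Pol L₁ L₂ X} (ha : a ∈ Pol.gr (k, l, r)) : a ∈ Pol.fil k l r := Pol.gr_le_fil le_rfl ha

/-- The ghost number of `z^A`. -/
def ghw : Fin m ⊕ Fin n → ℤ := Sum.elim (fun _ => -1) (fun _ => 1)
/-- The resolution degree of `z^A`. -/
def rew : Fin m ⊕ Fin n → ℤ := Sum.elim (fun _ => 1) (fun _ => 0)

variable {k l r : ℤ} {f : LocPol d m n}

theorem zP_mem (B : Fin m ⊕ Fin n) : (zP B : LocPol d m n) ∈ Pol.fil 0 (ghw B) (rew B) := by
  cases B with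
  | inl a => exact mem_fil_of_gr (Pol.eta_mem_gr _)
  | inr a => exact mem_fil_of_gr (Pol.c_mem_gr _)

theorem zsP_mem (B : Fin m ⊕ Fin n) :
    (zsP B : LocPol d m n) ∈ Pol.fil 1 (1 - ghw B) (1 - rew B) := by
  cases B with
  | inl a => exact mem_fil_of_gr (Pol.etaStar_mem_gr _)
  | inr a => exact mem_fil_of_gr (Pol.cStar_mem_gr _)

theorem odD_zForm_inl (a : Fin m) :
    (Pol.odD (zForm (.inl a)) : LocPol d m n →ₗ[ℝ] _) = Pol.dη (Pi.single a 1) := rfl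
theorem odD_zForm_inr (a : Fin n) :
    (Pol.odD (zForm (.inr a)) : LocPol d m n →ₗ[ℝ] _) = Pol.dc (Pi.single a 1) := rfl
theorem evD_zsForm_inl (a : Fin m) :
    (Pol.evD (zsForm (.inl a)) : LocPol d m n →ₗ[ℝ] _) = Pol.dηs (LinearMap.proj a) := rfl
theorem evD_zsForm_inr (a : Fin n) :
    (Pol.evD (zsForm (.inr a)) : LocPol d m n →ₗ[ℝ] _) = Pol.dcs (LinearMap.proj a) := rfl

theorem odD_zForm_mem (hf : f ∈ Pol.fil k l r) (B : Fin m ⊕ Fin n) :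
    Pol.odD (zForm B) f ∈ Pol.fil k (l - ghw B) (r - rew B) := by
  cases B with
  | inl a =>
    rw [odD_zForm_inl]
    have h := (Pol.shifts_dη (Pi.single a 1)).fil hf
    exact mem_fil_of_le h (by simp) (by simp [ghw]) (by simp [rew])
  | inr a =>
    rw [odD_zForm_inr]
    have h := (Pol.shifts_dc (Pi.single a 1)).fil hf
    exact mem_fil_of_le h (by simp) (by simp [ghw]; omega) (by simp [rew])

theorem evD_zsForm_mem (hf : f ∈ Pol.fil k l r) (B : Fin m ⊕ Fin n) :
    Pol.evD (zsForm B) f ∈ Pol.fil (k - 1) (l - 1 + ghw B) (r - 1 + rew B) := by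
  cases B with
  | inl a =>
    rw [evD_zsForm_inl]
    have h := (Pol.shifts_dηs (LinearMap.proj a)).fil hf
    exact mem_fil_of_le h (by omega) (by simp [ghw]; omega) (by simp [rew])
  | inr a =>
    rw [evD_zsForm_inr]
    have h := (Pol.shifts_dcs (LinearMap.proj a)).fil hf
    exact mem_fil_of_le h (by omega) (by simp [ghw]) (by simp [rew])

theorem odD_xsForm_mem (hf : f ∈ Pol.fil k l r) (i : Fin d) :
    Pol.odD (xsForm i) f ∈ Pol.fil (k - 1) (l - 1) r :=
  mem_fil_of_le ((Pol.shifts_dxs _).fil hf) (by omega) (by omega) (by omega)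

/-- Block diagonal matrices. -/
def IsBlk (A : Fin m ⊕ Fin n → Fin m ⊕ Fin n → ℝ) : Prop :=
  ∀ B C, A B C = 0 ∨ (ghw B = ghw C ∧ rew B = rew C)

theorem isBlk_blk {M : Type*} (f : Fin m → Fin m → M → ℝ) (g : Fin n → Fin n → M → ℝ) (x : M) :
    IsBlk fun B C => blk f g B C x := by
  intro B C
  cases B <;> cases C <;> simp [blk, ghw, rew]

/-- A block diagonal matrix replaces a coordinate by another of the same degrees. Covariant
derivatives therefore preserve the ghost degree and the resolution filtration. -/
theorem covP_mem {A : Fin m ⊕ Fin n → Fin m ⊕ Fin n → ℝ} (hA : IsBlk A) {f' : LocPol d m n}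
    (hf : f ∈ Pol.fil k l r) (hf' : f' ∈ Pol.fil k l r) : covP A f f' ∈ Pol.fil k l r := by
  refine add_mem hf' (sum_mem fun B _ => sum_mem fun C _ => ?_)
  rcases hA B C with h | ⟨h1, h2⟩
  · rw [h, zero_smul]; exact zero_mem _
  refine Submodule.smul_mem _ _ (sub_mem ?_ ?_)
  · exact mem_fil_of_le (Pol.mul_mem_fil (zsP_mem C) (evD_zsForm_mem hf B)) (by omega) (by omega)
      (by omega)
  · exact mem_fil_of_le (Pol.mul_mem_fil (zP_mem B) (odD_zForm_mem hf C)) (by omega) (by omega)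
      (by omega)

/-- The part of the bracket that does not differentiate along the base. -/
def vertP (S f : LocPol d m n) : LocPol d m n :=
  ∑ B, (Pol.evD (zsForm B) S * Pol.odD (zForm B) f + Pol.odD (zForm B) S * Pol.evD (zsForm B) f)

theorem vertP_add (S f g : LocPol d m n) : vertP S (f + g) = vertP S f + vertP S g := by
  simp only [vertP, map_add, mul_add, ← Finset.sum_add_distrib]
  exact Finset.sum_congr rfl fun _ _ => by abel

theorem vertP_smul (S f : LocPol d m n) (a : ℝ) : vertP S (a • f) = a • vertP S f := by
  simp only [vertP, map_smul, mul_smul_comm, ← smul_add, Finset.smul_sum]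

theorem sub_vertP (S S' f : LocPol d m n) : vertP (S - S') f = vertP S f - vertP S' f := by
  simp only [vertP, map_sub, sub_mul, ← Finset.sum_sub_distrib]
  exact Finset.sum_congr rfl fun _ _ => by abel

/-- The resolution degrees of z^A and z*_A add up to 1, and each summand differentiates once along
either of them. This is the only way in which the bracket lowers the degree. -/
theorem vertP_mem {s : ℤ} {S : LocPol d m n} (hS : S ∈ Pol.fil 1 2 s) (hf : f ∈ Pol.fil k l r) :
    vertP S f ∈ Pol.fil k (l + 1) (r + s - 1) := by
  refine sum_mem fun B _ => add_mem ?_ ?_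
  · exact mem_fil_of_le (Pol.mul_mem_fil (evD_zsForm_mem hS B) (odD_zForm_mem hf B)) (by omega)
      (by omega) (by omega)
  · exact mem_fil_of_le (Pol.mul_mem_fil (odD_zForm_mem hS B) (evD_zsForm_mem hf B)) (by omega)
      (by omega) (by omega)

/-- Every remaining term contains a derivative along x*, which leaves the resolution degree alone,
combined with a covariant derivative or with the curvature. The curvature function even has
resolution degree 1. -/
theorem braP_sub_vertP_mem {A : Fin d → Fin m ⊕ Fin n → Fin m ⊕ Fin n → ℝ}
    {K : Fin d → Fin d → Fin m ⊕ Fin n → Fin m ⊕ Fin n → ℝ} (hA : ∀ i, IsBlk (A i))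
    (hK : ∀ i j, IsBlk (K i j)) {S : LocPol d m n} {S' f' : Fin d → LocPol d m n}
    (hS : S ∈ Pol.fil 1 2 0) (hS' : ∀ i, S' i ∈ Pol.fil 1 2 0)
    (hf : f ∈ Pol.fil k l r) (hf' : ∀ i, f' i ∈ Pol.fil k l r) :
    braP A K S S' f f' - vertP S f ∈ Pol.fil k (l + 1) r := by
  have e : ∀ a b c : LocPol d m n, a + b + c - b = c + a := fun a b c => by abel
  rw [braP, vertP, e]
  refine add_mem (sum_mem fun i _ => sum_mem fun j _ => ?_) (sum_mem fun i _ =>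
    sub_mem (neg_mem ?_) ?_)
  · have hρ : (∑ B, ∑ C, K i j B C • (zP B * zsP C) : LocPol d m n) ∈ Pol.fil 1 1 1 := by
      refine sum_mem fun B _ => sum_mem fun C _ => ?_
      rcases hK i j B C with h | ⟨h1, h2⟩
      · rw [h, zero_smul]; exact zero_mem _
      · exact Submodule.smul_mem _ _ (mem_fil_of_le (Pol.mul_mem_fil (zP_mem B) (zsP_mem C))
          (by omega) (by omega) (by omega))
    exact mem_fil_of_le (Pol.mul_mem_fil (Pol.mul_mem_fil (odD_xsForm_mem hS i) hρ)
      (odD_xsForm_mem hf j)) (by omega) (by omega) (by omega)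
  · exact mem_fil_of_le (Pol.mul_mem_fil (odD_xsForm_mem hS i) (covP_mem (hA i) hf (hf' i)))
      (by omega) (by omega) (by omega)
  · exact mem_fil_of_le (Pol.mul_mem_fil (covP_mem (hA i) hS (hS' i)) (odD_xsForm_mem hf i))
      (by omega) (by omega) (by omega)

theorem fil_neg_one_le {L₁ L₂ X : Type*} [AddCommGroup L₁] [Module ℝ L₁]
    [AddCommGroup L₂] [Module ℝ L₂] [AddCommGroup X] [Module ℝ X] {k l : ℤ} :
    (Pol.fil k l (-1) : Submodule ℝ (Pol L₁ L₂ X)) ≤ Pol.fil k l 0 := by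
  refine Pol.fil_le fun r hr => ?_
  rcases hr.lt_or_eq with hr | rfl
  · exact Pol.gr_le_fil hr
  · rw [Pol.gr_eq_bot (Or.inl (by norm_num))]; exact bot_le

/-- The contraction over A is invariant and no matrix gets differentiated. Local solutions found in
different coordinates can therefore be compared pointwise. -/
theorem CoordChange.vertP_Φ {M : Type*} [TopologicalSpace M]
    [ChartedSpace (EuclideanSpace ℝ (Fin d)) M] [IsManifold (𝓡 d) ∞ M] {U : Set M}
    {q p : M} {A A' : Fin d → Fin m ⊕ Fin n → Fin m ⊕ Fin n → M → ℝ}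
    {h h' : Fin m ⊕ Fin n → Fin m ⊕ Fin n → M → ℝ} {Φ : M → LocPol d m n →ₐ[ℝ] LocPol d m n}
    (t : CoordChange q p U A A' h h' Φ) {x : M} (hx : x ∈ U) (S f : LocPol d m n) :
    vertP (Φ x S) (Φ x f) = Φ x (vertP S f) := by
  have key : ∀ (P Q : Fin m ⊕ Fin n → LocPol d m n),
      ∑ B, (∑ C, h C B x • P C) * (∑ D, h' B D x • Q D) = ∑ C, P C * Q C ∧
      ∑ B, (∑ D, h' B D x • Q D) * (∑ C, h C B x • P C) = ∑ C, Q C * P C := by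
    intro P Q
    have e : ∀ C D, ∑ B, h C B x * h' B D x = if C = D then 1 else 0 := t.h_h' x hx
    constructor
    · simp only [Finset.sum_mul_sum, smul_mul_smul_comm]
      rw [Finset.sum_comm]
      refine Finset.sum_congr rfl fun C _ => ?_
      rw [Finset.sum_comm]
      simp only [← Finset.sum_smul, e, ite_smul, one_smul, zero_smul, Finset.sum_ite_eq,
        Finset.mem_univ, if_true]
    · simp only [Finset.sum_mul_sum, smul_mul_smul_comm]
      rw [Finset.sum_comm]
      refine Finset.sum_congr rfl fun C _ => ?_
      rw [Finset.sum_comm]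
      simp only [mul_comm (h' _ _ _), ← Finset.sum_smul, e, ite_smul, one_smul, zero_smul,
        Finset.sum_ite_eq', Finset.mem_univ, if_true]
  simp only [vertP, t.odD_zForm_Φ hx, t.evD_zsForm_Φ hx, Finset.sum_add_distrib, map_add, map_sum,
    map_mul, (key _ _).1, (key _ _).2]

/-- A linear form that vanishes on Y vanishes along the family near x, hence on its derivative; Y is
the common kernel of these forms. -/
theorem vecDeriv_mem {M : Type*} [TopologicalSpace M]
    [ChartedSpace (EuclideanSpace ℝ (Fin d)) M] [IsManifold (𝓡 d) ∞ M] {W : Type*} [AddCommGroup W]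
    [Module ℝ W] {f : M → W} {U : Set M} (hU : IsOpen U) (hf : f ∈ Fam d W U) {Y : Submodule ℝ W}
    {x : M} (hx : x ∈ U) (hY : ∀ᶠ y in nhds x, f y ∈ Y) (v : TangentSpace (𝓡 d) x) :
    vecDeriv f x v ∈ Y := by
  refine (Subspace.forall_mem_dualAnnihilator_apply_eq_zero_iff Y _).1 fun φ hφ => ?_
  rw [← (Fam.hasVecDeriv hU hf hx v φ).2]
  have : (fun q => φ (f q)) =ᶠ[nhds x] fun _ => (0 : ℝ) := by
    filter_upwards [hY] with y hy using (Submodule.mem_dualAnnihilator φ).1 hφ _ hy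
  rw [mvfderiv_congr this, mvfderiv_const]; rfl

end LeadingTerm

/-! ### The homological vector field in coordinates -/

section Local

variable {d m n : ℕ} {M : Type*} [TopologicalSpace M] [ChartedSpace (EuclideanSpace ℝ (Fin d)) M]
  [IsManifold (𝓡 d) ∞ M] {W : Type*} [AddCommGroup W] [Module ℝ W] {U : Set M} {f g : M → W}

theorem Fam.indicator (hf : f ∈ Fam d W U) : U.indicator f ∈ Fam d W U := by
  have h1 : SmoothOn d U (U.indicator fun _ => (1 : ℝ)) := smoothOn_indicator contMDiffOn_const
  have : U.indicator f = fun x => U.indicator (fun _ => (1 : ℝ)) x • f x := by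
    funext x
    by_cases hx : x ∈ U
    · simp [hx]
    · simp [hx]
  rw [this]
  exact Fam.smul h1 hf

theorem vecDeriv_congr {x : M} (h : f =ᶠ[nhds x] g) (v : TangentSpace (𝓡 d) x) :
    vecDeriv f x v = vecDeriv g x v := by
  have : HasVecDeriv f x v = HasVecDeriv g x v := by
    funext w
    exact propext ⟨fun hf => hf.congr h.symm, fun hg => hg.congr h⟩
  unfold vecDeriv
  rw [this]

theorem indicator_eventuallyEq {x : M} (hU : IsOpen U) (hx : x ∈ U) (f : M → W) :
    U.indicator f =ᶠ[nhds x] f := by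
  filter_upwards [hU.mem_nhds hx] with y hy using Set.indicator_of_mem hy f

/-- A family, extended by zero. -/
def indFam {F : M → LocPol d m n} (hF : F ∈ Fam d (LocPol d m n) U) : FamAlg d (LocPol d m n) U :=
  ⟨U.indicator F, Fam.indicator hF⟩

theorem locConn_LQ_eq_braP {q : M} (hU : IsOpen U) (hUq : U ⊆ chartDom d q)
    {A : Fin d → Fin m ⊕ Fin n → Fin m ⊕ Fin n → M → ℝ} (hA : ∀ i B C, SmoothOn d U (A i B C))
    (S f : FamAlg d (LocPol d m n) U) {x : M} (hx : x ∈ U) {S' f' : M → LocPol d m n}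
    (hS : S' =ᶠ[nhds x] S.1) (hf : f' =ᶠ[nhds x] f.1) : ((locConn hU hUq hA).LQ S f).1 x =
      braP (fun i B C => A i B C x) (curvP q A x) (S' x)
        (fun i => vecDeriv S' x (coordVec q i x)) (f' x)
        (fun i => vecDeriv f' x (coordVec q i x)) := by
  rw [locConn_LQ_apply hU hUq hA S f hx, hS.eq_of_nhds, hf.eq_of_nhds]
  simp only [vecDeriv_congr hS, vecDeriv_congr hf]

end Local

/-! ### Global functions and their bracket in a fixed coordinate system -/

section Global

variable {d m n : ℕ} {M : Type*} [TopologicalSpace M] [ChartedSpace (EuclideanSpace ℝ (Fin d)) M]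
  [IsManifold (𝓡 d) ∞ M]
  {E : M → Type*} [TopologicalSpace (TotalSpace (Fin m → ℝ) E)]
  [∀ p, AddCommGroup (E p)] [∀ p, Module ℝ (E p)] [∀ p, TopologicalSpace (E p)]
  [FiberBundle (Fin m → ℝ) E] [VectorBundle ℝ (Fin m → ℝ) E]
  {F : M → Type*} [TopologicalSpace (TotalSpace (Fin n → ℝ) F)]
  [∀ p, AddCommGroup (F p)] [∀ p, Module ℝ (F p)] [∀ p, TopologicalSpace (F p)]
  [FiberBundle (Fin n → ℝ) F] [VectorBundle ℝ (Fin n → ℝ) F]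
  {q p x : M} {f g S : PreFun (d := d) E F}

theorem toPol_ofLocal (p : M) (w : LocAlg d m n) : toPol (ofLocal p w) =
    ofRep m n E F p p (toPol w) := rfl

theorem ext_rep (h : ∀ x, rep m n f x x = rep m n g x x) : f = g := by
  funext x
  have := congrArg (ofRep m n E F x x) (h x)
  rw [rep, rep, ofRep_toRep (mem_dom x), ofRep_toRep (mem_dom x)] at this
  exact toPol.injective this

theorem rep_mem {k l r : ℤ} (hf : toPol (f x) ∈ Pol.fil k l r) (q : M) :
    rep m n f q x ∈ Pol.fil k l r := Pol.map_mem_fil _ _ _ _ _ hf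

theorem toPol_mem {k l r : ℤ} (hx : x ∈ dom d m n E F q) (hf : rep m n f q x ∈ Pol.fil k l r) :
    toPol (f x) ∈ Pol.fil k l r := by
  rw [← ofRep_toRep hx (toPol (f x))]
  exact Pol.map_mem_fil _ _ _ _ _ hf

theorem rep_zero (q x : M) : rep m n (0 : PreFun (d := d) E F) q x = 0 := by
  rw [rep, Pi.zero_apply, map_zero, map_zero]

theorem mem_smoothFun {k : ℕ} {l : ℤ} (hd : ∀ p, toPol (f p) ∈ Pol.fil k l 0)
    (hs : ∀ (q : M) (φ : Dual ℝ (LocPol d m n)), SmoothOn d (dom d m n E F q) fun x => φ (rep m n f q x)) :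
    f ∈ smoothFun m n E F k l := by
  refine ⟨fun q φ => ?_, fun p => Pol.mem_bihomog_iff.2 (hd p)⟩
  exact (hs q (φ ∘ₗ toPol.symm.toLinearMap)).contMDiffAt ((isOpen_dom q).mem_nhds (mem_dom q))

theorem smoothFun_fil {k : ℕ} {l : ℤ} (hf : f ∈ smoothFun m n E F k l) (x : M) :
    toPol (f x) ∈ Pol.fil k l 0 := Pol.mem_bihomog_iff.1 (hf.2 x)

theorem bracket_zero_left [∀ p, IsTopologicalAddGroup (E p)] [∀ p, ContinuousSMul ℝ (E p)]
    [∀ p, IsTopologicalAddGroup (F p)] [∀ p, ContinuousSMul ℝ (F p)]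
    (covE : CovariantDerivative (𝓡 d) (Fin m → ℝ) E)
    (covF : CovariantDerivative (𝓡 d) (Fin n → ℝ) F) (g : PreFun (d := d) E F) :
    bracket covE covF 0 g = 0 ∧ bracket covE covF g 0 = 0 := by
  have h0 : ∀ q, localRep m n (0 : PreFun (d := d) E F) q = fun _ => 0 := by
    intro q; funext x; rw [localRep, Pi.zero_apply, map_zero]
  have h1 : ∀ (x : M) (v : TangentSpace (𝓡 d) x), vecDeriv (fun _ : M => (0 : LocAlg d m n)) x v = 0 := by
    intro x v
    refine HasVecDeriv.vecDeriv_eq fun φ => ⟨mdifferentiableAt_const, ?_⟩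
    rw [mvfderiv_const, map_zero]; rfl
  constructor
  · funext p
    have : ∀ u, coordDerivR (0 : LocAlg d m n) (fun _ => 0) u = 0 := by
      intro u; cases u <;> simp [coordDerivR]
    simp only [bracket, h0, h1, this, zero_mul, Finset.sum_const_zero]
    exact map_zero _
  · funext p
    have : ∀ u, coordDerivL (0 : LocAlg d m n) (fun _ => 0) u = 0 := by
      intro u; cases u <;> simp [coordDerivL]
    simp only [bracket, h0, h1, this, mul_zero, Finset.sum_const_zero]
    exact map_zero _

variable [ContMDiffVectorBundle ∞ (Fin m → ℝ) E (𝓡 d)]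
  [ContMDiffVectorBundle ∞ (Fin n → ℝ) F (𝓡 d)]
  [∀ p, IsTopologicalAddGroup (E p)] [∀ p, ContinuousSMul ℝ (E p)]
  [∀ p, IsTopologicalAddGroup (F p)] [∀ p, ContinuousSMul ℝ (F p)]
  (covE : CovariantDerivative (𝓡 d) (Fin m → ℝ) E)
  (covF : CovariantDerivative (𝓡 d) (Fin n → ℝ) F)
  [T2Space M] (hcovE : CovariantDerivative.ContMDiffCovariantDerivative covE ∞)
    (hcovF : CovariantDerivative.ContMDiffCovariantDerivative covF ∞)
include hcovE hcovF

theorem smoothOn_chg (q p : M) (e : LocPol d m n) (φ : Dual ℝ (LocPol d m n)) :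
    SmoothOn d (dom d m n E F q ∩ dom d m n E F p) fun x => φ (chg m n E F q p x e) :=
  (Fam.smooth ((coordChange covE covF hcovE hcovF q p).sub_mem e) φ).congr fun x hx => by
    rw [CoordChange.sub_of_mem hx]

/-- Both the substitution and its argument vary with the point. Expanding the argument in a basis of
a finite-dimensional space separates the two dependences. -/
theorem contMDiffAt_chg {Y : Submodule ℝ (LocPol d m n)} [FiniteDimensional ℝ Y] {h : M → LocPol d m n}
    (hY : ∀ᶠ x in nhds p, h x ∈ Y)
    (hh : ∀ φ : Dual ℝ (LocPol d m n), ContMDiffAt (𝓡 d) 𝓘(ℝ, ℝ) ∞ (fun x => φ (h x)) p)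
    (q q' : M) (hp : p ∈ dom d m n E F q) (hp' : p ∈ dom d m n E F q') (φ : Dual ℝ (LocPol d m n)) :
    ContMDiffAt (𝓡 d) 𝓘(ℝ, ℝ) ∞ (fun x => φ (chg m n E F q q' x (h x))) p := by
  let b := Module.finBasis ℝ Y
  choose ψ hψ using fun j => (b.coord j).exists_extend
  have h1 : (fun x => φ (chg m n E F q q' x (h x))) =ᶠ[nhds p]
      fun x => ∑ j, ψ j (h x) * φ (chg m n E F q q' x (b j)) := by
    filter_upwards [hY] with x hx
    have h2 := congrArg Subtype.val (b.sum_repr ⟨h x, hx⟩)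
    simp only [Submodule.coe_sum, Submodule.coe_smul] at h2
    have h3 : ∀ j, b.repr ⟨h x, hx⟩ j = ψ j (h x) :=
      fun j => (DFunLike.congr_fun (hψ j) ⟨h x, hx⟩).symm
    simp only [h3] at h2
    conv_lhs => rw [← h2]
    simp only [map_sum, map_smul, smul_eq_mul]
  refine ContMDiffAt.congr_of_eventuallyEq ?_ h1
  refine contMDiffAt_finsetSum fun j _ => (hh (ψ j)).smul ?_
  exact (smoothOn_chg covE covF hcovE hcovF q q' (b j) φ).contMDiffAt
    (((isOpen_dom q).inter (isOpen_dom q')).mem_nhds ⟨hp, hp'⟩)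

/-- `IsSmooth` tests the expression in the coordinates at p only near p itself. The transition to
the coordinates at q carries this over to every point of their domain. -/
theorem smoothOn_rep {k : ℕ} {l : ℤ} (hf : f ∈ smoothFun m n E F k l) (q : M)
    (φ : Dual ℝ (LocPol d m n)) : SmoothOn d (dom d m n E F q) fun x => φ (rep m n f q x) := by
  intro p hp
  have := Pol.finiteDimensional_fil (L₁ := Fin m → ℝ) (L₂ := Fin n → ℝ)
    (X := EuclideanSpace ℝ (Fin d)) k l 0
  have h := contMDiffAt_chg covE covF hcovE hcovF
    (Filter.Eventually.of_forall fun x => rep_mem (smoothFun_fil hf x) p)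
    (fun φ => hf.1 p (φ ∘ₗ toPol.toLinearMap)) p q (mem_dom p) hp φ
  refine (h.congr_of_eventuallyEq ?_).contMDiffWithinAt
  filter_upwards [(isOpen_dom p).mem_nhds (mem_dom (d := d) (m := m) (n := n) (E := E) (F := F) p)] with x hx
  rw [chg_rep hx]

theorem rep_mem_Fam {k : ℕ} {l : ℤ} (hf : f ∈ smoothFun m n E F k l) (q : M) :
    rep m n f q ∈ Fam d (LocPol d m n) (dom d m n E F q) := by
  have := Pol.finiteDimensional_fil (L₁ := Fin m → ℝ) (L₂ := Fin n → ℝ)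
    (X := EuclideanSpace ℝ (Fin d)) k l 0
  exact mem_Fam_of_finiteDimensional (fun x => rep_mem (smoothFun_fil hf x) q)
    (smoothOn_rep covE covF hcovE hcovF hf q)

theorem toPol_vecDeriv {k : ℕ} {l : ℤ} (hf : f ∈ smoothFun m n E F k l) (q : M)
    (hx : x ∈ dom d m n E F q) (v : TangentSpace (𝓡 d) x) :
    toPol (vecDeriv (localRep m n f q) x v) = vecDeriv (rep m n f q) x v := by
  have h := Fam.hasVecDeriv (isOpen_dom q) (rep_mem_Fam covE covF hcovE hcovF hf q) hx v
  have h2 := h.map toPol.symm.toLinearMap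
  have h3 : (fun y => toPol.symm.toLinearMap (rep m n f q y)) = localRep m n f q := by
    funext y; exact toPol.symm_apply_apply _
  rw [h3] at h2
  rw [h2.vecDeriv_eq]
  exact toPol.apply_symm_apply _

/-- The connection in the preferred coordinates at `q`. -/
def lconn (q : M) : (locCoord d m n (dom d m n E F q)).Conn :=
  locConn (isOpen_dom q) (fun _ h => h.1) (smoothOn_conn covE covF hcovE hcovF q)

omit hcovE hcovF in
theorem sumCurvCoeff_eq (x : M) :
    sumCurvCoeff covE covF x = curvP x (conn covE covF x) x := by
  funext i j B C
  rcases B with a | a <;> rcases C with b | b <;>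
    simp [sumCurvCoeff, curvP, conn, blk, curvCoeff, sd]

omit hcovE hcovF in
theorem sumConnCoeff_eq (x : M) :
    sumConnCoeff covE covF x = fun i B C => conn covE covF x i B C x := by
  funext i B C
  rcases B with a | a <;> rcases C with b | b <;> rfl

variable {k₀ k : ℕ} {l₀ l : ℤ}

theorem rep_bracket_self (hS : S ∈ smoothFun m n E F k₀ l₀) (hp : Even l₀)
    (hf : f ∈ smoothFun m n E F k l) (x : M) :
    rep m n (bracket covE covF S f) x x =
      braP (fun i B C => conn covE covF x i B C x) (curvP x (conn covE covF x) x) (rep m n S x x)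
        (fun i => vecDeriv (rep m n S x) x (coordVec x i x)) (rep m n f x x)
        (fun i => vecDeriv (rep m n f x) x (coordVec x i x)) := by
  have hpar : Pol.parity (toPol (localRep m n S x x)) = toPol (localRep m n S x x) := by
    have h := Pol.parity_of_mem_fil (rep_mem (m := m) (n := n) (smoothFun_fil hS x) x)
    rwa [hp.neg_one_zpow, one_smul] at h
  rw [rep, bracket, toPol_ofLocal, toRep_ofRep (mem_dom x), sum_coordBracket _ _ _ _ _ _ hpar]
  simp only [toPol_vecDeriv covE covF hcovE hcovF hS x (mem_dom x),
    toPol_vecDeriv covE covF hcovE hcovF hf x (mem_dom x), toPol_localRep,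
    sumConnCoeff_eq, sumCurvCoeff_eq]

/-- The definition of the bracket uses different coordinates at each point. Invariance allows one
coordinate system to be used on its whole domain, without which the bracket could not be
differentiated again. -/
theorem rep_bracket (hS : S ∈ smoothFun m n E F k₀ l₀) (hp : Even l₀)
    (hf : f ∈ smoothFun m n E F k l) (hx : x ∈ dom d m n E F q) :
    rep m n (bracket covE covF S f) q x =
      braP (fun i B C => conn covE covF q i B C x) (curvP q (conn covE covF q) x) (rep m n S q x)
        (fun i => vecDeriv (rep m n S q) x (coordVec q i x)) (rep m n f q x)
        (fun i => vecDeriv (rep m n f q) x (coordVec q i x)) := by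
  have t := coordChange covE covF hcovE hcovF x q
  have hxU : x ∈ dom d m n E F x ∩ dom d m n E F q := ⟨mem_dom x, hx⟩
  have mS : rep m n S x ∈ Fam d (LocPol d m n) (dom d m n E F x ∩ dom d m n E F q) :=
    Fam.mono Set.inter_subset_left (rep_mem_Fam covE covF hcovE hcovF hS x)
  have mf : rep m n f x ∈ Fam d (LocPol d m n) (dom d m n E F x ∩ dom d m n E F q) :=
    Fam.mono Set.inter_subset_left (rep_mem_Fam covE covF hcovE hcovF hf x)
  have hpar : (locCoord d m n (dom d m n E F x ∩ dom d m n E F q)).par (indFam mS) = indFam mS := by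
    refine Subtype.ext (funext fun y => ?_)
    change Pol.parity (Set.indicator _ _ y) = Set.indicator _ _ y
    by_cases hy : y ∈ dom d m n E F x ∩ dom d m n E F q
    · rw [Set.indicator_of_mem hy, Pol.parity_of_mem_fil (rep_mem (smoothFun_fil hS y) x),
        hp.neg_one_zpow, one_smul]
    · rw [Set.indicator_of_notMem hy, map_zero]
  have h1 := congrFun (congrArg Subtype.val (t.LQ_subst hpar (indFam mf))) x
  -- Near x the expression at q is the substituted expression at x. An identity of germs is required
  -- since the bracket differentiates along the base.
  have hsub : ∀ {g : PreFun (d := d) E F} (hg : rep m n g x ∈ Fam d (LocPol d m n)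
      (dom d m n E F x ∩ dom d m n E F q)), rep m n g q =ᶠ[nhds x] (t.subst (indFam hg)).1 := by
    intro g hg
    filter_upwards [t.isOpen.mem_nhds hxU] with y hy
    rw [t.subst_apply, CoordChange.sub_of_mem hy]
    change _ = chg m n E F x q y (Set.indicator _ _ y)
    rw [Set.indicator_of_mem hy, chg_rep hy.1]
  have h2 := locConn_LQ_eq_braP t.isOpen t.dom' t.smooth_A' (t.subst (indFam mS)) (t.subst (indFam mf)) hxU
    (hsub mS) (hsub mf)
  have h3 := locConn_LQ_eq_braP t.isOpen t.dom t.smooth_A (indFam mS) (indFam mf) hxU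
    (indicator_eventuallyEq t.isOpen hxU _).symm (indicator_eventuallyEq t.isOpen hxU _).symm
  rw [← h2, h1, t.subst_apply, CoordChange.sub_of_mem hxU, h3,
    ← rep_bracket_self covE covF hcovE hcovF hS hp hf, chg_rep (mem_dom x)]

theorem rep_bracket_eq_LQ (hS : S ∈ smoothFun m n E F k₀ l₀) (hp : Even l₀)
    (hf : f ∈ smoothFun m n E F k l) (hx : x ∈ dom d m n E F q) :
    rep m n (bracket covE covF S f) q x =
      ((lconn covE covF hcovE hcovF q).LQ (indFam (rep_mem_Fam covE covF hcovE hcovF hS q))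
        (indFam (rep_mem_Fam covE covF hcovE hcovF hf q))).1 x := by
  rw [rep_bracket covE covF hcovE hcovF hS hp hf hx]
  exact (locConn_LQ_eq_braP _ _ _ _ _ hx (indicator_eventuallyEq (isOpen_dom q) hx _).symm
    (indicator_eventuallyEq (isOpen_dom q) hx _).symm).symm

end Global

/-! ### The differential `Q` -/

section Local

variable {d m n : ℕ} {M : Type*} [TopologicalSpace M] [ChartedSpace (EuclideanSpace ℝ (Fin d)) M]
  [IsManifold (𝓡 d) ∞ M] {U : Set M} {q : M}

theorem isBlk_curvP {f : Fin d → Fin m → Fin m → M → ℝ} {g : Fin d → Fin n → Fin n → M → ℝ}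
    (x : M) (i j : Fin d) : IsBlk (curvP q (fun i => blk (f i) (g i)) x i j) := by
  have h0 : ∀ i : Fin d, sd q i (0 : M → ℝ) x = 0 := fun i =>
    DFunLike.congr_fun (mvfderiv_const (c := (0 : ℝ))) (coordVec q i x)
  intro B C
  rcases B with a | a <;> rcases C with b | b <;> simp [curvP, blk, h0, ghw, rew]

/-- With S extended by zero and the derivatives along the base cut off, nothing survives off U. This
turns (S, S) = 0 on U into an identity in the whole algebra of families, the form `LQ_LQ` needs. -/
theorem locConn_LQ_of_notMem (hU : IsOpen U) (hUq : U ⊆ chartDom d q)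
    {A : Fin d → Fin m ⊕ Fin n → Fin m ⊕ Fin n → M → ℝ} (hA : ∀ i B C, SmoothOn d U (A i B C))
    {S : FamAlg d (LocPol d m n) U} (f : FamAlg d (LocPol d m n) U) {x : M} (hx : x ∉ U)
    (hS : S.1 x = 0) : ((locConn hU hUq hA).LQ S f).1 x = 0 := by
  have h1 : ∀ i, ((locCoord d m n U).θ i S).1 x = 0 := fun i => by
    change Pol.odD (xsForm i) (S.1 x) = 0
    rw [hS, map_zero]
  have h2 : ∀ B, ((locCoord d m n U).χ B S).1 x = 0 := fun B => by
    change Pol.evD (zsForm B) (S.1 x) = 0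
    rw [hS, map_zero]
  have h3 : ∀ B, ((locCoord d m n U).ζ B S).1 x = 0 := fun B => by
    change Pol.odD (zForm B) (S.1 x) = 0
    rw [hS, map_zero]
  rw [SuperCoord.Conn.LQ_apply]
  simp only [FamAlg.add_apply, FamAlg.sub_apply, FamAlg.neg_apply, FamAlg.mul_apply,
    FamAlg.coe_sum, CoordChange.locConn_D_of_notMem hA _ _ hx, h1, h2, h3, zero_mul, neg_zero, sub_zero,
    add_zero, Finset.sum_const_zero]

end Local

section Global

variable {d m n : ℕ} {M : Type*} [TopologicalSpace M] [ChartedSpace (EuclideanSpace ℝ (Fin d)) M]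
  [IsManifold (𝓡 d) ∞ M]
  {E : M → Type*} [TopologicalSpace (TotalSpace (Fin m → ℝ) E)]
  [∀ p, AddCommGroup (E p)] [∀ p, Module ℝ (E p)] [∀ p, TopologicalSpace (E p)]
  [FiberBundle (Fin m → ℝ) E] [VectorBundle ℝ (Fin m → ℝ) E]
  {F : M → Type*} [TopologicalSpace (TotalSpace (Fin n → ℝ) F)]
  [∀ p, AddCommGroup (F p)] [∀ p, Module ℝ (F p)] [∀ p, TopologicalSpace (F p)]
  [FiberBundle (Fin n → ℝ) F] [VectorBundle ℝ (Fin n → ℝ) F]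
  {q p x : M} {f g S : PreFun (d := d) E F}
  [ContMDiffVectorBundle ∞ (Fin m → ℝ) E (𝓡 d)]
  [ContMDiffVectorBundle ∞ (Fin n → ℝ) F (𝓡 d)]
  [∀ p, IsTopologicalAddGroup (E p)] [∀ p, ContinuousSMul ℝ (E p)]
  [∀ p, IsTopologicalAddGroup (F p)] [∀ p, ContinuousSMul ℝ (F p)]
  (covE : CovariantDerivative (𝓡 d) (Fin m → ℝ) E)
  (covF : CovariantDerivative (𝓡 d) (Fin n → ℝ) F)
  [T2Space M] (hcovE : CovariantDerivative.ContMDiffCovariantDerivative covE ∞)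
    (hcovF : CovariantDerivative.ContMDiffCovariantDerivative covF ∞)
  {k : ℕ} {l : ℤ}

theorem rep_sub (q x : M) : rep m n (f - g) q x = rep m n f q x - rep m n g q x := by
  rw [rep, Pi.sub_apply, map_sub, map_sub]; rfl

theorem smoothFun_add (hf : f ∈ smoothFun m n E F k l) (hg : g ∈ smoothFun m n E F k l) :
    f + g ∈ smoothFun m n E F k l := by
  refine ⟨fun p φ => ?_, fun p => add_mem (hf.2 p) (hg.2 p)⟩
  have h := (hf.1 p φ).add (hg.1 p φ)
  refine h.congr_of_eventuallyEq (Filter.Eventually.of_forall fun x => ?_)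
  change φ (localRep m n (f + g) p x) = φ (localRep m n f p x) + φ (localRep m n g p x)
  rw [← map_add, localRep, Pi.add_apply, map_add]
  rfl

theorem smoothFun_sub (hf : f ∈ smoothFun m n E F k l) (hg : g ∈ smoothFun m n E F k l) :
    f - g ∈ smoothFun m n E F k l := by
  refine ⟨fun p φ => ?_, fun p => sub_mem (hf.2 p) (hg.2 p)⟩
  have h := (hf.1 p φ).sub (hg.1 p φ)
  refine h.congr_of_eventuallyEq (Filter.Eventually.of_forall fun x => ?_)
  change φ (localRep m n (f - g) p x) = φ (localRep m n f p x) - φ (localRep m n g p x)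
  rw [← map_sub, localRep, Pi.sub_apply, map_sub]
  rfl

include hcovE hcovF

theorem rep_bracket_sub_vertP_mem {r : ℤ} (hS : S ∈ smoothFun m n E F 1 2)
    (hf : f ∈ smoothFun m n E F k l) (hr : ∀ x, toPol (f x) ∈ Pol.fil k l r)
    (hx : x ∈ dom d m n E F q) :
    rep m n (bracket covE covF S f) q x - vertP (rep m n S q x) (rep m n f q x) ∈
      Pol.fil k (l + 1) r := by
  rw [rep_bracket covE covF hcovE hcovF hS even_two hf hx]
  refine braP_sub_vertP_mem (fun i => isBlk_blk _ _ x) (fun i j => isBlk_curvP x i j)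
    (by simpa using rep_mem (smoothFun_fil hS x) q) (fun i => ?_) (rep_mem (hr x) q) fun i => ?_
  · exact vecDeriv_mem (isOpen_dom q) (rep_mem_Fam covE covF hcovE hcovF hS q) hx
      (Filter.Eventually.of_forall fun y => by simpa using rep_mem (smoothFun_fil hS y) q) _
  · exact vecDeriv_mem (isOpen_dom q) (rep_mem_Fam covE covF hcovE hcovF hf q) hx
      (Filter.Eventually.of_forall fun y => rep_mem (hr y) q) _

/-- Smoothness holds because on each coordinate domain the bracket is a member of the algebra of
smooth families. The degree is the sum of the vertical part and the rest. -/
theorem bracket_mem (hS : S ∈ smoothFun m n E F 1 2) (hf : f ∈ smoothFun m n E F k l) :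
    bracket covE covF S f ∈ smoothFun m n E F k (l + 1) := by
  refine mem_smoothFun (fun p => toPol_mem (m := m) (n := n) (mem_dom p) ?_) fun q φ => ?_
  · have h1 := rep_bracket_sub_vertP_mem covE covF hcovE hcovF hS hf (smoothFun_fil hf) (mem_dom p)
    -- The vertical part is estimated only by resolution degree at least -1, and there is nothing of
    -- negative degree.
    have h2 := fil_neg_one_le (mem_fil_of_le (vertP_mem (d := d)
      (by simpa using rep_mem (m := m) (n := n) (smoothFun_fil hS p) p)
      (rep_mem (m := m) (n := n) (smoothFun_fil hf p) p)) rfl rfl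
      (by simp))
    have := add_mem h1 h2
    rwa [sub_add_cancel] at this
  · exact (Fam.smooth ((lconn covE covF hcovE hcovF q).LQ
        (indFam (rep_mem_Fam covE covF hcovE hcovF hS q))
        (indFam (rep_mem_Fam covE covF hcovE hcovF hf q))).2 φ).congr fun x hx => by
      rw [rep_bracket_eq_LQ covE covF hcovE hcovF hS even_two hf hx]

theorem bracket_sub (hS : S ∈ smoothFun m n E F 1 2) (hf : f ∈ smoothFun m n E F k l)
    (hg : g ∈ smoothFun m n E F k l) :
    bracket covE covF S (f - g) = bracket covE covF S f - bracket covE covF S g := by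
  refine ext_rep (m := m) (n := n) fun x => ?_
  rw [rep_sub]
  simp only [rep_bracket_eq_LQ covE covF hcovE hcovF hS even_two hf (mem_dom x),
    rep_bracket_eq_LQ covE covF hcovE hcovF hS even_two hg (mem_dom x),
    rep_bracket_eq_LQ covE covF hcovE hcovF hS even_two (smoothFun_sub hf hg) (mem_dom x),
    ← FamAlg.sub_apply, ← map_sub]
  refine congrArg (fun a => ((lconn covE covF hcovE hcovF x).LQ _ a).1 x) ?_
  refine Subtype.ext (funext fun y => ?_)
  change (dom d m n E F x).indicator (rep m n (f - g) x) y =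
    (dom d m n E F x).indicator (rep m n f x) y - (dom d m n E F x).indicator (rep m n g x) y
  by_cases hy : y ∈ dom d m n E F x
  · simp only [Set.indicator_of_mem hy, rep_sub]
  · simp only [Set.indicator_of_notMem hy, sub_zero]

/-- The Jacobi identity `LQ_LQ` in the coordinates at x. The inner bracket is identified with the
local operator on a whole neighbourhood of x, since the outer one differentiates it. -/
theorem bracket_bracket (hS : S ∈ smoothFun m n E F 1 2) (h0 : bracket covE covF S S = 0)
    (hf : f ∈ smoothFun m n E F k l) : bracket covE covF S (bracket covE covF S f) = 0 := by
  refine ext_rep (m := m) (n := n) fun x => ?_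
  rw [rep_zero, rep_bracket covE covF hcovE hcovF hS even_two
    (bracket_mem covE covF hcovE hcovF hS hf) (mem_dom x)]
  have hpar : (locCoord d m n (dom d m n E F x)).par
      (indFam (rep_mem_Fam covE covF hcovE hcovF hS x)) =
      indFam (rep_mem_Fam covE covF hcovE hcovF hS x) := by
    refine Subtype.ext (funext fun y => ?_)
    change Pol.parity (Set.indicator _ _ y) = Set.indicator _ _ y
    by_cases hy : y ∈ dom d m n E F x
    · rw [Set.indicator_of_mem hy, Pol.parity_of_mem_fil (rep_mem (smoothFun_fil hS y) x),
        even_two.neg_one_zpow, one_smul]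
    · rw [Set.indicator_of_notMem hy, map_zero]
  have hss : (lconn covE covF hcovE hcovF x).LQ (indFam (rep_mem_Fam covE covF hcovE hcovF hS x))
      (indFam (rep_mem_Fam covE covF hcovE hcovF hS x)) = 0 := by
    refine Subtype.ext (funext fun y => ?_)
    by_cases hy : y ∈ dom d m n E F x
    · rw [← rep_bracket_eq_LQ covE covF hcovE hcovF hS even_two hS hy, h0, rep_zero]; rfl
    · exact locConn_LQ_of_notMem _ _ _ _ hy (Set.indicator_of_notMem hy _)
  have h1 := (lconn covE covF hcovE hcovF x).LQ_LQ hpar hss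
    (indFam (rep_mem_Fam covE covF hcovE hcovF hf x))
  refine (locConn_LQ_eq_braP _ _ _ _ _ (mem_dom x)
    (indicator_eventuallyEq (isOpen_dom x) (mem_dom x) _).symm ?_).symm.trans
    (congrFun (congrArg Subtype.val h1) x)
  filter_upwards [(isOpen_dom (d := d) (m := m) (n := n) (E := E) (F := F) x).mem_nhds (mem_dom x)] with y hy
  exact rep_bracket_eq_LQ covE covF hcovE hcovF hS even_two hf hy

omit hcovE hcovF [T2Space M] [ContMDiffVectorBundle ∞ (Fin m → ℝ) E (𝓡 d)]
  [ContMDiffVectorBundle ∞ (Fin n → ℝ) F (𝓡 d)] in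
-- In the master equation with indices summing to 2, the vanishing of S 0 leaves only the pair (1,
-- 1).
theorem IsMasterFunction.bracket_self {S : ℕ → PreFun (d := d) E F}
    (hS : IsMasterFunction covE covF S) : bracket covE covF (S 1) (S 1) = 0 := by
  have h := hS.master 2
  have h2 : Finset.HasAntidiagonal.antidiagonal 2 = ({(0, 2), (1, 1), (2, 0)} : Finset (ℕ × ℕ)) := rfl
  rw [h2, Finset.sum_insert (by decide), Finset.sum_insert (by decide), Finset.sum_singleton] at h
  simpa only [hS.zero, (bracket_zero_left covE covF _).1, (bracket_zero_left covE covF _).2,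
    zero_add, add_zero] using h

end Global

/-! ### The Koszul differential of a point and its partial homotopy -/

section Derivations

variable {L₁ L₂ X : Type*} [AddCommGroup L₁] [Module ℝ L₁] [AddCommGroup L₂] [Module ℝ L₂]
  [AddCommGroup X] [Module ℝ X] {D D' : Pol L₁ L₂ X →ₗ[ℝ] Pol L₁ L₂ X}

/-- Even derivations. -/
def EvDer (D : Pol L₁ L₂ X →ₗ[ℝ] Pol L₁ L₂ X) : Prop := ∀ a b, D (a * b) = D a * b + a * D b

/-- Odd derivations. -/
structure OdDer (D : Pol L₁ L₂ X →ₗ[ℝ] Pol L₁ L₂ X) : Prop where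
  mul : ∀ a b, D (a * b) = D a * b + Pol.parity a * D b
  parity : ∀ a, Pol.parity (D a) = -D (Pol.parity a)

theorem EvDer.map_one (h : EvDer D) : D 1 = 0 := by
  have := h 1 1
  simpa using this

theorem OdDer.map_one (h : OdDer D) : D 1 = 0 := by
  have := h.mul 1 1
  simpa using this

theorem EvDer.add (h : EvDer D) (h' : EvDer D') : EvDer (D + D') := fun a b => by
  simp only [LinearMap.add_apply, h a b, h' a b, add_mul, mul_add]; abel

theorem OdDer.add (h : OdDer D) (h' : OdDer D') : OdDer (D + D') where
  mul a b := by simp only [LinearMap.add_apply, h.mul, h'.mul, add_mul, mul_add]; abel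
  parity a := by simp only [LinearMap.add_apply, map_add, h.parity, h'.parity, neg_add]

theorem EvDer.sum {J : Type*} {s : Finset J} {D : J → Pol L₁ L₂ X →ₗ[ℝ] Pol L₁ L₂ X}
    (h : ∀ j, EvDer (D j)) : EvDer (∑ j ∈ s, D j) := fun a b => by
  simp only [LinearMap.sum_apply, h _ a b, Finset.sum_add_distrib, Finset.sum_mul, Finset.mul_sum]

theorem OdDer.sum {J : Type*} {s : Finset J} {D : J → Pol L₁ L₂ X →ₗ[ℝ] Pol L₁ L₂ X}
    (h : ∀ j, OdDer (D j)) : OdDer (∑ j ∈ s, D j) where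
  mul a b := by
    simp only [LinearMap.sum_apply, (h _).mul, Finset.sum_add_distrib, Finset.sum_mul,
      Finset.mul_sum]
  parity a := by simp only [LinearMap.sum_apply, map_sum, (h _).parity, Finset.sum_neg_distrib]

theorem EvDer.comm (h : EvDer D) (h' : EvDer D') : EvDer (D ∘ₗ D' - D' ∘ₗ D) := fun a b => by
  simp only [LinearMap.sub_apply, LinearMap.comp_apply, h _ _, h' _ _, map_add, sub_mul, mul_sub]
  abel

theorem OdDer.anticomm (h : OdDer D) (h' : OdDer D') : EvDer (D ∘ₗ D' + D' ∘ₗ D) := fun a b => by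
  simp only [LinearMap.add_apply, LinearMap.comp_apply, h.mul, h'.mul, map_add, add_mul, mul_add,
    h.parity, h'.parity, Pol.parity_parity, neg_mul]
  abel

/-- With `OdDer.anticomm` and `EvDer.comm`, this turns every commutation relation of the Koszul
operators into a check on generators. -/
theorem EvDer.ext (h : EvDer D) (h' : EvDer D') (hev : ∀ v, D (Pol.ev v) = D' (Pol.ev v))
    (hod : ∀ w, D (Pol.od w) = D' (Pol.od w)) : D = D' := by
  ext a
  induction a using Pol.induction with
  | scalar r => rw [map_smul, map_smul, h.map_one, h'.map_one]
  | even v => exact hev v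
  | odd w => exact hod w
  | mul a b ha hb => rw [h a b, h' a b, ha, hb]
  | add a b ha hb => rw [map_add, map_add, ha, hb]

theorem evDer_evD (ℓ : Dual ℝ (L₁ × L₂)) : EvDer (Pol.evD ℓ : Pol L₁ L₂ X →ₗ[ℝ] _) := Pol.evD_mul ℓ

theorem odDer_odD (ℓ : Dual ℝ (OddGen L₁ L₂ X)) : OdDer (Pol.odD ℓ) :=
  ⟨Pol.odD_mul ℓ, Pol.parity_odD ℓ⟩

theorem odDer_od_evD (w : OddGen L₁ L₂ X) (ℓ : Dual ℝ (L₁ × L₂)) :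
    OdDer (LinearMap.mulLeft ℝ (Pol.od w) ∘ₗ Pol.evD ℓ) where
  mul a b := by
    simp only [LinearMap.comp_apply, LinearMap.mulLeft_apply, Pol.evD_mul, mul_add, ← mul_assoc,
      Pol.od_mul w a]
  parity a := by simp [Pol.parity_evD]

theorem odDer_ev_odD (v : L₁ × L₂) (ℓ : Dual ℝ (OddGen L₁ L₂ X)) :
    OdDer (LinearMap.mulLeft ℝ (Pol.ev v) ∘ₗ Pol.odD ℓ) where
  mul a b := by
    simp only [LinearMap.comp_apply, LinearMap.mulLeft_apply, Pol.odD_mul, mul_add, ← mul_assoc,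
      Pol.ev_mul_comm v (Pol.parity a)]
  parity a := by simp [Pol.parity_odD]

theorem evDer_ev_evD (v : L₁ × L₂) (ℓ : Dual ℝ (L₁ × L₂)) :
    EvDer (LinearMap.mulLeft ℝ (Pol.ev v : Pol L₁ L₂ X) ∘ₗ Pol.evD ℓ) := fun a b => by
  simp only [LinearMap.comp_apply, LinearMap.mulLeft_apply, Pol.evD_mul, mul_add, ← mul_assoc,
    Pol.ev_mul_comm v a]

theorem evDer_od_odD (w : OddGen L₁ L₂ X) (ℓ : Dual ℝ (OddGen L₁ L₂ X)) :
    EvDer (LinearMap.mulLeft ℝ (Pol.od w) ∘ₗ Pol.odD ℓ) := fun a b => by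
  simp only [LinearMap.comp_apply, LinearMap.mulLeft_apply, Pol.odD_mul, mul_add, ← mul_assoc,
    Pol.od_mul w (Pol.parity a), Pol.parity_parity]

end Derivations

/-! ### Operators with eigenvalues 0, …, k -/

section FallingProduct

variable {W : Type*} [AddCommGroup W] [Module ℝ W] (N : Module.End ℝ W)

/-- The operator `N (N - 1) ⋯ (N - (j - 1))`. -/
def fallingProd : ℕ → Module.End ℝ W
  | 0 => 1
  | j + 1 => (N - (j : ℝ) • 1) * fallingProd j

/-- The sum of the eigenspaces of `N` for the eigenvalues `0, …, k`. -/
def eigSum (k : ℤ) : Submodule ℝ W := ⨆ (i : ℕ) (_ : (i : ℤ) ≤ k), End.eigenspace N (i : ℝ)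

variable {N}

/-- On the eigenspace for i the operator acts as i(i - 1)⋯(i - j + 1), which contains the factor
zero as soon as j > i. -/
theorem fallingProd_eq_zero {k j : ℕ} (hj : k < j) {u : W} (hu : u ∈ eigSum N k) :
    fallingProd N j u = 0 := by
  have key : ∀ (i : ℕ) (u : W), u ∈ End.eigenspace N (i : ℝ) → ∀ j,
      fallingProd N j u ∈ End.eigenspace N (i : ℝ) ∧ (i < j → fallingProd N j u = 0) := by
    intro i u hu j
    induction j with
    | zero => exact ⟨hu, fun h => absurd h (Nat.not_lt_zero _)⟩
    | succ j ih =>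
      have h1 : fallingProd N (j + 1) u = ((i : ℝ) - j) • fallingProd N j u := by
        rw [fallingProd, Module.End.mul_apply, LinearMap.sub_apply, End.mem_eigenspace_iff.1 ih.1,
          LinearMap.smul_apply, Module.End.one_apply, sub_smul]
      refine ⟨h1 ▸ Submodule.smul_mem _ _ ih.1, fun hij => ?_⟩
      rcases (Nat.lt_succ_iff.1 hij).lt_or_eq with h | rfl
      · rw [h1, ih.2 h, smul_zero]
      · rw [h1, sub_self, zero_smul]
  have : eigSum N k ≤ LinearMap.ker (fallingProd N j) :=
    iSup₂_le fun i hi u hu => (key i u hu j).2 (by omega)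
  exact this hu

/-- Modulo Y the operator N acts on u as -1, which is not among its eigenvalues 0, …, k. The product
N(N - 1)⋯(N - k) annihilates u and is a nonzero multiple of u modulo Y. -/
theorem mem_of_add_mem {k : ℕ} {u : W} (hu : u ∈ eigSum N k) {Y : Submodule ℝ W}
    (hY : ∀ y ∈ Y, N y ∈ Y) (h : N u + u ∈ Y) : u ∈ Y := by
  have key : ∀ j, ∃ a : ℝ, a ≠ 0 ∧ fallingProd N j u - a • u ∈ Y := by
    intro j
    induction j with
    | zero => exact ⟨1, one_ne_zero, by simp [fallingProd]⟩
    | succ j ih =>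
      obtain ⟨a, ha, haY⟩ := ih
      -- The new factor N - j acts modulo Y as -1 - j, which is nonzero.
      refine ⟨(-1 - j) * a, mul_ne_zero (by linarith [Nat.cast_nonneg (α := ℝ) j]) ha, ?_⟩
      have e : fallingProd N (j + 1) u - ((-1 - j) * a) • u =
          N (fallingProd N j u - a • u) - (j : ℝ) • (fallingProd N j u - a • u) +
            a • (N u + u) := by
        simp only [fallingProd, Module.End.mul_apply, LinearMap.sub_apply, LinearMap.smul_apply,
          Module.End.one_apply, map_sub, map_smul]
        module
      rw [e]
      exact add_mem (sub_mem (hY _ haY) (Submodule.smul_mem _ _ haY)) (Submodule.smul_mem _ _ h)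
  obtain ⟨a, ha, haY⟩ := key (k + 1)
  rw [fallingProd_eq_zero (Nat.lt_succ_self k) hu, zero_sub, neg_mem_iff] at haY
  exact (Submodule.smul_mem_iff _ ha).1 haY

end FallingProduct

/-! ### The Koszul differential and the elimination of c* -/

section Koszul

variable {d m n : ℕ}

theorem sum_smul_single {V : Type*} [AddCommGroup V] [Module ℝ V] (f : (Fin n → ℝ) →ₗ[ℝ] V)
    (v : Fin n → ℝ) : ∑ i, v i • f (Pi.single i 1) = f v := by
  simp only [← map_smul, ← map_sum, ← Pi.single_smul, smul_eq_mul, mul_one, Finset.univ_sum_single]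

theorem sum_smul_euclideanSingle {V : Type*} [AddCommGroup V] [Module ℝ V]
    (f : EuclideanSpace ℝ (Fin d) →ₗ[ℝ] V) (v : EuclideanSpace ℝ (Fin d)) :
    ∑ i, v i • f (EuclideanSpace.single i 1) = f v := by
  conv_rhs => rw [← (EuclideanSpace.basisFun (Fin d) ℝ).sum_repr v]
  simp

variable (τ : Fin m → ℝ) (ρ : (Fin n → ℝ) →ₗ[ℝ] EuclideanSpace ℝ (Fin d))
  (P : EuclideanSpace ℝ (Fin d) →ₗ[ℝ] (Fin n → ℝ))

/-- The operator `R^i_α x*_i ∂/∂c*_α`. -/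
def ghostDiff : LocPol d m n →ₗ[ℝ] LocPol d m n :=
  ∑ α : Fin n, LinearMap.mulLeft ℝ (Pol.od (0, 0, ρ (Pi.single α 1))) ∘ₗ
    Pol.evD (zsForm (.inr α))

/-- The Koszul differential `T^a ∂/∂η^a + R^i_α x*_i ∂/∂c*_α`. -/
def kosDiff : LocPol d m n →ₗ[ℝ] LocPol d m n := Pol.dη τ + ghostDiff ρ

/-- The operator `P^α_i c*_α ∂/∂x*_i`. -/
def kosHtpy : LocPol d m n →ₗ[ℝ] LocPol d m n :=
  ∑ i : Fin d, LinearMap.mulLeft ℝ (Pol.ev (0, P (EuclideanSpace.single i 1))) ∘ₗ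
    Pol.odD (xsForm i)

theorem odDer_kosDiff : OdDer (kosDiff τ ρ : LocPol d m n →ₗ[ℝ] _) :=
  (odDer_odD _).add (OdDer.sum fun _ => odDer_od_evD _ _)

theorem odDer_kosHtpy : OdDer (kosHtpy P : LocPol d m n →ₗ[ℝ] _) := OdDer.sum fun _ => odDer_ev_odD _ _

theorem kosDiff_ev (v : (Fin m → ℝ) × (Fin n → ℝ)) :
    kosDiff τ ρ (Pol.ev v) = (Pol.od (0, 0, ρ v.2) : LocPol d m n) := by
  have h := sum_smul_single ((Pol.od : _ →ₗ[ℝ] LocPol d m n) ∘ₗ LinearMap.inr ℝ _ _ ∘ₗ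
    LinearMap.inr ℝ _ _ ∘ₗ ρ) v.2
  simp only [kosDiff, ghostDiff, Pol.dη, LinearMap.add_apply, Pol.odD_ev, zero_add,
    LinearMap.sum_apply, LinearMap.comp_apply, LinearMap.mulLeft_apply, Pol.evD_ev, mul_smul_comm,
    mul_one]
  exact h

theorem kosDiff_od (w : OddGen (Fin m → ℝ) (Fin n → ℝ) (EuclideanSpace ℝ (Fin d))) :
    kosDiff τ ρ (Pol.od w) = w.1 τ • 1 := by
  simp [kosDiff, ghostDiff, Pol.dη]

theorem kosHtpy_ev (v : (Fin m → ℝ) × (Fin n → ℝ)) : kosHtpy P (Pol.ev v : LocPol d m n) = 0 := by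
  simp [kosHtpy]

theorem kosHtpy_od (w : OddGen (Fin m → ℝ) (Fin n → ℝ) (EuclideanSpace ℝ (Fin d))) :
    kosHtpy P (Pol.od w) = Pol.ev (0, P w.2.2) := by
  have h := sum_smul_euclideanSingle ((Pol.ev : _ →ₗ[ℝ] LocPol d m n) ∘ₗ LinearMap.inr ℝ _ _ ∘ₗ P)
    w.2.2
  simp only [kosHtpy, LinearMap.sum_apply, LinearMap.comp_apply, LinearMap.mulLeft_apply,
    Pol.odD_od, mul_smul_comm, mul_one]
  exact h

/-- Twice the square of an odd derivation is its anticommutator with itself, an even derivation, so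
it is enough to look at the generators. -/
theorem kosDiff_kosDiff (a : LocPol d m n) : kosDiff τ ρ (kosDiff τ ρ a) = 0 := by
  have h : kosDiff τ ρ ∘ₗ kosDiff τ ρ + kosDiff τ ρ ∘ₗ kosDiff τ ρ =
      (0 : LocPol d m n →ₗ[ℝ] LocPol d m n) := by
    refine ((odDer_kosDiff τ ρ).anticomm (odDer_kosDiff τ ρ)).ext (fun a b => by simp) ?_ ?_
    · intro v; simp [kosDiff_ev, kosDiff_od]
    · intro w; simp [kosDiff_od, (odDer_kosDiff τ ρ).map_one]
  have := DFunLike.congr_fun h a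
  simp only [LinearMap.add_apply, LinearMap.comp_apply, LinearMap.zero_apply] at this
  rw [← two_smul ℝ] at this
  exact (smul_eq_zero.1 this).resolve_left two_ne_zero

/-- The anticommutator of the differential and the homotopy. -/
def kosNum : Module.End ℝ (LocPol d m n) :=
  kosDiff τ ρ ∘ₗ kosHtpy P + kosHtpy P ∘ₗ kosDiff τ ρ

theorem evDer_kosNum : EvDer (kosNum τ ρ P : LocPol d m n →ₗ[ℝ] _) :=
  (odDer_kosDiff τ ρ).anticomm (odDer_kosHtpy P)

variable {k l r : ℤ} {a : LocPol d m n}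

theorem ghostDiff_mem (ha : ∀ α, Pol.evD (zsForm (.inr α)) a ∈ Pol.fil (k - 1) l r) :
    ghostDiff ρ a ∈ Pol.fil k (l + 1) r := by
  simp only [ghostDiff, LinearMap.sum_apply, LinearMap.comp_apply, LinearMap.mulLeft_apply]
  exact sum_mem fun α _ => mem_fil_of_le (Pol.mul_mem_fil (mem_fil_of_gr (Pol.xs_mem_gr _)) (ha α))
    (by omega) (by omega) (by omega)

theorem dη_mem (ha : a ∈ Pol.fil k l r) : Pol.dη τ a ∈ Pol.fil k (l + 1) (r - 1) :=
  mem_fil_of_le ((Pol.shifts_dη τ).fil ha) (by omega) (by omega) (by omega)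

theorem dcs_mem (ha : a ∈ Pol.fil k l r) (α : Fin n) :
    Pol.evD (zsForm (.inr α)) a ∈ Pol.fil (k - 1) l (r - 1) :=
  mem_fil_of_le (evD_zsForm_mem ha (.inr α)) rfl (by simp [ghw]) (by simp [rew])

theorem kosDiff_mem (ha : a ∈ Pol.fil k l r) : kosDiff τ ρ a ∈ Pol.fil k (l + 1) (r - 1) :=
  add_mem (dη_mem τ ha) (ghostDiff_mem ρ fun α => dcs_mem ha α)

theorem kosHtpy_mem (ha : a ∈ Pol.fil k l r) : kosHtpy P a ∈ Pol.fil k (l - 1) (r + 1) := by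
  simp only [kosHtpy, LinearMap.sum_apply, LinearMap.comp_apply, LinearMap.mulLeft_apply]
  exact sum_mem fun i _ => mem_fil_of_le (Pol.mul_mem_fil (mem_fil_of_gr (Pol.cStar_mem_gr _))
    (odD_xsForm_mem ha i)) (by omega) (by omega) (by omega)

theorem kosNum_mem (ha : a ∈ Pol.fil k l r) : kosNum τ ρ P a ∈ Pol.fil k l r :=
  add_mem (mem_fil_of_le (kosDiff_mem τ ρ (kosHtpy_mem P ha)) rfl (by omega) (by omega))
    (mem_fil_of_le (kosHtpy_mem P (kosDiff_mem τ ρ ha)) rfl (by omega) (by omega))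

variable {P ρ} (hP : ∀ v, P (ρ v) = v)
include hP

theorem kosNum_ev (v : (Fin m → ℝ) × (Fin n → ℝ)) :
    kosNum τ ρ P (Pol.ev v : LocPol d m n) = Pol.ev (0, v.2) := by
  simp [kosNum, kosDiff_ev, kosHtpy_ev, kosHtpy_od, hP]

omit hP in
theorem kosNum_od (w : OddGen (Fin m → ℝ) (Fin n → ℝ) (EuclideanSpace ℝ (Fin d))) :
    kosNum τ ρ P (Pol.od w) = Pol.od (0, 0, ρ (P w.2.2)) := by
  simp [kosNum, kosDiff_ev, kosDiff_od, kosHtpy_od, (odDer_kosHtpy P).map_one]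

/-- The derivation N has eigenvalue 1 on c* and on the x* in the image of R, and 0 on η, c, η* and
the x* in the kernel of P. Only generators of momentum degree 1 count, so the eigenvalues are at
most k. -/
theorem mem_eigSum (ha : a ∈ Pol.fil k l r) : a ∈ eigSum (kosNum τ ρ P) k := by
  have hmul : ∀ (i : ℕ) (k : ℤ) (a b : LocPol d m n), a ∈ End.eigenspace (kosNum τ ρ P) (i : ℝ) →
      b ∈ eigSum (kosNum τ ρ P) k → a * b ∈ eigSum (kosNum τ ρ P) (i + k) := by
    intro i k a b ha hb
    have : eigSum (kosNum τ ρ P) k ≤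
        (eigSum (kosNum τ ρ P) (i + k)).comap (LinearMap.mulLeft ℝ a) := by
      refine iSup₂_le fun j hj b hb => ?_
      refine Submodule.mem_iSup_of_mem (i + j) (Submodule.mem_iSup_of_mem (by push_cast; omega) ?_)
      rw [End.mem_eigenspace_iff] at ha hb ⊢
      rw [LinearMap.mulLeft_apply, evDer_kosNum τ ρ P a b, ha, hb, smul_mul_assoc, mul_smul_comm,
        ← add_smul, Nat.cast_add]
    exact this hb
  have hmono : ∀ {k k' : ℤ}, k ≤ k' → eigSum (kosNum τ ρ P) k ≤ eigSum (kosNum τ ρ P) k' :=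
    fun {k k'} h => iSup₂_le fun i hi => le_iSup₂_of_le i (hi.trans h) le_rfl
  have h0 : ∀ {a : LocPol d m n}, kosNum τ ρ P a = 0 → a ∈ End.eigenspace (kosNum τ ρ P) ((0 : ℕ) : ℝ) :=
    fun h => End.mem_eigenspace_iff.2 (by rw [h, Nat.cast_zero, zero_smul])
  have h1 : ∀ {a : LocPol d m n}, kosNum τ ρ P a = a → a ∈ End.eigenspace (kosNum τ ρ P) ((1 : ℕ) : ℝ) :=
    fun h => End.mem_eigenspace_iff.2 (by rw [h, Nat.cast_one, one_smul])
  have key : ∀ L : List (Gen (Fin m → ℝ) (Fin n → ℝ) (EuclideanSpace ℝ (Fin d))),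
      (L.map Pol.gen).prod ∈ eigSum (kosNum τ ρ P) (L.map Pol.deg).sum.1 := by
    intro L
    induction L with
    | nil =>
      exact Submodule.mem_iSup_of_mem 0 (Submodule.mem_iSup_of_mem le_rfl
        (h0 (evDer_kosNum τ ρ P).map_one))
    | cons i L ih =>
      simp only [List.map_cons, List.prod_cons, List.sum_cons, Prod.fst_add]
      cases i with
      | eta ξ => exact hmul 0 _ _ _ (h0 (by simp [Pol.gen, Pol.η, kosNum_od]; exact map_zero _)) ih
      | gho ξ => exact hmul 0 _ _ _ (h0 (by simp [Pol.gen, Pol.c, kosNum_od]; exact map_zero _)) ih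
      | xs v =>
        -- Splitting by the projector ρP, whose image and kernel have eigenvalues 1 and 0.
        have e : (Pol.gen (.xs v) : LocPol d m n) = Pol.xs (ρ (P v)) + Pol.xs (v - ρ (P v)) := by
          rw [Pol.xs, Pol.xs, ← map_add]; simp [Pol.gen, Pol.xs]
        rw [e, add_mul]
        refine add_mem (hmul 1 _ _ _ (h1 (by simp [Pol.xs, kosNum_od, hP])) ih) ?_
        exact hmono (by simp [Pol.deg])
          (hmul 0 _ _ _ (h0 (by simp [Pol.xs, kosNum_od, hP]; exact map_zero _)) ih)
      | es v =>
        exact hmono (by simp [Pol.deg])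
          (hmul 0 _ _ _ (h0 (by simp [Pol.gen, Pol.ηs, kosNum_ev τ hP]; exact map_zero _)) ih)
      | gs v => exact hmul 1 _ _ _ (h1 (by simp [Pol.gen, Pol.cs, kosNum_ev τ hP])) ih
  have : Pol.fil k l r ≤ eigSum (kosNum τ ρ P) k := by
    refine Pol.fil_le fun r' _ => gradedSpan_le fun L hL => ?_
    have := key L
    rwa [hL] at this
  exact this ha

/-- N counts each c* once, so differentiating along c* lowers its eigenvalue by one. -/
theorem evD_kosNum (α : Fin n) (a : LocPol d m n) : Pol.evD (zsForm (.inr α)) (kosNum τ ρ P a) =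
    kosNum τ ρ P (Pol.evD (zsForm (.inr α)) a) + Pol.evD (zsForm (.inr α)) a := by
  have h : Pol.evD (zsForm (.inr α)) ∘ₗ kosNum τ ρ P - kosNum τ ρ P ∘ₗ Pol.evD (zsForm (.inr α)) =
      (Pol.evD (zsForm (.inr α)) : LocPol d m n →ₗ[ℝ] _) := by
    refine ((evDer_evD _).comm (evDer_kosNum τ ρ P)).ext (evDer_evD _) ?_ ?_
    · intro v
      simp [kosNum_ev τ hP, (evDer_kosNum τ ρ P).map_one, zsForm]
    · intro w; simp [kosNum_od]
  have := DFunLike.congr_fun h a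
  exact (sub_eq_iff_eq_add.1 this).trans (add_comm _ _)

omit hP

variable (ρ P) in
/-- The operator that removes the dependence on `c*` from a cocycle. -/
def ghostHtpy : ℕ → LocPol d m n →ₗ[ℝ] LocPol d m n
  | 0 => 0
  | j + 1 => ghostHtpy j + (j + 1 : ℝ)⁻¹ • kosHtpy P ∘ₗ (LinearMap.id - kosDiff τ ρ ∘ₗ ghostHtpy j)

theorem ghostHtpy_mem (ha : a ∈ Pol.fil k l r) (j : ℕ) :
    ghostHtpy τ ρ P j a ∈ Pol.fil k (l - 1) (r + 1) := by
  induction j with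
  | zero => exact zero_mem _
  | succ j ih =>
    refine add_mem ih (Submodule.smul_mem _ _ (kosHtpy_mem P (sub_mem ha ?_)))
    exact mem_fil_of_le (kosDiff_mem τ ρ ih) rfl (by omega) (by omega)

theorem sub_kosDiff_ghostHtpy_mem (ha : a ∈ Pol.fil k l r) (j : ℕ) :
    a - kosDiff τ ρ (ghostHtpy τ ρ P j a) ∈ Pol.fil k l r :=
  sub_mem ha (mem_fil_of_le (kosDiff_mem τ ρ (ghostHtpy_mem τ ha j)) rfl (by omega) (by omega))

/-- Write a_j for a - δ(h_j a). The recursion gives a_(j+1) = a_j - (N a_j - σδa)/(j + 1), where σ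
is `kosHtpy`. As δa lies in F^r, the term σδa lies in F^(r+1). Modulo F^(r+1) each step therefore
multiplies by a multiple of N - (j + 1). -/
theorem kosNum_sub_kosDiff (hδ : kosDiff τ ρ a ∈ Pol.fil k (l + 1) r)
    (j : ℕ) : ∃ t : ℝ, kosNum τ ρ P (a - kosDiff τ ρ (ghostHtpy τ ρ P j a)) -
      t • fallingProd (kosNum τ ρ P) (j + 1) a ∈ Pol.fil k l (r + 1) := by
  induction j with
  | zero => exact ⟨1, by simp [fallingProd, ghostHtpy]⟩
  | succ j ih =>
    obtain ⟨t, ht⟩ := ih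
    set N : Module.End ℝ (LocPol d m n) := kosNum τ ρ P with hN
    set b := a - kosDiff τ ρ (ghostHtpy τ ρ P j a) with hb
    have h0 : (j + 1 : ℝ) ≠ 0 := by positivity
    have h1 : a - kosDiff τ ρ (ghostHtpy τ ρ P (j + 1) a) =
        b - (j + 1 : ℝ)⁻¹ • (N b - kosHtpy P (kosDiff τ ρ a)) := by
      have h2 : kosDiff τ ρ b = kosDiff τ ρ a := by rw [hb, map_sub, kosDiff_kosDiff, sub_zero]
      have h3 : N b - kosHtpy P (kosDiff τ ρ a) = kosDiff τ ρ (kosHtpy P b) := by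
        rw [hN, kosNum, LinearMap.add_apply, LinearMap.comp_apply, LinearMap.comp_apply, h2,
          add_sub_cancel_right]
      rw [h3, ghostHtpy, LinearMap.add_apply, map_add, ← sub_sub, ← hb]
      simp only [LinearMap.smul_apply, LinearMap.comp_apply, LinearMap.sub_apply,
        LinearMap.id_apply, map_smul]
      rfl
    refine ⟨-((j + 1 : ℝ)⁻¹ * t), ?_⟩
    have e : N (a - kosDiff τ ρ (ghostHtpy τ ρ P (j + 1) a)) -
        (-((j + 1 : ℝ)⁻¹ * t)) • fallingProd N (j + 1 + 1) a =
        (-(j + 1 : ℝ)⁻¹) • (N (N b - t • fallingProd N (j + 1) a) -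
          (j + 1 : ℝ) • (N b - t • fallingProd N (j + 1) a)) +
        (j + 1 : ℝ)⁻¹ • N (kosHtpy P (kosDiff τ ρ a)) := by
      rw [h1, fallingProd]
      simp only [Module.End.mul_apply, LinearMap.sub_apply, LinearMap.smul_apply,
        Module.End.one_apply, map_sub, map_smul]
      push_cast
      match_scalars <;> field_simp
    rw [e]
    refine add_mem (Submodule.smul_mem _ _ (sub_mem (kosNum_mem τ ρ P ht)
      (Submodule.smul_mem _ _ ht))) (Submodule.smul_mem _ _ (kosNum_mem τ ρ P ?_))
    exact mem_fil_of_le (kosHtpy_mem P hδ) rfl (by omega) le_rfl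

include hP in
-- After k steps N maps the corrected function b into F^(r+1), because N(N - 1)⋯(N - k) = 0 in
-- momentum degree k. Applying ∂/∂c* gives (N + 1)∂b/∂c* in F^r, and N + 1 is invertible. The
-- leading term of b is thus free of c*.
theorem evD_sub_kosDiff_mem {k : ℕ} (ha : a ∈ Pol.fil k l r)
    (hδ : kosDiff τ ρ a ∈ Pol.fil k (l + 1) r) (α : Fin n) :
    Pol.evD (zsForm (.inr α)) (a - kosDiff τ ρ (ghostHtpy τ ρ P k a)) ∈ Pol.fil (k - 1) l r := by
  obtain ⟨t, ht⟩ := kosNum_sub_kosDiff τ (P := P) hδ k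
  rw [fallingProd_eq_zero (Nat.lt_succ_self k) (mem_eigSum τ hP ha), smul_zero, sub_zero] at ht
  set b := a - kosDiff τ ρ (ghostHtpy τ ρ P k a) with hb
  have hbm : b ∈ Pol.fil k l r := sub_kosDiff_ghostHtpy_mem τ ha k
  have h1 := dcs_mem ht α
  rw [evD_kosNum τ hP, add_sub_cancel_right] at h1
  cases k with
  -- A derivative along c* would have momentum degree -1, so it vanishes.
  | zero =>
    have h2 := mem_eigSum τ hP (dcs_mem hbm α)
    have h3 : (eigSum (kosNum τ ρ P) (((0 : ℕ) : ℤ) - 1) : Submodule ℝ (LocPol d m n)) = ⊥ :=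
      le_bot_iff.1 (iSup₂_le fun i hi => absurd hi (by push_cast; omega))
    rw [h3, Submodule.mem_bot] at h2
    rw [h2]; exact zero_mem _
  | succ k =>
    have h2 := mem_eigSum τ hP (dcs_mem hbm α)
    rw [Nat.cast_succ, add_sub_cancel_right] at h2
    exact mem_of_add_mem h2 (fun y hy => kosNum_mem τ ρ P hy) h1

/-- The operator `η^a ∂/∂η^a`. -/
def etaNum : LocPol d m n →ₗ[ℝ] LocPol d m n :=
  ∑ a : Fin m, LinearMap.mulLeft ℝ (Pol.od (LinearMap.proj a, 0, 0)) ∘ₗ Pol.odD (zForm (.inl a))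

/-- The operator `c*_α ∂/∂c*_α`. -/
def csNum : LocPol d m n →ₗ[ℝ] LocPol d m n :=
  ∑ α : Fin n, LinearMap.mulLeft ℝ (Pol.ev (0, Pi.single α 1)) ∘ₗ Pol.evD (zsForm (.inr α))

theorem etaNum_add_csNum_of_mem_gr {g : ℤ × ℤ × ℤ} (ha : a ∈ Pol.gr g) :
    etaNum a + csNum a = (g.2.2 : ℝ) • a := by
  have hD : EvDer (etaNum + csNum : LocPol d m n →ₗ[ℝ] _) :=
    (EvDer.sum fun _ => evDer_od_odD _ _).add (EvDer.sum fun _ => evDer_ev_evD _ _)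
  have hod : ∀ w, (etaNum + csNum : LocPol d m n →ₗ[ℝ] _) (Pol.od w) = Pol.od (w.1, 0, 0) := by
    intro w
    have h : (∑ a : Fin m, w.1 (Pi.single a 1) • (LinearMap.proj a : Dual ℝ (Fin m → ℝ))) = w.1 := by
      refine LinearMap.ext fun v => ?_
      rw [← sum_smul_single w.1 v]
      simp [mul_comm]
    have h2 := congrArg ((Pol.od : _ →ₗ[ℝ] LocPol d m n) ∘ₗ LinearMap.inl ℝ _ _) h
    rw [map_sum] at h2
    simp only [map_smul] at h2
    simp only [etaNum, csNum, LinearMap.add_apply, LinearMap.sum_apply, LinearMap.comp_apply,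
      LinearMap.mulLeft_apply, Pol.odD_od, Pol.evD_od, mul_zero, Finset.sum_const_zero, add_zero,
      mul_smul_comm, mul_one]
    exact h2
  have hev : ∀ v, (etaNum + csNum : LocPol d m n →ₗ[ℝ] _) (Pol.ev v) = Pol.ev (0, v.2) := by
    intro v
    have h := sum_smul_single ((Pol.ev : _ →ₗ[ℝ] LocPol d m n) ∘ₗ LinearMap.inr ℝ _ _) v.2
    simp only [etaNum, csNum, LinearMap.add_apply, LinearMap.sum_apply, LinearMap.comp_apply,
      LinearMap.mulLeft_apply, Pol.odD_ev, Pol.evD_ev, mul_zero, Finset.sum_const_zero, zero_add,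
      mul_smul_comm, mul_one]
    exact h
  have hgen : ∀ i : Gen (Fin m → ℝ) (Fin n → ℝ) (EuclideanSpace ℝ (Fin d)),
      (etaNum + csNum : LocPol d m n →ₗ[ℝ] _) (Pol.gen i) = ((Pol.deg i).2.2 : ℝ) • Pol.gen i := by
    intro i
    cases i <;> simp only [Pol.gen, Pol.η, Pol.c, Pol.xs, Pol.ηs, Pol.cs, hod, hev, Pol.deg,
      Int.cast_zero, Int.cast_one, zero_smul, one_smul]
    all_goals exact map_zero _
  have key : ∀ L : List (Gen (Fin m → ℝ) (Fin n → ℝ) (EuclideanSpace ℝ (Fin d))),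
      (etaNum + csNum : LocPol d m n →ₗ[ℝ] _) (L.map Pol.gen).prod =
        ((L.map Pol.deg).sum.2.2 : ℝ) • (L.map Pol.gen).prod := by
    intro L
    induction L with
    | nil => simpa using hD.map_one
    | cons i L ih =>
      rw [List.map_cons, List.prod_cons, List.map_cons, List.sum_cons, hD, hgen, ih, smul_mul_assoc,
        mul_smul_comm, ← add_smul, Prod.snd_add, Prod.snd_add, Int.cast_add]
  have : Pol.gr g ≤ LinearMap.ker ((etaNum + csNum : LocPol d m n →ₗ[ℝ] _) -
      (g.2.2 : ℝ) • LinearMap.id) := by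
    refine gradedSpan_le fun L hL => ?_
    rw [LinearMap.mem_ker, LinearMap.sub_apply, key, hL]
    exact sub_self _
  exact sub_eq_zero.1 (this ha)

/-- The operators counting η and c* add up to the resolution degree. Under `hc` the part counting c*
is negligible, so the number of η in the leading term is r. -/
theorem etaNum_sub_mem (ha : a ∈ Pol.fil k l r)
    (hc : ∀ α, Pol.evD (zsForm (.inr α)) a ∈ Pol.fil (k - 1) l r) :
    etaNum a - (r : ℝ) • a ∈ Pol.fil k l (r + 1) := by
  have h1 : csNum a ∈ Pol.fil k l (r + 1) := by
    simp only [csNum, LinearMap.sum_apply, LinearMap.comp_apply, LinearMap.mulLeft_apply]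
    exact sum_mem fun α _ => mem_fil_of_le (Pol.mul_mem_fil (mem_fil_of_gr (Pol.cStar_mem_gr _))
      (hc α)) (by omega) (by omega) (by omega)
  let D : LocPol d m n →ₗ[ℝ] LocPol d m n := etaNum + csNum - (r : ℝ) • LinearMap.id
  have h2 : Pol.fil k l r ≤ (Pol.fil k l (r + 1)).comap D := by
    refine Pol.fil_le fun r' hr' a ha => ?_
    have e : D a = ((r' : ℝ) - r) • a := by
      rw [sub_smul, ← etaNum_add_csNum_of_mem_gr ha]; rfl
    rw [Submodule.mem_comap, e]
    rcases hr'.lt_or_eq with h | rfl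
    · exact Submodule.smul_mem _ _ (Pol.gr_le_fil h ha)
    · rw [sub_self, zero_smul]; exact zero_mem _
  have h3 : D a - csNum a ∈ Pol.fil k l (r + 1) := sub_mem (h2 ha) h1
  have e : D a - csNum a = etaNum a - (r : ℝ) • a := by
    change etaNum a + csNum a - (r : ℝ) • a - csNum a = _
    abel
  rwa [e] at h3

end Koszul

/-! ### The Koszul homotopy in adapted coordinates -/

section ParametricIntegral

variable {H : Type*} [NormedAddCommGroup H] [NormedSpace ℝ H] [FiniteDimensional ℝ H]

theorem hasFDerivAt_parametric_integral {f : H × ℝ → ℝ} (hf : ContDiff ℝ 1 f) (x₀ : H) :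
    HasFDerivAt (fun x => ∫ t in (0 : ℝ)..1, f (x, t))
      (∫ t in (0 : ℝ)..1, (fderiv ℝ f (x₀, t)).comp (ContinuousLinearMap.inl ℝ H ℝ)) x₀ := by
  have hc : Continuous fun z : H × ℝ => (fderiv ℝ f z).comp (ContinuousLinearMap.inl ℝ H ℝ) :=
    (hf.continuous_fderiv one_ne_zero).clm_comp continuous_const
  have hcomp : IsCompact (Metric.closedBall x₀ 1 ×ˢ Set.Icc (0 : ℝ) 1) :=
    (isCompact_closedBall x₀ 1).prod isCompact_Icc
  obtain ⟨C, hC⟩ := hcomp.exists_bound_of_continuousOn hc.continuousOn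
  refine intervalIntegral.hasFDerivAt_integral_of_dominated_of_fderiv_le
    (F := fun x t => f (x, t)) (bound := fun _ => C)
    (F' := fun x t => (fderiv ℝ f (x, t)).comp (ContinuousLinearMap.inl ℝ H ℝ))
    (Metric.closedBall_mem_nhds x₀ one_pos) ?_ ?_ ?_ ?_ ?_ ?_
  · exact Filter.Eventually.of_forall fun x =>
      (hf.continuous.comp (Continuous.prodMk_right x)).aestronglyMeasurable
  · exact (hf.continuous.comp (Continuous.prodMk_right x₀)).intervalIntegrable 0 1
  · exact (hc.comp (Continuous.prodMk_right x₀)).aestronglyMeasurable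
  · refine Filter.Eventually.of_forall fun t ht x hx => hC (x, t) ⟨hx, ?_⟩
    rw [Set.uIoc_of_le zero_le_one] at ht
    exact Set.Ioc_subset_Icc_self ht
  · exact intervalIntegrable_const
  · refine Filter.Eventually.of_forall fun t _ x _ => ?_
    exact ((hf.differentiable one_ne_zero) (x, t)).hasFDerivAt.comp x (hasFDerivAt_prodMk_left x t)

/-- Induction on the order: a directional derivative of the integral is the integral of a
directional derivative of the integrand, which is again smooth. -/
theorem contDiff_parametric_integral {f : H × ℝ → ℝ} (hf : ContDiff ℝ ∞ f) :
    ContDiff ℝ ∞ fun x => ∫ t in (0 : ℝ)..1, f (x, t) := by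
  have key : ∀ (N : ℕ) (f : H × ℝ → ℝ), ContDiff ℝ ∞ f →
      ContDiff ℝ N fun x => ∫ t in (0 : ℝ)..1, f (x, t) := by
    intro N
    induction N with
    | zero =>
      intro f hf
      refine contDiff_zero.2 (continuous_iff_continuousAt.2 fun x => ?_)
      exact (hasFDerivAt_parametric_integral (hf.of_le (by simp)) x).continuousAt
    | succ N ih =>
      intro f hf
      have hf1 : ContDiff ℝ 1 f := hf.of_le (by simp)
      rw [Nat.cast_succ]
      refine contDiff_succ_iff_fderiv_apply.2 ⟨fun x =>
        (hasFDerivAt_parametric_integral hf1 x).differentiableAt, by simp, fun y => ?_⟩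
      have e : (fun x => fderiv ℝ (fun x => ∫ t in (0 : ℝ)..1, f (x, t)) x y) =
          fun x => ∫ t in (0 : ℝ)..1, fderiv ℝ f (x, t) (y, 0) := by
        funext x
        have hc : Continuous fun t : ℝ =>
            (fderiv ℝ f (x, t)).comp (ContinuousLinearMap.inl ℝ H ℝ) :=
          ((hf1.continuous_fderiv one_ne_zero).comp (Continuous.prodMk_right x)).clm_comp
            continuous_const
        rw [(hasFDerivAt_parametric_integral hf1 x).fderiv,
          ContinuousLinearMap.intervalIntegral_apply (hc.intervalIntegrable 0 1)]
        rfl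
      rw [e]
      refine ih (fun z => fderiv ℝ f z (y, 0)) ?_
      exact (contDiff_infty_iff_fderiv.1 hf).2.clm_apply contDiff_const
  exact contDiff_infty.2 fun N => key N f hf

end ParametricIntegral

/-! ### Radial integrals of smooth functions -/

section RadialHomotopy

variable {d : ℕ} (L : EuclideanSpace ℝ (Fin d) →L[ℝ] EuclideanSpace ℝ (Fin d)) (r : ℕ)
  (v : EuclideanSpace ℝ (Fin d)) {a : EuclideanSpace ℝ (Fin d) → ℝ}

/-- The operator `a ↦ ∫₀¹ t^r (∂_v a)(u - (1 - t) L u) dt`. -/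
def radInt (a : EuclideanSpace ℝ (Fin d) → ℝ) (u : EuclideanSpace ℝ (Fin d)) : ℝ :=
  ∫ t in (0 : ℝ)..1, t ^ r * fderiv ℝ a (u - (1 - t) • L u) v

theorem contDiff_radIntegrand (ha : ContDiff ℝ ∞ a) :
    ContDiff ℝ ∞ fun z : EuclideanSpace ℝ (Fin d) × ℝ =>
      z.2 ^ r * fderiv ℝ a (z.1 - (1 - z.2) • L z.1) v := by
  have h1 : ContDiff ℝ ∞ (fderiv ℝ a) := (contDiff_infty_iff_fderiv.1 ha).2
  have h2 : ContDiff ℝ ∞ fun z : EuclideanSpace ℝ (Fin d) × ℝ => z.1 - (1 - z.2) • L z.1 :=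
    contDiff_fst.sub ((contDiff_const.sub contDiff_snd).smul (L.contDiff.comp contDiff_fst))
  exact (contDiff_snd.pow r).mul ((h1.comp h2).clm_apply contDiff_const)

theorem contDiff_radInt (ha : ContDiff ℝ ∞ a) : ContDiff ℝ ∞ (radInt L r v a) :=
  contDiff_parametric_integral (contDiff_radIntegrand L r v ha)

theorem intervalIntegrable_radInt (ha : ContDiff ℝ ∞ a) (u : EuclideanSpace ℝ (Fin d)) :
    IntervalIntegrable (fun t : ℝ => t ^ r * fderiv ℝ a (u - (1 - t) • L u) v)
      MeasureTheory.volume 0 1 :=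
  ((contDiff_radIntegrand L r v ha).continuous.comp (Continuous.prodMk_right u)).intervalIntegrable
    0 1

theorem radInt_sum {J : Type*} [Fintype J] {a : J → EuclideanSpace ℝ (Fin d) → ℝ} (c : J → ℝ)
    (ha : ∀ j, ContDiff ℝ ∞ (a j)) (u : EuclideanSpace ℝ (Fin d)) :
    radInt L r v (fun x => ∑ j, a j x * c j) u = ∑ j, radInt L r v (a j) u * c j := by
  have h : ∀ x, fderiv ℝ (fun x => ∑ j, a j x * c j) x v = ∑ j, fderiv ℝ (a j) x v * c j := by
    intro x
    have := HasFDerivAt.fun_sum (u := Finset.univ) fun j _ =>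
      (((ha j).differentiable (by simp)) x).hasFDerivAt.mul_const (c j)
    rw [this.fderiv]
    simp [mul_comm]
  simp only [radInt, h, Finset.mul_sum]
  rw [intervalIntegral.integral_finsetSum]
  · simp only [← mul_assoc, intervalIntegral.integral_mul_const]
  · intro j _
    simpa only [mul_assoc] using (intervalIntegrable_radInt L r v (ha j) u).mul_const (c j)

end RadialHomotopy

/-! ### The Koszul homotopy for a linear section -/

section KoszulHomotopy

variable {d m n : ℕ}

theorem odD_sum_smul {L₁ L₂ X J : Type*} [AddCommGroup L₁] [Module ℝ L₁] [AddCommGroup L₂]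
    [Module ℝ L₂] [AddCommGroup X] [Module ℝ X] [Fintype J] (c : J → ℝ)
    (ℓ : J → Dual ℝ (OddGen L₁ L₂ X)) (a : Pol L₁ L₂ X) :
    Pol.odD (∑ j, c j • ℓ j) a = ∑ j, c j • Pol.odD (ℓ j) a := by
  induction a using Pol.induction with
  | scalar r => simp
  | even v => simp
  | odd w => simp [Finset.sum_smul, mul_smul]
  | mul a b ha hb =>
    simp only [Pol.odD_mul, ha, hb, smul_add, Finset.sum_add_distrib, Finset.sum_mul,
      Finset.mul_sum, smul_mul_assoc, mul_smul_comm]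
  | add a b ha hb => simp only [map_add, ha, hb, smul_add, Finset.sum_add_distrib]

theorem dη_eq_sum (τ : Fin m → ℝ) (a : LocPol d m n) :
    Pol.dη τ a = ∑ b, τ b • Pol.odD (zForm (.inl b)) a := by
  rw [← odD_sum_smul, Pol.dη]
  refine congrArg (fun ℓ => Pol.odD ℓ a) (LinearMap.ext fun w => ?_)
  change w.1 τ = _
  simp only [LinearMap.sum_apply, LinearMap.smul_apply, smul_eq_mul]
  exact (sum_smul_single w.1 τ).symm

theorem dη_eta_mul (τ : Fin m → ℝ) (j : Fin m) (a : LocPol d m n) :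
    Pol.dη τ (Pol.od (LinearMap.proj j, 0, 0) * a) =
      τ j • a - Pol.od (LinearMap.proj j, 0, 0) * Pol.dη τ a := by
  rw [Pol.dη, Pol.odD_mul, Pol.odD_od, Pol.parity_od, neg_mul, smul_mul_assoc, one_mul,
    ← sub_eq_add_neg]
  rfl

theorem exists_dual_of_finiteDimensional {W : Type*} [AddCommGroup W] [Module ℝ W]
    (Y : Submodule ℝ W) [FiniteDimensional ℝ Y] : ∃ (N : ℕ) (e : Fin N → W) (ψ : Fin N → Dual ℝ W),
      (∀ j, e j ∈ Y) ∧ ∀ y ∈ Y, y = ∑ j, ψ j y • e j := by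
  let b := Module.finBasis ℝ Y
  choose ψ hψ using fun j => (b.coord j).exists_extend
  refine ⟨_, fun j => b j, ψ, fun j => (b j).2, fun y hy => ?_⟩
  have h2 := congrArg Subtype.val (b.sum_repr ⟨y, hy⟩)
  simp only [Submodule.coe_sum, Submodule.coe_smul] at h2
  have h3 : ∀ j, b.repr ⟨y, hy⟩ j = ψ j y := fun j => (DFunLike.congr_fun (hψ j) ⟨y, hy⟩).symm
  simp only [h3] at h2
  exact h2.symm

/-- The algebra carries no topology, so the integral is formed in coordinates of a
finite-dimensional subspace. Afterwards it is characterised by its values under all linear forms. -/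
theorem exists_radInt {Y : Submodule ℝ (LocPol d m n)} [FiniteDimensional ℝ Y]
    (L : EuclideanSpace ℝ (Fin d) →L[ℝ] EuclideanSpace ℝ (Fin d)) (r : ℕ)
    (v : EuclideanSpace ℝ (Fin d)) {g : EuclideanSpace ℝ (Fin d) → LocPol d m n}
    (hY : ∀ u, g u ∈ Y) (hg : ∀ φ : Dual ℝ (LocPol d m n), ContDiff ℝ ∞ fun u => φ (g u)) :
    ∃ b : EuclideanSpace ℝ (Fin d) → LocPol d m n, (∀ u, b u ∈ Y) ∧
      ∀ φ : Dual ℝ (LocPol d m n), ∀ u, φ (b u) = radInt L r v (fun u => φ (g u)) u := by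
  obtain ⟨N, e, ψ, he, hψ⟩ := exists_dual_of_finiteDimensional Y
  refine ⟨fun u => ∑ j, radInt L r v (fun u => ψ j (g u)) u • e j,
    fun u => sum_mem fun j _ => Submodule.smul_mem _ _ (he j), fun φ u => ?_⟩
  have h : (fun u => φ (g u)) = fun u => ∑ j, ψ j (g u) * φ (e j) := by
    funext u
    conv_lhs => rw [hψ _ (hY u)]
    simp only [map_sum, map_smul, smul_eq_mul]
  rw [h, radInt_sum L r v _ fun j => hg (ψ j)]
  simp only [map_sum, map_smul, smul_eq_mul]

theorem mem_of_forall_dual {W : Type*} [AddCommGroup W] [Module ℝ W] {Y : Submodule ℝ W} {w : W}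
    (h : ∀ φ : Dual ℝ W, (∀ y ∈ Y, φ y = 0) → φ w = 0) : w ∈ Y :=
  (Subspace.forall_mem_dualAnnihilator_apply_eq_zero_iff Y _).1 fun φ hφ =>
    h φ fun y hy => (Submodule.mem_dualAnnihilator φ).1 hφ y hy

variable {k l : ℤ} {r : ℕ} {V : Set (EuclideanSpace ℝ (Fin d))}
  {g : EuclideanSpace ℝ (Fin d) → LocPol d m n}
  {pr : EuclideanSpace ℝ (Fin d) →L[ℝ] (Fin m → ℝ)} {B : (Fin m → ℝ) →L[ℝ] EuclideanSpace ℝ (Fin d)}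

/-- Modulo F^(r+1) the function η^a τ^b ∂g/∂η^b vanishes near v. Its derivative along τ^a is zero as
well, and by the product rule this derivative is η^a ∂g/∂η^a plus the term in which g is
differentiated. The factor t is the ratio of τ at v and at u. -/
theorem fderiv_eta_dη (hpr : ∀ w, pr (B w) = w) (hV : IsOpen V)
    (hg : ∀ φ : Dual ℝ (LocPol d m n), ContDiff ℝ ∞ fun u => φ (g u))
    (hgτ : ∀ v ∈ V, Pol.dη (pr v) (g v) ∈ Pol.fil k (l + 1) r)
    {φ : Dual ℝ (LocPol d m n)} (hφ : ∀ y ∈ Pol.fil k l (r + 1), φ y = 0) (a : Fin m)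
    {u v : EuclideanSpace ℝ (Fin d)} {t : ℝ} (hv : v ∈ V) (hvu : pr v = t • pr u) :
    t * fderiv ℝ (fun x => φ (Pol.od (LinearMap.proj a, 0, 0) * Pol.dη (pr u) (g x))) v
      (B (Pi.single a 1)) =
      -φ (Pol.od (LinearMap.proj a, 0, 0) * Pol.odD (zForm (.inl a)) (g v)) := by
  let Ψ : Fin m → Dual ℝ (LocPol d m n) := fun b =>
    φ ∘ₗ LinearMap.mulLeft ℝ (Pol.od (LinearMap.proj a, 0, 0)) ∘ₗ Pol.odD (zForm (.inl b))
  have hΨ : ∀ (s : Fin m → ℝ) (x), φ (Pol.od (LinearMap.proj a, 0, 0) * Pol.dη s (g x)) =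
      ∑ b, s b * Ψ b (g x) := by
    intro s x
    rw [dη_eq_sum, Finset.mul_sum, map_sum]
    refine Finset.sum_congr rfl fun b _ => ?_
    rw [mul_smul_comm, map_smul]; rfl
  have hd : ∀ b, HasFDerivAt (fun x => Ψ b (g x)) (fderiv ℝ (fun x => Ψ b (g x)) v) v :=
    fun b => ((hg (Ψ b)).differentiable (by simp) v).hasFDerivAt
  have h1 : HasFDerivAt (fun x => φ (Pol.od (LinearMap.proj a, 0, 0) * Pol.dη (pr u) (g x)))
      (∑ b, pr u b • fderiv ℝ (fun x => Ψ b (g x)) v) v := by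
    simp only [hΨ]
    exact HasFDerivAt.fun_sum fun b _ => (hd b).const_mul (pr u b)
  have hprd : ∀ b, HasFDerivAt (fun x => pr x b) ((ContinuousLinearMap.proj b).comp pr) v :=
    fun b => ((ContinuousLinearMap.proj b).comp pr).hasFDerivAt
  have h2 := HasFDerivAt.fun_sum (u := Finset.univ) fun b _ => (hprd b).mul (hd b)
  have h3 : (fun x => ∑ b, pr x b * Ψ b (g x)) =ᶠ[nhds v] fun _ => (0 : ℝ) := by
    filter_upwards [hV.mem_nhds hv] with x hx
    rw [← hΨ]
    exact hφ _ (mem_fil_of_le (Pol.mul_mem_fil (mem_fil_of_gr (Pol.eta_mem_gr _)) (hgτ x hx))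
      (by omega) (by omega) (by omega))
  have h4 := h2.unique ((hasFDerivAt_const (0 : ℝ) v).congr_of_eventuallyEq h3)
  have h5 := DFunLike.congr_fun h4 (B (Pi.single a 1))
  rw [h1.fderiv]
  simp only [_root_.sum_apply, _root_.add_apply,
    _root_.smul_apply, ContinuousLinearMap.comp_apply, ContinuousLinearMap.proj_apply,
    hpr, smul_eq_mul, _root_.zero_apply, Finset.sum_add_distrib, hvu, Pi.smul_apply,
    Pi.single_apply, mul_ite, mul_one, mul_zero, Finset.sum_ite_eq', Finset.mem_univ, if_true,
    mul_assoc] at h5 ⊢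
  rw [Finset.mul_sum]
  exact eq_neg_of_add_eq_zero_left h5

/-- The Koszul homotopy in coordinates in which the section is linear. -/
theorem exists_koszul_primitive (hr : 1 ≤ r) (hpr : ∀ w, pr (B w) = w) (hV : IsOpen V)
    (hgY : ∀ u, g u ∈ Pol.fil k l r)
    (hg : ∀ φ : Dual ℝ (LocPol d m n), ContDiff ℝ ∞ fun u => φ (g u))
    (hgτ : ∀ v ∈ V, Pol.dη (pr v) (g v) ∈ Pol.fil k (l + 1) r)
    (hgc : ∀ v ∈ V, ∀ α, Pol.evD (zsForm (.inr α)) (g v) ∈ Pol.fil (k - 1) l r) :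
    ∃ h : EuclideanSpace ℝ (Fin d) → LocPol d m n, (∀ u, h u ∈ Pol.fil k (l - 1) (r + 1)) ∧
      (∀ φ : Dual ℝ (LocPol d m n), ContDiff ℝ ∞ fun u => φ (h u)) ∧
      ∀ u, (∀ t ∈ Set.Icc (0 : ℝ) 1, u - (1 - t) • B (pr u) ∈ V) →
        ∀ ρ, g u - kosDiff (pr u) ρ (h u) ∈ Pol.fil k l (r + 1) := by
  have hfin : FiniteDimensional ℝ (Pol.fil k l r : Submodule ℝ (LocPol d m n)) :=
    Pol.finiteDimensional_fil _ _ _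
  choose b hbY hb using fun a : Fin m =>
    exists_radInt (B.comp pr) r (B (Pi.single a 1)) hgY hg
  -- The primitive is η^a ∫ t^r (∂g/∂τ^a) dt along the segment that shrinks the component τ of u to
  -- zero. The exponent r belongs to the number of η in the leading term.
  refine ⟨fun u => ∑ a, Pol.od (LinearMap.proj a, 0, 0) * b a u, fun u => ?_, fun φ => ?_, ?_⟩
  · exact sum_mem fun a _ => mem_fil_of_le (Pol.mul_mem_fil (mem_fil_of_gr (Pol.eta_mem_gr _))
      (hbY a u)) (by omega) (by omega) (by omega)
  · simp only [map_sum]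
    refine ContDiff.sum fun a _ => ?_
    have e : (fun u => φ (Pol.od (LinearMap.proj a, 0, 0) * b a u)) = radInt (B.comp pr) r
        (B (Pi.single a 1)) fun u => (φ ∘ₗ LinearMap.mulLeft ℝ (Pol.od (LinearMap.proj a, 0, 0))) (g u) := by
      funext u
      exact hb a (φ ∘ₗ LinearMap.mulLeft ℝ (Pol.od (LinearMap.proj a, 0, 0))) u
    rw [e]
    exact contDiff_radInt _ _ _ (hg _)
  · intro u hu ρ
    rw [kosDiff, LinearMap.add_apply, ← sub_sub]
    refine sub_mem ?_ ?_
    · refine mem_of_forall_dual fun φ hφ => ?_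
      have hφg := hg φ
      -- The function t^r g along the segment interpolates between 0 and g(u). The claim is the
      -- fundamental theorem of calculus for it, tested by forms that kill F^(r+1).
      have hdF : ∀ t : ℝ, HasDerivAt (fun t : ℝ => t ^ r * φ (g (u - (1 - t) • B (pr u))))
          (r * t ^ (r - 1) * φ (g (u - (1 - t) • B (pr u))) +
            t ^ r * fderiv ℝ (fun x => φ (g x)) (u - (1 - t) • B (pr u)) (B (pr u))) t := by
        intro t
        have h1 : HasDerivAt (fun t : ℝ => u - (1 - t) • B (pr u)) (B (pr u)) t := by
          have := (((hasDerivAt_id t).const_sub 1).smul_const (B (pr u))).const_sub u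
          simpa using this
        exact (hasDerivAt_pow r t).mul
          ((hφg.differentiable (by simp) _).hasFDerivAt.comp_hasDerivAt t h1)
      have hpt : ∀ t ∈ Set.uIcc (0 : ℝ) 1,
          ∑ a, (pr u a * (t ^ r * fderiv ℝ (fun x => φ (g x)) (u - (1 - t) • B (pr u))
              (B (Pi.single a 1))) -
            t ^ r * fderiv ℝ (fun x => φ (Pol.od (LinearMap.proj a, 0, 0) * Pol.dη (pr u) (g x)))
              (u - (1 - t) • B (pr u)) (B (Pi.single a 1))) =
          r * t ^ (r - 1) * φ (g (u - (1 - t) • B (pr u))) +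
            t ^ r * fderiv ℝ (fun x => φ (g x)) (u - (1 - t) • B (pr u)) (B (pr u)) := by
        intro t ht
        rw [Set.uIcc_of_le zero_le_one] at ht
        have hv := hu t ht
        have hprv : pr (u - (1 - t) • B (pr u)) = t • pr u := by
          rw [map_sub, map_smul, hpr]; module
        have e1 := sum_smul_single (((fderiv ℝ (fun x => φ (g x))
          (u - (1 - t) • B (pr u))).comp B).toLinearMap) (pr u)
        have e2 := sub_eq_zero.1 ((map_sub φ _ _).symm.trans
          -- The factor r coming from the derivative of t^r is traded for η^a ∂/∂η^a, and the latter
          -- for a derivative of the cocycle condition.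
          (hφ _ (etaNum_sub_mem (hgY (u - (1 - t) • B (pr u))) (hgc _ hv))))
        have e3 : t ^ r = t ^ (r - 1) * t := by rw [← pow_succ, Nat.sub_add_cancel hr]
        rw [Finset.sum_sub_distrib]
        have e4 : ∑ a, t ^ r * fderiv ℝ (fun x => φ (Pol.od (LinearMap.proj a, 0, 0) *
            Pol.dη (pr u) (g x))) (u - (1 - t) • B (pr u)) (B (Pi.single a 1)) =
            -(t ^ (r - 1) * (r * φ (g (u - (1 - t) • B (pr u))))) := by
          simp only [e3, mul_assoc, fderiv_eta_dη hpr hV hg hgτ hφ _ hv hprv]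
          rw [← Finset.mul_sum, Finset.sum_neg_distrib, ← map_sum, mul_neg]
          congr 2
          simp only [etaNum, LinearMap.sum_apply, LinearMap.comp_apply, LinearMap.mulLeft_apply,
            map_smul, smul_eq_mul, Int.cast_natCast] at e2
          exact e2
        have e5 : ∑ a, pr u a * (t ^ r * fderiv ℝ (fun x => φ (g x)) (u - (1 - t) • B (pr u))
              (B (Pi.single a 1))) =
            t ^ r * fderiv ℝ (fun x => φ (g x)) (u - (1 - t) • B (pr u)) (B (pr u)) := by
          simp only [mul_left_comm _ (t ^ r), ← Finset.mul_sum]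
          exact congrArg _ e1
        rw [e4, e5]; ring
      have hcont : ∀ a, IntervalIntegrable (fun t : ℝ =>
          pr u a * (t ^ r * fderiv ℝ (fun x => φ (g x)) (u - (1 - t) • B (pr u))
              (B (Pi.single a 1))) -
            t ^ r * fderiv ℝ (fun x => φ (Pol.od (LinearMap.proj a, 0, 0) * Pol.dη (pr u) (g x)))
              (u - (1 - t) • B (pr u)) (B (Pi.single a 1))) MeasureTheory.volume 0 1 := fun a =>
        ((intervalIntegrable_radInt (B.comp pr) r (B (Pi.single a 1)) hφg u).const_mul _).sub
          (intervalIntegrable_radInt (B.comp pr) r (B (Pi.single a 1))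
            (hg (φ ∘ₗ LinearMap.mulLeft ℝ (Pol.od (LinearMap.proj a, 0, 0)) ∘ₗ Pol.dη (pr u))) u)
      have hintg := intervalIntegral.integral_congr (μ := MeasureTheory.volume) hpt
      rw [intervalIntegral.integral_finsetSum fun a _ => hcont a,
        intervalIntegral.integral_eq_sub_of_hasDerivAt (fun t _ => hdF t)] at hintg
      -- Here r ≥ 1 matters: in degree zero the boundary term at t = 0 would survive as cohomology.
      · have e0 : (0 : ℝ) ^ r = 0 := zero_pow (by omega)
        simp only [one_pow, one_mul, sub_self, zero_smul, sub_zero, e0, zero_mul] at hintg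
        rw [map_sub, sub_eq_zero, ← hintg, map_sum, map_sum]
        refine Finset.sum_congr rfl fun a _ => ?_
        rw [dη_eta_mul, map_sub, map_smul, hb a φ u, smul_eq_mul, radInt,
          ← intervalIntegral.integral_const_mul,
          show φ (Pol.od (LinearMap.proj a, 0, 0) * Pol.dη (pr u) (b a u)) = _ from
            hb a (φ ∘ₗ LinearMap.mulLeft ℝ (Pol.od (LinearMap.proj a, 0, 0)) ∘ₗ Pol.dη (pr u)) u,
          radInt, ← intervalIntegral.integral_sub]
        · rfl
        · exact (intervalIntegrable_radInt (B.comp pr) r (B (Pi.single a 1)) hφg u).const_mul _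
        · exact intervalIntegrable_radInt (B.comp pr) r (B (Pi.single a 1))
            (hg (φ ∘ₗ LinearMap.mulLeft ℝ (Pol.od (LinearMap.proj a, 0, 0)) ∘ₗ Pol.dη (pr u))) u
      · have := IntervalIntegrable.sum Finset.univ fun a _ => hcont a
        refine this.congr_uIoo fun t ht => ?_
        rw [Finset.sum_apply]
        exact hpt t (Set.uIoo_subset_uIcc_self ht)
    -- The part of δ that differentiates along c* is harmless: the integrals inherit from g that
    -- their leading term is free of c*.
    · refine mem_fil_of_le (ghostDiff_mem (l := l - 1) ρ fun α => ?_) rfl (by omega) le_rfl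
      rw [map_sum]
      refine sum_mem fun a _ => ?_
      rw [Pol.evD_mul, Pol.evD_od, zero_mul, zero_add]
      have hb' : Pol.evD (zsForm (.inr α)) (b a u) ∈ Pol.fil (k - 1) l r := by
        refine mem_of_forall_dual fun φ hφ => ?_
        rw [show φ (Pol.evD (zsForm (.inr α)) (b a u)) = _ from
          hb a (φ ∘ₗ Pol.evD (zsForm (.inr α))) u, radInt]
        have : ∀ t ∈ Set.uIcc (0 : ℝ) 1, t ^ r * fderiv ℝ (fun u =>
            (φ ∘ₗ Pol.evD (zsForm (.inr α))) (g u)) (u - (1 - t) • (B.comp pr) u)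
              (B (Pi.single a 1)) = 0 := by
          intro t ht
          rw [Set.uIcc_of_le zero_le_one] at ht
          have h3 : (fun u => (φ ∘ₗ Pol.evD (zsForm (.inr α))) (g u)) =ᶠ[
              nhds (u - (1 - t) • (B.comp pr) u)] fun _ => (0 : ℝ) := by
            filter_upwards [hV.mem_nhds (hu t ht)] with x hx using hφ _ (hgc x hx α)
          rw [h3.fderiv_eq, fderiv_fun_const]
          simp
        rw [intervalIntegral.integral_congr this, intervalIntegral.integral_zero]
      exact mem_fil_of_le (Pol.mul_mem_fil (mem_fil_of_gr (Pol.eta_mem_gr _)) hb') (by omega)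
        (by omega) (by omega)

end KoszulHomotopy

/-! ### Local solutions -/

section Straightening

variable {d m : ℕ}

/-- A submersion is linear in suitable coordinates. -/
theorem exists_straightening {W : Set (EuclideanSpace ℝ (Fin d))} (hW : IsOpen W)
    {y₀ : EuclideanSpace ℝ (Fin d)} (hy₀ : y₀ ∈ W) {τ : EuclideanSpace ℝ (Fin d) → Fin m → ℝ}
    (hτ : ContDiffOn ℝ ∞ τ W) (h0 : τ y₀ = 0) (hs : Function.Surjective (fderiv ℝ τ y₀)) :
    ∃ (pr : EuclideanSpace ℝ (Fin d) →L[ℝ] (Fin m → ℝ))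
      (B : (Fin m → ℝ) →L[ℝ] EuclideanSpace ℝ (Fin d))
      (Ψ Θ : EuclideanSpace ℝ (Fin d) → EuclideanSpace ℝ (Fin d))
      (s : Set (EuclideanSpace ℝ (Fin d))) (ε : ℝ), 0 < ε ∧ (∀ w, pr (B w) = w) ∧ IsOpen s ∧
      y₀ ∈ s ∧ s ⊆ W ∧ ContDiffOn ℝ ∞ Ψ s ∧ Ψ y₀ = 0 ∧
      (∀ y ∈ s, Θ (Ψ y) = y ∧ τ y = pr (Ψ y)) ∧ ContDiffOn ℝ ∞ Θ (Metric.ball 0 ε) ∧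
      ∀ v ∈ Metric.ball 0 ε, Θ v ∈ s ∧ Ψ (Θ v) = v := by
  set pr := fderiv ℝ τ y₀ with hpr
  obtain ⟨B₀, hB₀⟩ := pr.toLinearMap.exists_rightInverse_of_surjective (LinearMap.range_eq_top.2 hs)
  let B : (Fin m → ℝ) →L[ℝ] EuclideanSpace ℝ (Fin d) := LinearMap.toContinuousLinearMap B₀
  have hB : ∀ w, pr (B w) = w := fun w => DFunLike.congr_fun hB₀ w
  -- The correction along the right inverse B makes pr Ψ = τ exact, and its derivative at y₀
  -- vanishes, so Ψ has the identity as derivative there.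
  let Ψ : EuclideanSpace ℝ (Fin d) → EuclideanSpace ℝ (Fin d) :=
    fun y => (y - y₀) + B (τ y - pr (y - y₀))
  have hsub : ContDiff ℝ ∞ fun y : EuclideanSpace ℝ (Fin d) => y - y₀ := contDiff_id.sub contDiff_const
  have hΨ : ContDiffOn ℝ ∞ Ψ W :=
    hsub.contDiffOn.add (B.contDiff.comp_contDiffOn (hτ.sub (pr.contDiff.comp hsub).contDiffOn))
  have hΨ0 : Ψ y₀ = 0 := by simp [Ψ, h0]
  have hprΨ : ∀ y, τ y = pr (Ψ y) := by
    intro y; simp only [Ψ, map_add, hB, map_sub]; abel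
  have hat : ∀ y ∈ W, ContDiffAt ℝ ∞ Ψ y := fun y hy => hΨ.contDiffAt (hW.mem_nhds hy)
  have hτd : HasFDerivAt τ pr y₀ :=
    ((hτ.contDiffAt (hW.mem_nhds hy₀)).differentiableAt (by simp)).hasFDerivAt
  have hd : HasFDerivAt Ψ
      ((ContinuousLinearEquiv.refl ℝ (EuclideanSpace ℝ (Fin d)) : _ ≃L[ℝ] _) :
        EuclideanSpace ℝ (Fin d) →L[ℝ] EuclideanSpace ℝ (Fin d)) y₀ := by
    have h1 : HasFDerivAt (fun y : EuclideanSpace ℝ (Fin d) => y - y₀)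
      (ContinuousLinearMap.id ℝ _) y₀ := (hasFDerivAt_id y₀).sub_const y₀
    have h2 := h1.add (B.hasFDerivAt.comp y₀ (hτd.sub (pr.hasFDerivAt.comp y₀ h1)))
    have e : ContinuousLinearMap.id ℝ (EuclideanSpace ℝ (Fin d)) +
        B.comp (pr - pr.comp (ContinuousLinearMap.id ℝ _)) =
        ((ContinuousLinearEquiv.refl ℝ (EuclideanSpace ℝ (Fin d)) : _ ≃L[ℝ] _) :
        EuclideanSpace ℝ (Fin d) →L[ℝ] EuclideanSpace ℝ (Fin d)) := by
      ext v; simp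
    rw [← e]; exact h2
  let e := (hat y₀ hy₀).toOpenPartialHomeomorph Ψ hd (by simp)
  have hsrc : y₀ ∈ e.source := (hat y₀ hy₀).mem_toOpenPartialHomeomorph_source hd (by simp)
  -- The inverse function theorem gives smoothness of the inverse at a single point. It extends to
  -- all points at which the derivative is invertible, and these form an open set.
  have hinv : IsOpen (W ∩ (fun y => fderiv ℝ Ψ y) ⁻¹' Set.range
      (fun L : EuclideanSpace ℝ (Fin d) ≃L[ℝ] EuclideanSpace ℝ (Fin d) =>
        (L : EuclideanSpace ℝ (Fin d) →L[ℝ] EuclideanSpace ℝ (Fin d)))) :=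
    (hΨ.continuousOn_fderiv_of_isOpen hW (by simp)).isOpen_inter_preimage hW
      ContinuousLinearEquiv.isOpen
  set s := e.source ∩ (W ∩ (fun y => fderiv ℝ Ψ y) ⁻¹' Set.range
      (fun L : EuclideanSpace ℝ (Fin d) ≃L[ℝ] EuclideanSpace ℝ (Fin d) =>
        (L : EuclideanSpace ℝ (Fin d) →L[ℝ] EuclideanSpace ℝ (Fin d)))) with hs_def
  have hso : IsOpen s := e.open_source.inter hinv
  have hys : y₀ ∈ s := ⟨hsrc, hy₀, ContinuousLinearEquiv.refl ℝ _, hd.fderiv.symm⟩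
  have hto : IsOpen (e.target ∩ e.symm ⁻¹' s) := e.isOpen_inter_preimage_symm hso
  have h0t : (0 : EuclideanSpace ℝ (Fin d)) ∈ e.target ∩ e.symm ⁻¹' s := by
    have h1 : e y₀ = 0 := hΨ0
    refine ⟨h1 ▸ e.map_source hsrc, ?_⟩
    rw [Set.mem_preimage, ← h1, e.left_inv hsrc]; exact hys
  obtain ⟨ε, hε, hball⟩ := Metric.isOpen_iff.1 hto 0 h0t
  refine ⟨pr, B, Ψ, e.symm, s, ε, hε, hB, hso, hys, fun y hy => hy.2.1,
    hΨ.mono fun y hy => hy.2.1, hΨ0, fun y hy => ⟨e.left_inv hy.1, hprΨ y⟩, ?_,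
    fun v hv => ⟨(hball hv).2, e.right_inv (hball hv).1⟩⟩
  intro v hv
  obtain ⟨h1, h2, h3, L, hL⟩ := hball hv
  refine (e.contDiffAt_symm (f₀' := L) h1 ?_ (hat _ h3)).contDiffWithinAt
  have := ((hat _ h3).differentiableAt (by simp)).hasFDerivAt
  rw [show fderiv ℝ Ψ (e.symm v) = L from hL.symm] at this
  exact this

end Straightening

/-! ### Koszul primitives near a zero of the section -/

section LocalKoszul

variable {d m n : ℕ} {M : Type*} [TopologicalSpace M] [ChartedSpace (EuclideanSpace ℝ (Fin d)) M]
  [IsManifold (𝓡 d) ∞ M] {U : Set M} {p₀ : M} {k l : ℤ} {r : ℕ}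

/-- In straightened coordinates the section is linear and the radial homotopy applies. The cut-off
makes the function globally smooth on the vector space, and the cocycle conditions are needed only
on a smaller ball where the cut-off equals 1. -/
theorem exists_local_koszul_primitive (hr : 1 ≤ r) (hU : IsOpen U) (hp₀ : p₀ ∈ U)
    (hUq : U ⊆ chartDom d p₀) {τ : M → Fin m → ℝ} (hτ : ∀ a, SmoothOn d U fun x => τ x a)
    (h0 : τ p₀ = 0) (hs : Function.Surjective
      (fderiv ℝ (fun y => τ ((extChartAt (𝓡 d) p₀).symm y)) (extChartAt (𝓡 d) p₀ p₀)))
    {g : M → LocPol d m n} (hg : g ∈ Fam d (LocPol d m n) U) (hgY : ∀ x ∈ U, g x ∈ Pol.fil k l r)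
    (hgτ : ∀ x ∈ U, Pol.dη (τ x) (g x) ∈ Pol.fil k (l + 1) r)
    (hgc : ∀ x ∈ U, ∀ α, Pol.evD (zsForm (.inr α)) (g x) ∈ Pol.fil (k - 1) l r) :
    ∃ (U' : Set M) (h : M → LocPol d m n), IsOpen U' ∧ p₀ ∈ U' ∧ U' ⊆ U ∧
      h ∈ Fam d (LocPol d m n) U' ∧ (∀ x, h x ∈ Pol.fil k (l - 1) (r + 1)) ∧
      ∀ x ∈ U', ∀ ρ, g x - kosDiff (τ x) ρ (h x) ∈ Pol.fil k l (r + 1) := by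
  set c := extChartAt (𝓡 d) p₀ with hc
  set W := c.target ∩ c.symm ⁻¹' U with hW
  have hcU : ∀ x ∈ U, x ∈ c.source := fun x hx => by rw [hc, extChartAt_source]; exact hUq hx
  have hWo : IsOpen W := isOpen_chart_image hU p₀
  have hτW : ContDiffOn ℝ ∞ (fun y => τ (c.symm y)) W :=
    contDiffOn_pi.2 fun a => (hτ a).comp_symm p₀
  obtain ⟨pr, B, Ψ, Θ, s, ε, hε, hB, hso, hys, hsW, hΨ, hΨ0, hΘΨ, hΘ, hΨΘ⟩ :=
    exists_straightening hWo (mem_chart_image hUq hp₀) hτW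
      (by rw [hc, extChartAt_to_inv]; exact h0) hs
  -- Equal to 1 on radius ε/2, where the equation is solved, and supported within radius 3ε/4,
  -- strictly inside the domain of Θ.
  let χ : ContDiffBump (0 : EuclideanSpace ℝ (Fin d)) :=
    ⟨ε / 2, 3 * ε / 4, by positivity, by linarith⟩
  let G : EuclideanSpace ℝ (Fin d) → LocPol d m n := fun v => χ v • g (c.symm (Θ v))
  have hχ0 : ∀ v ∉ Metric.ball (0 : EuclideanSpace ℝ (Fin d)) (3 * ε / 4), χ v = 0 := by
    intro v hv
    exact χ.zero_of_le_dist (by simpa using hv)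
  have hmem : ∀ v ∈ Metric.ball (0 : EuclideanSpace ℝ (Fin d)) ε, c.symm (Θ v) ∈ U :=
    fun v hv => (hsW (hΨΘ v hv).1).2
  have hbb : Metric.ball (0 : EuclideanSpace ℝ (Fin d)) (3 * ε / 4) ⊆ Metric.ball 0 ε :=
    Metric.ball_subset_ball (by linarith)
  have hbb' : Metric.ball (0 : EuclideanSpace ℝ (Fin d)) (ε / 2) ⊆ Metric.ball 0 ε :=
    Metric.ball_subset_ball (by linarith)
  have hGY : ∀ v, G v ∈ Pol.fil k l r := by
    intro v
    by_cases hv : v ∈ Metric.ball (0 : EuclideanSpace ℝ (Fin d)) (3 * ε / 4)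
    · exact Submodule.smul_mem _ _ (hgY _ (hmem v (hbb hv)))
    · simp only [G, hχ0 v hv, zero_smul]; exact zero_mem _
  have hG : ∀ φ : Dual ℝ (LocPol d m n), ContDiff ℝ ∞ fun v => φ (G v) := by
    intro φ
    have h1 : ContDiffOn ℝ ∞ (fun v => φ (g (c.symm (Θ v)))) (Metric.ball 0 ε) :=
      ((Fam.smooth hg φ).comp_symm p₀).comp hΘ fun v hv => hsW (hΨΘ v hv).1
    have h2 : (fun v => φ (G v)) = fun v => χ v * φ (g (c.symm (Θ v))) := by
      funext v; simp only [G, map_smul, smul_eq_mul]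
    rw [h2]
    refine contDiff_iff_contDiffAt.2 fun v => ?_
    by_cases hv : v ∈ Metric.ball (0 : EuclideanSpace ℝ (Fin d)) ε
    · exact χ.contDiffAt.mul (h1.contDiffAt (Metric.isOpen_ball.mem_nhds hv))
    · have h3 : (fun v => χ v * φ (g (c.symm (Θ v)))) =ᶠ[nhds v] fun _ => 0 := by
        have hv' : v ∈ (Metric.closedBall (0 : EuclideanSpace ℝ (Fin d)) (3 * ε / 4))ᶜ := by
          simp only [Metric.mem_ball, not_lt] at hv
          simp only [Set.mem_compl_iff, Metric.mem_closedBall, not_le]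
          linarith
        filter_upwards [Metric.isClosed_closedBall.isOpen_compl.mem_nhds hv'] with w hw
        rw [hχ0 w fun h => hw (Metric.ball_subset_closedBall h), zero_mul]
      exact contDiffAt_const.congr_of_eventuallyEq h3
  have hGeq : ∀ v ∈ Metric.ball (0 : EuclideanSpace ℝ (Fin d)) (ε / 2), G v = g (c.symm (Θ v)) := by
    intro v hv
    have : χ v = 1 := χ.one_of_mem_closedBall (Metric.ball_subset_closedBall hv)
    simp only [G, this, one_smul]
  have hτeq : ∀ v ∈ Metric.ball (0 : EuclideanSpace ℝ (Fin d)) ε, τ (c.symm (Θ v)) = pr v := by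
    intro v hv
    have := (hΘΨ _ (hΨΘ v hv).1).2
    rwa [(hΨΘ v hv).2] at this
  obtain ⟨H, hHY, hH, hHs⟩ := exists_koszul_primitive (V := Metric.ball 0 (ε / 2)) hr hB
    Metric.isOpen_ball hGY hG
    (fun v hv => by rw [hGeq v hv, ← hτeq v (hbb' hv)]; exact hgτ _ (hmem v (hbb' hv)))
    (fun v hv => by rw [hGeq v hv]; exact hgc _ (hmem v (hbb' hv)))
  -- Chosen so that the whole segment from u to u - B(pr u) stays in the ball of radius ε/2 when |u|
  -- < δ.
  set δ := ε / (2 * (1 + ‖B.comp pr‖)) with hδ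
  have hδ0 : 0 < δ := by positivity
  have hδε : δ * (1 + ‖B.comp pr‖) = ε / 2 := by rw [hδ]; field_simp
  have hs'o : IsOpen (s ∩ Ψ ⁻¹' Metric.ball 0 δ) :=
    hΨ.continuousOn.isOpen_inter_preimage hso Metric.isOpen_ball
  have hcc : IsOpen (U ∩ c ⁻¹' (s ∩ Ψ ⁻¹' Metric.ball 0 δ)) :=
    ((continuousOn_extChartAt (I := 𝓡 d) p₀).mono hcU).isOpen_inter_preimage hU hs'o
  have hsub : U ∩ c ⁻¹' (s ∩ Ψ ⁻¹' Metric.ball 0 δ) ⊆ chartDom d p₀ := fun x hx => hUq hx.1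
  refine ⟨U ∩ c ⁻¹' (s ∩ Ψ ⁻¹' Metric.ball 0 δ), fun x => H (Ψ (c x)), hcc,
    ⟨hp₀, hys, ?_⟩, Set.inter_subset_left, ?_, fun x => hHY _, ?_⟩
  · rw [Set.mem_preimage, hΨ0]; exact Metric.mem_ball_self hδ0
  · have hfin := Pol.finiteDimensional_fil (L₁ := Fin m → ℝ) (L₂ := Fin n → ℝ)
      (X := EuclideanSpace ℝ (Fin d)) k (l - 1) (r + 1)
    refine mem_Fam_of_finiteDimensional (fun x => hHY _) fun φ => ?_
    refine SmoothOn.of_comp_symm (q := p₀) hsub (g := fun y => φ (H (Ψ y))) ?_ fun x _ => rfl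
    refine (hH φ).comp_contDiffOn (hΨ.mono fun y hy => ?_)
    have : c (c.symm y) ∈ s := hy.2.2.1
    rwa [c.right_inv hy.1] at this
  · intro x hx ρ
    have h1 := hΘΨ _ hx.2.1
    rw [c.left_inv (hcU x hx.1)] at h1
    have hxδ : ‖Ψ (c x)‖ < δ := mem_ball_zero_iff.1 hx.2.2
    have hball : ∀ t ∈ Set.Icc (0 : ℝ) 1,
        Ψ (c x) - (1 - t) • B (pr (Ψ (c x))) ∈ Metric.ball (0 : EuclideanSpace ℝ (Fin d)) (ε / 2) := by
      intro t ht
      rw [mem_ball_zero_iff, ← hδε]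
      have h2 : ‖B (pr (Ψ (c x)))‖ ≤ ‖B.comp pr‖ * ‖Ψ (c x)‖ := (B.comp pr).le_opNorm _
      have h3 : ‖(1 - t) • B (pr (Ψ (c x)))‖ ≤ ‖B.comp pr‖ * ‖Ψ (c x)‖ := by
        rw [norm_smul, Real.norm_of_nonneg (by linarith [ht.2])]
        exact (mul_le_of_le_one_left (norm_nonneg _) (by linarith [ht.1])).trans h2
      calc _ ≤ ‖Ψ (c x)‖ + ‖B.comp pr‖ * ‖Ψ (c x)‖ := (norm_sub_le _ _).trans (by gcongr)
        _ = ‖Ψ (c x)‖ * (1 + ‖B.comp pr‖) := by ring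
        _ < δ * (1 + ‖B.comp pr‖) := by gcongr
    have h4 := hHs (Ψ (c x)) hball ρ
    have h5 := hball 1 ⟨zero_le_one, le_rfl⟩
    rw [sub_self, zero_smul, sub_zero] at h5
    rw [hGeq _ h5, h1.1, c.left_inv (hcU x hx.1), ← h1.2] at h4
    exact h4

end LocalKoszul

/-! ### Local solutions at an arbitrary point -/

section LocalPrimitive

variable {d m n : ℕ} {M : Type*} [TopologicalSpace M] [ChartedSpace (EuclideanSpace ℝ (Fin d)) M]
  [IsManifold (𝓡 d) ∞ M] {U : Set M} {p₀ : M}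

theorem Fam.sum {W J : Type*} [AddCommGroup W] [Module ℝ W] {s : Finset J} {F : J → M → W}
    (h : ∀ j ∈ s, F j ∈ Fam d W U) : (fun x => ∑ j ∈ s, F j x) ∈ Fam d W U := by
  rw [← Finset.sum_fn]
  exact Submodule.sum_mem _ h

variable {τ : M → Fin m → ℝ} {ρ : M → (Fin n → ℝ) →ₗ[ℝ] EuclideanSpace ℝ (Fin d)}
  {P : M → EuclideanSpace ℝ (Fin d) →ₗ[ℝ] (Fin n → ℝ)} {f : M → LocPol d m n}

theorem kosDiff_mem_Fam (hτ : ∀ a, SmoothOn d U fun x => τ x a)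
    (hρ : ∀ α i, SmoothOn d U fun x => ρ x (Pi.single α 1) i) (hf : f ∈ Fam d (LocPol d m n) U) :
    (fun x => kosDiff (τ x) (ρ x) (f x)) ∈ Fam d (LocPol d m n) U := by
  have h1 : (fun x => Pol.dη (τ x) (f x)) ∈ Fam d (LocPol d m n) U := by
    simp only [dη_eq_sum]
    exact Fam.sum fun a _ => Fam.smul (hτ a) (Fam.map _ hf)
  have h2 : (fun x => ghostDiff (ρ x) (f x)) ∈ Fam d (LocPol d m n) U := by
    have e : (fun x => ghostDiff (ρ x) (f x)) = fun x => ∑ α : Fin n, ∑ i : Fin d,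
        ρ x (Pi.single α 1) i •
          (LinearMap.mulLeft ℝ (Pol.od (0, 0, EuclideanSpace.single i 1)) ∘ₗ
            Pol.evD (zsForm (.inr α))) (f x) := by
      funext x
      simp only [ghostDiff, LinearMap.sum_apply, LinearMap.comp_apply, LinearMap.mulLeft_apply,
        ← smul_mul_assoc, ← Finset.sum_mul]
      refine Finset.sum_congr rfl fun α _ => congrArg (· * _) ?_
      exact (sum_smul_euclideanSingle ((Pol.od : _ →ₗ[ℝ] LocPol d m n) ∘ₗ LinearMap.inr ℝ _ _ ∘ₗ
        LinearMap.inr ℝ _ _) (ρ x (Pi.single α 1))).symm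
    rw [e]
    exact Fam.sum fun α _ => Fam.sum fun i _ => Fam.smul (hρ α i) (Fam.map _ hf)
  exact add_mem h1 h2

theorem kosHtpy_mem_Fam (hP : ∀ i α, SmoothOn d U fun x => P x (EuclideanSpace.single i 1) α)
    (hf : f ∈ Fam d (LocPol d m n) U) :
    (fun x => kosHtpy (P x) (f x)) ∈ Fam d (LocPol d m n) U := by
  have e : (fun x => kosHtpy (P x) (f x)) = fun x => ∑ i : Fin d, ∑ α : Fin n,
      P x (EuclideanSpace.single i 1) α • (LinearMap.mulLeft ℝ (Pol.ev (0, Pi.single α 1)) ∘ₗ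
          Pol.odD (xsForm i)) (f x) := by
    funext x
    simp only [kosHtpy, LinearMap.sum_apply, LinearMap.comp_apply, LinearMap.mulLeft_apply,
      ← smul_mul_assoc, ← Finset.sum_mul]
    refine Finset.sum_congr rfl fun α _ => congrArg (· * _) ?_
    exact (sum_smul_single ((Pol.ev : _ →ₗ[ℝ] LocPol d m n) ∘ₗ LinearMap.inr ℝ _ _) _).symm
  rw [e]
  exact Fam.sum fun i _ => Fam.sum fun α _ => Fam.smul (hP i α) (Fam.map _ hf)

theorem ghostHtpy_mem_Fam (hτ : ∀ a, SmoothOn d U fun x => τ x a)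
    (hρ : ∀ α i, SmoothOn d U fun x => ρ x (Pi.single α 1) i)
    (hP : ∀ i α, SmoothOn d U fun x => P x (EuclideanSpace.single i 1) α)
    (hf : f ∈ Fam d (LocPol d m n) U) (j : ℕ) :
    (fun x => ghostHtpy (τ x) (ρ x) (P x) j (f x)) ∈ Fam d (LocPol d m n) U := by
  induction j with
  | zero => exact zero_mem _
  | succ j ih =>
    have h := kosHtpy_mem_Fam hP (sub_mem hf (kosDiff_mem_Fam hτ hρ ih))
    exact add_mem ih (Submodule.smul_mem _ (j + 1 : ℝ)⁻¹ h)

theorem smoothOn_det {A : M → Matrix (Fin n) (Fin n) ℝ} (hA : ∀ i j, SmoothOn d U fun x => A x i j) :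
    SmoothOn d U fun x => (A x).det := by
  simp only [Matrix.det_apply]
  refine contMDiffOn_finsetSum fun σ _ => ?_
  have h : SmoothOn d U fun x => ∏ i, A x (σ i) i := contMDiffOn_finsetProd fun i _ => hA _ _
  have e : (fun x => Equiv.Perm.sign σ • ∏ i, A x (σ i) i) =
      fun x => ((Equiv.Perm.sign σ : ℤ) : ℝ) * ∏ i, A x (σ i) i := by
    funext x
    rw [Units.smul_def, zsmul_eq_mul]
  rw [e]
  exact ContMDiffOn.mul contMDiffOn_const h

theorem smoothOn_inv {a : M → ℝ} (ha : SmoothOn d U a) (h0 : ∀ x ∈ U, a x ≠ 0) :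
    SmoothOn d U fun x => (a x)⁻¹ := fun x hx =>
  ContDiffAt.comp_contMDiffWithinAt (contDiffAt_inv ℝ (h0 x hx)) (ha x hx)

/-- A bundle map that is injective at a point has a smooth left inverse near the point. -/
theorem exists_leftInverse (hU : IsOpen U) (hp₀ : p₀ ∈ U)
    (hρ : ∀ α i, SmoothOn d U fun x => ρ x (Pi.single α 1) i) (hinj : Function.Injective (ρ p₀)) :
    ∃ (U' : Set M) (P : M → EuclideanSpace ℝ (Fin d) →ₗ[ℝ] (Fin n → ℝ)), IsOpen U' ∧ p₀ ∈ U' ∧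
      U' ⊆ U ∧ (∀ i α, SmoothOn d U' fun x => P x (EuclideanSpace.single i 1) α) ∧
      ∀ x ∈ U', ∀ v, P x (ρ x v) = v := by
  obtain ⟨P₀, hP₀⟩ := (ρ p₀).exists_leftInverse_of_injective (LinearMap.ker_eq_bot.2 hinj)
  -- The left inverse is A⁻¹P₀ with A = P₀ρ, which is the unit matrix at the given point. The
  -- adjugate formula shows that it depends smoothly on the point.
  let A : M → Matrix (Fin n) (Fin n) ℝ := fun x => LinearMap.toMatrix' (P₀ ∘ₗ ρ x)
  have hA : ∀ i j, SmoothOn d U fun x => A x i j := by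
    intro i j
    have e : (fun x => A x i j) = fun x => ∑ k, ρ x (Pi.single j 1) k * P₀ (EuclideanSpace.single k 1) i := by
      funext x
      change LinearMap.toMatrix' (P₀ ∘ₗ ρ x) i j = _
      rw [LinearMap.toMatrix'_apply, LinearMap.comp_apply, ← sum_smul_euclideanSingle P₀]
      simp
    rw [e]
    exact contMDiffOn_finsetSum fun k _ => ContMDiffOn.mul (hρ j k) contMDiffOn_const
  have hdet := smoothOn_det hA
  have hA0 : (A p₀).det = 1 := by
    change (LinearMap.toMatrix' (P₀ ∘ₗ ρ p₀)).det = 1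
    rw [hP₀, LinearMap.toMatrix'_id, Matrix.det_one]
  refine ⟨U ∩ (fun x => (A x).det) ⁻¹' {0}ᶜ,
    fun x => ((A x).det)⁻¹ • (Matrix.toLin' (A x).adjugate ∘ₗ P₀),
    hdet.continuousOn.isOpen_inter_preimage hU isClosed_singleton.isOpen_compl,
    ⟨hp₀, by simp [hA0]⟩, Set.inter_subset_left, fun i α => ?_, fun x hx v => ?_⟩
  · have hadj : ∀ i j, SmoothOn d U fun x => (A x).adjugate i j := by
      intro i j
      simp only [Matrix.adjugate_apply]
      refine smoothOn_det fun i' j' => ?_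
      simp only [Matrix.updateRow_apply]
      split_ifs
      · exact contMDiffOn_const
      · exact hA _ _
    have e : (fun x => (((A x).det)⁻¹ • (Matrix.toLin' (A x).adjugate ∘ₗ P₀))
        (EuclideanSpace.single i 1) α) = fun x => ((A x).det)⁻¹ *
          ∑ j, (A x).adjugate α j * P₀ (EuclideanSpace.single i 1) j := by
      funext x
      simp [Matrix.toLin'_apply, Matrix.mulVec, dotProduct]
    rw [e]
    refine ContMDiffOn.mul (smoothOn_inv (hdet.mono Set.inter_subset_left) fun x hx => hx.2) ?_
    exact (contMDiffOn_finsetSum fun j _ => ContMDiffOn.mul (hadj α j) contMDiffOn_const).mono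
      Set.inter_subset_left
  · have h1 : P₀ (ρ x v) = Matrix.mulVec (A x) v := by
      rw [← Matrix.toLin'_apply, Matrix.toLin'_toMatrix']; rfl
    have h2 : (A x).det ≠ 0 := hx.2
    rw [LinearMap.smul_apply, LinearMap.comp_apply, h1, Matrix.toLin'_apply, Matrix.mulVec_mulVec,
      Matrix.adjugate_mul, Matrix.smul_mulVec, Matrix.one_mulVec, smul_smul, inv_mul_cancel₀ h2,
      one_smul]

/-- Local solutions of the leading part of the equation. -/
theorem exists_local_primitive {k r : ℕ} {l : ℤ} (hr : 1 ≤ r) (hU : IsOpen U) (hp₀ : p₀ ∈ U)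
    (hUq : U ⊆ chartDom d p₀) (hτ : ∀ a, SmoothOn d U fun x => τ x a)
    (hρ : ∀ α i, SmoothOn d U fun x => ρ x (Pi.single α 1) i)
    (hreg : τ p₀ = 0 → Function.Injective (ρ p₀) ∧ Function.Surjective
      (fderiv ℝ (fun y => τ ((extChartAt (𝓡 d) p₀).symm y)) (extChartAt (𝓡 d) p₀ p₀)))
    (hf : f ∈ Fam d (LocPol d m n) U) (hfY : ∀ x ∈ U, f x ∈ Pol.fil k l r)
    (hfδ : ∀ x ∈ U, kosDiff (τ x) (ρ x) (f x) ∈ Pol.fil k (l + 1) r) :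
    ∃ (U' : Set M) (h : M → LocPol d m n), IsOpen U' ∧ p₀ ∈ U' ∧ U' ⊆ U ∧
      h ∈ Fam d (LocPol d m n) U' ∧ (∀ x ∈ U', h x ∈ Pol.fil k (l - 1) (r + 1)) ∧
      ∀ x ∈ U', f x - kosDiff (τ x) (ρ x) (h x) ∈ Pol.fil k l (r + 1) := by
  by_cases h0 : τ p₀ = 0
  · obtain ⟨hinj, hsurj⟩ := hreg h0
    obtain ⟨U₁, P, hU₁, hp₁, hU₁U, hP, hPρ⟩ := exists_leftInverse hU hp₀ hρ hinj
    have hτ₁ : ∀ a, SmoothOn d U₁ fun x => τ x a := fun a => (hτ a).mono hU₁U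
    have hρ₁ : ∀ α i, SmoothOn d U₁ fun x => ρ x (Pi.single α 1) i := fun α i => (hρ α i).mono hU₁U
    have hf₁ := Fam.mono hU₁U hf
    have hgh := ghostHtpy_mem_Fam hτ₁ hρ₁ hP hf₁ k
    have hc : ∀ x ∈ U₁, ∀ α, Pol.evD (zsForm (.inr α))
        (f x - kosDiff (τ x) (ρ x) (ghostHtpy (τ x) (ρ x) (P x) k (f x))) ∈ Pol.fil (k - 1) l r :=
      fun x hx α => evD_sub_kosDiff_mem (τ x) (hPρ x hx) (hfY x (hU₁U hx)) (hfδ x (hU₁U hx)) α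
    -- The Koszul homotopy is applied to the function whose leading term has been freed of c*. For
    -- it the c* part of δ is negligible, and the cocycle condition concerns τ alone.
    obtain ⟨U', h, hU', hp', hU'U, hh, hhY, hs⟩ := exists_local_koszul_primitive hr hU₁ hp₁
      (hU₁U.trans hUq) hτ₁ h0 hsurj (sub_mem hf₁ (kosDiff_mem_Fam hτ₁ hρ₁ hgh))
      (fun x hx => sub_kosDiff_ghostHtpy_mem (τ x) (hfY x (hU₁U hx)) k)
      (fun x hx => by
        have h1 : kosDiff (τ x) (ρ x)
            (f x - kosDiff (τ x) (ρ x) (ghostHtpy (τ x) (ρ x) (P x) k (f x))) =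
            kosDiff (τ x) (ρ x) (f x) := by rw [map_sub, kosDiff_kosDiff, sub_zero]
        have h2 := sub_mem (h1 ▸ hfδ x (hU₁U hx)) (ghostDiff_mem (ρ x) (hc x hx))
        rwa [kosDiff, LinearMap.add_apply, add_sub_cancel_right] at h2) hc
    refine ⟨U', fun x => ghostHtpy (τ x) (ρ x) (P x) k (f x) + h x, hU', hp', hU'U.trans hU₁U,
      add_mem (Fam.mono hU'U hgh) hh,
      fun x hx => add_mem (ghostHtpy_mem (τ x) (hfY x (hU₁U (hU'U hx))) k) (hhY x),
      fun x hx => ?_⟩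
    rw [map_add, ← sub_sub]
    exact hs x hx (ρ x)
  · obtain ⟨a, ha⟩ := Function.ne_iff.1 h0
    -- Where a component τ^a is invertible, η^a/τ^a has δ-derivative 1, so multiplication by it
    -- contracts the complex. The error is this factor times δf, which the extra η^a puts into
    -- F^(r+1).
    refine ⟨U ∩ (fun x => τ x a) ⁻¹' {0}ᶜ,
      fun x => (τ x a)⁻¹ • LinearMap.mulLeft ℝ (Pol.od (LinearMap.proj a, 0, 0)) (f x),
      (hτ a).continuousOn.isOpen_inter_preimage hU isClosed_singleton.isOpen_compl, ⟨hp₀, ha⟩,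
      Set.inter_subset_left, ?_, fun x hx => ?_, fun x hx => ?_⟩
    · exact Fam.smul (smoothOn_inv ((hτ a).mono Set.inter_subset_left) fun x hx => hx.2)
        (Fam.map _ (Fam.mono Set.inter_subset_left hf))
    · exact Submodule.smul_mem _ _ (mem_fil_of_le (Pol.mul_mem_fil
        (mem_fil_of_gr (Pol.eta_mem_gr _)) (hfY x hx.1)) (by omega) (by omega) (by omega))
    · have e : f x - kosDiff (τ x) (ρ x) ((τ x a)⁻¹ •
          LinearMap.mulLeft ℝ (Pol.od (LinearMap.proj a, 0, 0)) (f x)) =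
          (τ x a)⁻¹ • (Pol.od (LinearMap.proj a, 0, 0) * kosDiff (τ x) (ρ x) (f x)) := by
        have hx2 : τ x a ≠ 0 := hx.2
        rw [map_smul, LinearMap.mulLeft_apply, (odDer_kosDiff _ _).mul, kosDiff_od, Pol.parity_od,
          smul_mul_assoc, one_mul, neg_mul, smul_add, smul_smul, LinearMap.proj_apply,
          inv_mul_cancel₀ hx2, one_smul, smul_neg]
        abel
      rw [e]
      exact Submodule.smul_mem _ _ (mem_fil_of_le (Pol.mul_mem_fil
        (mem_fil_of_gr (Pol.eta_mem_gr _)) (hfδ x hx.1)) (by omega) (by omega) (by omega))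

end LocalPrimitive

/-! ### The leading term of `Q` -/

section Leading

variable {d m n : ℕ}

/-- The function `T^a η*_a + c^α R^i_α x*_i`. -/
def leadP (τ : Fin m → ℝ) (ρ : (Fin n → ℝ) →ₗ[ℝ] EuclideanSpace ℝ (Fin d)) : LocPol d m n :=
  Pol.ev (τ, 0) + ∑ α : Fin n, Pol.od (0, LinearMap.proj α, 0) * Pol.od (0, 0, ρ (Pi.single α 1))

/-- The only nonzero vertical derivatives of the initial term are T^a along η*_a and R^i_α x*_i
along c^α. They multiply the derivatives along η and along c*. -/
theorem vertP_leadP (τ : Fin m → ℝ) (ρ : (Fin n → ℝ) →ₗ[ℝ] EuclideanSpace ℝ (Fin d))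
    (f : LocPol d m n) : vertP (leadP τ ρ) f = kosDiff τ ρ f := by
  have h1 : ∀ a, Pol.evD (zsForm (.inl a)) (leadP τ ρ : LocPol d m n) = τ a • 1 := fun a => by
    simp [leadP, Pol.evD_mul, zsForm]
  have h2 : ∀ α, Pol.evD (zsForm (.inr α)) (leadP τ ρ : LocPol d m n) = 0 := fun α => by
    simp [leadP, Pol.evD_mul, zsForm]
  have h3 : ∀ a, Pol.odD (zForm (.inl a)) (leadP τ ρ : LocPol d m n) = 0 := fun a => by
    simp [leadP, Pol.odD_mul, zForm]
  have h4 : ∀ α, Pol.odD (zForm (.inr α)) (leadP τ ρ : LocPol d m n) =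
      Pol.od (0, 0, ρ (Pi.single α 1)) := fun α => by
    simp [leadP, Pol.odD_mul, zForm, Pi.single_apply]
  rw [vertP, Fintype.sum_sum_type, kosDiff, LinearMap.add_apply, dη_eq_sum, ghostDiff]
  simp only [h1, h2, h3, h4, zero_mul, add_zero, zero_add, smul_mul_assoc, one_mul,
    LinearMap.sum_apply, LinearMap.comp_apply, LinearMap.mulLeft_apply]

variable {M : Type*} [TopologicalSpace M] [ChartedSpace (EuclideanSpace ℝ (Fin d)) M]
  [IsManifold (𝓡 d) ∞ M]
  {E : M → Type*} [TopologicalSpace (TotalSpace (Fin m → ℝ) E)]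
  [∀ p, AddCommGroup (E p)] [∀ p, Module ℝ (E p)] [∀ p, TopologicalSpace (E p)]
  [FiberBundle (Fin m → ℝ) E] [VectorBundle ℝ (Fin m → ℝ) E]
  {F : M → Type*} [TopologicalSpace (TotalSpace (Fin n → ℝ) F)]
  [∀ p, AddCommGroup (F p)] [∀ p, Module ℝ (F p)] [∀ p, TopologicalSpace (F p)]
  [FiberBundle (Fin n → ℝ) F] [VectorBundle ℝ (Fin n → ℝ) F]
  {q p x : M}

/-- The matrix of a bundle map to the tangent bundle. -/
def tmat (R : (p : M) → F p →L[ℝ] TangentSpace (𝓡 d) p) (q x : M) :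
    (Fin n → ℝ) →ₗ[ℝ] EuclideanSpace ℝ (Fin d) :=
  tcomps q x ∘ₗ (R x).toLinearMap ∘ₗ csymm F q x

theorem linearMap_sum_smul {W W' J : Type*} [AddCommGroup W] [Module ℝ W] [AddCommGroup W'] [Module ℝ W']
    [Fintype J] (L : W →ₗ[ℝ] W') (c : J → ℝ) (v : J → W) :
    L (∑ j, c j • v j) = ∑ j, c j • L (v j) := by
  simp only [map_sum, map_smul]

/-- The initial term is written in the frame preferred at x, the right side in the one at q. They
agree because a sum of dual frame vectors times frame vectors does not depend on the frame. -/
theorem rep_initialTerm (T : (p : M) → E p) (R : (p : M) → F p →L[ℝ] TangentSpace (𝓡 d) p)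
    (q x : M) : rep m n (initialTerm n T R) q x =
      leadP (comps m q x (T x)) (tmat R q x) := by
  have e : toPol (initialTerm n T R x) = Pol.ev (T x, 0) +
      ∑ α : Fin n, Pol.od (0, LinearMap.proj α ∘ₗ comps (V := F) n x x, 0) *
        Pol.od (0, 0, R x (frame (V := F) x α x)) := by
    rw [initialTerm, map_add, map_sum]
    simp only [map_mul]
    rfl
  have hx : x ∈ frameDom n F x := FiberBundle.mem_baseSet_trivializationAt' x
  rw [rep, e, toRep, map_add, map_sum, leadP]
  simp only [map_mul, Pol.map_ev, Pol.map_od, map_zero, LinearMap.zero_comp]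
  congr 1
  have h1 : ∀ α : Fin n, (LinearMap.proj α ∘ₗ comps (V := F) n x x) ∘ₗ csymm F q x =
      ∑ β : Fin n, trans F q x β α x • (LinearMap.proj β : (Fin n → ℝ) →ₗ[ℝ] ℝ) := by
    intro α
    refine LinearMap.pi_ext' fun i => LinearMap.ext_ring ?_
    simp [Pi.single_apply, trans, frame]
  have h2 : ∀ β : Fin n, (tmat R q x) (Pi.single β 1) =
      ∑ α, trans F q x β α x • tcomps q x (R x (frame (V := F) x α x)) := by
    intro β
    have h3 := frame_eq_sum (V := F) (q := q) hx β
    change tcomps q x (R x (frame (V := F) q β x)) = _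
    rw [h3]
    simp
  have h4 : ∀ α : Fin n, (Pol.od (0, (LinearMap.proj α ∘ₗ comps (V := F) n x x) ∘ₗ csymm F q x, 0) : LocPol d m n) =
      ∑ β : Fin n, trans F q x β α x • Pol.od (0, LinearMap.proj β, 0) := fun α => by
    rw [h1]
    exact linearMap_sum_smul ((Pol.od : _ →ₗ[ℝ] LocPol d m n) ∘ₗ LinearMap.inr ℝ _ _ ∘ₗ
      LinearMap.inl ℝ _ _) (fun β => trans F q x β α x) fun β => LinearMap.proj β
  have h5 : ∀ β : Fin n, (Pol.od (0, 0, tmat R q x (Pi.single β 1)) : LocPol d m n) =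
      ∑ α, trans F q x β α x • Pol.od (0, 0, tcomps q x (R x (frame (V := F) x α x))) := fun β => by
    rw [h2]
    exact linearMap_sum_smul ((Pol.od : _ →ₗ[ℝ] LocPol d m n) ∘ₗ LinearMap.inr ℝ _ _ ∘ₗ
      LinearMap.inr ℝ _ _) (fun α => trans F q x β α x) fun α => tcomps q x (R x (frame (V := F) x α x))
  simp only [h4, h5, Finset.sum_mul, Finset.mul_sum, smul_mul_assoc, mul_smul_comm]
  exact Finset.sum_comm

/-- The rest of S¹ has resolution degree at least 1, which makes up for the degree lost by the
vertical derivatives. -/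
theorem vertP_rep_sub_kosDiff_mem {T : (p : M) → E p}
    {R : (p : M) → F p →L[ℝ] TangentSpace (𝓡 d) p} {S : PreFun (d := d) E F}
    (hS : S x - initialTerm n T R x ∈ bihomogResPos 1 2) (q : M) {k l r : ℤ} {f : LocPol d m n}
    (hf : f ∈ Pol.fil k l r) :
    vertP (rep m n S q x) f - kosDiff (comps m q x (T x)) (tmat R q x) f ∈ Pol.fil k (l + 1) r := by
  rw [← vertP_leadP, ← rep_initialTerm, ← sub_vertP]
  have h : toRep m n E F q x (toPol (S x - initialTerm n T R x)) ∈ Pol.fil 1 2 1 :=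
    Pol.map_mem_fil _ _ _ _ _ (by simpa using Pol.toPol_mem_of_mem_bihomogResPos hS)
  rw [map_sub, map_sub] at h
  exact mem_fil_of_le (vertP_mem h hf) rfl rfl (by simp)

variable [ContMDiffVectorBundle ∞ (Fin m → ℝ) E (𝓡 d)]
  [ContMDiffVectorBundle ∞ (Fin n → ℝ) F (𝓡 d)]

theorem smoothOn_tcomps {s : (x : M) → TangentSpace (𝓡 d) x} {U : Set M} (hU : IsOpen U)
    (hUq : U ⊆ chartDom d q)
    (hs : ContMDiffOn (𝓡 d) ((𝓡 d).prod 𝓘(ℝ, EuclideanSpace ℝ (Fin d))) ∞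
      (fun x => TotalSpace.mk' (EuclideanSpace ℝ (Fin d)) (E := TangentSpace (𝓡 d)) x (s x)) U)
    (i : Fin d) : SmoothOn d U fun x => tcomps q x (s x) i := by
  have : IsManifold (𝓡 d) (∞ + 1) M := by simpa using ‹IsManifold (𝓡 d) ∞ M›
  have : IsManifold (𝓡 d) 1 M := isManifold_one
  rw [(trivializationAt (EuclideanSpace ℝ (Fin d)) (TangentSpace (𝓡 d) : M → Type _)
    q).contMDiffOn_section_iff hU (fun x hx => mem_tangent_baseSet (hUq hx))] at hs
  have h2 : ContMDiff 𝓘(ℝ, EuclideanSpace ℝ (Fin d)) 𝓘(ℝ, ℝ) ∞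
      (EuclideanSpace.proj i : EuclideanSpace ℝ (Fin d) →L[ℝ] ℝ) := ContinuousLinearMap.contMDiff _
  refine (h2.comp_contMDiffOn hs).congr fun x hx => ?_
  rw [tcomps, Trivialization.coe_linearMapAt_of_mem _ (mem_tangent_baseSet (hUq hx))]
  rfl

theorem smoothOn_tmat [∀ p, IsTopologicalAddGroup (F p)] [∀ p, ContinuousSMul ℝ (F p)]
    (R : Cₛ^∞⟮𝓡 d; (Fin n → ℝ) →L[ℝ] EuclideanSpace ℝ (Fin d),
      fun p : M => F p →L[ℝ] TangentSpace (𝓡 d) p⟯) {U : Set M} (hU : IsOpen U)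
    (hUq : U ⊆ chartDom d q) (hUF : U ⊆ frameDom n F q) (α : Fin n) (i : Fin d) :
    SmoothOn d U fun x => tmat R q x (Pi.single α 1) i := by
  have : IsManifold (𝓡 d) (∞ + 1) M := by simpa using ‹IsManifold (𝓡 d) ∞ M›
  have : IsManifold (𝓡 d) 1 M := isManifold_one
  refine smoothOn_tcomps hU hUq (s := fun x => R x (frame q α x)) ?_ i
  exact ContMDiffOn.clm_bundle_apply (b := fun x => x) R.contMDiff.contMDiffOn
    ((contMDiffOn_frame F q α).mono hUF)

/-- At a zero of T the connection terms in ∇T are multiplied by the components of T and vanish. The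
covariant derivative is then the ordinary derivative of the components in the chart. -/
theorem regular_of_zero [∀ p, IsTopologicalAddGroup (E p)] [∀ p, ContinuousSMul ℝ (E p)]
    (covE : CovariantDerivative (𝓡 d) (Fin m → ℝ) E)
    {T : (p : M) → E p} (hTs : ContMDiff (𝓡 d) ((𝓡 d).prod 𝓘(ℝ, Fin m → ℝ)) ∞
      (fun x => TotalSpace.mk' (Fin m → ℝ) x (T x)))
    {R : (p : M) → F p →L[ℝ] TangentSpace (𝓡 d) p}
    (hT : T p = 0 → Function.Surjective (covE T p)) (hR : T p = 0 → Function.Injective (R p))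
    (h0 : comps m p p (T p) = 0) : Function.Injective (tmat (n := n) R p p) ∧ Function.Surjective
      (fderiv ℝ (fun y => comps m p ((extChartAt (𝓡 d) p).symm y) (T ((extChartAt (𝓡 d) p).symm y)))
        (extChartAt (𝓡 d) p p)) := by
  have hpE : p ∈ frameDom m E p := FiberBundle.mem_baseSet_trivializationAt' p
  have hpF : p ∈ frameDom n F p := FiberBundle.mem_baseSet_trivializationAt' p
  have hpc : p ∈ chartDom d p := mem_chart_source _ p
  have hTp : T p = 0 := by
    have := LinearMap.congr_fun (csymm_comp_comps hpE) (T p)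
    rw [LinearMap.comp_apply, h0, map_zero] at this
    exact this.symm
  constructor
  · have hi1 : Function.Injective (csymm F p p) :=
      Function.LeftInverse.injective (LinearMap.congr_fun (comps_comp_csymm hpF))
    have hi2 : Function.Injective (tcomps (d := d) p p) :=
      Function.LeftInverse.injective (LinearMap.congr_fun (tsymm_comp_tcomps hpc))
    exact hi2.comp ((hR hTp).comp hi1)
  · have hsm : ∀ c, SmoothOn d (frameDom m E p) fun x => comps m p x (T x) c := fun c =>
      smoothOn_comps (trivializationAt (Fin m → ℝ) E p).open_baseSet subset_rfl hTs.contMDiffOn c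
    have hmd : ∀ c, MDifferentiableAt (𝓡 d) 𝓘(ℝ, ℝ) (fun x => comps m p x (T x) c) p := fun c =>
      (hsm c).mdifferentiableAt (trivializationAt (Fin m → ℝ) E p).open_baseSet hpE
    have hdiff : ∀ c, DifferentiableAt ℝ (fun y => comps m p ((extChartAt (𝓡 d) p).symm y)
        (T ((extChartAt (𝓡 d) p).symm y)) c) (extChartAt (𝓡 d) p p) := fun c => by
      have hm := (hsm c).mono (Set.inter_subset_left (t := chartDom d p))
      have ho := (trivializationAt (Fin m → ℝ) E p).open_baseSet.inter
        (chartAt (EuclideanSpace ℝ (Fin d)) p).open_source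
      exact ((SmoothOn.comp_symm hm p).contDiffAt ((isOpen_chart_image ho p).mem_nhds
        (mem_chart_image (fun _ h => h.2) ⟨hpE, hpc⟩))).differentiableAt (by simp)
    intro w
    obtain ⟨v, hv⟩ := hT hTp (csymm E p p w)
    refine ⟨∑ k, mvfderiv (𝓡 d) (chartCoord p k) p v • EuclideanSpace.single k 1, ?_⟩
    have hc := cov_eq_sum covE hpE (trivializationAt (Fin m → ℝ) E p).open_baseSet hpE subset_rfl
      hTs.contMDiffOn v
    rw [hv] at hc
    funext c
    have h1 := congrFun (congrArg (comps m p p) hc) c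
    have h2 : comps m p p (csymm E p p w) = w := LinearMap.congr_fun (comps_comp_csymm hpE) w
    simp only [h2, h0, Pi.zero_apply, zero_smul, zero_add, map_sum, map_smul, comps_frame hpE,
      Finset.sum_apply, Pi.smul_apply, Pi.single_apply, smul_eq_mul, mul_ite, mul_one, mul_zero,
      Finset.sum_ite_eq, Finset.mem_univ, if_true] at h1
    rw [h1, fderiv_pi hdiff]
    conv_rhs => rw [eq_sum_coordVec hpc v]
    simp only [map_sum, map_smul, ContinuousLinearMap.pi_apply]
    refine Finset.sum_congr rfl fun k _ => congrArg _ ?_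
    exact (sd_eq_fderiv hpc k (hmd c)).symm

end Leading

/-! ### Exactness of `Q` -/

section Exactness

variable {d m n : ℕ} {M : Type*} [TopologicalSpace M] [ChartedSpace (EuclideanSpace ℝ (Fin d)) M]
  [IsManifold (𝓡 d) ∞ M]
  {E : M → Type*} [TopologicalSpace (TotalSpace (Fin m → ℝ) E)]
  [∀ p, AddCommGroup (E p)] [∀ p, Module ℝ (E p)] [∀ p, TopologicalSpace (E p)]
  [FiberBundle (Fin m → ℝ) E] [VectorBundle ℝ (Fin m → ℝ) E]
  {F : M → Type*} [TopologicalSpace (TotalSpace (Fin n → ℝ) F)]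
  [∀ p, AddCommGroup (F p)] [∀ p, Module ℝ (F p)] [∀ p, TopologicalSpace (F p)]
  [FiberBundle (Fin n → ℝ) F] [VectorBundle ℝ (Fin n → ℝ) F]
  {S G : PreFun (d := d) E F}
  [ContMDiffVectorBundle ∞ (Fin m → ℝ) E (𝓡 d)]
  [ContMDiffVectorBundle ∞ (Fin n → ℝ) F (𝓡 d)]
  [∀ p, IsTopologicalAddGroup (E p)] [∀ p, ContinuousSMul ℝ (E p)]
  [∀ p, IsTopologicalAddGroup (F p)] [∀ p, ContinuousSMul ℝ (F p)]
  (covE : CovariantDerivative (𝓡 d) (Fin m → ℝ) E)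
  (covF : CovariantDerivative (𝓡 d) (Fin n → ℝ) F)
  [T2Space M] (hcovE : CovariantDerivative.ContMDiffCovariantDerivative covE ∞)
    (hcovF : CovariantDerivative.ContMDiffCovariantDerivative covF ∞)
  {k : ℕ} {l : ℤ} {r : ℕ}
include hcovE hcovF

/-- QG = 0 and the leading term of Q show that δG lies in F^r. A primitive for δ is also one for the
vertical part of Q, since the two differ by terms in F^(r+1) on h. -/
theorem exists_local_solution (T : Cₛ^∞⟮𝓡 d; Fin m → ℝ, E⟯)
    (R : Cₛ^∞⟮𝓡 d; (Fin n → ℝ) →L[ℝ] EuclideanSpace ℝ (Fin d),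
      fun p : M => F p →L[ℝ] TangentSpace (𝓡 d) p⟯)
    (hT : ∀ p, T p = 0 → Function.Surjective (covE T p))
    (hR : ∀ p, T p = 0 → Function.Injective (R p))
    (hS : S ∈ smoothFun m n E F 1 2)
    (hS₁ : ∀ p, S p - initialTerm n T R p ∈ bihomogResPos 1 2)
    (hr : 1 ≤ r) (hG : G ∈ smoothFun m n E F k l) (hQ : bracket covE covF S G = 0)
    (hGr : ∀ x, toPol (G x) ∈ Pol.fil k l r) (p : M) :
    ∃ (U : Set M) (h : M → LocPol d m n), IsOpen U ∧ p ∈ U ∧ U ⊆ dom d m n E F p ∧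
      h ∈ Fam d (LocPol d m n) U ∧ (∀ x ∈ U, h x ∈ Pol.fil k (l - 1) (r + 1)) ∧
      ∀ x ∈ U, rep m n G p x - vertP (rep m n S p x) (h x) ∈ Pol.fil k l (r + 1) := by
  have ho : IsOpen (dom d m n E F p) := isOpen_dom p
  obtain ⟨U, h, hU, hpU, hUd, hh, hhr, hs⟩ := exists_local_primitive (l := l)
    (τ := fun x => comps m p x (T x)) (ρ := tmat R p) (f := rep m n G p) (k := k) hr
    ho (mem_dom p) (fun _ hx => hx.1)
    (fun a => smoothOn_comps ho (fun _ hx => hx.2.1) T.contMDiff.contMDiffOn a)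
    (fun α i => smoothOn_tmat R ho (fun _ hx => hx.1) (fun _ hx => hx.2.2) α i)
    (regular_of_zero covE T.contMDiff (hT p) (hR p))
    (rep_mem_Fam covE covF hcovE hcovF hG p) (fun x _ => rep_mem (hGr x) p) (fun x hx => by
      have h1 := rep_bracket_sub_vertP_mem covE covF hcovE hcovF hS hG hGr hx
      rw [hQ, rep_zero, zero_sub] at h1
      have h2 := vertP_rep_sub_kosDiff_mem (hS₁ x) p (rep_mem (m := m) (n := n) (hGr x) p)
      have h3 := neg_mem (add_mem h1 h2)
      rwa [neg_add_eq_sub, sub_sub_cancel_left, neg_neg] at h3)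
  refine ⟨U, h, hU, hpU, hUd, hh, hhr, fun x hx => ?_⟩
  have h2 := vertP_rep_sub_kosDiff_mem (hS₁ x) p (hhr x hx)
  rw [sub_add_cancel] at h2
  have h3 := sub_mem (hs x hx) h2
  rwa [sub_sub_sub_cancel_right] at h3

/-- The vertical part of Q is real linear at each point, does not differentiate the partition
functions and commutes with changes of coordinates. The remaining part of Q, which does
differentiate them, maps F^(r+1) to itself and is absorbed in the error. -/
theorem exists_glued [SigmaCompactSpace M] {U : M → Set M} {h : M → M → LocPol d m n}
    (hS : S ∈ smoothFun m n E F 1 2) (hU : ∀ p, IsOpen (U p)) (hpU : ∀ p, p ∈ U p)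
    (hUd : ∀ p, U p ⊆ dom d m n E F p) (hh : ∀ p, h p ∈ Fam d (LocPol d m n) (U p))
    (hhr : ∀ p, ∀ x ∈ U p, h p x ∈ Pol.fil k (l - 1) (r + 1))
    (hs : ∀ p, ∀ x ∈ U p, rep m n G p x - vertP (rep m n S p x) (h p x) ∈ Pol.fil k l (r + 1)) :
    ∃ H ∈ smoothFun m n E F k (l - 1),
      ∀ x, toPol ((G - bracket covE covF S H) x) ∈ Pol.fil k l (r + 1) := by
  obtain ⟨χ, hχ⟩ := SmoothPartitionOfUnity.exists_isSubordinate (𝓡 d) isClosed_univ U hU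
    (fun p _ => Set.mem_iUnion.2 ⟨p, hpU p⟩)
  have hmem : ∀ x, ∀ p ∈ χ.finsupport x, x ∈ U p := fun x p hp =>
    hχ p (subset_closure ((χ.mem_finsupport x).1 hp))
  let H : PreFun (d := d) E F := fun x =>
    toPol.symm (∑ p ∈ χ.finsupport x, χ p x • ofRep m n E F p x (h p x))
  have hH : ∀ x, toPol (H x) = ∑ p ∈ χ.finsupport x, χ p x • ofRep m n E F p x (h p x) :=
    fun x => toPol.apply_symm_apply _
  have hrep : ∀ q x, rep m n H q x = ∑ p ∈ χ.finsupport x, χ p x • chg m n E F p q x (h p x) := by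
    intro q x
    rw [rep, hH, map_sum]
    exact Finset.sum_congr rfl fun p _ => map_smul _ _ _
  have hfil : ∀ x, toPol (H x) ∈ Pol.fil k (l - 1) (r + 1) := fun x => by
    rw [hH]
    exact sum_mem fun p hp => Submodule.smul_mem _ _
      (Pol.map_mem_fil _ _ _ _ _ (hhr p x (hmem x p hp)))
  have hHs : H ∈ smoothFun m n E F k (l - 1) := by
    refine mem_smoothFun (fun p => Pol.fil_mono (by omega) (hfil p)) fun q φ x₀ hx₀ => ?_
    refine ContMDiffAt.contMDiffWithinAt ?_
    -- Written as a locally finite sum over all indices, to which the smoothness statement for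
    -- partitions of unity applies.
    have e : (fun x => φ (rep m n H q x)) =
        fun x => ∑ᶠ p, χ p x • φ (chg m n E F p q x (h p x)) := by
      funext x
      rw [hrep, map_sum, ← χ.sum_finsupport_smul_eq_finsum x fun p x => φ (chg m n E F p q x (h p x))]
      exact Finset.sum_congr rfl fun p _ => map_smul _ _ _
    rw [e]
    refine χ.contMDiffAt_finsum fun p hp => ?_
    have := Pol.finiteDimensional_fil (L₁ := Fin m → ℝ) (L₂ := Fin n → ℝ)
      (X := EuclideanSpace ℝ (Fin d)) k (l - 1) (r + 1)
    have hxU := hχ p hp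
    refine contMDiffAt_chg covE covF hcovE hcovF (Y := Pol.fil k (l - 1) (r + 1)) ?_
      (fun φ => (Fam.smooth (hh p) φ).contMDiffAt ((hU p).mem_nhds hxU)) p q (hUd p hxU) hx₀ φ
    filter_upwards [(hU p).mem_nhds hxU] with y hy using hhr p y hy
  refine ⟨H, hHs, fun x => toPol_mem (m := m) (n := n) (mem_dom x) ?_⟩
  have h1 := rep_bracket_sub_vertP_mem covE covF hcovE hcovF hS hHs hfil (mem_dom x)
  have h2 : rep m n G x x - vertP (rep m n S x x) (rep m n H x x) ∈ Pol.fil k l (r + 1) := by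
    have e : rep m n G x x - vertP (rep m n S x x) (rep m n H x x) =
        ∑ p ∈ χ.finsupport x, χ p x •
          chg m n E F p x x (rep m n G p x - vertP (rep m n S p x) (h p x)) := by
      have e1 : rep m n G x x = ∑ p ∈ χ.finsupport x, χ p x • rep m n G x x := by
        rw [← Finset.sum_smul, χ.sum_finsupport x (Set.mem_univ x), one_smul]
      have e2 : vertP (rep m n S x x) (rep m n H x x) = ∑ p ∈ χ.finsupport x,
          χ p x • vertP (rep m n S x x) (chg m n E F p x x (h p x)) := by
        rw [hrep]
        let L : LocPol d m n →ₗ[ℝ] LocPol d m n :=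
          { toFun := vertP (rep m n S x x)
            map_add' := vertP_add _
            map_smul' := fun c f => vertP_smul _ f c }
        exact (map_sum L _ _).trans (Finset.sum_congr rfl fun p _ => map_smul L _ _)
      rw [e2]
      conv_lhs => rw [e1]
      rw [← Finset.sum_sub_distrib]
      refine Finset.sum_congr rfl fun p hp => ?_
      have hxp := hUd p (hmem x p hp)
      rw [← smul_sub, map_sub, chg_rep hxp,
        ← (coordChange covE covF hcovE hcovF p x).vertP_Φ ⟨hxp, mem_dom x⟩, chg_rep hxp]
    rw [e]
    exact sum_mem fun p hp => Submodule.smul_mem _ _ (chg_mem_fil p x x (hs p x (hmem x p hp)))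
  rw [sub_add_cancel] at h1
  have h3 := sub_mem h2 h1
  rw [sub_sub_sub_cancel_right] at h3
  rw [rep_sub]
  exact h3

/-- Descent along the filtration. N bounds the number of steps left before r exceeds m + k, where
nothing but zero remains. The error of each step is again a cocycle because Q² = 0. -/
theorem exists_primitive [SigmaCompactSpace M] (T : Cₛ^∞⟮𝓡 d; Fin m → ℝ, E⟯)
    (R : Cₛ^∞⟮𝓡 d; (Fin n → ℝ) →L[ℝ] EuclideanSpace ℝ (Fin d),
      fun p : M => F p →L[ℝ] TangentSpace (𝓡 d) p⟯)
    (hT : ∀ p, T p = 0 → Function.Surjective (covE T p))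
    (hR : ∀ p, T p = 0 → Function.Injective (R p))
    (hS : S ∈ smoothFun m n E F 1 2)
    (hS₁ : ∀ p, S p - initialTerm n T R p ∈ bihomogResPos 1 2)
    (hSS : bracket covE covF S S = 0) (N : ℕ) :
    ∀ (r : ℕ) (_ : 1 ≤ r) (_ : m + k < r + N) (G : PreFun (d := d) E F)
      (_ : G ∈ smoothFun m n E F k l) (_ : bracket covE covF S G = 0)
      (_ : ∀ x, toPol (G x) ∈ Pol.fil k l r),
      ∃ H ∈ smoothFun m n E F k (l - 1), bracket covE covF S H = G := by
  induction N with
  | zero =>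
    intro r _ hrN G hG _ hGr
    have h0 : G = 0 := ext_rep (m := m) (n := n) fun x => by
      have h1 := rep_mem (m := m) (n := n) (hGr x) x
      rw [Pol.fil_eq_bot_of_lt (by rw [Module.finrank_fin_fun]; exact_mod_cast hrN)] at h1
      rw [rep_zero]
      exact h1
    refine ⟨0, mem_smoothFun (fun p => ?_) fun q φ => ?_, ?_⟩
    · rw [Pi.zero_apply, map_zero]; exact zero_mem _
    · simp only [rep_zero, map_zero]; exact contMDiffOn_const
    · rw [(bracket_zero_left covE covF S).2, h0]
  | succ N ih =>
    intro r hr hrN G hG hQ hGr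
    choose U h hU hpU hUd hh hhr hs using
      exists_local_solution covE covF hcovE hcovF T R hT hR hS hS₁ hr hG hQ hGr
    obtain ⟨H₁, hH₁, hGH⟩ := exists_glued covE covF hcovE hcovF hS hU hpU hUd hh hhr hs
    have hb : bracket covE covF S H₁ ∈ smoothFun m n E F k l := by
      simpa using bracket_mem covE covF hcovE hcovF hS hH₁
    obtain ⟨H₂, hH₂, hQ₂⟩ := ih (r + 1) (by omega) (by omega) (G - bracket covE covF S H₁)
      (smoothFun_sub hG hb)
      (by rw [bracket_sub covE covF hcovE hcovF hS hG hb, hQ,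
        bracket_bracket covE covF hcovE hcovF hS hSS hH₁, sub_zero])
      (by exact_mod_cast hGH)
    have hH : H₂ + H₁ ∈ smoothFun m n E F k (l - 1) := smoothFun_add hH₂ hH₁
    refine ⟨H₂ + H₁, hH, ?_⟩
    have h3 := bracket_sub covE covF hcovE hcovF hS hH hH₁
    rw [add_sub_cancel_right, hQ₂] at h3
    exact (sub_left_inj.1 h3).symm

end Exactness

end BRST

end

theorem lemma1 {d m n : ℕ}
    {M : Type*} [TopologicalSpace M] [ChartedSpace (EuclideanSpace ℝ (Fin d)) M]
    [IsManifold (𝓡 d) ∞ M] [T2Space M] [SigmaCompactSpace M]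
    {E : M → Type*} [TopologicalSpace (TotalSpace (Fin m → ℝ) E)]
    [∀ p, AddCommGroup (E p)] [∀ p, Module ℝ (E p)] [∀ p, TopologicalSpace (E p)]
    [∀ p, IsTopologicalAddGroup (E p)] [∀ p, ContinuousSMul ℝ (E p)]
    [FiberBundle (Fin m → ℝ) E] [VectorBundle ℝ (Fin m → ℝ) E]
    [ContMDiffVectorBundle ∞ (Fin m → ℝ) E (𝓡 d)]
    {F : M → Type*} [TopologicalSpace (TotalSpace (Fin n → ℝ) F)]
    [∀ p, AddCommGroup (F p)] [∀ p, Module ℝ (F p)] [∀ p, TopologicalSpace (F p)]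
    [∀ p, IsTopologicalAddGroup (F p)] [∀ p, ContinuousSMul ℝ (F p)]
    [FiberBundle (Fin n → ℝ) F] [VectorBundle ℝ (Fin n → ℝ) F]
    [ContMDiffVectorBundle ∞ (Fin n → ℝ) F (𝓡 d)]
    (covE : CovariantDerivative (𝓡 d) (Fin m → ℝ) E)
    (covF : CovariantDerivative (𝓡 d) (Fin n → ℝ) F)
    (hcovE : CovariantDerivative.ContMDiffCovariantDerivative covE ∞)
    (hcovF : CovariantDerivative.ContMDiffCovariantDerivative covF ∞)
    -- the section `T` of `E` and the bundle map `R : F → TM`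
    (T : Cₛ^∞⟮𝓡 d; Fin m → ℝ, E⟯)
    (R : Cₛ^∞⟮𝓡 d; (Fin n → ℝ) →L[ℝ] EuclideanSpace ℝ (Fin d),
      fun p : M => F p →L[ℝ] TangentSpace (𝓡 d) p⟯)
    -- regularity: over `Σ = {T = 0}`, `∇_E T : TM → E` is onto and `R : F → TM` is one-to-one
    (hT : ∀ p, T p = 0 → Function.Surjective (covE T p))
    (hR : ∀ p, T p = 0 → Function.Injective (R p))
    -- the master function, with `S = T^a η*_a + c^α R^i_α x*_i + ⋯`
    (S : ℕ → BRST.PreFun (d := d) E F)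
    (hS : BRST.IsMasterFunction covE covF S)
    (hS₁ : ∀ p, S 1 p - BRST.initialTerm n T R p ∈ BRST.bihomogResPos 1 2)
    (k : ℕ) (l : ℤ) (hkl : l < k) :
    BRST.cocycles covE covF S k l = BRST.coboundaries covE covF S k l := by
  have hS1 : S 1 ∈ BRST.smoothFun m n E F 1 2 := hS.mem 1
  have hSS := BRST.IsMasterFunction.bracket_self covE covF hS
  ext G
  constructor
  · rintro ⟨hG, hQ⟩
    -- The descent starts at resolution degree 1, as l < k allows, and m + k steps suffice from
    -- there.
    refine BRST.exists_primitive covE covF hcovE hcovF T R hT hR hS1 hS₁ hSS (m + k) 1 le_rfl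
      (by omega) G hG hQ fun x => ?_
    exact BRST.Pol.fil_zero_le_fil_one hkl (BRST.smoothFun_fil hG x)
  · rintro ⟨H, hH, rfl⟩
    refine ⟨?_, BRST.bracket_bracket covE covF hcovE hcovF hS1 hSS hH⟩
    have h := BRST.bracket_mem covE covF hcovE hcovF hS1 hH
    rwa [sub_add_cancel] at h
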